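/- Let $R=\mathbb C[u_1,\dots,u_m\,|\,\upsilon_1,\dots,\upsilon_q]$ be a free supercommutative algebra and $r\ge 0$. Let $V$ be the free $R$-supermodule with even linear coordinates $x^{a,k}$ ($k\ge1$) and odd linear coordinates $\theta^{a,k}$ ($k\ge 0$), $a\in[r]$. Let $A$ be the set of all these coordinates and $\hat A=\{\theta^{a,0}\}_{a\in[r]}$. Let $\mathcal D_V$ be the completed super Weyl algebra, i.e. the operators $\sum_{k\le M}\sum_{a_1,\dots,a_k\in A}p^{a_1\dots a_k}(A)\,\partial_{a_1}\cdots\partial_{a_k}$ with polynomial $p^{a_1\dots a_k}$ (infinitely many may be non-zero), filtered by giving all coordinates and derivatives degree $1$, and let $\widehat{\mathcal D}^\hbar_V=\prod_{n\ge0}\hbar^nF_n\mathcal D_V$. A family in $\widehat{\mathcal D}^\hbar_V$ is *bounded* if each $\hbar^n\partial_{a_1}\cdots\partial_{a_k}$ has a non-zero polynomial coefficient in only finitely many members; the left ideal it *generates* consists of all (possibly infinite) sums $\sum_i c_iH_i$ with $c_i\in\widehat{\mathcal D}^\hbar_V$. A left ideal $\mathcal I$ of $\widehat{\mathcal D}^\hbar_V$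 is a *partial Airy structure* on $(V,\hat A)$, in the linear coordinates $A$, if it is generated by a bounded family of parity-homogeneous elements $H_j$, $j\in A\setminus\hat A$, with $H_j=\hbar\partial_j+\hbar p_{j}(A)+\mathcal O(\hbar^2)$, where $p_j$ is a polynomial of degree at most $1$, and $[\mathcal I,\mathcal I]\subseteq\hbar^2\mathcal I$ for the supercommutator. Set $J_{a,k}=\hbar\partial_{x^{a,k}}$, $J_{a,0}=0$, $J_{a,-k}=k\hbar x^{a,k}$, $\Gamma_{a,k}=\hbar\partial_{\theta^{a,k}}$, $\Gamma_{a,0}=\hbar(\tfrac12\theta^{a,0}+\partial_{\theta^{a,0}})$, $\Gamma_{a,-k}=\hbar\theta^{a,k}$ for $k>0$, and, with normal ordering $:\!XY\!:\;=XY-\langle 0|XY|0\rangle$, where $\langle0|XY|0\rangle$ is the value at the origin of $XY$ applied to $1$, $$L_{a,2n}=\tfrac12\sum_{j\in\mathbb Z}(-1)^{j-1}:\!J_{a,-j}J_{a,2n+j}\!:+\tfrac12\sum_{j\in\mathbb Z}(-1)^j(j+n):\!\Gamma_{a,-j}\Gamma_{a,2n+j}\!:+\tfrac{\hbar^2}4\delta_{n,0},\qquad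 G_{a,2n+1}=\sum_{j\in\mathbb Z}(-1)^{j-1}J_{a,-j}\Gamma_{a,2n+1+j}.$$ Let $t_{a,k}$ ($k\in\mathbb Z$), $B^{ab}_{kl},V^{ab}_{kl}$ ($k,l\ge0$) be even and $\tau_{a,k},\phi^{ab}_{kl}$ be odd elements of $R$ with $t_{a,k}=\tau_{a,k}=0$ for $k\ll0$ and $$t_{a,0}=0,\quad B^{ab}_{0l}=B^{ab}_{k0}=\phi^{ab}_{0l}=V^{ab}_{00}=0,\quad B^{ab}_{kl}=B^{ba}_{lk},\quad V^{ab}_{kl}=-V^{ba}_{lk}.$$ Put (omitting terms containing some $J_{a,0}=0$) $$T=\exp\Big(\hbar^{-2}\sum_{a,k}\big(\tfrac{J_{a,k}}{k}t_{a,k}-\Gamma_{a,k}\tau_{a,k}\big)\Big),\qquad \Phi=\exp\Big(\tfrac1{2\hbar^2}\sum_{a,b}\sum_{k,l\ge0}\big(\tfrac{J_{a,k}J_{b,l}}{kl}B^{ab}_{kl}-2\tfrac{J_{a,k}\Gamma_{b,l}}{k}\phi^{ab}_{kl}+\Gamma_{a,k}\Gamma_{b,l}V^{ab}_{kl}\big)\Big),$$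 and $\tilde L_{a,2n}=\Phi TL_{a,2n}T^{-1}\Phi^{-1}$, $\tilde G_{a,2n+1}=\Phi TG_{a,2n+1}T^{-1}\Phi^{-1}$. Assume that $s_a=\min\{k\text{ odd}: t_{a,k}\text{ invertible}\}$ exists and lies in $\{1,3\}$ for all $a\in[r]$. Near the $a$-th Ramond puncture, with Ramond coordinates $(z|\theta)$, $[dz]=[d\theta]\theta z$, $D^*_\theta=\partial_\theta+\theta z\partial_z$ and $\sigma_a:(z|\theta)\mapsto(-z|-\theta)$, let $\omega_{0,1}=\sum_k[dz]t_{a,k}z^{k-1}+[d\theta]\tau_{a,k}z^k=[d\theta]f_a$. The twisted super quadratic Casimir of $\omega_{0,1}\boxtimes\omega_{0,1}=[d\theta_1][d\theta_2]g$, $g(z_1,z_2)=f_a(z_1)f_a(z_2)$ (writing $z$ for $(z|\theta)$), is $\mathcal C^{\sigma_a}(\omega_{0,1}\boxtimes\omega_{0,1})(z)=\tfrac12[d\theta]^3\big(D^*_{\theta_1}g|_{z_1=z,\,z_2=\sigma_a z}-D^*_{\theta_1}g|_{z_1=\sigma_az,\,z_2=z}\big)$. Suppose that for every $a\in[r]$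 $$\omega_{0,1}(z)+\omega_{0,1}(\sigma_a z)=[d\theta]\,\mathcal O(z)\qquad\text{and}\qquad \mathcal C^{\sigma_a}(\omega_{0,1}\boxtimes\omega_{0,1})(z)=[d\theta]^3\,\mathcal O(z^{s_a}).$$ Then the collection $$\{J_{a,2j},\ \Gamma_{a,2j-1},\ \tilde L_{a,2j-s_a-1},\ \tilde G_{a,2j-s_a}\ |\ a\in[r],\ j\ge1\}$$ is bounded and generates a partial Airy structure on $V$, in suitable linear coordinates: there is a linear change of coordinates over $R$ that keeps all coordinates in $A\setminus\hat A$ and adds to each zero mode $\theta^{a,0}$ a finite odd $R$-linear combination of coordinates in $A\setminus\hat A$, such that, in the new coordinates, the left ideal generated by the collection is a partial Airy structure on $(V,\hat A)$. If the $\hbar^1$-coefficients of the elements of the collection contain no $\partial_{\theta^{a,0}}$, $a\in[r]$, the original coordinates themselves can be taken. -/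

import Mathlib

open scoped TensorProduct

noncomputable section

namespace SuperAiry

/-! ### Free supercommutative algebras -/

/-- The free supercommutative `ℂ`-algebra `ℂ[E | O]` on even generators indexed by `E` and odd
generators indexed by `O`: polynomials in the even generators, tensor the exterior algebra on the
odd generators. (The polynomial factor is purely even, so no sign enters the tensor product.) -/
def SPoly (E O : Type) : Type :=
  MvPolynomial E ℂ ⊗[ℂ] ExteriorAlgebra ℂ (O →₀ ℂ)

namespace SPoly

variable {E O : Type}

instance : Ring (SPoly E O) :=
  inferInstanceAs (Ring (MvPolynomial E ℂ ⊗[ℂ] ExteriorAlgebra ℂ (O →₀ ℂ)))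

instance : Algebra ℂ (SPoly E O) :=
  inferInstanceAs (Algebra ℂ (MvPolynomial E ℂ ⊗[ℂ] ExteriorAlgebra ℂ (O →₀ ℂ)))

/-- The even generator with index `e`. -/
def evenGen (e : E) : SPoly E O := MvPolynomial.X e ⊗ₜ 1

/-- The odd generator with index `o`. -/
def oddGen (o : O) : SPoly E O := 1 ⊗ₜ ExteriorAlgebra.ι ℂ (Finsupp.single o 1)

/-- The parity automorphism: `+1` on even and `-1` on odd elements. -/
def parity : SPoly E O →ₗ[ℂ] SPoly E O :=
  LinearMap.lTensor (MvPolynomial E ℂ)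
    (CliffordAlgebra.involute (Q := (0 : QuadraticForm ℂ (O →₀ ℂ)))).toLinearMap

/-- Even elements. -/
def IsEven (p : SPoly E O) : Prop := parity p = p

/-- Odd elements. -/
def IsOdd (p : SPoly E O) : Prop := parity p = -p

/-- The partial derivative with respect to an even generator. -/
def evenDeriv (e : E) : Module.End ℂ (SPoly E O) :=
  LinearMap.rTensor (ExteriorAlgebra ℂ (O →₀ ℂ))
    (Derivation.toLinearMap (MvPolynomial.pderiv (R := ℂ) e))

/-- The (left, odd) partial derivative with respect to an odd generator: contraction with the
corresponding coordinate functional. -/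
def oddDeriv (o : O) : Module.End ℂ (SPoly E O) :=
  LinearMap.lTensor (MvPolynomial E ℂ)
    (CliffordAlgebra.contractLeft (Q := (0 : QuadraticForm ℂ (O →₀ ℂ))) (Finsupp.lapply o))

/-- The algebra map induced by maps of the index sets of the generators. -/
def map {E' O' : Type} (f : E → E') (g : O → O') : SPoly E O →ₐ[ℂ] SPoly E' O' :=
  Algebra.TensorProduct.map (MvPolynomial.rename f)
    (ExteriorAlgebra.map (Finsupp.lmapDomain ℂ ℂ g))

end SPoly

/-- The base ring `R = ℂ[u₁, …, u_m | υ₁, …, υ_q]`. -/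
abbrev Params (m q : ℕ) : Type := SPoly (Fin m) (Fin q)

/-! ### The completed super Rees Weyl algebra -/

section Weyl

variable {m q : ℕ} {A₀ A₁ : Type}

/-- Polynomial functions on the free `R`-supermodule `V = V₀ ⊕ V₁` with even linear coordinates
`A₀` and odd linear coordinates `A₁`, that is `R[A₀ | A₁]`. -/
abbrev Fun (m q : ℕ) (A₀ A₁ : Type) : Type := SPoly (Fin m ⊕ A₀) (Fin q ⊕ A₁)

/-- The inclusion of the constants `R` into `R[A₀ | A₁]`. -/
def const : Params m q →ₐ[ℂ] Fun m q A₀ A₁ := SPoly.map Sum.inl Sum.inl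

/-- The linear coordinate with index `j ∈ A = A₀ ∪ A₁`. -/
def coord : A₀ ⊕ A₁ → Fun m q A₀ A₁
  | .inl i => SPoly.evenGen (.inr i)
  | .inr i => SPoly.oddGen (.inr i)

/-- Operators on `R[A₀ | A₁]`. The completed super Weyl algebra is a subalgebra of these: its
elements act faithfully on polynomials, and its product is composition. -/
abbrev Op (m q : ℕ) (A₀ A₁ : Type) : Type := Module.End ℂ (Fun m q A₀ A₁)

/-- Left multiplication by a polynomial. -/
def mulOp (p : Fun m q A₀ A₁) : Op m q A₀ A₁ := LinearMap.mulLeft ℂ p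

/-- The partial derivative `∂_j`. -/
def partialDeriv : A₀ ⊕ A₁ → Op m q A₀ A₁
  | .inl i => SPoly.evenDeriv (.inr i)
  | .inr i => SPoly.oddDeriv (.inr i)

/-- The iterated derivative `∂_{a₁} ⋯ ∂_{a_n}`. -/
def partialDerivs (w : List (A₀ ⊕ A₁)) : Op m q A₀ A₁ := (w.map partialDeriv).prod

/-- Polynomials in the coordinates `A`, with coefficients in `R`, of degree at most `d`. -/
def degLE (d : ℕ) : Submodule ℂ (Fun m q A₀ A₁) :=
  Submodule.span ℂ {p | ∃ (c : Params m q) (w : List (A₀ ⊕ A₁)),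
    w.length ≤ d ∧ p = const c * (w.map coord).prod}

/-- `D = ∑ p^{a₁…a_k}(A) ∂_{a₁} ⋯ ∂_{a_k}`, a possibly infinite sum over all words with `k ≤ n`
letters, where `p^{a₁…a_k}` is a polynomial of degree at most `n - k`. Applied to a polynomial, only
finitely many terms do not vanish. -/
structure HasExpansion (D : Op m q A₀ A₁) (n : ℕ) (p : List (A₀ ⊕ A₁) → Fun m q A₀ A₁) :
    Prop where
  order_le : ∀ w, n < w.length → p w = 0
  degree_le : ∀ w, p w ∈ degLE (n - w.length)
  finite : ∀ f, {w | p w * partialDerivs w f ≠ 0}.Finite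
  eq_sum : ∀ f, D f = ∑ᶠ w, p w * partialDerivs w f

/-- `F_n 𝓓_V`: operators in the completed super Weyl algebra of degree at most `n`, where all
coordinates and all derivatives have degree one. -/
def weylFiltration (n : ℕ) : Set (Op m q A₀ A₁) := {D | ∃ p, HasExpansion D n p}

/-- Formal Laurent series in `ħ` (a central variable) whose coefficients are operators. -/
abbrev HOp (m q : ℕ) (A₀ A₁ : Type) : Type := LaurentSeries (Op m q A₀ A₁)

/-- `ħ^n D`. -/
def hbarPow (n : ℤ) (D : Op m q A₀ A₁) : HOp m q A₀ A₁ := HahnSeries.single n D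

/-- The completed super Rees Weyl algebra `∏_{n ≥ 0} ħ^n F_n 𝓓_V`. -/
def reesWeyl (m q : ℕ) (A₀ A₁ : Type) : Set (HOp m q A₀ A₁) :=
  {Z | (∀ n < 0, Z.coeff n = 0) ∧ ∀ n : ℕ, Z.coeff n ∈ weylFiltration n}

/-- Conjugation of an operator by the parity automorphism. -/
def opParity : Op m q A₀ A₁ →ₗ[ℂ] Op m q A₀ A₁ :=
  (LinearMap.mulLeft ℂ (SPoly.parity : Op m q A₀ A₁)) ∘ₗ
    (LinearMap.mulRight ℂ (SPoly.parity : Op m q A₀ A₁))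

/-- The parity automorphism of operator-valued series; `ħ` is even. -/
def hParity (Z : HOp m q A₀ A₁) : HOp m q A₀ A₁ := Z.map opParity

/-- Even or odd. -/
def IsHomogeneous (Z : HOp m q A₀ A₁) : Prop := hParity Z = Z ∨ hParity Z = -Z

/-- The even part. -/
def evenPart (Z : HOp m q A₀ A₁) : HOp m q A₀ A₁ := (1 / 2 : ℂ) • (Z + hParity Z)

/-- The odd part. -/
def oddPart (Z : HOp m q A₀ A₁) : HOp m q A₀ A₁ := (1 / 2 : ℂ) • (Z - hParity Z)

/-- The supercommutator: `XY - (-1)^{|X||Y|} YX` on homogeneous elements, extended biadditively. -/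
def superComm (X Y : HOp m q A₀ A₁) : HOp m q A₀ A₁ :=
  X * Y - Y * evenPart X - hParity Y * oddPart X

/-- A family in the completed super Rees Weyl algebra is bounded if, in its normally ordered
expansions, every `ħ^n ∂_{a₁} ⋯ ∂_{a_k}` has a non-zero coefficient for only finitely many members. -/
def IsBounded {ι : Type} (G : ι → HOp m q A₀ A₁) : Prop :=
  (∀ i, ∀ n < 0, (G i).coeff n = 0) ∧
  ∃ p : ι → ℕ → List (A₀ ⊕ A₁) → Fun m q A₀ A₁,
    (∀ i (n : ℕ), HasExpansion ((G i).coeff n) n (p i n)) ∧ ∀ n w, {i | p i n w ≠ 0}.Finite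

/-- `Z` is the (possibly infinite) sum of the family `F`: for every power of `ħ` and every
polynomial, all but finitely many members vanish on it, and the others add up to `Z`. -/
def IsSum {ι : Type} (F : ι → HOp m q A₀ A₁) (Z : HOp m q A₀ A₁) : Prop :=
  ∀ n f, {i | (F i).coeff n f ≠ 0}.Finite ∧ Z.coeff n f = ∑ᶠ i, (F i).coeff n f

/-- The left ideal generated by a (bounded) family: all possibly infinite sums `∑ c_i G_i` with
`c_i` in the completed super Rees Weyl algebra. -/
def generatedIdeal {ι : Type} (G : ι → HOp m q A₀ A₁) : Set (HOp m q A₀ A₁) :=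
  {Z | ∃ c : ι → HOp m q A₀ A₁, (∀ i, c i ∈ reesWeyl m q A₀ A₁) ∧ IsSum (fun i => c i * G i) Z}

/-- `I` is a partial (super) Airy structure on `(V, Â)`, in the linear coordinates `A = A₀ ∪ A₁`. -/
structure IsPartialAiryStructure (Ahat : Set (A₀ ⊕ A₁)) (I : Set (HOp m q A₀ A₁)) : Prop where
  finite : Ahat.Finite
  subset : I ⊆ reesWeyl m q A₀ A₁
  zero_mem : 0 ∈ I
  add_mem : ∀ X ∈ I, ∀ Y ∈ I, X + Y ∈ I
  mul_mem : ∀ c ∈ reesWeyl m q A₀ A₁, ∀ X ∈ I, c * X ∈ I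
  exists_generators : ∃ H : {j : A₀ ⊕ A₁ // j ∉ Ahat} → HOp m q A₀ A₁,
    (∀ j, IsHomogeneous (H j)) ∧
    IsBounded H ∧
    I = generatedIdeal H ∧
    ∀ j, (H j).coeff 0 = 0 ∧ ∃ p ∈ degLE 1, (H j).coeff 1 = partialDeriv j.1 + mulOp p
  superComm_mem : ∀ X ∈ I, ∀ Y ∈ I, ∃ Z ∈ I, superComm X Y = hbarPow 2 1 * Z

/-- A linear change of coordinates of `V` over `R` (given by the resulting even automorphism of
`R[A₀ | A₁]`, which sends each old coordinate to the corresponding new one) that keeps the coordinates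
outside `Â` and adds to each coordinate in `Â` a finite `R`-linear combination of coordinates outside
`Â`. -/
structure IsShear (Ahat : Set (A₀ ⊕ A₁)) (Ψ : Fun m q A₀ A₁ ≃ₐ[ℂ] Fun m q A₀ A₁) : Prop where
  map_const : ∀ c : Params m q, Ψ (const c) = const c
  map_parity : ∀ f, Ψ (SPoly.parity f) = SPoly.parity (Ψ f)
  map_coord : ∀ j ∉ Ahat, Ψ (coord j) = coord j
  map_coord_hat : ∀ j ∈ Ahat, Ψ (coord j) - coord j ∈
    Submodule.span ℂ {p | ∃ (c : Params m q), ∃ i ∉ Ahat, p = const c * coord i}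

/-- The expression of an operator-valued series in the new coordinates `y_j = Ψ(x_j)`: an operator
`∑ p(y) ∂_y` becomes `∑ p(x) ∂_x`. -/
def inCoordinates (Ψ : Fun m q A₀ A₁ ≃ₐ[ℂ] Fun m q A₀ A₁) (Z : HOp m q A₀ A₁) : HOp m q A₀ A₁ :=
  Z.map Ψ.symm.toLinearEquiv.conj

/-! ### Infinite sums of operators, and exponentials of derivations -/

open Classical in
/-- The sum of a family of operators, finitely many of which are non-zero on each polynomial. -/
def opSum {ι : Type} (F : ι → Op m q A₀ A₁) : Op m q A₀ A₁ :=
  if h : ∀ f, (Function.support fun i => F i f).Finite then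
    { toFun := fun f => ∑ᶠ i, F i f
      map_add' := fun f g => by
        simp only [map_add]
        exact finsum_add_distrib (h f) (h g)
      map_smul' := fun c f => by
        simp only [map_smul, RingHom.id_apply]
        exact (smul_finsum' c (h f)).symm }
  else 0

/-- `exp(X) Y exp(-X) = ∑ ad_X^n(Y) / n!`, for `Y` on which `ad_X` is nilpotent. -/
def expConj (X Y : HOp m q A₀ A₁) : HOp m q A₀ A₁ :=
  ∑ᶠ n : ℕ, ((n.factorial : ℂ)⁻¹) • (fun W => X * W - W * X)^[n] Y

end Weyl

/-! ### Heisenberg, Clifford and twisted super Virasoro modes -/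

section Modes

variable {m q r : ℕ}

/-- Polynomials in `x^{a,k}` (even, `k ≥ 1`) and `θ^{a,k}` (odd, `k ≥ 0`) for `a ∈ [r]`. -/
abbrev FunR (m q r : ℕ) : Type := Fun m q (Fin r × ℕ+) (Fin r × ℕ)

/-- Operators on these polynomials. -/
abbrev OpR (m q r : ℕ) : Type := Op m q (Fin r × ℕ+) (Fin r × ℕ)

/-- Operator-valued series in `ħ`. -/
abbrev HOpR (m q r : ℕ) : Type := HOp m q (Fin r × ℕ+) (Fin r × ℕ)

/-- The index of `x^{a,k}`. -/
def ixB (a : Fin r) (k : ℕ+) : (Fin r × ℕ+) ⊕ (Fin r × ℕ) := .inl (a, k)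

/-- The index of `θ^{a,k}`. -/
def ixF (a : Fin r) (k : ℕ) : (Fin r × ℕ+) ⊕ (Fin r × ℕ) := .inr (a, k)

/-- The zero modes `Â_r`, i.e. the indices of the coordinates `θ^{a,0}`. -/
def zeroModes (r : ℕ) : Set ((Fin r × ℕ+) ⊕ (Fin r × ℕ)) := Set.range fun a => ixF a 0

/-- `ħ⁻¹ J_{a,k}`; in the last case the mode is `k = -(n+1)`. -/
def jOp (a : Fin r) : ℤ → OpR m q r
  | .ofNat 0 => 0
  | .ofNat (n + 1) => partialDeriv (ixB a n.succPNat)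
  | .negSucc n => ((n : ℂ) + 1) • mulOp (coord (ixB a n.succPNat))

/-- `ħ⁻¹ Γ_{a,k}`; in the last case the mode is `k = -(n+1)`. -/
def gammaOp (a : Fin r) : ℤ → OpR m q r
  | .ofNat 0 => (1 / 2 : ℂ) • mulOp (coord (ixF a 0)) + partialDeriv (ixF a 0)
  | .ofNat (n + 1) => partialDeriv (ixF a (n + 1))
  | .negSucc n => mulOp (coord (ixF a (n + 1)))

/-- `ħ⁻² :J_{a,k} J_{a,l}:`, where `:XY: = XY - ⟨XY⟩`. -/
def normalJJ (a : Fin r) (k l : ℤ) : OpR m q r :=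
  jOp a k * jOp a l - (if k + l = 0 ∧ 0 < k then (k : ℂ) else 0) • (1 : OpR m q r)

/-- `ħ⁻² :Γ_{a,k} Γ_{a,l}:`, where `:XY: = XY - ⟨XY⟩`; in particular `:Γ_0 Γ_0: = 0`. -/
def normalGammaGamma (a : Fin r) (k l : ℤ) : OpR m q r :=
  gammaOp a k * gammaOp a l -
    (if k + l = 0 then (if 0 < k then (1 : ℂ) else if k = 0 then 1 / 2 else 0) else 0) •
      (1 : OpR m q r)

/-- The Heisenberg mode `J_{a,k}`. -/
def J (a : Fin r) (k : ℤ) : HOpR m q r := hbarPow 1 (jOp a k)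

/-- The Clifford mode `Γ_{a,k}`. -/
def Gam (a : Fin r) (k : ℤ) : HOpR m q r := hbarPow 1 (gammaOp a k)

/-- The mode `L_{a,2n}` of the twisted super Virasoro algebra. -/
def L (a : Fin r) (n : ℤ) : HOpR m q r :=
  hbarPow 2
    ((1 / 2 : ℂ) • opSum (fun j : ℤ => (-1 : ℂ) ^ (j - 1) • normalJJ a (-j) (2 * n + j)) +
      (1 / 2 : ℂ) • opSum (fun j : ℤ =>
        ((-1 : ℂ) ^ j * ((j : ℂ) + n)) • normalGammaGamma a (-j) (2 * n + j)) +
      (if n = 0 then (1 / 4 : ℂ) else 0) • (1 : OpR m q r))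

/-- The mode `G_{a,2n+1}` of the twisted super Virasoro algebra. -/
def G (a : Fin r) (n : ℤ) : HOpR m q r :=
  hbarPow 2 (opSum fun j : ℤ => (-1 : ℂ) ^ (j - 1) • (jOp a (-j) * gammaOp a (2 * n + 1 + j)))

end Modes

/-! ### Dilaton shift and change of polarisation -/

section Data

variable {m q r : ℕ}

/-- Local data at `r` Ramond punctures. The Laurent series `t a = ∑ t_{a,k} z^k` and
`τ a = ∑ τ_{a,k} z^k` collect the dilaton shift parameters, which vanish for `k ≪ 0`. -/
structure LocalData (m q r : ℕ) where
  t : Fin r → LaurentSeries (Params m q)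
  τ : Fin r → LaurentSeries (Params m q)
  B : Fin r → Fin r → ℕ → ℕ → Params m q
  φ : Fin r → Fin r → ℕ → ℕ → Params m q
  V : Fin r → Fin r → ℕ → ℕ → Params m q
  t_even : ∀ a k, SPoly.IsEven ((t a).coeff k)
  τ_odd : ∀ a k, SPoly.IsOdd ((τ a).coeff k)
  B_even : ∀ a b k l, SPoly.IsEven (B a b k l)
  φ_odd : ∀ a b k l, SPoly.IsOdd (φ a b k l)
  V_even : ∀ a b k l, SPoly.IsEven (V a b k l)
  t_zero : ∀ a, (t a).coeff 0 = 0
  B_zero_left : ∀ a b l, B a b 0 l = 0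
  B_zero_right : ∀ a b k, B a b k 0 = 0
  φ_zero_left : ∀ a b l, φ a b 0 l = 0
  V_zero_zero : ∀ a b, V a b 0 0 = 0
  B_symm : ∀ a b k l, B a b k l = B b a l k
  V_antisymm : ∀ a b k l, V a b k l = -V b a l k

namespace LocalData

variable (d : LocalData m q r)

/-- `log T = ħ⁻² ∑ (J_{a,k} t_{a,k} / k - Γ_{a,k} τ_{a,k})`, where the term with `J_{a,0} = 0` is
absent. -/
def logT : HOpR m q r :=
  hbarPow (-1) (opSum fun i : Fin r × ℤ =>
    ((i.2 : ℂ)⁻¹) • (jOp i.1 i.2 * mulOp (const ((d.t i.1).coeff i.2))) -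
      gammaOp i.1 i.2 * mulOp (const ((d.τ i.1).coeff i.2)))

/-- `log Φ = (1/2ħ²) ∑ (J_{a,k} J_{b,l} B^{ab}_{kl} / kl - 2 J_{a,k} Γ_{b,l} φ^{ab}_{kl} / k
+ Γ_{a,k} Γ_{b,l} V^{ab}_{kl})`, summed over `a, b` and over `k, l ≥ 0`, where the terms with
`J_{a,0} = 0` are absent. -/
def logPhi : HOpR m q r :=
  hbarPow 0 ((1 / 2 : ℂ) • opSum fun i : (Fin r × Fin r) × (ℕ × ℕ) =>
    (((i.2.1 : ℂ) * (i.2.2 : ℂ))⁻¹) •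
        (jOp i.1.1 i.2.1 * jOp i.1.2 i.2.2 * mulOp (const (d.B i.1.1 i.1.2 i.2.1 i.2.2))) -
      (2 * (i.2.1 : ℂ)⁻¹) •
        (jOp i.1.1 i.2.1 * gammaOp i.1.2 i.2.2 * mulOp (const (d.φ i.1.1 i.1.2 i.2.1 i.2.2))) +
      gammaOp i.1.1 i.2.1 * gammaOp i.1.2 i.2.2 *
        mulOp (const (d.V i.1.1 i.1.2 i.2.1 i.2.2)))

/-- `L̃_{a,2n} = Φ T L_{a,2n} T⁻¹ Φ⁻¹`. -/
def Lt (a : Fin r) (n : ℤ) : HOpR m q r := expConj d.logPhi (expConj d.logT (L a n))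

/-- `G̃_{a,2n+1} = Φ T G_{a,2n+1} T⁻¹ Φ⁻¹`. -/
def Gt (a : Fin r) (n : ℤ) : HOpR m q r := expConj d.logPhi (expConj d.logT (G a n))

end LocalData

/-- Indices of the four kinds of generators, with `a ∈ [r]` and `j ≥ 1`. -/
inductive GenIndex (r : ℕ) : Type
  | J (a : Fin r) (j : ℕ+)
  | Gam (a : Fin r) (j : ℕ+)
  | L (a : Fin r) (j : ℕ+)
  | G (a : Fin r) (j : ℕ+)

/-- The collection `J_{a,2j}`, `Γ_{a,2j-1}`, `L̃_{a,2j-s_a-1}`, `G̃_{a,2j-s_a}`. For odd `s_a`, the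
division by two is exact, with `2n = 2j - s_a - 1` and `2n + 1 = 2j - s_a`. -/
def LocalData.generator (d : LocalData m q r) (s : Fin r → ℤ) : GenIndex r → HOpR m q r
  | .J a j => J a (2 * (j : ℤ))
  | .Gam a j => Gam a (2 * (j : ℤ) - 1)
  | .L a j => d.Lt a ((2 * (j : ℤ) - s a - 1) / 2)
  | .G a j => d.Gt a ((2 * (j : ℤ) - s a - 1) / 2)

end Data

/-! ### Meromorphic differentials on a formal disc around a Ramond puncture -/

section Disc

variable {m q r : ℕ}

/-- A formal meromorphic function `c0 + θ c1` in Ramond coordinates `(z | θ)`, with `c0` and `c1` in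
`R((z))`. -/
structure Mero (m q : ℕ) where
  c0 : LaurentSeries (Params m q)
  c1 : LaurentSeries (Params m q)

/-- Multiply the coefficient of `z^k` by `c k`. -/
def scaleCoeff (c : ℤ → ℂ) (f : LaurentSeries (Params m q)) : LaurentSeries (Params m q) where
  coeff k := c k • f.coeff k
  isPWO_support' := f.isPWO_support.mono fun k hk hf => hk (by simp [hf])

namespace Mero

instance : Sub (Mero m q) := ⟨fun f g => ⟨f.c0 - g.c0, f.c1 - g.c1⟩⟩

instance : Neg (Mero m q) := ⟨fun f => ⟨-f.c0, -f.c1⟩⟩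

instance : Add (Mero m q) := ⟨fun f g => ⟨f.c0 + g.c0, f.c1 + g.c1⟩⟩

instance : SMul ℂ (Mero m q) := ⟨fun c f => ⟨c • f.c0, c • f.c1⟩⟩

/-- The product, where `c θ = θ c` for even and `c θ = -θ c` for odd coefficients `c`. -/
instance : Mul (Mero m q) :=
  ⟨fun f g => ⟨f.c0 * g.c0, f.c1 * g.c0 + f.c0.map SPoly.parity * g.c1⟩⟩

/-- `D^*_θ = ∂/∂θ + θ z ∂/∂z`. -/
def dStar (f : Mero m q) : Mero m q := ⟨f.c1, scaleCoeff (fun k => (k : ℂ)) f.c0⟩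

/-- `f(σ(z | θ))` for the involution `σ : (z | θ) ↦ (-z | -θ)`. -/
def sigma (f : Mero m q) : Mero m q :=
  ⟨scaleCoeff (fun k => (-1 : ℂ) ^ k) f.c0, -scaleCoeff (fun k => (-1 : ℂ) ^ k) f.c1⟩

/-- `f` is `O(z^n)`. -/
def IsBigO (f : Mero m q) (n : ℤ) : Prop := ∀ k < n, f.c0.coeff k = 0 ∧ f.c1.coeff k = 0

end Mero

/-- Formal meromorphic sections of `𝒬 = Ω¹ / (dz - dθ · θ z)`, a free module on `[dθ]`: the section
`[dθ] f` is represented by `f`. -/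
structure Form (m q : ℕ) where
  coef : Mero m q

namespace Form

instance : Add (Form m q) := ⟨fun ω η => ⟨ω.coef + η.coef⟩⟩

/-- `[dθ] h(z)`. -/
def dtheta (h : LaurentSeries (Params m q)) : Form m q := ⟨⟨h, 0⟩⟩

/-- `[dz] h(z) = [dθ] θ z h(z)`. -/
def dz (h : LaurentSeries (Params m q)) : Form m q := ⟨⟨0, HahnSeries.single 1 1 * h⟩⟩

/-- The pullback `ω(σ(z))` of a section; here `σ^*[dθ] = -[dθ]`. -/
def sigma (ω : Form m q) : Form m q := ⟨-ω.coef.sigma⟩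

/-- The twisted super quadratic Casimir `𝒞^σ(ω ⊠ ω)`, represented by the coefficient of `[dθ]³`. Here
`ω ⊠ ω = [dθ₁][dθ₂] g` with `g(z₁, z₂) = f(z₁) f(z₂)` for `ω = [dθ] f`, and the value is
`½ (D^*_{θ₁} g (z, σ z) - D^*_{θ₁} g (σ z, z))`. -/
def twistedCasimir (ω : Form m q) : Mero m q :=
  (1 / 2 : ℂ) • (ω.coef.dStar * ω.coef.sigma - ω.coef.dStar.sigma * ω.coef)

end Form

/-- The residueless section `ω_{0,1} = ∑_k [dz] t_{a,k} z^{k-1} + [dθ] τ_{a,k} z^k` near the `a`-th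
puncture. -/
def LocalData.omega01 (d : LocalData m q r) (a : Fin r) : Form m q :=
  Form.dz (HahnSeries.single (-1) 1 * d.t a) + Form.dtheta (d.τ a)

end Disc

end SuperAiry

end

open SuperAiry

/-! At each puncture the modes split into two supercommuting sectors: `oMode` ($J$ of odd and
$\Gamma$ of even number) and `eMode` ($J$ of even and $\Gamma$ of odd number). For parity reasons
every term of $L_{2n}$ and of $G_{2n+1}$ is a product of two modes of the same sector. So $L$ and
$G$ are the operators `opL` and `opG` in the first sector plus bilinear expressions in the second.
The collection contains all `eMode`s of positive number. The linear condition on $\omega_{0,1}$ and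
the shape of $\Phi$ imply that conjugation fixes them, and every non-zero bilinear term of the
second sector has one of them as its right factor. Hence the ideal does not change when $L$ and $G$
are replaced by `opL` and `opG` (`generatedIdeal_fullFrame`).

The new generators close under supercommutators. Positive `eMode`s supercommute with each other and
with the first sector, while `opL` and `opG` satisfy the super Virasoro relations, without a central
term in the range that occurs (`br_quad`). These relations hold because an operator is determined by
its brackets with the modes up to a constant, and the constant is a vacuum expectation value
(`IsModeOp.eq`). For $s_a\in\{1,3\}$ every bracket that would leave the range has structure constant
zero (`quadBracket_eq_zero`). Conjugation by $T$ and $\Phi$ is the exponential of derivations that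
act nilpotently, so it preserves the relations. A supercommutator lowers the total degree by two
(`br_mem_Fil`), so brackets in the Rees algebra are divisible by $\hbar^2$; with the Leibniz rule,
closure passes from the generators to infinite left combinations (`superComm_mem_generatedIdeal`).

It remains to put the linear parts into normal form. $T$ shifts the modes by the constants $t$ and
$\tau$. The $\hbar^0$ coefficient of a conjugated quadratic generator comes from the twofold shift,
a coefficient of the Casimir, and therefore vanishes (`adj_adj_quad`). In the $\hbar^1$ coefficient
the derivatives have coefficients given by shifts, up to a correction by $\Phi$ with vanishing body.
On the diagonal the body is a non-zero number times that of $t_{a,s_a}$, hence a unit. Below the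
diagonal the indices are less than $s_a$: the $\tau$'s are odd, and the odd $t$'s have vanishing
body because the lowest one with non-zero body would have its square as the body of a Casimir
coefficient (`body_t_eq_zero`). So the matrix of symbols is triangular with invertible diagonal
modulo nilpotents, and has a column-finite inverse (`exists_inverse`).

After multiplication by this inverse, the linear parts are $\partial_j$ plus combinations of the
$\partial_{\theta^{a,0}}$ plus polynomials. A shear of the zero modes absorbs the extra derivatives.
If the collection has none of them at order $\hbar$, neither has its ideal, and the shear is the
identity (`IsFrame.exists_isPartialAiryStructure`).

All infinite sums are taken pointwise on polynomials, and the normally ordered expansions of the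
statement are traded for the filtration `Fil`, which is defined by iterated supercommutators
(`mem_weylFiltration`). -/

noncomputable section

namespace SuperAiry

/-! ### Free supercommutative algebras: signs, homomorphisms, derivatives. -/

namespace SPoly

variable {E O : Type}

/-- A pure tensor. -/
def tm (p : MvPolynomial E ℂ) (x : ExteriorAlgebra ℂ (O →₀ ℂ)) : SPoly E O := p ⊗ₜ x

theorem tm_mul_tm (p p' : MvPolynomial E ℂ) (x x' : ExteriorAlgebra ℂ (O →₀ ℂ)) :
    tm p x * tm p' x' = tm (p * p') (x * x') :=
  Algebra.TensorProduct.tmul_mul_tmul (R := ℂ) p p' x x'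

theorem tm_add (p : MvPolynomial E ℂ) (x y : ExteriorAlgebra ℂ (O →₀ ℂ)) :
    tm p (x + y) = tm p x + tm p y := TensorProduct.tmul_add _ _ _

theorem add_tm (p q : MvPolynomial E ℂ) (x : ExteriorAlgebra ℂ (O →₀ ℂ)) :
    tm (p + q) x = tm p x + tm q x := TensorProduct.add_tmul _ _ _

theorem tm_smul (c : ℂ) (p : MvPolynomial E ℂ) (x : ExteriorAlgebra ℂ (O →₀ ℂ)) :
    tm p (c • x) = c • tm p x := TensorProduct.tmul_smul _ _ _

theorem smul_tm (c : ℂ) (p : MvPolynomial E ℂ) (x : ExteriorAlgebra ℂ (O →₀ ℂ)) :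
    tm (c • p) x = c • tm p x := (TensorProduct.smul_tmul' _ _ _).symm

theorem tm_zero (p : MvPolynomial E ℂ) : tm p (0 : ExteriorAlgebra ℂ (O →₀ ℂ)) = 0 :=
  TensorProduct.tmul_zero _ _

theorem zero_tm (x : ExteriorAlgebra ℂ (O →₀ ℂ)) : tm (0 : MvPolynomial E ℂ) x = 0 :=
  TensorProduct.zero_tmul _ _

theorem tm_induction {P : SPoly E O → Prop} (zero : P 0) (tm : ∀ p x, P (tm p x))
    (add : ∀ f g, P f → P g → P (f + g)) (f : SPoly E O) : P f :=
  TensorProduct.induction_on (motive := P) f zero tm add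

theorem evenGen_eq (e : E) : (evenGen e : SPoly E O) = tm (MvPolynomial.X e) 1 := rfl

theorem oddGen_eq (o : O) :
    (oddGen o : SPoly E O) = tm 1 (ExteriorAlgebra.ι ℂ (Finsupp.single o 1)) := rfl

theorem evenGen_mul_tm (e : E) (p : MvPolynomial E ℂ) (x : ExteriorAlgebra ℂ (O →₀ ℂ)) :
    evenGen e * tm p x = tm (MvPolynomial.X e * p) x := by
  rw [evenGen_eq, tm_mul_tm, one_mul]

theorem oddGen_mul_tm (o : O) (p : MvPolynomial E ℂ) (x : ExteriorAlgebra ℂ (O →₀ ℂ)) :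
    oddGen o * tm p x = tm p (ExteriorAlgebra.ι ℂ (Finsupp.single o 1) * x) := by
  rw [oddGen_eq, tm_mul_tm, one_mul]

theorem one_eq_tm : (1 : SPoly E O) = tm 1 1 := rfl

/-- Generators of both parities. -/
def gen : E ⊕ O → SPoly E O
  | .inl e => evenGen e
  | .inr o => oddGen o

/-- Induction from `1` by sums, scalar multiples, and left multiplication by generators. -/
theorem left_induction {P : SPoly E O → Prop} (one : P 1) (add : ∀ f g, P f → P g → P (f + g))
    (smul : ∀ (c : ℂ) f, P f → P (c • f)) (gen_mul : ∀ i f, P f → P (gen i * f))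
    (f : SPoly E O) : P f := by
  have zero : P 0 := by simpa using smul 0 1 one
  induction f using tm_induction with
  | zero => exact zero
  | add f g hf hg => exact add f g hf hg
  | tm p x =>
  induction x using CliffordAlgebra.left_induction with
  | algebraMap c =>
    have key : P (tm p 1) := by
      induction p using MvPolynomial.induction_on with
      | C a =>
        rw [MvPolynomial.C_eq_smul_one, smul_tm]
        exact smul _ _ one
      | add p q hp hq =>
        rw [add_tm]
        exact add _ _ hp hq
      | mul_X p i hp =>
        rw [mul_comm, ← evenGen_mul_tm]
        exact gen_mul (.inl i) _ hp
    rw [Algebra.algebraMap_eq_smul_one]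
    exact (tm_smul c p 1).symm ▸ smul _ _ key
  | add x y hx hy =>
    exact (tm_add p x y).symm ▸ add _ _ hx hy
  | ι_mul x v hx =>
    induction v using Finsupp.induction_linear with
    | zero =>
      rw [map_zero, zero_mul]
      exact (tm_zero (O := O) p).symm ▸ zero
    | add v w hv hw =>
      rw [map_add, add_mul]
      exact (tm_add p _ _).symm ▸ add _ _ hv hw
    | single o c =>
      have := smul c _ (gen_mul (.inr o) _ hx)
      rw [gen, oddGen_mul_tm, ← tm_smul, ← smul_mul_assoc, ← map_smul,
        Finsupp.smul_single_one] at this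
      exact this

/-- The parity of a generator. -/
def genPar : E ⊕ O → ℕ
  | .inl _ => 0
  | .inr _ => 1

theorem parity_tm (p : MvPolynomial E ℂ) (x : ExteriorAlgebra ℂ (O →₀ ℂ)) :
    parity (tm p x) = tm p (CliffordAlgebra.involute x) :=
  LinearMap.lTensor_tmul (MvPolynomial E ℂ) _ _ _

theorem parity_one : parity (1 : SPoly E O) = 1 := by
  rw [one_eq_tm, parity_tm]
  exact congrArg (tm 1) (map_one _)

theorem parity_mul (f g : SPoly E O) : parity (f * g) = parity f * parity g := by
  induction f using tm_induction with
  | zero => rw [zero_mul, map_zero, zero_mul]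
  | add f f' hf hf' => rw [map_add, add_mul, add_mul, map_add, hf, hf']
  | tm p x =>
    induction g using tm_induction with
    | zero => rw [mul_zero, map_zero, mul_zero]
    | add f f' hf hf' => rw [map_add, mul_add, mul_add, map_add, hf, hf']
    | tm p' x' =>
      rw [tm_mul_tm, parity_tm, parity_tm, parity_tm, tm_mul_tm]
      exact congrArg (tm _) (map_mul _ _ _)

/-- The parity automorphism as a homomorphism of algebras. -/
def parityHom : SPoly E O →ₐ[ℂ] SPoly E O :=
  AlgHom.ofLinearMap parity parity_one parity_mul

theorem parity_evenGen (e : E) : parity (evenGen e : SPoly E O) = evenGen e := by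
  rw [evenGen_eq, parity_tm]
  exact congrArg (tm _) (map_one _)

theorem parity_oddGen (o : O) : parity (oddGen o : SPoly E O) = -oddGen o := by
  rw [oddGen_eq, parity_tm, ← neg_one_smul ℂ (tm _ _), ← tm_smul, neg_one_smul]
  exact congrArg (tm _) (CliffordAlgebra.involute_ι _)

theorem parity_gen (i : E ⊕ O) : parity (gen i) = (-1 : ℂ) ^ genPar i • gen i := by
  cases i <;> simp [gen, genPar, parity_evenGen, parity_oddGen]

theorem parity_parity (f : SPoly E O) : parity (parity f) = f := by
  induction f using left_induction with
  | one => rw [parity_one, parity_one]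
  | add f g hf hg => rw [map_add, map_add, hf, hg]
  | smul c f hf => rw [map_smul, map_smul, hf]
  | gen_mul i f hf =>
    rw [parity_mul, parity_mul, hf, parity_gen, map_smul, parity_gen, smul_smul, ← mul_pow]
    simp

theorem evenGen_comm (e : E) (f : SPoly E O) : evenGen e * f = f * evenGen e := by
  induction f using tm_induction with
  | zero => rw [mul_zero, zero_mul]
  | add f g hf hg => rw [mul_add, add_mul, hf, hg]
  | tm p x => rw [evenGen_mul_tm, evenGen_eq, tm_mul_tm, mul_one, mul_comm]

theorem oddGen_anticomm (o o' : O) :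
    (oddGen o : SPoly E O) * oddGen o' = -(oddGen o' * oddGen o) := by
  rw [eq_neg_iff_add_eq_zero, oddGen_eq, oddGen_eq, tm_mul_tm, tm_mul_tm, ← tm_add,
    ExteriorAlgebra.ι_add_mul_swap, tm_zero]

theorem oddGen_comm (o : O) (f : SPoly E O) : oddGen o * f = parity f * oddGen o := by
  induction f using left_induction with
  | one => rw [parity_one, one_mul, mul_one]
  | add f g hf hg => rw [map_add, mul_add, add_mul, hf, hg]
  | smul c f hf => rw [map_smul, mul_smul_comm, smul_mul_assoc, hf]
  | gen_mul i f hf =>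
    rw [parity_mul, mul_assoc, ← hf, ← mul_assoc, ← mul_assoc]
    congr 1
    cases i with
    | inl e => rw [gen, parity_evenGen, evenGen_comm]
    | inr o' => rw [gen, parity_oddGen, oddGen_anticomm, neg_mul]

theorem gen_comm (i : E ⊕ O) (f : SPoly E O) :
    gen i * f = (parity^[genPar i] f) * gen i := by
  cases i with
  | inl e => exact evenGen_comm e f
  | inr o => exact oddGen_comm o f

/-- The sign rule without homogeneity: the even half of `f` passes `g` freely and the odd half
twists it by parity. It follows by induction on `f` from the case of generators, for all `g` at
once. -/
theorem comm_super (f g : SPoly E O) :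
    f * g = g * ((1 / 2 : ℂ) • (f + parity f)) + parity g * ((1 / 2 : ℂ) • (f - parity f)) := by
  induction f using left_induction generalizing g with
  | one => rw [parity_one, sub_self, smul_zero, mul_zero, add_zero, ← two_smul ℂ (1 : SPoly E O),
      smul_smul]; simp
  | add f f' hf hf' =>
    rw [add_mul, hf, hf', map_add]
    simp only [mul_add, mul_sub, smul_add, smul_sub, mul_smul_comm]
    abel
  | smul c f hf =>
    rw [smul_mul_assoc, hf, map_smul]
    simp only [mul_add, mul_sub, smul_add, smul_sub, mul_smul_comm, smul_comm c]
  | gen_mul i f hf =>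
    rw [mul_assoc, hf, mul_add, ← mul_assoc, ← mul_assoc, parity_mul, parity_gen]
    rw [gen_comm, gen_comm]
    cases i <;> simp only [genPar, Function.iterate_zero, Function.iterate_one, id, pow_zero,
      one_smul, pow_one, neg_smul, parity_parity, mul_assoc, mul_smul_comm, mul_add, mul_sub,
      neg_mul, sub_neg_eq_add, smul_add, smul_sub, mul_neg, smul_neg] <;> abel

theorem IsEven.comm {f : SPoly E O} (hf : IsEven f) (g : SPoly E O) : f * g = g * f := by
  rw [comm_super f g, hf, sub_self, smul_zero, mul_zero, add_zero, ← two_smul ℂ f, smul_smul]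
  simp

theorem IsOdd.comm {f : SPoly E O} (hf : IsOdd f) (g : SPoly E O) : f * g = parity g * f := by
  have h := comm_super f g
  rw [hf, add_neg_cancel, smul_zero, mul_zero, zero_add, sub_neg_eq_add, ← two_smul ℂ f,
    smul_smul] at h
  simpa using h

theorem isEven_evenGen (e : E) : IsEven (evenGen e : SPoly E O) := parity_evenGen e

theorem isOdd_oddGen (o : O) : IsOdd (oddGen o : SPoly E O) := parity_oddGen o

/-! ### Homomorphisms out of `ℂ[E | O]` -/

theorem algHom_ext {A : Type*} [Ring A] [Algebra ℂ A] {φ ψ : SPoly E O →ₐ[ℂ] A}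
    (h : ∀ i, φ (gen i) = ψ (gen i)) : φ = ψ := by
  refine AlgHom.ext fun f => ?_
  induction f using left_induction with
  | one => rw [map_one, map_one]
  | add f g hf hg => rw [map_add, map_add, hf, hg]
  | smul c f hf => rw [map_smul, map_smul, hf]
  | gen_mul i f hf => rw [map_mul, map_mul, hf, h]

section Lift

variable {E' O' : Type} (ev : E → SPoly E' O') (od : O → SPoly E' O')

/-- An odd element anticommutes with itself and two is invertible. This is the relation needed to
map out of an exterior algebra. -/
theorem IsOdd.sq {f : SPoly E O} (hf : IsOdd f) : f * f = 0 := by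
  have h := hf.comm f
  rw [hf, neg_mul] at h
  have h2 : (2 : ℂ) • (f * f) = 0 := by rw [two_smul]; nth_rewrite 1 [h]; exact neg_add_cancel _
  exact (smul_eq_zero.mp h2).resolve_left two_ne_zero

theorem isEven_add {f g : SPoly E O} (hf : IsEven f) (hg : IsEven g) : IsEven (f + g) := by
  rw [IsEven, map_add, hf, hg]

theorem isOdd_add {f g : SPoly E O} (hf : IsOdd f) (hg : IsOdd g) : IsOdd (f + g) := by
  rw [IsOdd, map_add, hf, hg, neg_add]

/-- The subalgebra of even elements. -/
def evenSubalgebra (E O : Type) : Subalgebra ℂ (SPoly E O) where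
  carrier := {f | IsEven f}
  mul_mem' {f g} hf hg := by
    simp only [Set.mem_ofPred_eq, IsEven] at *
    rw [parity_mul, hf, hg]
  add_mem' hf hg := isEven_add hf hg
  algebraMap_mem' c := by
    simp only [Set.mem_ofPred_eq, IsEven, Algebra.algebraMap_eq_smul_one, map_smul, parity_one]

/-- Polynomial evaluation needs a commutative target; in `lift` the even generators are evaluated
here, and the values are central in the whole algebra. -/
instance : CommRing (evenSubalgebra E O) where
  mul_comm f g := Subtype.ext (f.2.comm g.1)

theorem isOdd_sum (od : O → SPoly E' O') (hod : ∀ o, IsOdd (od o)) (v : O →₀ ℂ) :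
    IsOdd (Finsupp.linearCombination ℂ od v) := by
  induction v using Finsupp.induction_linear with
  | zero => simp [IsOdd]
  | add v w hv hw => rw [map_add]; exact isOdd_add hv hw
  | single o c => simp [IsOdd, show parity (od o) = -od o from hod o]

/-- The homomorphism that sends the generators to given elements of the same parity. -/
def lift (hev : ∀ e, IsEven (ev e)) (hod : ∀ o, IsOdd (od o)) : SPoly E O →ₐ[ℂ] SPoly E' O' :=
  Algebra.TensorProduct.lift
    ((evenSubalgebra E' O').val.comp (MvPolynomial.aeval fun e => ⟨ev e, hev e⟩))
    (ExteriorAlgebra.lift ℂ ⟨Finsupp.linearCombination ℂ od, fun v => (isOdd_sum od hod v).sq⟩)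
    (fun p _ => (MvPolynomial.aeval (fun e => (⟨ev e, hev e⟩ : evenSubalgebra E' O')) p).2.comm _)

variable {ev od}

theorem lift_evenGen (hev : ∀ e, IsEven (ev e)) (hod : ∀ o, IsOdd (od o)) (e : E) :
    lift ev od hev hod (evenGen e) = ev e := by
  refine (Algebra.TensorProduct.lift_tmul _ _ _ _ _).trans ?_
  simp

theorem lift_oddGen (hev : ∀ e, IsEven (ev e)) (hod : ∀ o, IsOdd (od o)) (o : O) :
    lift ev od hev hod (oddGen o) = od o := by
  refine (Algebra.TensorProduct.lift_tmul _ _ _ _ _).trans ?_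
  simp

theorem map_evenGen (f : E → E') (g : O → O') (e : E) :
    map f g (evenGen e) = evenGen (f e) := by
  refine (Algebra.TensorProduct.map_tmul _ _ _ _).trans ?_
  simp only [MvPolynomial.rename_X, map_one]; rfl

theorem map_oddGen (f : E → E') (g : O → O') (o : O) :
    map f g (oddGen o) = oddGen (g o) := by
  refine (Algebra.TensorProduct.map_tmul _ _ _ _).trans ?_
  rw [map_one, ExteriorAlgebra.map_apply_ι]
  simp [oddGen]

theorem map_parity_of_gen (φ : SPoly E O →ₐ[ℂ] SPoly E' O')
    (h : ∀ i, φ (parity (gen i)) = parity (φ (gen i))) (f : SPoly E O) :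
    φ (parity f) = parity (φ f) := by
  have : φ.comp parityHom = parityHom.comp φ := algHom_ext h
  exact DFunLike.congr_fun this f

end Lift

/-! ### Derivatives -/

theorem evenDeriv_tm (e : E) (p : MvPolynomial E ℂ) (x : ExteriorAlgebra ℂ (O →₀ ℂ)) :
    evenDeriv e (tm p x) = tm (MvPolynomial.pderiv e p) x :=
  LinearMap.rTensor_tmul _ _ _ _

theorem oddDeriv_tm (o : O) (p : MvPolynomial E ℂ) (x : ExteriorAlgebra ℂ (O →₀ ℂ)) :
    oddDeriv o (tm p x) = tm p
      (CliffordAlgebra.contractLeft (Q := (0 : QuadraticForm ℂ (O →₀ ℂ))) (Finsupp.lapply o) x) :=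
  LinearMap.lTensor_tmul _ _ _ _

open Classical in
theorem evenDeriv_evenGen_mul (e e' : E) (f : SPoly E O) :
    evenDeriv e (evenGen e' * f) = (if e = e' then f else 0) + evenGen e' * evenDeriv e f := by
  induction f using tm_induction with
  | zero => simp
  | add f g hf hg => rw [mul_add, map_add, map_add, hf, hg, mul_add]; split_ifs <;> abel
  | tm p x =>
    rw [evenGen_mul_tm, evenDeriv_tm, evenDeriv_tm, evenGen_mul_tm, Derivation.leibniz,
      MvPolynomial.pderiv_X, smul_eq_mul, smul_eq_mul, add_tm, add_comm]
    by_cases h : e = e'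
    · subst h; simp
    · rw [Pi.single_eq_of_ne' h, if_neg h, mul_zero, zero_tm]

theorem evenDeriv_oddGen_mul (e : E) (o : O) (f : SPoly E O) :
    evenDeriv e (oddGen o * f) = oddGen o * evenDeriv e f := by
  induction f using tm_induction with
  | zero => simp
  | add f g hf hg => rw [mul_add, map_add, map_add, hf, hg, mul_add]
  | tm p x => rw [oddGen_mul_tm, evenDeriv_tm, evenDeriv_tm, oddGen_mul_tm]

theorem oddDeriv_evenGen_mul (o : O) (e : E) (f : SPoly E O) :
    oddDeriv o (evenGen e * f) = evenGen e * oddDeriv o f := by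
  induction f using tm_induction with
  | zero => simp
  | add f g hf hg => rw [mul_add, map_add, map_add, hf, hg, mul_add]
  | tm p x => rw [evenGen_mul_tm, oddDeriv_tm, oddDeriv_tm, evenGen_mul_tm]

open Classical in
theorem oddDeriv_oddGen_mul (o o' : O) (f : SPoly E O) :
    oddDeriv o (oddGen o' * f) = (if o = o' then f else 0) - oddGen o' * oddDeriv o f := by
  induction f using tm_induction with
  | zero => simp
  | add f g hf hg => rw [mul_add, map_add, map_add, hf, hg, mul_add]; split_ifs <;> abel
  | tm p x =>
    rw [oddGen_mul_tm, oddDeriv_tm, oddDeriv_tm, oddGen_mul_tm]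
    refine (congrArg (tm p) (CliffordAlgebra.contractLeft_ι_mul _ _ _)).trans ?_
    rw [sub_eq_add_neg, tm_add, sub_eq_add_neg, ← neg_one_smul ℂ (tm _ _), ← tm_smul,
      neg_one_smul]
    refine congrArg₂ (· + ·) ?_ rfl
    by_cases h : o = o'
    · subst h; simp
    · rw [if_neg h, Finsupp.lapply_apply, Finsupp.single_eq_of_ne h, zero_smul, tm_zero]

theorem evenDeriv_one (e : E) : evenDeriv e (1 : SPoly E O) = 0 := by
  rw [one_eq_tm, evenDeriv_tm, Derivation.map_one_eq_zero, zero_tm]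

theorem oddDeriv_one (o : O) : oddDeriv o (1 : SPoly E O) = 0 := by
  rw [one_eq_tm, oddDeriv_tm]
  exact (congrArg (tm 1) (CliffordAlgebra.contractLeft_one _ _)).trans (tm_zero _)

/-- The partial derivative with respect to a generator of either parity. -/
def deriv : E ⊕ O → Module.End ℂ (SPoly E O)
  | .inl e => evenDeriv e
  | .inr o => oddDeriv o

theorem deriv_one (i : E ⊕ O) : deriv i (1 : SPoly E O) = 0 := by
  cases i
  · exact evenDeriv_one _
  · exact oddDeriv_one _

-- The super Leibniz rule, uniform in the parities. Together with `deriv_one` it determines the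
-- derivatives, so their remaining properties are inductions along it.
open Classical in
theorem deriv_gen_mul (i j : E ⊕ O) (f : SPoly E O) :
    deriv i (gen j * f) =
      (if i = j then f else 0) + (-1 : ℂ) ^ (genPar i * genPar j) • (gen j * deriv i f) := by
  cases i <;> cases j <;> simp [deriv, gen, genPar, evenDeriv_evenGen_mul, evenDeriv_oddGen_mul,
    oddDeriv_evenGen_mul, oddDeriv_oddGen_mul, sub_eq_add_neg]

theorem neg_one_pow_mul_self (n : ℕ) : ((-1 : ℂ) ^ n) * (-1) ^ n = 1 := by
  rw [← mul_pow]; simp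

theorem parity_deriv (i : E ⊕ O) (f : SPoly E O) :
    parity (deriv i f) = (-1 : ℂ) ^ genPar i • deriv i (parity f) := by
  classical
  induction f using left_induction with
  | one => rw [parity_one, deriv_one, map_zero, smul_zero]
  | add f g hf hg => simp only [map_add, hf, hg, smul_add]
  | smul c f hf => simp only [map_smul, hf, smul_comm c]
  | gen_mul j f hf =>
    rw [deriv_gen_mul, map_add, map_smul, parity_mul, parity_mul, hf, parity_gen, smul_mul_assoc,
      smul_mul_assoc, map_smul, deriv_gen_mul]
    by_cases h : i = j
    · subst h
      cases i <;> simp [genPar, sub_eq_add_neg, add_comm]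
    · simp only [if_neg h, map_zero, zero_add]
      cases i <;> cases j <;> simp [genPar]

theorem deriv_comm (i j : E ⊕ O) (f : SPoly E O) :
    deriv i (deriv j f) = (-1 : ℂ) ^ (genPar i * genPar j) • deriv j (deriv i f) := by
  classical
  induction f using left_induction with
  | one => simp only [deriv_one, map_zero, smul_zero]
  | add f g hf hg => simp only [map_add, hf, hg, smul_add]
  | smul c f hf => simp only [map_smul, hf, smul_comm c]
  | gen_mul k f hf =>
    -- Exchanging `i` and `j` permutes the two Kronecker terms, so it suffices to separate the cases
    -- in which `i` or `j` equals `k`.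
    have key : ∀ i j : E ⊕ O, deriv i (deriv j (gen k * f)) = (if j = k then deriv i f else 0) +
        (-1 : ℂ) ^ (genPar j * genPar k) • ((if i = k then deriv j f else 0) +
          (-1 : ℂ) ^ (genPar i * genPar k) • (gen k * deriv i (deriv j f))) := fun i j => by
      rw [deriv_gen_mul, map_add, map_smul, deriv_gen_mul, apply_ite (deriv i), map_zero]
    rw [key, key, hf]
    by_cases hik : i = k <;> by_cases hjk : j = k
    · subst hik; subst hjk
      cases j <;> simp [genPar]
    · subst hik
      simp only [if_true, if_neg hjk]
      cases i <;> cases j <;> simp [genPar, add_comm]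
    · subst hjk
      simp only [if_true, if_neg hik]
      cases i <;> cases j <;> simp [genPar, add_comm]
    · simp only [if_neg hik, if_neg hjk]
      cases i <;> cases j <;> cases k <;> simp [genPar]

end SPoly

end SuperAiry

end

/-! ### Operators, their parity, linearity over the constants, and superbrackets. -/

noncomputable section

namespace SuperAiry

variable {m q : ℕ} {A₀ A₁ : Type}

/-! ### Operators and their parity -/

/-- The parity of a coordinate. -/
def par : A₀ ⊕ A₁ → ℕ
  | .inl _ => 0
  | .inr _ => 1

/-- The generator of `R[A₀ | A₁]` that belongs to a coordinate. -/
def coordIx (m q : ℕ) : A₀ ⊕ A₁ → (Fin m ⊕ A₀) ⊕ (Fin q ⊕ A₁)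
  | .inl i => .inl (.inr i)
  | .inr i => .inr (.inr i)

theorem coord_eq_gen (j : A₀ ⊕ A₁) : (coord j : Fun m q A₀ A₁) = SPoly.gen (coordIx m q j) := by
  cases j <;> rfl

theorem partialDeriv_eq_deriv (j : A₀ ⊕ A₁) :
    (partialDeriv j : Op m q A₀ A₁) = SPoly.deriv (coordIx m q j) := by
  cases j <;> rfl

theorem genPar_coordIx (j : A₀ ⊕ A₁) : SPoly.genPar (coordIx m q j) = par j := by
  cases j <;> rfl

theorem coordIx_injective : Function.Injective (coordIx m q : A₀ ⊕ A₁ → _) := by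
  rintro (i | i) (j | j) h <;> simp_all [coordIx]

theorem parity_const (c : Params m q) :
    SPoly.parity (const c : Fun m q A₀ A₁) = const (SPoly.parity c) := by
  refine (SPoly.map_parity_of_gen const (fun i => ?_) c).symm
  cases i with
  | inl i => rw [SPoly.gen, const, SPoly.parity_evenGen, SPoly.map_evenGen, SPoly.parity_evenGen]
  | inr i =>
    rw [SPoly.gen, const, SPoly.parity_oddGen, map_neg, SPoly.map_oddGen, SPoly.parity_oddGen]

theorem parity_coord (j : A₀ ⊕ A₁) :
    SPoly.parity (coord j : Fun m q A₀ A₁) = (-1 : ℂ) ^ par j • coord j := by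
  rw [coord_eq_gen, SPoly.parity_gen, genPar_coordIx]

theorem parity_pow_const (e : ℕ) (c : Params m q) :
    SPoly.parity^[e] (const c : Fun m q A₀ A₁) = const (SPoly.parity^[e] c) := by
  induction e generalizing c with
  | zero => rfl
  | succ e ih => rw [Function.iterate_succ_apply, Function.iterate_succ_apply, parity_const, ih]

theorem coord_comm (j : A₀ ⊕ A₁) (f : Fun m q A₀ A₁) :
    coord j * f = SPoly.parity^[par j] f * coord j := by
  rw [coord_eq_gen, SPoly.gen_comm, genPar_coordIx]

theorem parity_pow_parity_pow (e : ℕ) (f : Fun m q A₀ A₁) :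
    SPoly.parity^[e] (SPoly.parity^[e] f) = f := by
  induction e generalizing f with
  | zero => rfl
  | succ e ih =>
    rw [Function.iterate_succ_apply, Function.iterate_succ_apply' SPoly.parity,
      SPoly.parity_parity, ih]

theorem mul_coord (j : A₀ ⊕ A₁) (f : Fun m q A₀ A₁) :
    f * coord j = coord j * SPoly.parity^[par j] f := by
  rw [coord_comm, parity_pow_parity_pow]

theorem partialDeriv_one (j : A₀ ⊕ A₁) : (partialDeriv j : Op m q A₀ A₁) 1 = 0 := by
  rw [partialDeriv_eq_deriv, SPoly.deriv_one]

open Classical in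
theorem partialDeriv_coord_mul (i j : A₀ ⊕ A₁) (f : Fun m q A₀ A₁) :
    partialDeriv i (coord j * f) = (if i = j then f else 0) +
      (-1 : ℂ) ^ (par i * par j) • (coord j * partialDeriv i f) := by
  rw [partialDeriv_eq_deriv, coord_eq_gen, SPoly.deriv_gen_mul, genPar_coordIx, genPar_coordIx]
  simp only [coordIx_injective.eq_iff]

theorem parity_partialDeriv (j : A₀ ⊕ A₁) (f : Fun m q A₀ A₁) :
    SPoly.parity (partialDeriv j f) = (-1 : ℂ) ^ par j • partialDeriv j (SPoly.parity f) := by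
  rw [partialDeriv_eq_deriv, SPoly.parity_deriv, genPar_coordIx]

theorem partialDeriv_comm (i j : A₀ ⊕ A₁) (f : Fun m q A₀ A₁) :
    partialDeriv i (partialDeriv j f) =
      (-1 : ℂ) ^ (par i * par j) • partialDeriv j (partialDeriv i f) := by
  rw [partialDeriv_eq_deriv, partialDeriv_eq_deriv, SPoly.deriv_comm, genPar_coordIx,
    genPar_coordIx]

theorem const_mul_coord (c : Params m q) (j : A₀ ⊕ A₁) (f : Fun m q A₀ A₁) :
    const c * (coord j * f) = coord j * (const (SPoly.parity^[par j] c) * f) := by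
  rw [← mul_assoc, mul_coord, parity_pow_const, mul_assoc]

/-- Induction from constants, by sums and left multiplication by coordinates. -/
theorem fun_induction {P : Fun m q A₀ A₁ → Prop} (hconst : ∀ c, P (const c))
    (add : ∀ f g, P f → P g → P (f + g)) (coord_mul : ∀ j f, P f → P (coord j * f))
    (f : Fun m q A₀ A₁) : P f := by
  -- A free constant factor absorbs the generators of $R$ that occur in `f`; a coordinate moves past
  -- it and twists it by parity.
  suffices h : ∀ c, P (const c * f) by simpa using h 1
  induction f using SPoly.left_induction with
  | one => intro c; rw [mul_one]; exact hconst c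
  | add f g hf hg => intro c; rw [mul_add]; exact add _ _ (hf c) (hg c)
  | smul a f hf =>
    intro c
    have := hf (a • c)
    rwa [map_smul, smul_mul_assoc, ← mul_smul_comm] at this
  | gen_mul i f hf =>
    intro c
    have hcoord : ∀ j : A₀ ⊕ A₁, P (const c * (coord j * f)) := fun j => by
      rw [const_mul_coord]; exact coord_mul _ _ (hf _)
    rcases i with (i | i) | (i | i)
    · have := hf (c * SPoly.evenGen i)
      rwa [map_mul, const, SPoly.map_evenGen, mul_assoc] at this
    · exact hcoord (.inl i)
    · have := hf (c * SPoly.oddGen i)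
      rwa [map_mul, const, SPoly.map_oddGen, mul_assoc] at this
    · exact hcoord (.inr i)

theorem partialDeriv_const (j : A₀ ⊕ A₁) (c : Params m q) :
    (partialDeriv j : Op m q A₀ A₁) (const c) = 0 := by
  classical
  induction c using SPoly.left_induction with
  | one => rw [map_one, partialDeriv_one]
  | add f g hf hg => rw [map_add, map_add, hf, hg, add_zero]
  | smul a f hf => rw [map_smul, map_smul, hf, smul_zero]
  | gen_mul i f hf =>
    rw [map_mul]
    have h : ∃ i', (const (SPoly.gen i : Params m q) : Fun m q A₀ A₁) = SPoly.gen i' ∧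
        coordIx m q j ≠ i' := by
      rcases i with i | i
      · exact ⟨.inl (.inl i), SPoly.map_evenGen _ _ _, by cases j <;> simp [coordIx]⟩
      · exact ⟨.inr (.inl i), SPoly.map_oddGen _ _ _, by cases j <;> simp [coordIx]⟩
    obtain ⟨i', h1, h2⟩ := h
    rw [h1, partialDeriv_eq_deriv, SPoly.deriv_gen_mul, if_neg h2, ← partialDeriv_eq_deriv, hf]
    simp

theorem partialDeriv_mul_const (j : A₀ ⊕ A₁) (f : Fun m q A₀ A₁) (c : Params m q) :
    partialDeriv j (f * const c) = partialDeriv j f * const c := by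
  classical
  induction f using fun_induction with
  | hconst b => rw [← map_mul, partialDeriv_const, partialDeriv_const, zero_mul]
  | add f g hf hg => rw [add_mul, map_add, map_add, add_mul, hf, hg]
  | coord_mul i f hf =>
    rw [mul_assoc, partialDeriv_coord_mul, partialDeriv_coord_mul, hf, add_mul, smul_mul_assoc,
      mul_assoc]
    split_ifs <;> simp

/-- Conjugation by the parity automorphism, as a homomorphism of algebras. -/
def sgn : Op m q A₀ A₁ →ₐ[ℂ] Op m q A₀ A₁ :=
  AlgHom.ofLinearMap opParity
    (LinearMap.ext fun f => SPoly.parity_parity f)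
    (fun D E => LinearMap.ext fun f => congrArg SPoly.parity
      (congrArg D (SPoly.parity_parity (E (SPoly.parity f))).symm))

theorem sgn_apply (D : Op m q A₀ A₁) (f : Fun m q A₀ A₁) :
    sgn D f = SPoly.parity (D (SPoly.parity f)) := rfl

theorem sgn_sgn (D : Op m q A₀ A₁) : sgn (sgn D) = D :=
  LinearMap.ext fun f => by simp only [sgn_apply, SPoly.parity_parity]

theorem sgn_pow_apply (e : ℕ) (D : Op m q A₀ A₁) (f : Fun m q A₀ A₁) :
    (sgn ^ e) D f = SPoly.parity^[e] (D (SPoly.parity^[e] f)) := by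
  induction e generalizing D with
  | zero => rfl
  | succ e ih =>
    rw [pow_succ, AlgHom.mul_apply, ih, sgn_apply, Function.iterate_succ_apply,
      Function.iterate_succ_apply' SPoly.parity e f]

theorem sgn_pow_succ_apply (e : ℕ) (D : Op m q A₀ A₁) : (sgn ^ (e + 1)) D = sgn ((sgn ^ e) D) := by
  rw [pow_succ', AlgHom.mul_apply]

theorem sgn_pow_sgn (e : ℕ) (D : Op m q A₀ A₁) : (sgn ^ e) (sgn D) = sgn ((sgn ^ e) D) := by
  rw [← AlgHom.mul_apply, ← AlgHom.mul_apply, (Commute.pow_self sgn e).eq]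

theorem sgn_pow_sgn_pow (e : ℕ) (D : Op m q A₀ A₁) : (sgn ^ e) ((sgn ^ e) D) = D := by
  refine LinearMap.ext fun f => ?_
  rw [sgn_pow_apply, sgn_pow_apply, parity_pow_parity_pow, parity_pow_parity_pow]

/-- `D` is homogeneous of parity `e`. -/
def HasPar (e : ℕ) (D : Op m q A₀ A₁) : Prop := sgn D = (-1 : ℂ) ^ e • D

theorem HasPar.pow {e : ℕ} {D : Op m q A₀ A₁} (h : HasPar e D) (k : ℕ) :
    (sgn ^ k) D = (-1 : ℂ) ^ (e * k) • D := by
  induction k with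
  | zero => simp
  | succ k ih => rw [sgn_pow_succ_apply, ih, map_smul, h, smul_smul, ← pow_add, mul_add, mul_one]

theorem HasPar.mul {e e' : ℕ} {D E : Op m q A₀ A₁} (hD : HasPar e D) (hE : HasPar e' E) :
    HasPar (e + e') (D * E) := by
  rw [HasPar, map_mul, hD, hE, smul_mul_smul_comm, pow_add]

theorem HasPar.smul {e : ℕ} {D : Op m q A₀ A₁} (hD : HasPar e D) (c : ℂ) : HasPar e (c • D) := by
  rw [HasPar, map_smul, hD, smul_comm]

theorem HasPar.add {e : ℕ} {D E : Op m q A₀ A₁} (hD : HasPar e D) (hE : HasPar e E) :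
    HasPar e (D + E) := by
  rw [HasPar, map_add, hD, hE, smul_add]

theorem HasPar.sub {e : ℕ} {D E : Op m q A₀ A₁} (hD : HasPar e D) (hE : HasPar e E) :
    HasPar e (D - E) := by
  rw [HasPar, map_sub, hD, hE, smul_sub]

theorem hasPar_zero (e : ℕ) : HasPar e (0 : Op m q A₀ A₁) := by simp [HasPar]

theorem hasPar_one : HasPar 0 (1 : Op m q A₀ A₁) := by simp [HasPar]

theorem HasPar.congr {e e' : ℕ} {D : Op m q A₀ A₁} (h : HasPar e D)
    (he : (-1 : ℂ) ^ e = (-1) ^ e') : HasPar e' D := by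
  rw [HasPar, h, he]

theorem sgn_mulOp (f : Fun m q A₀ A₁) : sgn (mulOp f) = mulOp (SPoly.parity f) :=
  LinearMap.ext fun g => by
    simp only [sgn_apply, mulOp, LinearMap.mulLeft_apply, SPoly.parity_mul, SPoly.parity_parity]

theorem sgn_pow_mulOp (e : ℕ) (f : Fun m q A₀ A₁) :
    (sgn ^ e) (mulOp f) = mulOp (SPoly.parity^[e] f) := by
  induction e with
  | zero => rfl
  | succ e ih => rw [sgn_pow_succ_apply, ih, sgn_mulOp, Function.iterate_succ_apply']

theorem mulOp_apply (f g : Fun m q A₀ A₁) : mulOp f g = f * g := rfl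

theorem mulOp_smul (c : ℂ) (f : Fun m q A₀ A₁) : mulOp (c • f) = c • mulOp f :=
  LinearMap.ext fun g => smul_mul_assoc c f g

theorem mulOp_add (f g : Fun m q A₀ A₁) : mulOp (f + g) = mulOp f + mulOp g :=
  LinearMap.ext fun h => add_mul f g h

theorem mulOp_neg (f : Fun m q A₀ A₁) : mulOp (-f) = -mulOp f :=
  LinearMap.ext fun h => neg_mul f h

theorem mulOp_mul (f g : Fun m q A₀ A₁) : mulOp (f * g) = mulOp f * mulOp g :=
  LinearMap.ext fun h => mul_assoc f g h

theorem mulOp_one : mulOp (1 : Fun m q A₀ A₁) = 1 := LinearMap.ext fun h => one_mul h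

theorem mulOp_zero : mulOp (0 : Fun m q A₀ A₁) = 0 := LinearMap.ext fun h => zero_mul h

theorem hasPar_coord (j : A₀ ⊕ A₁) : HasPar (par j) (mulOp (coord j) : Op m q A₀ A₁) := by
  rw [HasPar, sgn_mulOp, parity_coord, mulOp_smul]

theorem hasPar_partialDeriv (j : A₀ ⊕ A₁) : HasPar (par j) (partialDeriv j : Op m q A₀ A₁) :=
  LinearMap.ext fun f => by
    rw [sgn_apply, parity_partialDeriv, SPoly.parity_parity, LinearMap.smul_apply]

theorem hasPar_const_even {c : Params m q} (hc : SPoly.IsEven c) :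
    HasPar 0 (mulOp (const c) : Op m q A₀ A₁) := by
  rw [HasPar, sgn_mulOp, parity_const, hc, pow_zero, one_smul]

theorem hasPar_const_odd {c : Params m q} (hc : SPoly.IsOdd c) :
    HasPar 1 (mulOp (const c) : Op m q A₀ A₁) := by
  rw [HasPar, sgn_mulOp, parity_const, hc, pow_one, map_neg, mulOp_neg]
  exact (neg_one_smul ℂ _).symm

/-! ### Linearity over the constants -/

/-- Operators that commute with right multiplication by constants. -/
def RLin (m q : ℕ) (A₀ A₁ : Type) : Subalgebra ℂ (Op m q A₀ A₁) where
  carrier := {D | ∀ f c, D (f * const c) = D f * const c}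
  mul_mem' {D E} hD hE f c := by
    change D (E _) = D (E _) * _
    rw [hE, hD]
  add_mem' {D E} hD hE f c := by
    change D _ + E _ = (D _ + E _) * _
    rw [hD, hE, add_mul]
  algebraMap_mem' a f c := by
    simp [Algebra.algebraMap_eq_smul_one]

theorem mem_RLin {D : Op m q A₀ A₁} :
    D ∈ RLin m q A₀ A₁ ↔ ∀ f c, D (f * const c) = D f * const c := Iff.rfl

/-- Left and right multiplications commute. This is why linearity over $R$ is taken on the right:
odd operators then need no signs. -/
theorem mulOp_mem_RLin (f : Fun m q A₀ A₁) : mulOp f ∈ RLin m q A₀ A₁ :=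
  fun g c => (mul_assoc f g _).symm

theorem partialDeriv_mem_RLin (j : A₀ ⊕ A₁) : partialDeriv j ∈ RLin m q A₀ A₁ :=
  partialDeriv_mul_const j

theorem sgn_mem_RLin {D : Op m q A₀ A₁} (hD : D ∈ RLin m q A₀ A₁) : sgn D ∈ RLin m q A₀ A₁ := by
  intro f c
  rw [sgn_apply, SPoly.parity_mul, parity_const, hD, SPoly.parity_mul, parity_const,
    SPoly.parity_parity, sgn_apply]

theorem sgn_pow_mem_RLin {D : Op m q A₀ A₁} (hD : D ∈ RLin m q A₀ A₁) (e : ℕ) :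
    (sgn ^ e) D ∈ RLin m q A₀ A₁ := by
  induction e with
  | zero => exact hD
  | succ e ih => rw [sgn_pow_succ_apply]; exact sgn_mem_RLin ih

theorem RLin.apply_const {D : Op m q A₀ A₁} (hD : D ∈ RLin m q A₀ A₁) (c : Params m q) :
    D (const c) = D 1 * const c := by
  have := hD 1 c
  rwa [one_mul] at this

/-! ### Brackets -/

/-- The supercommutator `[D, y]` with an operator `y` of parity `e`. -/
def ad (e : ℕ) (y : Op m q A₀ A₁) : Op m q A₀ A₁ →ₗ[ℂ] Op m q A₀ A₁ :=
  LinearMap.mulRight ℂ y - LinearMap.mulLeft ℂ y ∘ₗ (sgn ^ e).toLinearMap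

theorem ad_apply (e : ℕ) (y D : Op m q A₀ A₁) : ad e y D = D * y - y * (sgn ^ e) D := rfl

/-- The supercommutator `[D, E]` with an operator `D` of parity `e`. -/
def br (e : ℕ) (D : Op m q A₀ A₁) : Op m q A₀ A₁ →ₗ[ℂ] Op m q A₀ A₁ :=
  LinearMap.mulLeft ℂ D - LinearMap.mulRight ℂ D ∘ₗ (sgn ^ e).toLinearMap

theorem br_apply (e : ℕ) (D E : Op m q A₀ A₁) : br e D E = D * E - (sgn ^ e) E * D := rfl

/-- The element `y` acts from the right, so the sign falls on the factor it passes. It is carried by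
`sgn ^ e`, and neither factor has to be homogeneous. -/
theorem ad_mul (e : ℕ) (y D E : Op m q A₀ A₁) :
    ad e y (D * E) = D * ad e y E + ad e y D * (sgn ^ e) E := by
  simp only [ad_apply, map_mul, mul_sub, sub_mul, mul_assoc]
  abel

theorem br_mul (e : ℕ) (D E E' : Op m q A₀ A₁) :
    br e D (E * E') = br e D E * E' + (sgn ^ e) E * br e D E' := by
  simp only [br_apply, map_mul, mul_sub, sub_mul, mul_assoc]
  abel

theorem sgn_ad {e : ℕ} {y : Op m q A₀ A₁} (hy : HasPar e y) (k : ℕ) (D : Op m q A₀ A₁) :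
    sgn (ad k y D) = (-1 : ℂ) ^ e • ad k y (sgn D) := by
  simp only [ad_apply, map_sub, map_mul, sgn_pow_sgn]
  rw [hy]
  simp only [mul_smul_comm, smul_mul_assoc, smul_sub]

theorem sgn_pow_ad {e : ℕ} {y : Op m q A₀ A₁} (hy : HasPar e y) (k l : ℕ) (D : Op m q A₀ A₁) :
    (sgn ^ l) (ad k y D) = (-1 : ℂ) ^ (e * l) • ad k y ((sgn ^ l) D) := by
  induction l with
  | zero => simp
  | succ l ih =>
    rw [sgn_pow_succ_apply, ih, map_smul, sgn_ad hy, smul_smul, ← pow_add, sgn_pow_succ_apply,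
      mul_add, mul_one]

theorem HasPar.ad {e e' k : ℕ} {y D : Op m q A₀ A₁} (hy : HasPar e y) (hD : HasPar e' D) :
    HasPar (e + e') (ad k y D) := by
  rw [HasPar, sgn_ad hy, hD, map_smul, smul_smul, pow_add]

theorem HasPar.br {e e' k : ℕ} {y D : Op m q A₀ A₁} (hy : HasPar e y) (hD : HasPar e' D) :
    HasPar (e + e') (br k y D) := by
  rw [HasPar, br_apply, map_sub, map_mul, map_mul, hy, ← sgn_pow_sgn, hD, map_smul]
  simp only [smul_mul_smul_comm, smul_sub, pow_add, mul_comm]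

/-- The super Jacobi identity. Only `y` and `D` have to be homogeneous, since the sign of `E` is
expressed through `sgn`. -/
theorem ad_br {e e' : ℕ} {y D : Op m q A₀ A₁} (hy : HasPar e' y) (hD : HasPar e D)
    (E : Op m q A₀ A₁) :
    ad e' y (br e D E) = br e D (ad e' y E) + br (e + e') (ad e' y D) ((sgn ^ e') E) := by
  have h1 := hD.pow e'
  have h2 : (sgn ^ e) (ad e' y E) = (-1 : ℂ) ^ (e' * e) • ad e' y ((sgn ^ e) E) :=
    sgn_pow_ad hy e' e E
  have h3 : (sgn ^ (e + e')) ((sgn ^ e') E) = (sgn ^ e) E := by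
    rw [pow_add, AlgHom.mul_apply, sgn_pow_sgn_pow]
  have h4 : (sgn ^ e') ((sgn ^ e) E) = (sgn ^ e) ((sgn ^ e') E) := by
    rw [← AlgHom.mul_apply, ← AlgHom.mul_apply, ((Commute.refl sgn).pow_pow e' e).eq]
  rw [br_apply e D (ad e' y E), h2, br_apply (e + e'), h3]
  simp only [ad_apply, br_apply, map_sub, map_mul, h1, h4, smul_sub, mul_sub, sub_mul,
    mul_smul_comm, smul_mul_assoc, mul_assoc, mul_comm e' e]
  abel

theorem ad_mulOp_left (j : A₀ ⊕ A₁) (f : Fun m q A₀ A₁) (D : Op m q A₀ A₁) :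
    ad (par j) (mulOp (coord j)) (mulOp f * D) = mulOp f * ad (par j) (mulOp (coord j)) D := by
  rw [ad_mul, add_eq_left, ad_apply, sgn_pow_mulOp, ← mulOp_mul, ← mulOp_mul, mul_coord, sub_self,
    zero_mul]

theorem ad_coord_mulOp (j : A₀ ⊕ A₁) (f : Fun m q A₀ A₁) :
    ad (par j) (mulOp (coord j)) (mulOp f) = 0 := by
  rw [ad_apply, sgn_pow_mulOp, ← mulOp_mul, ← mulOp_mul, mul_coord, sub_self]

open Classical in
theorem ad_coord_partialDeriv (i j : A₀ ⊕ A₁) :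
    ad (par j) (mulOp (coord j)) (partialDeriv i : Op m q A₀ A₁) = if i = j then 1 else 0 := by
  refine LinearMap.ext fun f => ?_
  rw [ad_apply, (hasPar_partialDeriv i).pow, LinearMap.sub_apply, Module.End.mul_apply,
    mulOp_apply, partialDeriv_coord_mul, Module.End.mul_apply, LinearMap.smul_apply, mulOp_apply,
    mul_smul_comm, add_sub_cancel_right]
  split_ifs <;> rfl

open Classical in
theorem ad_partialDeriv_coord (i j : A₀ ⊕ A₁) :
    ad (par i) (partialDeriv i) (mulOp (coord j) : Op m q A₀ A₁) =
      if i = j then -(-1 : ℂ) ^ par j • (1 : Op m q A₀ A₁) else 0 := by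
  refine LinearMap.ext fun f => ?_
  rw [ad_apply, (hasPar_coord j).pow, LinearMap.sub_apply, Module.End.mul_apply,
    mulOp_apply, Module.End.mul_apply, LinearMap.smul_apply, mulOp_apply, map_smul,
    partialDeriv_coord_mul, smul_add, smul_smul, mul_comm (par j), SPoly.neg_one_pow_mul_self,
    one_smul, sub_add_cancel_right]
  by_cases h : i = j
  · subst h
    rw [if_pos rfl, if_pos rfl]
    cases i <;> simp [par]
  · simp [h]

theorem ad_partialDeriv_partialDeriv (i j : A₀ ⊕ A₁) :
    ad (par i) (partialDeriv i) (partialDeriv j : Op m q A₀ A₁) = 0 := by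
  refine LinearMap.ext fun f => ?_
  rw [ad_apply, (hasPar_partialDeriv j).pow, LinearMap.sub_apply, Module.End.mul_apply,
    Module.End.mul_apply, LinearMap.smul_apply, map_smul, partialDeriv_comm, mul_comm (par j),
    sub_self, LinearMap.zero_apply]

theorem ad_partialDeriv_const (i : A₀ ⊕ A₁) (c : Params m q) :
    ad (par i) (partialDeriv i) (mulOp (const c) : Op m q A₀ A₁) = 0 := by
  refine LinearMap.ext fun f => ?_
  rw [ad_apply, LinearMap.sub_apply, sgn_pow_mulOp, parity_pow_const]
  induction f using fun_induction generalizing c with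
  | hconst b =>
    simp only [Module.End.mul_apply, mulOp_apply, ← map_mul, partialDeriv_const, map_zero,
      mul_zero, sub_self, LinearMap.zero_apply]
  | add f g hf hg =>
    have h1 := hf c
    have h2 := hg c
    rw [map_add, map_add, add_sub_add_comm, h1, h2]; simp
  | coord_mul j f hf =>
    classical
    have h1 := sub_eq_zero.mp (hf (SPoly.parity^[par j] c))
    simp only [Module.End.mul_apply, mulOp_apply] at h1 ⊢
    rw [LinearMap.zero_apply, partialDeriv_coord_mul, mul_add, mul_smul_comm, const_mul_coord, h1,
      const_mul_coord, partialDeriv_coord_mul]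
    have h2 : SPoly.parity^[par j] (SPoly.parity^[par i] c) =
      SPoly.parity^[par i] (SPoly.parity^[par j] c) := (Function.Commute.iterate_iterate_self _ _ _) c
    rw [h2]
    by_cases h : i = j
    · subst h
      rw [if_pos rfl, if_pos rfl, ← parity_pow_const, ← parity_pow_const, parity_pow_parity_pow]
      simp
    · simp [h]

/-- An operator linear over the constants is determined by its value at `1` and its
supercommutators with the coordinates. -/
theorem RLin.ext {D E : Op m q A₀ A₁} (hD : D ∈ RLin m q A₀ A₁) (hE : E ∈ RLin m q A₀ A₁)
    (h1 : D 1 = E 1)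
    (h : ∀ j, ad (par j) (mulOp (coord j)) D = ad (par j) (mulOp (coord j)) E) : D = E := by
  rw [← sub_eq_zero]
  have hZ := sub_mem hD hE
  have hZ1 : (D - E) 1 = 0 := by rw [LinearMap.sub_apply, h1, sub_self]
  replace h : ∀ j, ad (par j) (mulOp (coord j)) (D - E) = 0 := fun j => by
    rw [map_sub, h, sub_self]
  generalize D - E = Z at hZ hZ1 h
  refine LinearMap.ext fun f => ?_
  rw [LinearMap.zero_apply]
  -- Passing a coordinate twists the polynomial by parity, so the induction treats all parity twists
  -- of `f` together.
  suffices H : ∀ e, Z (SPoly.parity^[e] f) = 0 from H 0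
  induction f using fun_induction with
  | hconst c => intro e; rw [parity_pow_const, RLin.apply_const hZ, hZ1, zero_mul]
  | add f g hf hg => intro e; rw [iterate_map_add, map_add, hf, hg, add_zero]
  | coord_mul j f hf =>
    intro e
    have h2 : ∀ e, SPoly.parity^[e] (coord j * f) = (-1 : ℂ) ^ (par j * e) •
        (coord j * SPoly.parity^[e] f) := fun e => by
      induction e with
      | zero => simp
      | succ e ih =>
        rw [Function.iterate_succ_apply', ih, map_smul, SPoly.parity_mul, parity_coord,
          Function.iterate_succ_apply', smul_mul_assoc, smul_smul, mul_add, mul_one, pow_add]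
    have h3 := DFunLike.congr_fun (h j) (SPoly.parity^[e] f)
    rw [ad_apply, LinearMap.sub_apply, Module.End.mul_apply, Module.End.mul_apply, mulOp_apply,
      mulOp_apply, sgn_pow_apply, ← Function.iterate_add_apply, hf, iterate_map_zero, mul_zero,
      sub_zero, LinearMap.zero_apply] at h3
    rw [h2, map_smul, h3, smul_zero]

end SuperAiry

end

/-! ### Pointwise finite sums and the filtration by total degree. -/

noncomputable section

namespace SuperAiry

variable {m q : ℕ} {A₀ A₁ : Type} {ι κ : Type}

/-! ### Pointwise finite sums of operators -/

/-- Every polynomial is annihilated by all but finitely many members of the family. -/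
def PFin (F : ι → Op m q A₀ A₁) : Prop := ∀ f, (Function.support fun i => F i f).Finite

/-- `D` is the sum of the pointwise finite family `F`. -/
def PSum (F : ι → Op m q A₀ A₁) (D : Op m q A₀ A₁) : Prop := PFin F ∧ ∀ f, D f = ∑ᶠ i, F i f

theorem PFin.psum {F : ι → Op m q A₀ A₁} (h : PFin F) : PSum F (opSum F) := by
  refine ⟨h, fun f => ?_⟩
  unfold opSum
  exact LinearMap.congr_fun (dif_pos h) f

namespace PFin

variable {F G : ι → Op m q A₀ A₁}

theorem mono (hF : PFin F) (h : ∀ i f, F i f = 0 → G i f = 0) : PFin G :=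
  fun f => (hF f).subset fun i hi hi' => hi (h i f hi')

theorem mul_right (hF : PFin F) (E : Op m q A₀ A₁) : PFin fun i => F i * E := fun f => hF (E f)

theorem mul_left (hF : PFin F) (E : ι → Op m q A₀ A₁) : PFin fun i => E i * F i :=
  hF.mono fun i f h => by rw [Module.End.mul_apply, h, map_zero]

theorem add (hF : PFin F) (hG : PFin G) : PFin fun i => F i + G i := fun f =>
  ((hF f).union (hG f)).subset (Function.support_add _ _)

theorem sub (hF : PFin F) (hG : PFin G) : PFin fun i => F i - G i := fun f =>
  ((hF f).union (hG f)).subset (Function.support_sub _ _)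

theorem smul (hF : PFin F) (c : ι → ℂ) : PFin fun i => c i • F i :=
  hF.mono fun i f h => by rw [LinearMap.smul_apply, h, smul_zero]

theorem sgn (hF : PFin F) : PFin fun i => sgn (F i) := fun f =>
  (hF (SPoly.parity f)).subset fun i hi hi' => hi (by
    simp only [sgn_apply]; exact (congrArg SPoly.parity hi').trans (map_zero _))

theorem sgn_pow (hF : PFin F) (e : ℕ) : PFin fun i => (SuperAiry.sgn ^ e) (F i) := by
  induction e with
  | zero => exact hF
  | succ e ih => simpa only [sgn_pow_succ_apply] using ih.sgn

theorem ad (hF : PFin F) (e : ℕ) (y : Op m q A₀ A₁) : PFin fun i => SuperAiry.ad e y (F i) :=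
  (hF.mul_right y).sub ((hF.sgn_pow e).mul_left _)

theorem finset_sum {F : κ → ι → Op m q A₀ A₁} (s : Finset κ) (hF : ∀ k ∈ s, PFin (F k)) :
    PFin fun i => ∑ k ∈ s, F k i := by
  classical
  induction s using Finset.induction_on with
  | empty => intro f; simp
  | insert a s ha ih =>
    simp only [Finset.sum_insert ha]
    exact (hF _ (Finset.mem_insert_self _ _)).add
      (ih fun k hk => hF k (Finset.mem_insert_of_mem hk))

theorem comp (hF : PFin F) {φ : κ → ι} (hφ : Function.Injective φ) : PFin fun k => F (φ k) :=
  fun f => (hF f).preimage hφ.injOn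

/-- The operators `G k` act first and leave finitely many `k`; for each of these, `F k` then sees a
single polynomial. -/
theorem mul_prod {F : κ → ι → Op m q A₀ A₁} {G : κ → Op m q A₀ A₁} (hF : ∀ k, PFin (F k))
    (hG : PFin G) : PFin fun p : κ × ι => F p.1 p.2 * G p.1 := fun f => by
  refine ((hG f).biUnion fun k _ => (hF k (G k f)).image fun i => (k, i)).subset ?_
  rintro ⟨k, i⟩ h
  refine Set.mem_biUnion (x := k) (fun h' => h ?_) ⟨i, h, rfl⟩
  change F k i (G k f) = 0
  rw [show G k f = 0 from h', map_zero]

/-- A constant on the left of `f` becomes a constant on the right of `f` and one on the right of its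
parity image. Hence a member that kills both of these also kills `f` after multiplication by any
constant. -/
theorem mul_const (hF : PFin F) (hR : ∀ i, F i ∈ RLin m q A₀ A₁) (c : ι → Params m q) :
    PFin fun i => F i * mulOp (const (c i)) := fun f => by
  refine ((hF f).union (hF (SPoly.parity f))).subset fun i hi => ?_
  by_contra h
  simp only [Set.mem_union, Function.mem_support, not_or, not_not] at h
  refine hi ?_
  simp only [Module.End.mul_apply, mulOp_apply]
  rw [SPoly.comm_super, parity_const, ← map_add, ← map_sub, ← map_smul, ← map_smul, map_add,
    hR, hR, h.1, h.2, zero_mul, zero_mul, add_zero]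

end PFin

namespace PSum

variable {F G : ι → Op m q A₀ A₁} {D E : Op m q A₀ A₁}

theorem unique (hD : PSum F D) (hE : PSum F E) : D = E :=
  LinearMap.ext fun f => (hD.2 f).trans (hE.2 f).symm

theorem mul_left (hF : PSum F D) (E : Op m q A₀ A₁) : PSum (fun i => E * F i) (E * D) := by
  refine ⟨hF.1.mul_left _, fun f => ?_⟩
  rw [Module.End.mul_apply, hF.2]
  exact AddMonoidHom.map_finsum E.toAddMonoidHom (hF.1 f)

theorem mul_right (hF : PSum F D) (E : Op m q A₀ A₁) : PSum (fun i => F i * E) (D * E) :=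
  ⟨hF.1.mul_right _, fun f => hF.2 (E f)⟩

theorem add (hF : PSum F D) (hG : PSum G E) : PSum (fun i => F i + G i) (D + E) := by
  refine ⟨hF.1.add hG.1, fun f => ?_⟩
  rw [LinearMap.add_apply, hF.2, hG.2]
  exact (finsum_add_distrib (hF.1 f) (hG.1 f)).symm

theorem sub (hF : PSum F D) (hG : PSum G E) : PSum (fun i => F i - G i) (D - E) := by
  refine ⟨hF.1.sub hG.1, fun f => ?_⟩
  rw [LinearMap.sub_apply, hF.2, hG.2]
  exact (finsum_sub_distrib (hF.1 f) (hG.1 f)).symm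

theorem smul (hF : PSum F D) (c : ℂ) : PSum (fun i => c • F i) (c • D) := by
  refine ⟨hF.1.smul _, fun f => ?_⟩
  rw [LinearMap.smul_apply, hF.2]
  exact smul_finsum' c (hF.1 f)

theorem sgn (hF : PSum F D) : PSum (fun i => SuperAiry.sgn (F i)) (SuperAiry.sgn D) :=
  (hF.mul_right (SPoly.parity : Op m q A₀ A₁)).mul_left (SPoly.parity : Op m q A₀ A₁)

theorem sgn_pow (hF : PSum F D) (e : ℕ) :
    PSum (fun i => (SuperAiry.sgn ^ e) (F i)) ((SuperAiry.sgn ^ e) D) := by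
  induction e with
  | zero => exact hF
  | succ e ih => simpa only [sgn_pow_succ_apply] using ih.sgn

theorem ad (hF : PSum F D) (e : ℕ) (y : Op m q A₀ A₁) :
    PSum (fun i => SuperAiry.ad e y (F i)) (SuperAiry.ad e y D) :=
  (hF.mul_right y).sub ((hF.sgn_pow e).mul_left y)

theorem br (hF : PSum F D) (e : ℕ) (y : Op m q A₀ A₁) :
    PSum (fun i => SuperAiry.br e y (F i)) (SuperAiry.br e y D) :=
  (hF.mul_left y).sub ((hF.sgn_pow e).mul_right y)

theorem zero : PSum (fun _ : ι => (0 : Op m q A₀ A₁)) 0 :=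
  ⟨fun f => by simp, fun f => by simp⟩

theorem finset_sum {F : κ → ι → Op m q A₀ A₁} {D : κ → Op m q A₀ A₁} (s : Finset κ)
    (hF : ∀ k ∈ s, PSum (F k) (D k)) : PSum (fun i => ∑ k ∈ s, F k i) (∑ k ∈ s, D k) := by
  classical
  induction s using Finset.induction_on with
  | empty => simpa using zero
  | insert a s ha ih =>
    simp only [Finset.sum_insert ha]
    exact (hF _ (Finset.mem_insert_self _ _)).add
      (ih fun k hk => hF k (Finset.mem_insert_of_mem hk))

theorem ite_eq [DecidableEq ι] (j : ι) (D : ι → Op m q A₀ A₁) :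
    PSum (fun i => if i = j then D i else 0) (D j) := by
  have h : ∀ f i, i ≠ j → (if i = j then D i else 0 : Op m q A₀ A₁) f = 0 := fun f i hi => by
    rw [if_neg hi, LinearMap.zero_apply]
  refine ⟨fun f => (Set.finite_singleton j).subset fun i hi => ?_, fun f => ?_⟩
  · by_contra h'; exact hi (h f i h')
  · rw [finsum_eq_single _ j (h f), if_pos rfl]

theorem comp_equiv (hF : PSum F D) (e : κ ≃ ι) : PSum (fun k => F (e k)) D :=
  ⟨hF.1.comp e.injective, fun f => by
    rw [hF.2]; exact (finsum_comp_equiv e (f := fun i => F i f)).symm⟩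

theorem curry {F : ι → κ → Op m q A₀ A₁} {E : ι → Op m q A₀ A₁}
    (hD : PSum (fun p : ι × κ => F p.1 p.2) D) (hE : ∀ i, PSum (F i) (E i)) : PSum E D := by
  refine ⟨fun f => ((hD.1 f).image Prod.fst).subset fun i hi => ?_, fun f => ?_⟩
  · by_contra h
    refine hi (((hE i).2 f).trans ?_)
    refine finsum_eq_zero_of_forall_eq_zero fun k => ?_
    by_contra hk
    exact h ⟨(i, k), hk, rfl⟩
  · rw [hD.2, finsum_curry _ (hD.1 f)]
    exact finsum_congr fun i => ((hE i).2 f).symm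

theorem uncurry {F : ι → κ → Op m q A₀ A₁} {E : ι → Op m q A₀ A₁}
    (hF : PFin (fun p : ι × κ => F p.1 p.2)) (hE : ∀ i, PSum (F i) (E i)) (hD : PSum E D) :
    PSum (fun p : ι × κ => F p.1 p.2) D := by
  have h := curry hF.psum hE
  rw [hD.unique h]
  exact hF.psum

open Classical in
/-- Regroup a sum according to the fibers of a map. -/
theorem fiber {F : κ → Op m q A₀ A₁} {E : ι → Op m q A₀ A₁} (π : κ → ι)
    (hE : ∀ i, PSum (fun k => if π k = i then F k else 0) (E i)) :
    PSum F D → PSum E D := by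
  intro hD
  have hfin : PFin fun p : κ × ι => if π p.1 = p.2 then F p.1 else 0 := fun f => by
    refine ((hD.1 f).image fun k => (k, π k)).subset ?_
    rintro ⟨k, i⟩ h
    by_cases hk : π k = i
    · refine ⟨k, fun h' => h ?_, by rw [← hk]⟩
      simp only [hk, if_true]; exact h'
    · refine absurd ?_ h
      simp [hk]
  have h1 : PSum (fun p : κ × ι => if π p.1 = p.2 then F p.1 else 0) D :=
    uncurry (F := fun k i => if π k = i then F k else 0) hfin (fun k => by
      simpa only [eq_comm] using ite_eq (π k) (fun _ => F k)) hD
  exact curry (h1.comp_equiv (Equiv.prodComm ι κ)) hE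

open Classical in
theorem extend (hF : PSum F D) {φ : ι → κ} (hφ : Function.Injective φ) {G : κ → Op m q A₀ A₁}
    (h : ∀ i, G (φ i) = F i) (h0 : ∀ k, k ∉ Set.range φ → G k = 0) : PSum G D := by
  refine ⟨fun f => ((hF.1 f).image φ).subset fun k hk => ?_, fun f => ?_⟩
  · by_cases hk' : k ∈ Set.range φ
    · obtain ⟨i, rfl⟩ := hk'
      exact ⟨i, by simpa only [Function.mem_support, h] using hk, rfl⟩
    · exact absurd (by simp only [h0 k hk', LinearMap.zero_apply]) hk
  · rw [hF.2]
    have h1 : Function.support (fun k => G k f) ⊆ Set.range φ := fun k hk => by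
      by_contra hk'
      exact hk (by simp only [h0 k hk', LinearMap.zero_apply])
    rw [← Set.indicator_eq_self.mpr h1, ← finsum_mem_def, finsum_mem_range hφ]
    exact finsum_congr fun i => by rw [h]

theorem congr (hF : PSum F D) (h : ∀ i, F i = G i) : PSum G D := by
  rwa [← funext h]

end PSum

theorem PSum.mem_RLin {F : ι → Op m q A₀ A₁} {D : Op m q A₀ A₁} (h : PSum F D)
    (hF : ∀ i, F i ∈ RLin m q A₀ A₁) : D ∈ RLin m q A₀ A₁ := by
  intro f c
  rw [h.2, h.2]
  have := AddMonoidHom.map_finsum (AddMonoidHom.mulRight (const c : Fun m q A₀ A₁)) (h.1 f)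
  refine Eq.trans ?_ this.symm
  exact finsum_congr fun i => hF i f c

/-! ### The filtration by total degree -/

/-- Operators all of whose `n`-fold supercommutators with coordinates and derivatives vanish. -/
def Fil (m q : ℕ) (A₀ A₁ : Type) : ℕ → Submodule ℂ (Op m q A₀ A₁)
  | 0 => ⊥
  | n + 1 => (RLin m q A₀ A₁).toSubmodule ⊓
      ⨅ j, (Fil m q A₀ A₁ n).comap (ad (par j) (mulOp (coord j))) ⊓
        (Fil m q A₀ A₁ n).comap (ad (par j) (partialDeriv j))

theorem mem_Fil_zero {D : Op m q A₀ A₁} : D ∈ Fil m q A₀ A₁ 0 ↔ D = 0 := Iff.rfl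

/-- The index is one more than the degree: index `n + 1` stands for total degree at most `n`, and
index zero for the zero operator, so that inductions start at zero. -/
theorem mem_Fil_succ {n : ℕ} {D : Op m q A₀ A₁} : D ∈ Fil m q A₀ A₁ (n + 1) ↔
    D ∈ RLin m q A₀ A₁ ∧ ∀ j, ad (par j) (mulOp (coord j)) D ∈ Fil m q A₀ A₁ n ∧
      ad (par j) (partialDeriv j) D ∈ Fil m q A₀ A₁ n := by
  simp [Fil, Submodule.mem_iInf]

theorem Fil_le_RLin {n : ℕ} {D : Op m q A₀ A₁} (h : D ∈ Fil m q A₀ A₁ n) :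
    D ∈ RLin m q A₀ A₁ := by
  cases n with
  | zero => rw [mem_Fil_zero.mp h]; exact zero_mem _
  | succ n => exact (mem_Fil_succ.mp h).1

theorem Fil_le_succ (n : ℕ) : Fil m q A₀ A₁ n ≤ Fil m q A₀ A₁ (n + 1) := by
  induction n with
  | zero => intro D hD; rw [mem_Fil_zero.mp hD]; exact zero_mem _
  | succ n ih =>
    intro D hD
    rw [mem_Fil_succ] at hD ⊢
    exact ⟨hD.1, fun j => ⟨ih (hD.2 j).1, ih (hD.2 j).2⟩⟩

theorem Fil_mono : Monotone (Fil m q A₀ A₁) := monotone_nat_of_le_succ Fil_le_succ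

theorem sgn_mem_Fil {n : ℕ} {D : Op m q A₀ A₁} (hD : D ∈ Fil m q A₀ A₁ n) :
    sgn D ∈ Fil m q A₀ A₁ n := by
  induction n generalizing D with
  | zero => rw [mem_Fil_zero.mp hD, map_zero]; exact zero_mem _
  | succ n ih =>
    rw [mem_Fil_succ] at hD ⊢
    have key : ∀ (j : A₀ ⊕ A₁) (y : Op m q A₀ A₁), HasPar (par j) y →
        ad (par j) y D ∈ Fil m q A₀ A₁ n → ad (par j) y (sgn D) ∈ Fil m q A₀ A₁ n := by
      intro j y hy h
      have h1 := sgn_ad hy (par j) D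
      have h2 : ad (par j) y (sgn D) = (-1 : ℂ) ^ par j • sgn (ad (par j) y D) := by
        rw [h1, smul_smul, SPoly.neg_one_pow_mul_self, one_smul]
      rw [h2]
      exact Submodule.smul_mem _ _ (ih h)
    exact ⟨sgn_mem_RLin hD.1, fun j => ⟨key j _ (hasPar_coord j) (hD.2 j).1,
      key j _ (hasPar_partialDeriv j) (hD.2 j).2⟩⟩

theorem sgn_pow_mem_Fil {n : ℕ} {D : Op m q A₀ A₁} (hD : D ∈ Fil m q A₀ A₁ n) (e : ℕ) :
    (sgn ^ e) D ∈ Fil m q A₀ A₁ n := by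
  induction e with
  | zero => exact hD
  | succ e ih => rw [sgn_pow_succ_apply]; exact sgn_mem_Fil ih

/-- Brackets with a fixed operator commute with pointwise sums. This closure under infinite sums is
what makes the filtration by brackets convenient. -/
theorem PSum.mem_Fil {n : ℕ} {F : ι → Op m q A₀ A₁} {D : Op m q A₀ A₁} (h : PSum F D)
    (hF : ∀ i, F i ∈ Fil m q A₀ A₁ n) : D ∈ Fil m q A₀ A₁ n := by
  induction n generalizing F D with
  | zero =>
    refine mem_Fil_zero.mpr (LinearMap.ext fun f => ?_)
    rw [h.2]
    refine finsum_eq_zero_of_forall_eq_zero fun i => ?_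
    rw [mem_Fil_zero.mp (hF i), LinearMap.zero_apply]
  | succ n ih =>
    rw [mem_Fil_succ]
    have h1 := fun i => mem_Fil_succ.mp (hF i)
    exact ⟨h.mem_RLin fun i => (h1 i).1, fun j =>
      ⟨ih (h.ad _ _) fun i => ((h1 i).2 j).1, ih (h.ad _ _) fun i => ((h1 i).2 j).2⟩⟩

/-- Degrees add by the Leibniz rule; since indices exceed degrees by one, the condition reads `a + b
≤ n + 1`. -/
theorem mul_mem_Fil {a b n : ℕ} {D E : Op m q A₀ A₁} (hD : D ∈ Fil m q A₀ A₁ a)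
    (hE : E ∈ Fil m q A₀ A₁ b) (hn : a + b ≤ n + 1) : D * E ∈ Fil m q A₀ A₁ n := by
  induction n generalizing a b D E with
  | zero =>
    have : a = 0 ∨ b = 0 := by omega
    rcases this with rfl | rfl
    · rw [mem_Fil_zero.mp hD, zero_mul]; exact zero_mem _
    · rw [mem_Fil_zero.mp hE, mul_zero]; exact zero_mem _
  | succ n ih =>
    rcases a with - | a
    · rw [mem_Fil_zero.mp hD, zero_mul]; exact zero_mem _
    rcases b with - | b
    · rw [mem_Fil_zero.mp hE, mul_zero]; exact zero_mem _
    have hD' := mem_Fil_succ.mp hD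
    have hE' := mem_Fil_succ.mp hE
    rw [mem_Fil_succ]
    refine ⟨mul_mem hD'.1 hE'.1, fun j => ⟨?_, ?_⟩⟩
    · rw [ad_mul]
      exact add_mem (ih hD (hE'.2 j).1 (by omega))
        (ih (hD'.2 j).1 (sgn_pow_mem_Fil hE _) (by omega))
    · rw [ad_mul]
      exact add_mem (ih hD (hE'.2 j).2 (by omega))
        (ih (hD'.2 j).2 (sgn_pow_mem_Fil hE _) (by omega))

theorem const_mem_Fil (c : Params m q) : mulOp (const c) ∈ Fil m q A₀ A₁ 1 := by
  rw [mem_Fil_succ]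
  exact ⟨mulOp_mem_RLin _, fun j => ⟨by rw [ad_coord_mulOp]; exact zero_mem _,
    by rw [ad_partialDeriv_const]; exact zero_mem _⟩⟩

theorem one_mem_Fil : (1 : Op m q A₀ A₁) ∈ Fil m q A₀ A₁ 1 := by
  have := const_mem_Fil (A₀ := A₀) (A₁ := A₁) (1 : Params m q)
  rwa [map_one, mulOp_one] at this

theorem coord_mem_Fil (j : A₀ ⊕ A₁) : mulOp (coord j) ∈ Fil m q A₀ A₁ 2 := by
  classical
  rw [mem_Fil_succ]
  refine ⟨mulOp_mem_RLin _, fun i => ⟨by rw [ad_coord_mulOp]; exact zero_mem _, ?_⟩⟩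
  rw [ad_partialDeriv_coord]
  split_ifs
  · exact Submodule.smul_mem _ _ one_mem_Fil
  · exact zero_mem _

theorem partialDeriv_mem_Fil (j : A₀ ⊕ A₁) : partialDeriv j ∈ Fil m q A₀ A₁ 2 := by
  classical
  rw [mem_Fil_succ]
  refine ⟨partialDeriv_mem_RLin _, fun i =>
    ⟨?_, by rw [ad_partialDeriv_partialDeriv]; exact zero_mem _⟩⟩
  rw [ad_coord_partialDeriv]
  split_ifs
  · exact one_mem_Fil
  · exact zero_mem _

theorem const_mul_mem_Fil {n : ℕ} (c : Params m q) {D : Op m q A₀ A₁} (hD : D ∈ Fil m q A₀ A₁ n) :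
    mulOp (const c) * D ∈ Fil m q A₀ A₁ n :=
  mul_mem_Fil (const_mem_Fil c) hD (by omega)

theorem mul_const_mem_Fil {n : ℕ} (c : Params m q) {D : Op m q A₀ A₁} (hD : D ∈ Fil m q A₀ A₁ n) :
    D * mulOp (const c) ∈ Fil m q A₀ A₁ n :=
  mul_mem_Fil hD (const_mem_Fil c) (by omega)

/-! ### Polynomials of bounded degree -/

theorem const_mem_degLE (c : Params m q) (n : ℕ) :
    (const c : Fun m q A₀ A₁) ∈ degLE (m := m) (q := q) (A₀ := A₀) (A₁ := A₁) n :=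
  Submodule.subset_span ⟨c, [], by simp, by simp⟩

theorem degLE_mono : Monotone (degLE : ℕ → Submodule ℂ (Fun m q A₀ A₁)) := fun a b h =>
  Submodule.span_mono fun _ ⟨c, w, hw, hp⟩ => ⟨c, w, hw.trans h, hp⟩

theorem coord_mul_const (c : Params m q) (j : A₀ ⊕ A₁) :
    (coord j : Fun m q A₀ A₁) * const c = const (SPoly.parity^[par j] c) * coord j := by
  rw [coord_comm, parity_pow_const]

theorem coord_mul_mem_degLE (j : A₀ ⊕ A₁) {n : ℕ} {f : Fun m q A₀ A₁} (hf : f ∈ degLE n) :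
    coord j * f ∈ degLE (n + 1) := by
  induction hf using Submodule.span_induction with
  | mem f h =>
    obtain ⟨b, w, hw, rfl⟩ := h
    refine Submodule.subset_span ⟨SPoly.parity^[par j] b, j :: w, by simpa using hw, ?_⟩
    rw [← mul_assoc, coord_mul_const, mul_assoc, List.map_cons, List.prod_cons]
  | zero => rw [mul_zero]; exact zero_mem _
  | add f g _ _ hf hg => rw [mul_add]; exact add_mem hf hg
  | smul a f _ hf => rw [mul_smul_comm]; exact Submodule.smul_mem _ _ hf

/-- Induction on polynomials of degree at most `n`. -/
theorem degLE_induction {P : ℕ → Fun m q A₀ A₁ → Prop} (hconst : ∀ n c, P n (const c))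
    (add : ∀ n f g, P n f → P n g → P n (f + g)) (smul : ∀ n (a : ℂ) f, P n f → P n (a • f))
    (coord_mul : ∀ n j f, f ∈ degLE n → P n f → P (n + 1) (coord j * f)) {n : ℕ}
    {f : Fun m q A₀ A₁} (hf : f ∈ degLE n) : P n f := by
  induction hf using Submodule.span_induction with
  | mem f h =>
    obtain ⟨c, w, hw, rfl⟩ := h
    induction w generalizing c n with
    | nil => simpa using hconst n c
    | cons j w ih =>
      obtain ⟨k, rfl⟩ : ∃ k, n = k + 1 := ⟨n - 1, by simp at hw; omega⟩
      rw [List.map_cons, List.prod_cons, const_mul_coord]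
      have hw' : w.length ≤ k := by simpa using hw
      exact coord_mul k j _ (Submodule.subset_span ⟨_, w, hw', rfl⟩) (ih _ hw')
  | zero => simpa using hconst n 0
  | add f g _ _ hf hg => exact add _ _ _ hf hg
  | smul a f _ hf => exact smul _ _ _ hf

theorem exists_mem_degLE (f : Fun m q A₀ A₁) : ∃ n, f ∈ degLE n := by
  induction f using fun_induction with
  | hconst c => exact ⟨0, const_mem_degLE c 0⟩
  | add f g hf hg =>
    obtain ⟨a, ha⟩ := hf
    obtain ⟨b, hb⟩ := hg
    exact ⟨max a b, add_mem (degLE_mono (le_max_left a b) ha) (degLE_mono (le_max_right a b) hb)⟩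
  | coord_mul j f hf =>
    obtain ⟨a, ha⟩ := hf
    exact ⟨a + 1, coord_mul_mem_degLE j ha⟩

theorem mem_degLE_zero {f : Fun m q A₀ A₁} (hf : f ∈ degLE 0) : ∃ c, f = const c := by
  have : ∀ n f, f ∈ degLE n → n = 0 → ∃ c : Params m q, (f : Fun m q A₀ A₁) = const c := by
    intro n f hf
    refine degLE_induction (P := fun n f => n = 0 → ∃ c : Params m q, (f : Fun m q A₀ A₁) = const c)
      ?_ ?_ ?_ ?_ hf
    · intro n c _; exact ⟨c, rfl⟩
    · intro n f g hf hg hn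
      obtain ⟨c, rfl⟩ := hf hn
      obtain ⟨c', rfl⟩ := hg hn
      exact ⟨c + c', (map_add _ _ _).symm⟩
    · intro n a f hf hn
      obtain ⟨c, rfl⟩ := hf hn
      exact ⟨a • c, (map_smul _ _ _).symm⟩
    · intro n j f _ _ hn; omega
  exact this 0 f hf rfl

/-- All but finitely many derivatives annihilate a given polynomial. -/
theorem pfin_partialDeriv : PFin (partialDeriv : A₀ ⊕ A₁ → Op m q A₀ A₁) := by
  classical
  intro f
  induction f using fun_induction with
  | hconst c => simp [Function.support, partialDeriv_const]
  | add f g hf hg =>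
    refine (hf.union hg).subset fun i hi => ?_
    · by_contra h
      simp only [Set.mem_union, Function.mem_support, not_or, not_not] at h
      exact hi (by simp only [map_add, h.1, h.2, add_zero])
  | coord_mul j f hf =>
    refine (hf.union (Set.finite_singleton j)).subset fun i hi => ?_
    by_contra h
    simp only [Set.mem_union, Function.mem_support, not_or, not_not, Set.mem_singleton_iff] at h
    refine hi ?_
    simp only [partialDeriv_coord_mul, if_neg h.2, h.1, mul_zero, smul_zero, add_zero]

theorem parity_pow_coord (e : ℕ) (j : A₀ ⊕ A₁) :
    SPoly.parity^[e] (coord j : Fun m q A₀ A₁) = (-1 : ℂ) ^ (par j * e) • coord j := by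
  induction e with
  | zero => simp
  | succ e ih =>
    rw [Function.iterate_succ_apply', ih, map_smul, parity_coord, smul_smul, ← pow_add, mul_add,
      mul_one]

/-- The Euler operator. -/
def euler : Op m q A₀ A₁ := opSum fun j => mulOp (coord j) * partialDeriv j

theorem psum_euler : PSum (fun j => mulOp (coord j) * partialDeriv j) (euler : Op m q A₀ A₁) :=
  (pfin_partialDeriv.mul_left _).psum

theorem euler_const (c : Params m q) : (euler : Op m q A₀ A₁) (const c) = 0 := by
  rw [psum_euler.2]
  refine finsum_eq_zero_of_forall_eq_zero fun j => ?_
  rw [Module.End.mul_apply, partialDeriv_const, map_zero]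

theorem euler_coord_mul (j : A₀ ⊕ A₁) (f : Fun m q A₀ A₁) :
    euler (coord j * f) = coord j * f + coord j * euler f := by
  classical
  have h1 := psum_euler (m := m) (q := q) (A₀ := A₀) (A₁ := A₁).mul_right (mulOp (coord j))
  have h2 := (PSum.ite_eq j fun _ => (mulOp (coord j) : Op m q A₀ A₁)).add
    (psum_euler (m := m) (q := q) (A₀ := A₀) (A₁ := A₁).mul_left (mulOp (coord j)))
  have h3 := h1.unique (h2.congr fun i => LinearMap.ext fun g => ?_)
  · exact DFunLike.congr_fun h3 f
  · simp only [LinearMap.add_apply, Module.End.mul_apply, mulOp_apply, partialDeriv_coord_mul,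
      mul_add, mul_smul_comm, ← mul_assoc]
    have h4 : (coord i : Fun m q A₀ A₁) * coord j =
        (-1 : ℂ) ^ (par i * par j) • (coord j * coord i) := by
      rw [coord_comm, parity_pow_coord, smul_mul_assoc, mul_comm (par j)]
    rw [h4, smul_mul_assoc, smul_smul, SPoly.neg_one_pow_mul_self, one_smul]
    congr 1
    split_ifs with h
    · subst h; rfl
    · simp

/-- The Euler operator multiplies the part of degree $n+1$ by $n+1$, so the top degree cancels. -/
theorem euler_sub_mem_degLE {n : ℕ} {f : Fun m q A₀ A₁} (hf : f ∈ degLE (n + 1)) :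
    euler f - ((n : ℂ) + 1) • f ∈ degLE n := by
  -- This is the space of degree less than `k`. It is zero for `k = 0`, which agrees with the Euler
  -- operator killing the constants.
  let S : ℕ → Submodule ℂ (Fun m q A₀ A₁) := fun k => k.casesOn ⊥ degLE
  suffices h : ∀ k f, f ∈ degLE k → euler f - (k : ℂ) • f ∈ S k by
    have := h _ f hf
    push_cast at this
    exact this
  intro k f hf
  refine degLE_induction (P := fun k f => euler f - (k : ℂ) • f ∈ S k) ?_ ?_ ?_ ?_ hf
  · intro n c
    rw [euler_const, zero_sub]
    cases n with
    | zero => simp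
    | succ n => exact neg_mem (Submodule.smul_mem _ _ (const_mem_degLE c n))
  · intro n f g hf hg
    rw [map_add, smul_add, add_sub_add_comm]
    exact add_mem hf hg
  · intro n a f hf
    rw [map_smul, smul_comm, ← smul_sub]
    exact Submodule.smul_mem _ _ hf
  · intro n j f _ hf
    have h : euler (coord j * f) - ((n + 1 : ℕ) : ℂ) • (coord j * f) =
        coord j * (euler f - (n : ℂ) • f) := by
      rw [euler_coord_mul, Nat.cast_succ, add_smul, one_smul, mul_sub, mul_smul_comm]
      abel
    rw [h]
    cases n with
    | zero =>
      have h0 : euler f - ((0 : ℕ) : ℂ) • f = 0 := hf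
      rw [h0, mul_zero]; exact zero_mem _
    | succ n => exact coord_mul_mem_degLE j hf

/-- Descend from any degree bound `n + N + 1`: both the Euler image of `f` and its difference from
`n + N + 1` times `f` have lower degree, and the factor `n + N + 1` is invertible. -/
theorem mem_degLE_of_euler {n : ℕ} {f : Fun m q A₀ A₁} (hf : euler f ∈ degLE n) :
    f ∈ degLE n := by
  obtain ⟨N, hN⟩ := exists_mem_degLE f
  replace hN : f ∈ degLE (n + N) := degLE_mono (Nat.le_add_left _ _) hN
  induction N with
  | zero => exact hN
  | succ N ih =>
    refine ih ?_
    have h1 := euler_sub_mem_degLE (n := n + N) hN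
    have h2 : euler f ∈ degLE (n + N) := degLE_mono (Nat.le_add_right _ _) hf
    have h3 := sub_mem h2 h1
    rw [sub_sub_cancel] at h3
    have h4 := Submodule.smul_mem _ (((n + N : ℕ) : ℂ) + 1)⁻¹ h3
    rwa [smul_smul, inv_mul_cancel₀ (Nat.cast_add_one_ne_zero _), one_smul] at h4

theorem euler_mem {S : Submodule ℂ (Fun m q A₀ A₁)} {f : Fun m q A₀ A₁}
    (h : ∀ j, coord j * partialDeriv j f ∈ S) : euler f ∈ S := by
  rw [psum_euler.2]
  exact finsum_induction (p := (· ∈ S)) (zero_mem _) (fun _ _ => add_mem) h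

/-- A derivative of $D(1)$ is, up to sign, the value at $1$ of a bracket of `D` with that
derivative, hence of smaller degree by induction; the Euler operator recovers the degree of $D(1)$
itself. -/
theorem apply_one_mem_degLE {n : ℕ} {D : Op m q A₀ A₁} (hD : D ∈ Fil m q A₀ A₁ (n + 1)) :
    D 1 ∈ degLE n := by
  have key : ∀ {D : Op m q A₀ A₁} (j : A₀ ⊕ A₁), partialDeriv j (D 1) =
      -(ad (par j) (partialDeriv j) ((sgn ^ par j) D)) 1 := fun {D} j => by
    rw [ad_apply, sgn_pow_sgn_pow, LinearMap.sub_apply, Module.End.mul_apply, partialDeriv_one,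
      map_zero, zero_sub, neg_neg, Module.End.mul_apply]
  induction n generalizing D with
  | zero =>
    refine mem_degLE_of_euler (euler_mem fun j => ?_)
    have h := ((mem_Fil_succ.mp (sgn_pow_mem_Fil hD (par j))).2 j).2
    rw [key, mem_Fil_zero.mp h]
    simp
  | succ n ih =>
    refine mem_degLE_of_euler (euler_mem fun j => coord_mul_mem_degLE j ?_)
    rw [key]
    exact neg_mem (ih ((mem_Fil_succ.mp (sgn_pow_mem_Fil hD (par j))).2 j).2)

theorem mulOp_mem_Fil {n : ℕ} {f : Fun m q A₀ A₁} (hf : f ∈ degLE n) :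
    mulOp f ∈ Fil m q A₀ A₁ (n + 1) := by
  refine degLE_induction (P := fun n f => mulOp f ∈ Fil m q A₀ A₁ (n + 1)) ?_ ?_ ?_ ?_ hf
  · exact fun n c => Fil_mono (by omega) (const_mem_Fil c)
  · exact fun n f g hf hg => by rw [mulOp_add]; exact add_mem hf hg
  · exact fun n a f hf => by rw [mulOp_smul]; exact Submodule.smul_mem _ _ hf
  · exact fun n j f _ hf => by
      rw [mulOp_mul]; exact mul_mem_Fil (coord_mem_Fil j) hf (by omega)

/-- Operators of degree zero are the constants. -/
theorem mem_Fil_one {D : Op m q A₀ A₁} :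
    D ∈ Fil m q A₀ A₁ 1 ↔ ∃ c : Params m q, D = mulOp (const c) := by
  refine ⟨fun hD => ?_, fun ⟨c, hc⟩ => hc ▸ const_mem_Fil c⟩
  obtain ⟨c, hc⟩ := mem_degLE_zero (apply_one_mem_degLE hD)
  refine ⟨c, RLin.ext (Fil_le_RLin hD) (mulOp_mem_RLin _) (by rw [hc, mulOp_apply, mul_one])
    fun j => ?_⟩
  rw [ad_coord_mulOp, mem_Fil_zero.mp ((mem_Fil_succ.mp hD).2 j).1]

theorem parity_pow_mul (e : ℕ) (f g : Fun m q A₀ A₁) :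
    SPoly.parity^[e] (f * g) = SPoly.parity^[e] f * SPoly.parity^[e] g := by
  induction e generalizing f g with
  | zero => rfl
  | succ e ih => rw [Function.iterate_succ_apply, SPoly.parity_mul, ih]; rfl

/-- Left multiplication by a homogeneous constant is right multiplication after a parity twist, and
right multiplication commutes with `E`. -/
theorem br_const {c : Params m q} {e : ℕ} (hc : HasPar e (mulOp (const c) : Op m q A₀ A₁))
    {E : Op m q A₀ A₁} (hE : E ∈ RLin m q A₀ A₁) : br e (mulOp (const c)) E = 0 := by
  refine LinearMap.ext fun f => ?_
  have h0 : ∀ g : Fun m q A₀ A₁, const c * g = SPoly.parity^[e] g * const c := by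
    intro g
    have h1 : (const (SPoly.parity c) : Fun m q A₀ A₁) = (-1 : ℂ) ^ e • const c := by
      have := DFunLike.congr_fun hc (1 : Fun m q A₀ A₁)
      rwa [sgn_mulOp, parity_const, LinearMap.smul_apply, mulOp_apply, mulOp_apply, mul_one,
        mul_one] at this
    rcases Nat.even_or_odd e with he | he
    · rw [he.neg_one_pow, one_smul, ← parity_const] at h1
      obtain ⟨k, rfl⟩ := he
      rw [Function.iterate_add_apply, parity_pow_parity_pow]
      exact SPoly.IsEven.comm h1 g
    · rw [he.neg_one_pow, ← parity_const] at h1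
      obtain ⟨k, rfl⟩ := he
      rw [two_mul, Function.iterate_add_apply, Function.iterate_add_apply,
        parity_pow_parity_pow, Function.iterate_one]
      exact SPoly.IsOdd.comm (h1.trans (neg_one_smul ℂ _)) g
  rw [br_apply, LinearMap.sub_apply, Module.End.mul_apply, Module.End.mul_apply, sgn_pow_apply,
    mulOp_apply, mulOp_apply, h0 f, parity_pow_mul, parity_pow_parity_pow, parity_pow_const, hE,
    parity_pow_mul, ← parity_pow_const, parity_pow_parity_pow, h0 (E f), sub_self,
    LinearMap.zero_apply]

theorem HasPar.br_swap {e k : ℕ} {D E : Op m q A₀ A₁} (hD : HasPar e D) (hE : HasPar k E) :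
    SuperAiry.br e D E = -(-1 : ℂ) ^ (e * k) • SuperAiry.br k E D := by
  rw [br_apply, br_apply, hD.pow, hE.pow, smul_sub, smul_mul_assoc, smul_mul_assoc, smul_smul,
    neg_mul, SPoly.neg_one_pow_mul_self, mul_comm k e]
  module

theorem br_const_right {D : Op m q A₀ A₁} {e : ℕ} (he : HasPar e D) (hD : D ∈ RLin m q A₀ A₁)
    (c : Params m q) : br e D (mulOp (const c)) = 0 := by
  have key : ∀ (k : ℕ) (b : Params m q), HasPar k (mulOp (const b) : Op m q A₀ A₁) →
      br e D (mulOp (const b)) = 0 := fun k b hb => by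
    rw [HasPar.br_swap he hb, br_const hb hD, smul_zero]
  have h0 : SPoly.IsEven ((1 / 2 : ℂ) • (c + SPoly.parity c)) := by
    rw [SPoly.IsEven, map_smul, map_add, SPoly.parity_parity, add_comm]
  have h1 : SPoly.IsOdd ((1 / 2 : ℂ) • (c - SPoly.parity c)) := by
    rw [SPoly.IsOdd, map_smul, map_sub, SPoly.parity_parity, ← smul_neg, neg_sub]
  have h2 : c = (1 / 2 : ℂ) • (c + SPoly.parity c) + (1 / 2 : ℂ) • (c - SPoly.parity c) := by
    module
  rw [h2, map_add, mulOp_add, map_add, key 0 _ (hasPar_const_even h0),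
    key 1 _ (hasPar_const_odd h1), add_zero]

/-- The supercommutator lowers the total degree by two. -/
theorem br_mem_Fil {a b n e : ℕ} {D E : Op m q A₀ A₁} (hD : D ∈ Fil m q A₀ A₁ a)
    (hE : E ∈ Fil m q A₀ A₁ b) (he : HasPar e D) (hn : a + b ≤ n + 3) :
    br e D E ∈ Fil m q A₀ A₁ n := by
  induction n generalizing a b e D E with
  | zero =>
    -- The indices add up to at most three, so one of the two operators has index at most one and is
    -- a constant, which supercommutes with everything linear over $R$.
    by_cases ha : a ≤ 1
    · obtain ⟨c, rfl⟩ := mem_Fil_one.mp (Fil_mono ha hD)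
      rw [br_const he (Fil_le_RLin hE)]; exact zero_mem _
    · obtain ⟨c, rfl⟩ := mem_Fil_one.mp (Fil_mono (show b ≤ 1 by omega) hE)
      rw [br_const_right he (Fil_le_RLin hD)]; exact zero_mem _
  | succ n ih =>
    rcases a with - | a
    · rw [mem_Fil_zero.mp hD, br_apply, zero_mul, mul_zero, sub_zero]; exact zero_mem _
    rcases b with - | b
    · rw [mem_Fil_zero.mp hE, map_zero]; exact zero_mem _
    have hD' := mem_Fil_succ.mp hD
    have hE' := mem_Fil_succ.mp hE
    have key : ∀ (j : A₀ ⊕ A₁) (y : Op m q A₀ A₁), HasPar (par j) y →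
        ad (par j) y D ∈ Fil m q A₀ A₁ a → ad (par j) y E ∈ Fil m q A₀ A₁ b →
        ad (par j) y (br e D E) ∈ Fil m q A₀ A₁ n := fun j y hy h1 h2 => by
      rw [ad_br hy he]
      refine add_mem (ih hD h2 he (by omega)) (ih h1 (sgn_pow_mem_Fil hE _) ?_ (by omega))
      rw [add_comm]
      exact HasPar.ad hy he
    rw [mem_Fil_succ]
    refine ⟨sub_mem (mul_mem hD'.1 hE'.1) (mul_mem (sgn_pow_mem_RLin hE'.1 _) hD'.1),
      fun j => ⟨key j _ (hasPar_coord j) (hD'.2 j).1 (hE'.2 j).1,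
        key j _ (hasPar_partialDeriv j) (hD'.2 j).2 (hE'.2 j).2⟩⟩

end SuperAiry

end

/-! ### Normally ordered expansions as Taylor expansions of symbols. -/

noncomputable section

namespace SuperAiry

variable {m q : ℕ} {A₀ A₁ : Type} {ι κ : Type}

/-! ### Normally ordered expansions -/

/-- The supercommutator with a coordinate. -/
def adx (j : A₀ ⊕ A₁) : Op m q A₀ A₁ →ₗ[ℂ] Op m q A₀ A₁ := ad (par j) (mulOp (coord j))

/-- The iterated supercommutator of `D` with the coordinates in a word, applied to `1`. -/
def symbol (D : Op m q A₀ A₁) (w : List (A₀ ⊕ A₁)) : Fun m q A₀ A₁ := w.foldr (fun j E => adx j E) D 1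

theorem symbol_append (D : Op m q A₀ A₁) (w : List (A₀ ⊕ A₁)) (j : A₀ ⊕ A₁) :
    symbol D (w ++ [j]) = symbol (adx j D) w := by
  simp [symbol]

/-- The operator `∑ c(|w|) [⋯[D, x_{w_k}], ⋯, x_{w_1}](1) ∂_{w_1} ⋯ ∂_{w_k}`, summed over words
with less than `n` letters. -/
def wordSum : ℕ → (ℕ → ℂ) → Op m q A₀ A₁ → Op m q A₀ A₁
  | 0, _, _ => 0
  | n + 1, c, D => c 0 • mulOp (D 1) +
      opSum fun j => wordSum n (fun k => c (k + 1)) (adx j D) * partialDeriv j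

theorem psum_wordSum (n : ℕ) (c : ℕ → ℂ) (D : Op m q A₀ A₁) :
    PSum (fun j => wordSum n (fun k => c (k + 1)) (adx j D) * partialDeriv j)
      (opSum fun j => wordSum n (fun k => c (k + 1)) (adx j D) * partialDeriv j) :=
  (pfin_partialDeriv.mul_left _).psum

theorem adx_adx (i j : A₀ ⊕ A₁) (D : Op m q A₀ A₁) :
    adx i (adx j D) = (-1 : ℂ) ^ (par j * par i) • adx j (adx i D) := by
  have h1 : (mulOp (coord i) * mulOp (coord j) : Op m q A₀ A₁) =
      (-1 : ℂ) ^ (par j * par i) • (mulOp (coord j) * mulOp (coord i)) := by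
    rw [← mulOp_mul, ← mulOp_mul, coord_comm, parity_pow_coord, smul_mul_assoc, mulOp_smul]
  have h2 : (mulOp (coord j) * mulOp (coord i) : Op m q A₀ A₁) =
      (-1 : ℂ) ^ (par j * par i) • (mulOp (coord i) * mulOp (coord j)) := by
    rw [h1, smul_smul, SPoly.neg_one_pow_mul_self, one_smul]
  have h3 : (sgn ^ par i) ((sgn ^ par j) D) = (sgn ^ par j) ((sgn ^ par i) D) := by
    rw [← AlgHom.mul_apply, ← AlgHom.mul_apply, ((Commute.refl sgn).pow_pow _ _).eq]
  simp only [adx, ad_apply, map_sub, map_mul, (hasPar_coord _).pow, sub_mul, mul_sub,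
    smul_mul_assoc, mul_smul_comm, smul_sub, smul_smul, mul_assoc, h3]
  rw [h2, ← mul_assoc (mulOp (coord i)) (mulOp (coord j)), h1]
  simp only [mul_smul_comm, smul_smul, SPoly.neg_one_pow_mul_self, mul_comm (par i) (par j),
    one_smul, smul_mul_assoc, mul_assoc]
  abel

theorem wordSum_smul (n : ℕ) (c : ℕ → ℂ) (a : ℂ) (D : Op m q A₀ A₁) :
    wordSum n c (a • D) = a • wordSum n c D := by
  induction n generalizing c D with
  | zero => simp [wordSum]
  | succ n ih =>
    rw [wordSum, wordSum, smul_add, LinearMap.smul_apply, mulOp_smul, smul_comm]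
    congr 1
    refine (psum_wordSum n c _).unique (((psum_wordSum n c D).smul a).congr fun j => ?_)
    rw [map_smul, ih, smul_mul_assoc]

theorem wordSum_add (n : ℕ) (c c' : ℕ → ℂ) (D : Op m q A₀ A₁) :
    wordSum n (fun k => c k + c' k) D = wordSum n c D + wordSum n c' D := by
  induction n generalizing c c' D with
  | zero => simp [wordSum]
  | succ n ih =>
    rw [wordSum, wordSum, wordSum, add_smul, add_add_add_comm]
    congr 1
    refine (psum_wordSum n (fun k => c k + c' k) D).unique
      (((psum_wordSum n c D).add (psum_wordSum n c' D)).congr fun j => ?_)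
    rw [ih, add_mul]

theorem wordSum_mem_RLin (n : ℕ) (c : ℕ → ℂ) (D : Op m q A₀ A₁) :
    wordSum n c D ∈ RLin m q A₀ A₁ := by
  induction n generalizing c D with
  | zero => exact zero_mem _
  | succ n ih =>
    exact add_mem (Subalgebra.smul_mem _ (mulOp_mem_RLin _) _)
      ((psum_wordSum n c D).mem_RLin fun j => mul_mem (ih _ _) (partialDeriv_mem_RLin j))

theorem wordSum_one (n : ℕ) (c : ℕ → ℂ) (D : Op m q A₀ A₁) :
    wordSum (n + 1) c D 1 = c 0 • D 1 := by
  rw [wordSum, LinearMap.add_apply, LinearMap.smul_apply, mulOp_apply, mul_one,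
    (psum_wordSum n c D).2, finsum_eq_zero_of_forall_eq_zero, add_zero]
  intro j
  rw [Module.End.mul_apply, partialDeriv_one, map_zero]

/-- Bracketing with a coordinate differentiates formally in the derivatives. The weight `c` of the
words of given length is therefore differentiated like a power series, which singles out $1/k!$. -/
theorem adx_wordSum (n : ℕ) (c : ℕ → ℂ) (D : Op m q A₀ A₁) (i : A₀ ⊕ A₁) :
    adx i (wordSum (n + 1) c D) = wordSum n (fun k => (k + 1) * c (k + 1)) (adx i D) := by
  classical
  induction n generalizing c D with
  | zero =>
    have h : opSum (fun _ : A₀ ⊕ A₁ => (0 : Op m q A₀ A₁)) = 0 := PSum.zero.1.psum.unique PSum.zero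
    simp [wordSum, adx, ad_coord_mulOp, h]
  | succ n ih =>
    have h1 : PSum (fun j => (if j = i then wordSum (n + 1) (fun k => c (k + 1)) (adx j D) else 0) +
        wordSum n (fun k => (k + 1) * c (k + 2)) (adx j (adx i D)) * partialDeriv j)
        (adx i (wordSum (n + 2) c D)) := by
      rw [wordSum, map_add, map_smul, adx, ad_coord_mulOp, smul_zero, zero_add]
      refine ((psum_wordSum (n + 1) c D).ad _ _).congr fun j => ?_
      rw [ad_mul, ad_coord_partialDeriv, (hasPar_partialDeriv j).pow]
      congr 1
      · split_ifs <;> simp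
      · have := ih (fun k => c (k + 1)) (adx j D)
        rw [adx] at this
        rw [this, ← adx, adx_adx, wordSum_smul, smul_mul_smul_comm, SPoly.neg_one_pow_mul_self,
          one_smul]
    have h2 := (PSum.ite_eq i fun j => wordSum (n + 1) (fun k => c (k + 1)) (adx j D)).add
      ((pfin_partialDeriv.mul_left fun j =>
        wordSum n (fun k => (k + 1) * c (k + 2)) (adx j (adx i D))).psum)
    rw [h1.unique h2, wordSum, wordSum, add_assoc]
    congr 1
    · simp
    · refine ((psum_wordSum n (fun k => c (k + 1)) (adx i D)).add
        (pfin_partialDeriv.mul_left _).psum).unique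
        (((psum_wordSum n (fun k => ((k : ℂ) + 1) * c (k + 1)) (adx i D))).congr fun j => ?_)
      rw [← add_mul, ← wordSum_add]
      congr 2
      funext k
      push_cast
      ring

/-- Taylor's formula: both sides agree at $1$ and, by induction on `n`, have the same brackets with
all coordinates, which determines an operator linear over the constants. -/
theorem wordSum_eq {n : ℕ} {D : Op m q A₀ A₁} (hD : D ∈ Fil m q A₀ A₁ n) :
    wordSum n (fun k => (k.factorial : ℂ)⁻¹) D = D := by
  induction n generalizing D with
  | zero => rw [mem_Fil_zero.mp hD]; rfl
  | succ n ih =>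
    refine RLin.ext (wordSum_mem_RLin _ _ _) (Fil_le_RLin hD) (by simp [wordSum_one]) fun j => ?_
    have h1 := adx_wordSum n (fun k => (k.factorial : ℂ)⁻¹) D j
    rw [adx] at h1
    rw [h1]
    have h2 : (fun k : ℕ => ((k : ℂ) + 1) * ((k + 1).factorial : ℂ)⁻¹) =
        fun k => (k.factorial : ℂ)⁻¹ := by
      funext k
      rw [Nat.factorial_succ]
      push_cast
      rw [mul_inv, ← mul_assoc, mul_inv_cancel₀ (Nat.cast_add_one_ne_zero k), one_mul]
    rw [h2]
    exact ih ((mem_Fil_succ.mp hD).2 j).1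

theorem partialDerivs_append (w : List (A₀ ⊕ A₁)) (j : A₀ ⊕ A₁) :
    (partialDerivs (w ++ [j]) : Op m q A₀ A₁) = partialDerivs w * partialDeriv j := by
  simp [partialDerivs]

theorem psum_words (n : ℕ) (c : ℕ → ℂ) (D : Op m q A₀ A₁) :
    PSum (fun w => if w.length < n then c w.length • (mulOp (symbol D w) * partialDerivs w) else 0)
      (wordSum n c D) := by
  classical
  induction n generalizing c D with
  | zero => simpa [wordSum] using PSum.zero
  | succ n ih =>
    have h1 := PSum.ite_eq ([] : List (A₀ ⊕ A₁)) fun _ => c 0 • (mulOp (D 1) : Op m q A₀ A₁)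
    have h2 := fun j => (ih (fun k => c (k + 1)) (adx j D)).mul_right (partialDeriv j)
    have h3 := PSum.uncurry (PFin.mul_prod (fun j => (ih (fun k => c (k + 1)) (adx j D)).1)
      pfin_partialDeriv) h2 (psum_wordSum n c D)
    -- A non-empty word is a shorter word followed by a unique last letter. The derivative of the
    -- last letter acts first, so the double sum over letters and shorter words is pointwise finite.
    have hinj : Function.Injective fun p : (A₀ ⊕ A₁) × List (A₀ ⊕ A₁) => p.2 ++ [p.1] := by
      rintro ⟨a, w⟩ ⟨b, w'⟩ h
      have := List.append_inj' h rfl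
      simp_all
    have h4 := h3.extend hinj (G := fun w => if w = [] then 0 else if w.length < n + 1 then
      c w.length • (mulOp (symbol D w) * partialDerivs w) else 0) (fun p => by
        have : p.2 ++ [p.1] ≠ [] := by simp
        simp only [if_neg this, List.length_append, List.length_singleton, Nat.add_lt_add_iff_right,
          symbol_append, partialDerivs_append]
        split_ifs
        · simp only [smul_mul_assoc, mul_assoc]
        · simp) (fun w hw => by
        rcases List.eq_nil_or_concat w with rfl | ⟨w', j, rfl⟩
        · simp
        · exact absurd ⟨(j, w'), by simp⟩ hw)
    refine (h1.add h4).congr fun w => ?_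
    by_cases hw : w = []
    · subst hw
      simp [symbol, partialDerivs]
    · simp [hw]

theorem foldr_adx_mem_Fil {n : ℕ} {D : Op m q A₀ A₁} (hD : D ∈ Fil m q A₀ A₁ n)
    (w : List (A₀ ⊕ A₁)) : w.foldr (fun j E => adx j E) D ∈ Fil m q A₀ A₁ (n - w.length) := by
  induction w with
  | nil => exact hD
  | cons j w ih =>
    rw [List.foldr_cons, List.length_cons, ← Nat.sub_sub]
    generalize n - w.length = k at ih
    cases k with
    | zero => rw [mem_Fil_zero.mp ih, map_zero]; exact zero_mem _
    | succ k => exact ((mem_Fil_succ.mp ih).2 j).1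

theorem hasExpansion_of_mem_Fil {n : ℕ} {D : Op m q A₀ A₁} (hD : D ∈ Fil m q A₀ A₁ (n + 1)) :
    HasExpansion D n fun w => (w.length.factorial : ℂ)⁻¹ • symbol D w := by
  have h0 : ∀ w : List (A₀ ⊕ A₁), n < w.length → symbol D w = 0 := fun w hw => by
    have := foldr_adx_mem_Fil hD w
    rw [show n + 1 - w.length = 0 by omega] at this
    rw [symbol, mem_Fil_zero.mp this, LinearMap.zero_apply]
  have h1 := psum_words (n + 1) (fun k => (k.factorial : ℂ)⁻¹) D
  rw [wordSum_eq hD] at h1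
  have h2 : PSum (fun w : List (A₀ ⊕ A₁) =>
      mulOp ((w.length.factorial : ℂ)⁻¹ • symbol D w) * partialDerivs w) D := by
    refine h1.congr fun w => ?_
    split_ifs with hw
    · rw [mulOp_smul, smul_mul_assoc]
    · rw [h0 w (by omega), smul_zero, mulOp_zero, zero_mul]
  refine ⟨fun w hw => by rw [h0 w hw, smul_zero], fun w => Submodule.smul_mem _ _ ?_, h2.1, h2.2⟩
  by_cases hw : w.length ≤ n
  · have := foldr_adx_mem_Fil hD w
    rw [show n + 1 - w.length = n - w.length + 1 by omega] at this
    exact apply_one_mem_degLE this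
  · rw [h0 w (by omega)]; exact zero_mem _

theorem partialDerivs_mem_Fil (w : List (A₀ ⊕ A₁)) :
    partialDerivs w ∈ Fil m q A₀ A₁ (w.length + 1) := by
  induction w with
  | nil => exact one_mem_Fil
  | cons j w ih =>
    rw [partialDerivs, List.map_cons, List.prod_cons, List.length_cons]
    exact mul_mem_Fil (partialDeriv_mem_Fil j) ih (by omega)

/-- An expansion exists as soon as the iterated brackets terminate: its coefficients are the symbols
divided by factorials. From here on no coefficients have to be chosen, and degree bounds are checked
on brackets. -/
theorem mem_weylFiltration {n : ℕ} {D : Op m q A₀ A₁} :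
    D ∈ weylFiltration n ↔ D ∈ Fil m q A₀ A₁ (n + 1) := by
  refine ⟨fun ⟨p, h⟩ => ?_, fun h => ⟨_, hasExpansion_of_mem_Fil h⟩⟩
  have h1 : PSum (fun w => mulOp (p w) * partialDerivs w) D := ⟨h.finite, h.eq_sum⟩
  refine h1.mem_Fil fun w => ?_
  by_cases hw : w.length ≤ n
  · exact mul_mem_Fil (mulOp_mem_Fil (h.degree_le w)) (partialDerivs_mem_Fil w) (by omega)
  · rw [h.order_le w (by omega), mulOp_zero, zero_mul]; exact zero_mem _

theorem finite_symbol_ne_zero {D : ι → Op m q A₀ A₁} (hD : PFin D) (w : List (A₀ ⊕ A₁)) :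
    {i | symbol (D i) w ≠ 0}.Finite := by
  have : PFin fun i => w.foldr (fun j E => adx j E) (D i) := by
    induction w with
    | nil => exact hD
    | cons j w ih => exact ih.ad _ _
  exact this 1

theorem mem_reesWeyl {Z : HOp m q A₀ A₁} : Z ∈ reesWeyl m q A₀ A₁ ↔
    (∀ n < 0, Z.coeff n = 0) ∧ ∀ n : ℕ, Z.coeff n ∈ Fil m q A₀ A₁ (n + 1) := by
  simp only [reesWeyl, Set.mem_ofPred_eq, mem_weylFiltration]

/-- Every power of `ħ` and every polynomial see only finitely many members of the family. -/
def HFin (F : ι → HOp m q A₀ A₁) : Prop := ∀ n, PFin fun i => (F i).coeff n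

/-- The Taylor coefficient at a word is the value at $1$ of a fixed iterated bracket. For a
pointwise finite family it vanishes for all but finitely many members. -/
theorem isBounded_of_hfin {G : ι → HOp m q A₀ A₁} (hG : ∀ i, G i ∈ reesWeyl m q A₀ A₁)
    (h : HFin G) : IsBounded G := by
  refine ⟨fun i => (mem_reesWeyl.mp (hG i)).1,
    fun i n w => (w.length.factorial : ℂ)⁻¹ • symbol ((G i).coeff n) w,
    fun i n => hasExpansion_of_mem_Fil ((mem_reesWeyl.mp (hG i)).2 n), fun n w => ?_⟩
  refine (finite_symbol_ne_zero (h n) w).subset fun i hi h0 => hi ?_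
  simp only [h0, smul_zero]

end SuperAiry

end

/-! ### Series in $\hbar$, their infinite sums, and generated left ideals. -/

noncomputable section

namespace SuperAiry

variable {m q : ℕ} {A₀ A₁ : Type} {ι κ : Type}

/-! ### Series of operators -/

/-- Only non-negative powers of `ħ` occur. -/
def Nonneg (Z : HOp m q A₀ A₁) : Prop := ∀ n < 0, Z.coeff n = 0

theorem coeff_mul_neg {X Y : HOp m q A₀ A₁} (hX : Nonneg X) (hY : Nonneg Y) : Nonneg (X * Y) := by
  intro n hn
  rw [HahnSeries.coeff_mul]
  refine Finset.sum_eq_zero fun p hp => ?_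
  rw [Finset.mem_antidiagonal] at hp
  by_cases h : p.1 < 0
  · rw [hX _ h, zero_mul]
  · rw [hY p.2 (by omega), mul_zero]

theorem coeff_mul_nat {X Y : HOp m q A₀ A₁} (hX : Nonneg X) (hY : Nonneg Y) (n : ℕ) :
    (X * Y).coeff n = ∑ p ∈ Finset.HasAntidiagonal.antidiagonal n, X.coeff p.1 * Y.coeff p.2 := by
  rw [HahnSeries.coeff_mul]
  let e : ℕ × ℕ ↪ ℤ × ℤ := ⟨fun p => (p.1, p.2), fun p p' h => by
    simp only [Prod.mk.injEq, Nat.cast_inj] at h; exact Prod.ext h.1 h.2⟩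
  have h1 : ∑ p ∈ Finset.HasAntidiagonal.antidiagonal n, X.coeff p.1 * Y.coeff p.2 =
      ∑ p ∈ (Finset.HasAntidiagonal.antidiagonal n).map e, X.coeff p.1 * Y.coeff p.2 := by
    rw [Finset.sum_map]; rfl
  rw [h1]
  refine Finset.sum_subset (fun p hp => ?_) (fun p hp' hp => ?_)
  · rw [Finset.mem_antidiagonal] at hp
    have h2 : 0 ≤ p.1 := by by_contra h; exact hp.1 (hX _ (by omega))
    have h3 : 0 ≤ p.2 := by by_contra h; exact hp.2.1 (hY _ (by omega))
    refine Finset.mem_map.mpr ⟨(p.1.toNat, p.2.toNat), ?_, ?_⟩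
    · rw [Finset.HasAntidiagonal.mem_antidiagonal]; change p.1.toNat + p.2.toNat = n; omega
    · exact Prod.ext (Int.toNat_of_nonneg h2) (Int.toNat_of_nonneg h3)
  · obtain ⟨p', hp'', rfl⟩ := Finset.mem_map.mp hp'
    by_contra hne
    refine hp (Finset.mem_antidiagonal.mpr ⟨left_ne_zero_of_mul hne,
      right_ne_zero_of_mul hne, ?_⟩)
    rw [Finset.HasAntidiagonal.mem_antidiagonal] at hp''
    change (p'.1 : ℤ) + p'.2 = n
    omega

theorem Nonneg.of_rees {Z : HOp m q A₀ A₁} (h : Z ∈ reesWeyl m q A₀ A₁) : Nonneg Z :=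
  (mem_reesWeyl.mp h).1

theorem rees_coeff {Z : HOp m q A₀ A₁} (h : Z ∈ reesWeyl m q A₀ A₁) (n : ℕ) :
    Z.coeff n ∈ Fil m q A₀ A₁ (n + 1) := (mem_reesWeyl.mp h).2 n

theorem hop_ext {X Y : HOp m q A₀ A₁} (h : ∀ n, X.coeff n = Y.coeff n) : X = Y :=
  HahnSeries.ext (funext h)

theorem zero_mem_rees : (0 : HOp m q A₀ A₁) ∈ reesWeyl m q A₀ A₁ :=
  mem_reesWeyl.mpr ⟨fun _ _ => rfl, fun _ => zero_mem _⟩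

theorem add_mem_rees {X Y : HOp m q A₀ A₁} (hX : X ∈ reesWeyl m q A₀ A₁)
    (hY : Y ∈ reesWeyl m q A₀ A₁) : X + Y ∈ reesWeyl m q A₀ A₁ :=
  mem_reesWeyl.mpr ⟨fun n hn => by
    rw [HahnSeries.coeff_add, Nonneg.of_rees hX n hn, Nonneg.of_rees hY n hn, add_zero],
    fun n => by rw [HahnSeries.coeff_add]; exact add_mem (rees_coeff hX n) (rees_coeff hY n)⟩

theorem smul_mem_rees (c : ℂ) {X : HOp m q A₀ A₁} (hX : X ∈ reesWeyl m q A₀ A₁) :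
    c • X ∈ reesWeyl m q A₀ A₁ :=
  mem_reesWeyl.mpr ⟨fun n hn => by
    rw [HahnSeries.coeff_smul, Nonneg.of_rees hX n hn, smul_zero],
    fun n => by rw [HahnSeries.coeff_smul]; exact Submodule.smul_mem _ _ (rees_coeff hX n)⟩

theorem mul_mem_rees {X Y : HOp m q A₀ A₁} (hX : X ∈ reesWeyl m q A₀ A₁)
    (hY : Y ∈ reesWeyl m q A₀ A₁) : X * Y ∈ reesWeyl m q A₀ A₁ :=
  mem_reesWeyl.mpr ⟨coeff_mul_neg (.of_rees hX) (.of_rees hY), fun n => by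
    rw [coeff_mul_nat (.of_rees hX) (.of_rees hY)]
    refine sum_mem fun p hp => mul_mem_Fil (rees_coeff hX _) (rees_coeff hY _) ?_
    rw [Finset.HasAntidiagonal.mem_antidiagonal] at hp
    omega⟩

theorem hbarPow_mem_rees {k n : ℕ} (h : k ≤ n) {D : Op m q A₀ A₁}
    (hD : D ∈ Fil m q A₀ A₁ (k + 1)) : hbarPow (n : ℤ) D ∈ reesWeyl m q A₀ A₁ := by
  refine mem_reesWeyl.mpr ⟨fun l hl => HahnSeries.coeff_single_of_ne (by omega), fun l => ?_⟩
  by_cases hl : l = n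
  · subst hl
    rw [hbarPow, HahnSeries.coeff_single_same]
    exact Fil_mono (by omega) hD
  · rw [hbarPow, HahnSeries.coeff_single_of_ne (by omega)]
    exact zero_mem _

theorem one_mem_rees : (1 : HOp m q A₀ A₁) ∈ reesWeyl m q A₀ A₁ :=
  hbarPow_mem_rees (k := 0) (n := 0) le_rfl one_mem_Fil

/-! ### Parity of series -/

theorem coeff_hParity (Z : HOp m q A₀ A₁) (n : ℤ) : (hParity Z).coeff n = sgn (Z.coeff n) := rfl

theorem hParity_mul (X Y : HOp m q A₀ A₁) : hParity (X * Y) = hParity X * hParity Y :=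
  HahnSeries.map_mul (sgn : Op m q A₀ A₁ →ₐ[ℂ] Op m q A₀ A₁).toNonUnitalRingHom

theorem coeff_hParity_pow (e : ℕ) (Z : HOp m q A₀ A₁) (n : ℤ) :
    (hParity^[e] Z).coeff n = (sgn ^ e) (Z.coeff n) := by
  induction e with
  | zero => rfl
  | succ e ih => rw [Function.iterate_succ_apply', coeff_hParity, ih, sgn_pow_succ_apply]

theorem hParity_pow_mul (e : ℕ) (X Y : HOp m q A₀ A₁) :
    hParity^[e] (X * Y) = hParity^[e] X * hParity^[e] Y := by
  induction e generalizing X Y with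
  | zero => rfl
  | succ e ih => rw [Function.iterate_succ_apply, hParity_mul, ih]; rfl

theorem hParity_pow_mem_rees (e : ℕ) {X : HOp m q A₀ A₁} (hX : X ∈ reesWeyl m q A₀ A₁) :
    hParity^[e] X ∈ reesWeyl m q A₀ A₁ :=
  mem_reesWeyl.mpr ⟨fun n hn => by rw [coeff_hParity_pow, Nonneg.of_rees hX n hn, map_zero],
    fun n => by rw [coeff_hParity_pow]; exact sgn_pow_mem_Fil (rees_coeff hX n) e⟩

/-- `Z` is homogeneous of parity `e`. -/
def HPar (e : ℕ) (Z : HOp m q A₀ A₁) : Prop := hParity Z = (-1 : ℂ) ^ e • Z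

theorem HPar.coeff {e : ℕ} {Z : HOp m q A₀ A₁} (h : HPar e Z) (n : ℤ) : HasPar e (Z.coeff n) := by
  rw [HasPar, ← coeff_hParity, h, HahnSeries.coeff_smul]

theorem HPar.of_coeff {e : ℕ} {Z : HOp m q A₀ A₁} (h : ∀ n, HasPar e (Z.coeff n)) : HPar e Z :=
  hop_ext fun n => by rw [coeff_hParity, h n, HahnSeries.coeff_smul]

theorem HPar.pow {e : ℕ} {Z : HOp m q A₀ A₁} (h : HPar e Z) (k : ℕ) :
    hParity^[k] Z = (-1 : ℂ) ^ (e * k) • Z :=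
  hop_ext fun n => by rw [coeff_hParity_pow, (h.coeff n).pow, HahnSeries.coeff_smul]

theorem HPar.isHomogeneous {e : ℕ} {Z : HOp m q A₀ A₁} (h : HPar e Z) : IsHomogeneous Z := by
  rcases Nat.even_or_odd e with he | he
  · left; rw [h, he.neg_one_pow, one_smul]
  · right; rw [h, he.neg_one_pow]; exact neg_one_smul ℂ Z

theorem hbarPow_mul_coeff (n k : ℤ) (Z : HOp m q A₀ A₁) :
    (hbarPow n 1 * Z).coeff k = Z.coeff (k - n) := by
  rw [hbarPow, HahnSeries.coeff_single_mul, one_mul]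

theorem hbarPow_mul_hbarPow_mul (a b : ℤ) (Z : HOp m q A₀ A₁) :
    hbarPow a 1 * (hbarPow b 1 * Z) = hbarPow (a + b) 1 * Z := by
  rw [← mul_assoc, hbarPow, hbarPow, hbarPow, HahnSeries.single_mul_single, one_mul]

theorem hbarPow_comm (n : ℤ) (Y Z : HOp m q A₀ A₁) :
    Y * (hbarPow n 1 * Z) = hbarPow n 1 * (Y * Z) := by
  have : Y * hbarPow n 1 = hbarPow n 1 * Y := hop_ext fun k => by
    rw [hbarPow_mul_coeff, hbarPow, HahnSeries.coeff_mul_single, mul_one]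
  rw [← mul_assoc, this, mul_assoc]

/-! ### Infinite sums of series -/

theorem isSum_iff {F : ι → HOp m q A₀ A₁} {Z : HOp m q A₀ A₁} :
    IsSum F Z ↔ ∀ n, PSum (fun i => (F i).coeff n) (Z.coeff n) :=
  ⟨fun h n => ⟨fun f => (h n f).1, fun f => (h n f).2⟩, fun h n f => ⟨(h n).1 f, (h n).2 f⟩⟩

theorem IsSum.hfin {F : ι → HOp m q A₀ A₁} {Z : HOp m q A₀ A₁} (h : IsSum F Z) : HFin F :=
  fun n => (isSum_iff.mp h n).1

theorem IsSum.unique {F : ι → HOp m q A₀ A₁} {Y Z : HOp m q A₀ A₁} (h : IsSum F Y)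
    (h' : IsSum F Z) : Y = Z :=
  hop_ext fun n => (isSum_iff.mp h n).unique (isSum_iff.mp h' n)

theorem IsSum.mem_rees {F : ι → HOp m q A₀ A₁} {Z : HOp m q A₀ A₁} (h : IsSum F Z)
    (hF : ∀ i, F i ∈ reesWeyl m q A₀ A₁) : Z ∈ reesWeyl m q A₀ A₁ := by
  rw [isSum_iff] at h
  refine mem_reesWeyl.mpr ⟨fun n hn => ?_, fun n => (h n).mem_Fil fun i => rees_coeff (hF i) n⟩
  refine (h n).unique (PSum.zero.congr fun i => ?_)
  rw [Nonneg.of_rees (hF i) n hn]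

/-- The sum is formed separately for every power of $\hbar$; no negative power occurs, so the result
is again a Laurent series, and it stays in the Rees algebra because `Fil` is closed under pointwise
sums. -/
theorem HFin.exists_isSum {F : ι → HOp m q A₀ A₁} (h : HFin F)
    (hF : ∀ i, F i ∈ reesWeyl m q A₀ A₁) : ∃ Z ∈ reesWeyl m q A₀ A₁, IsSum F Z := by
  have h0 : ∀ n < 0, opSum (fun i => (F i).coeff n) = 0 := fun n hn =>
    (h n).psum.unique (PSum.zero.congr fun i => by rw [Nonneg.of_rees (hF i) n hn])
  have h1 : IsSum F (HahnSeries.ofSuppBddBelow (fun n => opSum fun i => (F i).coeff n)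
      ⟨0, fun n hn => not_lt.mp fun h => hn (h0 n h)⟩) :=
    isSum_iff.mpr fun n => (h n).psum
  exact ⟨_, h1.mem_rees hF, h1⟩

theorem IsSum.mul_left {F : ι → HOp m q A₀ A₁} {Z c : HOp m q A₀ A₁} (h : IsSum F Z)
    (hc : Nonneg c) (hF : ∀ i, Nonneg (F i)) (hZ : Nonneg Z) :
    IsSum (fun i => c * F i) (c * Z) := by
  rw [isSum_iff] at h ⊢
  intro n
  by_cases hn : n < 0
  · rw [coeff_mul_neg hc hZ n hn]
    exact PSum.zero.congr fun i => (coeff_mul_neg hc (hF i) n hn).symm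
  · obtain ⟨k, rfl⟩ := Int.eq_ofNat_of_zero_le (not_lt.mp hn)
    rw [coeff_mul_nat hc hZ]
    simp only [coeff_mul_nat hc (hF _)]
    exact PSum.finset_sum _ fun p _ => (h _).mul_left _

theorem IsSum.mul_right {F : ι → HOp m q A₀ A₁} {Z c : HOp m q A₀ A₁} (h : IsSum F Z)
    (hc : Nonneg c) (hF : ∀ i, Nonneg (F i)) (hZ : Nonneg Z) :
    IsSum (fun i => F i * c) (Z * c) := by
  rw [isSum_iff] at h ⊢
  intro n
  by_cases hn : n < 0
  · rw [coeff_mul_neg hZ hc n hn]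
    exact PSum.zero.congr fun i => (coeff_mul_neg (hF i) hc n hn).symm
  · obtain ⟨k, rfl⟩ := Int.eq_ofNat_of_zero_le (not_lt.mp hn)
    rw [coeff_mul_nat hZ hc]
    simp only [coeff_mul_nat (hF _) hc]
    exact PSum.finset_sum _ fun p _ => (h _).mul_right _

theorem IsSum.add {F G : ι → HOp m q A₀ A₁} {Y Z : HOp m q A₀ A₁} (h : IsSum F Y)
    (h' : IsSum G Z) : IsSum (fun i => F i + G i) (Y + Z) := by
  rw [isSum_iff] at *
  exact fun n => (h n).add (h' n)

theorem IsSum.sub {F G : ι → HOp m q A₀ A₁} {Y Z : HOp m q A₀ A₁} (h : IsSum F Y)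
    (h' : IsSum G Z) : IsSum (fun i => F i - G i) (Y - Z) := by
  rw [isSum_iff] at *
  exact fun n => (h n).sub (h' n)

theorem IsSum.hbarPow_mul {F : ι → HOp m q A₀ A₁} {Z : HOp m q A₀ A₁} (h : IsSum F Z) (k : ℤ) :
    IsSum (fun i => hbarPow k 1 * F i) (hbarPow k 1 * Z) := by
  rw [isSum_iff] at *
  intro n
  simp only [hbarPow_mul_coeff]
  exact h _

theorem IsSum.hParity_pow {F : ι → HOp m q A₀ A₁} {Z : HOp m q A₀ A₁} (h : IsSum F Z) (e : ℕ) :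
    IsSum (fun i => hParity^[e] (F i)) (hParity^[e] Z) := by
  rw [isSum_iff] at *
  intro n
  simp only [coeff_hParity_pow]
  exact (h n).sgn_pow e

theorem IsSum.congr {F G : ι → HOp m q A₀ A₁} {Z : HOp m q A₀ A₁} (h : IsSum F Z)
    (hFG : ∀ i, F i = G i) : IsSum G Z := by
  rwa [← funext hFG]

theorem IsSum.curry {F : ι → κ → HOp m q A₀ A₁} {E : ι → HOp m q A₀ A₁} {Z : HOp m q A₀ A₁}
    (hZ : IsSum (fun p : ι × κ => F p.1 p.2) Z) (hE : ∀ i, IsSum (F i) (E i)) : IsSum E Z := by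
  rw [isSum_iff] at *
  exact fun n => (hZ n).curry fun i => isSum_iff.mp (hE i) n

theorem IsSum.uncurry {F : ι → κ → HOp m q A₀ A₁} {E : ι → HOp m q A₀ A₁} {Z : HOp m q A₀ A₁}
    (hF : HFin (fun p : ι × κ => F p.1 p.2)) (hE : ∀ i, IsSum (F i) (E i)) (hZ : IsSum E Z) :
    IsSum (fun p : ι × κ => F p.1 p.2) Z := by
  rw [isSum_iff] at *
  exact fun n => PSum.uncurry (hF n) (fun i => isSum_iff.mp (hE i) n) (hZ n)

theorem HFin.mul_left {F : ι → HOp m q A₀ A₁} (hF : HFin F) {c : ι → HOp m q A₀ A₁}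
    (hc : ∀ i, Nonneg (c i)) (hF' : ∀ i, Nonneg (F i)) : HFin fun i => c i * F i := by
  intro n
  by_cases hn : n < 0
  · simp only [coeff_mul_neg (hc _) (hF' _) n hn]
    exact PSum.zero.1
  · obtain ⟨k, rfl⟩ := Int.eq_ofNat_of_zero_le (not_lt.mp hn)
    simp only [coeff_mul_nat (hc _) (hF' _)]
    exact PFin.finset_sum _ fun p _ => (hF _).mul_left _

theorem HFin.mul_right {F : ι → HOp m q A₀ A₁} (hF : HFin F) {c : HOp m q A₀ A₁}
    (hc : Nonneg c) (hF' : ∀ i, Nonneg (F i)) : HFin fun i => F i * c := by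
  intro n
  by_cases hn : n < 0
  · simp only [coeff_mul_neg (hF' _) hc n hn]
    exact PSum.zero.1
  · obtain ⟨k, rfl⟩ := Int.eq_ofNat_of_zero_le (not_lt.mp hn)
    simp only [coeff_mul_nat (hF' _) hc]
    exact PFin.finset_sum _ fun p _ => (hF _).mul_right _

open Classical in
/-- The family `C` is pointwise finite on every fiber of `π`. -/
def FiberFin (π : κ → ι) (C : κ → HOp m q A₀ A₁) : Prop :=
  ∀ l, HFin fun k => if π k = l then C k else 0

theorem FiberFin.mul_left {π : κ → ι} {C c : κ → HOp m q A₀ A₁} (h : FiberFin π C)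
    (hc : ∀ k, Nonneg (c k)) (hC : ∀ k, Nonneg (C k)) : FiberFin π fun k => c k * C k := by
  classical
  intro l
  have := (h l).mul_left hc fun k => by
    split_ifs
    · exact hC k
    · exact fun _ _ => rfl
  intro n
  refine (this n).mono fun k f hk => ?_
  simp only [mul_ite, mul_zero] at hk
  exact hk

/-- A given polynomial survives only finitely many right factors `K l`, and over each of these
finitely many `C k` remain. -/
theorem FiberFin.hfin {π : κ → ι} {C : κ → HOp m q A₀ A₁} (h : FiberFin π C)
    (hC : ∀ k, Nonneg (C k)) {K : ι → HOp m q A₀ A₁} (hK : HFin K) (hK' : ∀ i, Nonneg (K i)) :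
    HFin fun k => C k * K (π k) := by
  intro n
  by_cases hn : n < 0
  · simp only [coeff_mul_neg (hC _) (hK' _) n hn]
    exact PSum.zero.1
  · obtain ⟨n, rfl⟩ := Int.eq_ofNat_of_zero_le (not_lt.mp hn)
    simp only [coeff_mul_nat (hC _) (hK' _)]
    refine PFin.finset_sum _ fun p _ f => ?_
    refine ((hK p.2 f).biUnion fun l _ => h l p.1 ((K l).coeff p.2 f)).subset fun k hk => ?_
    refine Set.mem_biUnion (x := π k) (fun h0 => hk ?_) (fun h0 => hk ?_)
    · change (C k).coeff _ ((K (π k)).coeff _ f) = 0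
      exact (congrArg _ h0).trans (map_zero _)
    · simp only [if_true] at h0
      exact h0

/-! ### Generated ideals -/

/-- The terms are collected by their right factor: the new coefficient of `K l` is the sum of `C k`
over the fiber of `l`, which converges by fiber finiteness. -/
theorem mem_generatedIdeal_of_isSum {K : ι → HOp m q A₀ A₁} (hK : ∀ i, K i ∈ reesWeyl m q A₀ A₁)
    {π : κ → ι} {C : κ → HOp m q A₀ A₁} (hC : ∀ k, C k ∈ reesWeyl m q A₀ A₁) (hCf : FiberFin π C)
    {Z : HOp m q A₀ A₁} (hZ : IsSum (fun k => C k * K (π k)) Z) : Z ∈ generatedIdeal K := by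
  classical
  have hC' : ∀ l k, (if π k = l then C k else 0) ∈ reesWeyl m q A₀ A₁ := fun l k => by
    split_ifs
    · exact hC k
    · exact zero_mem_rees
  choose c hc hcs using fun l => HFin.exists_isSum (hCf l) (hC' l)
  refine ⟨c, hc, isSum_iff.mpr fun n => ?_⟩
  refine PSum.fiber π (fun l => ?_) (isSum_iff.mp hZ n)
  have := (hcs l).mul_right (.of_rees (hK l)) (fun k => .of_rees (hC' l k)) (.of_rees (hc l))
  refine (isSum_iff.mp this n).congr fun k => ?_
  by_cases hk : π k = l
  · subst hk; simp only [if_true]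
  · simp [hk]

/-- Substituting the expansions of the `g k` gives a double sum. Fiber finiteness survives
multiplication by coefficients on the left, so the double sum converges and can be regrouped. -/
theorem generatedIdeal_subset {g : κ → HOp m q A₀ A₁} {K : ι → HOp m q A₀ A₁} {P : Type}
    (hK : ∀ i, K i ∈ reesWeyl m q A₀ A₁) (hKf : HFin K) {π : κ → P → ι} {C : κ → P → HOp m q A₀ A₁}
    (hC : ∀ k p, C k p ∈ reesWeyl m q A₀ A₁)
    (hCf : FiberFin (fun x : κ × P => π x.1 x.2) fun x => C x.1 x.2)
    (hg : ∀ k, IsSum (fun p => C k p * K (π k p)) (g k)) :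
    generatedIdeal g ⊆ generatedIdeal K := by
  rintro Z ⟨c, hc, hZ⟩
  have h1 := hCf.mul_left (c := fun x => c x.1) (fun x => .of_rees (hc _))
    (fun x => .of_rees (hC _ _))
  refine mem_generatedIdeal_of_isSum hK (fun x : κ × P => mul_mem_rees (hc x.1) (hC x.1 x.2)) h1 ?_
  have h2 := h1.hfin (fun x => .of_rees (mul_mem_rees (hc x.1) (hC x.1 x.2))) hKf
    (fun i => .of_rees (hK i))
  refine IsSum.uncurry (F := fun k p => c k * C k p * K (π k p)) h2 (fun k => ?_) hZ
  refine ((hg k).mul_left (.of_rees (hc k)) (fun p => .of_rees (mul_mem_rees (hC k p) (hK _)))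
    (.of_rees ?_)).congr fun p => (mul_assoc _ _ _).symm
  exact (hg k).mem_rees fun p => mul_mem_rees (hC k p) (hK _)

theorem generatedIdeal_subset_rees {K : ι → HOp m q A₀ A₁}
    (hK : ∀ i, K i ∈ reesWeyl m q A₀ A₁) : generatedIdeal K ⊆ reesWeyl m q A₀ A₁ := by
  rintro Z ⟨c, hc, hZ⟩
  exact hZ.mem_rees fun i => mul_mem_rees (hc i) (hK i)

theorem zero_mem_generatedIdeal (K : ι → HOp m q A₀ A₁) : 0 ∈ generatedIdeal K :=
  ⟨fun _ => 0, fun _ => zero_mem_rees, isSum_iff.mpr fun n => by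
    simpa using PSum.zero⟩

theorem add_mem_generatedIdeal {K : ι → HOp m q A₀ A₁} {X Y : HOp m q A₀ A₁}
    (hX : X ∈ generatedIdeal K) (hY : Y ∈ generatedIdeal K) : X + Y ∈ generatedIdeal K := by
  obtain ⟨c, hc, hX⟩ := hX
  obtain ⟨d, hd, hY⟩ := hY
  exact ⟨fun i => c i + d i, fun i => add_mem_rees (hc i) (hd i),
    (hX.add hY).congr fun i => (add_mul _ _ _).symm⟩

theorem mul_mem_generatedIdeal {K : ι → HOp m q A₀ A₁} (hK : ∀ i, K i ∈ reesWeyl m q A₀ A₁)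
    {c X : HOp m q A₀ A₁} (hc : c ∈ reesWeyl m q A₀ A₁) (hX : X ∈ generatedIdeal K) :
    c * X ∈ generatedIdeal K := by
  have hX' := generatedIdeal_subset_rees hK hX
  obtain ⟨d, hd, hX⟩ := hX
  exact ⟨fun i => c * d i, fun i => mul_mem_rees hc (hd i),
    (hX.mul_left (.of_rees hc) (fun i => .of_rees (mul_mem_rees (hd i) (hK i)))
      (.of_rees hX')).congr fun i => (mul_assoc _ _ _).symm⟩

theorem smul_mul_hop (a : ℂ) (X Y : HOp m q A₀ A₁) : (a • X) * Y = a • (X * Y) := by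
  have h : ∀ Z : HOp m q A₀ A₁, hbarPow 0 (a • 1) * Z = a • Z := fun Z => hop_ext fun n => by
    rw [hbarPow, HahnSeries.coeff_single_mul, sub_zero, smul_one_mul, HahnSeries.coeff_smul]
  rw [← h, mul_assoc, h]

theorem mul_smul_hop (a : ℂ) (X Y : HOp m q A₀ A₁) : X * (a • Y) = a • (X * Y) := by
  have h : ∀ Z : HOp m q A₀ A₁, Z * hbarPow 0 (a • 1) = a • Z := fun Z => hop_ext fun n => by
    rw [hbarPow, HahnSeries.coeff_mul_single, sub_zero, mul_smul_one, HahnSeries.coeff_smul]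
  rw [← h, ← mul_assoc, h]

theorem smul_mem_generatedIdeal {K : ι → HOp m q A₀ A₁} (hK : ∀ i, K i ∈ reesWeyl m q A₀ A₁)
    (a : ℂ) {X : HOp m q A₀ A₁} (hX : X ∈ generatedIdeal K) : a • X ∈ generatedIdeal K := by
  have := mul_mem_generatedIdeal hK (smul_mem_rees a one_mem_rees) hX
  rwa [smul_mul_hop, one_mul] at this

end SuperAiry

end

/-! ### Supercommutators of series and of elements of a generated ideal. -/

noncomputable section

namespace SuperAiry

variable {m q : ℕ} {A₀ A₁ : Type} {ι κ : Type}

/-! ### Supercommutators of series -/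

/-- The supercommutator `[X, Y]` with `X` of parity `e`. -/
def hbr (e : ℕ) (X Y : HOp m q A₀ A₁) : HOp m q A₀ A₁ := X * Y - hParity^[e] Y * X

theorem evenPart_add_oddPart (X : HOp m q A₀ A₁) : evenPart X + oddPart X = X :=
  hop_ext fun n => by
    simp only [evenPart, oddPart, HahnSeries.coeff_add, HahnSeries.coeff_smul,
      HahnSeries.coeff_sub]
    module

/-- Only the first argument has to be split into homogeneous parts; the sign for the second one is
carried by `hParity`. -/
theorem superComm_eq_hbr (X Y : HOp m q A₀ A₁) :
    superComm X Y = hbr 0 (evenPart X) Y + hbr 1 (oddPart X) Y := by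
  have key : ∀ {S : Type} [Ring S] (a b y y' : S),
      (a + b) * y - y * a - y' * b = (a * y - y * a) + (b * y - y' * b) := by
    intro S _ a b y y'; noncomm_ring
  conv_lhs => rw [superComm]; enter [1, 1, 1]; rw [← evenPart_add_oddPart X]
  exact key (S := HOp m q A₀ A₁) _ _ _ _

theorem hPar_evenPart (X : HOp m q A₀ A₁) : HPar 0 (evenPart X) := .of_coeff fun n => by
  simp only [HasPar, evenPart, HahnSeries.coeff_add, HahnSeries.coeff_smul, coeff_hParity,
    map_add, map_smul, sgn_sgn]
  module

theorem hPar_oddPart (X : HOp m q A₀ A₁) : HPar 1 (oddPart X) := .of_coeff fun n => by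
  simp only [HasPar, oddPart, HahnSeries.coeff_sub, HahnSeries.coeff_smul, coeff_hParity,
    map_sub, map_smul, sgn_sgn]
  module

theorem coeff_hbr {X Y : HOp m q A₀ A₁} (e : ℕ) (hX : Nonneg X) (hY : Nonneg Y) (n : ℕ) :
    (hbr e X Y).coeff n =
      ∑ p ∈ Finset.HasAntidiagonal.antidiagonal n, br e (X.coeff p.1) (Y.coeff p.2) := by
  have hY' : Nonneg (hParity^[e] Y) := fun k hk => by rw [coeff_hParity_pow, hY k hk, map_zero]
  rw [hbr, HahnSeries.coeff_sub, coeff_mul_nat hX hY, coeff_mul_nat hY' hX]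
  simp only [br_apply, Finset.sum_sub_distrib, coeff_hParity_pow]
  congr 1
  exact Finset.sum_bij' (fun p _ => p.swap) (fun p _ => p.swap) (by simp [add_comm])
    (by simp [add_comm]) (by simp) (by simp) (by simp)

/-- The bracket loses two degrees, exactly what is needed to divide by $\hbar^2$. In particular its
coefficients of $\hbar^0$ and $\hbar^1$ vanish, so no negative power appears. -/
theorem hbr_div_mem_rees {e : ℕ} {X Y : HOp m q A₀ A₁} (hX : X ∈ reesWeyl m q A₀ A₁)
    (hY : Y ∈ reesWeyl m q A₀ A₁) (he : HPar e X) :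
    hbarPow (-2) 1 * hbr e X Y ∈ reesWeyl m q A₀ A₁ := by
  have h : ∀ n : ℕ, (hbr e X Y).coeff n ∈ Fil m q A₀ A₁ (n - 1) := fun n => by
    rw [coeff_hbr e (.of_rees hX) (.of_rees hY)]
    refine sum_mem fun p hp => br_mem_Fil (rees_coeff hX _) (rees_coeff hY _) (he.coeff _) ?_
    rw [Finset.HasAntidiagonal.mem_antidiagonal] at hp
    omega
  have h0 : Nonneg (hbr e X Y) := fun n hn => by
    rw [hbr, HahnSeries.coeff_sub, coeff_mul_neg (.of_rees hX) (.of_rees hY) n hn,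
      coeff_mul_neg (.of_rees (hParity_pow_mem_rees e hY)) (.of_rees hX) n hn, sub_zero]
  refine mem_reesWeyl.mpr ⟨fun n hn => ?_, fun n => ?_⟩
  · rw [hbarPow_mul_coeff]
    by_cases hn' : n - -2 < 0
    · exact h0 _ hn'
    · have h1 : n - -2 = ((n + 2).toNat : ℤ) := by omega
      have h2 := h (n + 2).toNat
      rw [h1]
      rwa [show (n + 2).toNat - 1 = 0 by omega, mem_Fil_zero] at h2
  · rw [hbarPow_mul_coeff]
    exact h (n + 2)

theorem hbr_mul {e : ℕ} (X c Y : HOp m q A₀ A₁) :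
    hbr e X (c * Y) = hbr e X c * Y + hParity^[e] c * hbr e X Y := by
  have key : ∀ {S : Type} [Ring S] (x c y c' y' : S),
      x * (c * y) - c' * y' * x = (x * c - c' * x) * y + c' * (x * y - y' * x) := by
    intro S _ x c y c' y'; noncomm_ring
  simp only [hbr, hParity_pow_mul]
  exact key (S := HOp m q A₀ A₁) _ _ _ _ _

theorem HPar.hbr_swap {e k : ℕ} {X Y : HOp m q A₀ A₁} (hX : HPar e X) (hY : HPar k Y) :
    hbr e X Y = (-(-1 : ℂ) ^ (e * k)) • hbr k Y X := by
  refine hop_ext fun n => ?_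
  rw [hbr, hbr, HPar.pow hY, HPar.pow hX, smul_mul_hop, smul_mul_hop, HahnSeries.coeff_smul,
    HahnSeries.coeff_sub, HahnSeries.coeff_sub, HahnSeries.coeff_smul, HahnSeries.coeff_smul,
    smul_sub, smul_smul, mul_comm k e, neg_mul, SPoly.neg_one_pow_mul_self, neg_smul, neg_smul,
    one_smul]
  abel

theorem IsSum.hbr {F : ι → HOp m q A₀ A₁} {X Y : HOp m q A₀ A₁} (e : ℕ) (h : IsSum F Y)
    (hX : X ∈ reesWeyl m q A₀ A₁) (hF : ∀ i, F i ∈ reesWeyl m q A₀ A₁) :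
    IsSum (fun i => SuperAiry.hbr e X (F i)) (SuperAiry.hbr e X Y) :=
  (h.mul_left (.of_rees hX) (fun i => .of_rees (hF i)) (.of_rees (h.mem_rees hF))).sub
    ((h.hParity_pow e).mul_right (.of_rees hX)
      (fun i => .of_rees (hParity_pow_mem_rees e (hF i)))
      (.of_rees (hParity_pow_mem_rees e (h.mem_rees hF))))

theorem hbarPow_mul_mul (n : ℤ) (Y Z : HOp m q A₀ A₁) :
    hbarPow n 1 * (Y * Z) = (hbarPow n 1 * Y) * Z := (mul_assoc _ _ _).symm

theorem hbarPow_mul_add (n : ℤ) (Y Z : HOp m q A₀ A₁) :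
    hbarPow n 1 * (Y + Z) = hbarPow n 1 * Y + hbarPow n 1 * Z := mul_add _ _ _

theorem hop_add_sub_cancel (Y Z : HOp m q A₀ A₁) : Y + Z - Y = Z :=
  hop_ext fun n => by simp only [HahnSeries.coeff_add, HahnSeries.coeff_sub, add_sub_cancel_left]

theorem hop_mul_add_mul_sub (c Y Z : HOp m q A₀ A₁) : c * Y + c * (Z - Y) = c * Z := by
  have h : Y + (Z - Y) = Z := hop_ext fun n => by
    simp only [HahnSeries.coeff_add, HahnSeries.coeff_sub, add_sub_cancel]
  rw [← mul_add, h]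

theorem exists_isSum_mul {K : ι → HOp m q A₀ A₁} (hK : ∀ i, K i ∈ reesWeyl m q A₀ A₁)
    (hKf : HFin K) {P : Type} {π : κ → P → ι} {C : κ → P → HOp m q A₀ A₁}
    (hC : ∀ k p, C k p ∈ reesWeyl m q A₀ A₁)
    (hCf : FiberFin (fun x : κ × P => π x.1 x.2) fun x => C x.1 x.2)
    {c V : κ → HOp m q A₀ A₁} (hc : ∀ k, c k ∈ reesWeyl m q A₀ A₁)
    (hV : ∀ k, IsSum (fun p => C k p * K (π k p)) (V k)) :
    ∃ Z ∈ generatedIdeal K, IsSum (fun k => c k * V k) Z := by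
  have h0 := fun x : κ × P => mul_mem_rees (hc x.1) (hC x.1 x.2)
  have h1 := hCf.mul_left (c := fun x => c x.1) (fun x => .of_rees (hc _))
    (fun x => .of_rees (hC _ _))
  have h2 := h1.hfin (fun x => .of_rees (h0 x)) hKf (fun i => .of_rees (hK i))
  obtain ⟨Z, -, hZ⟩ := h2.exists_isSum fun x => mul_mem_rees (h0 x) (hK _)
  refine ⟨Z, mem_generatedIdeal_of_isSum hK h0 h1 hZ, ?_⟩
  refine IsSum.curry (F := fun k p => c k * C k p * K (π k p)) hZ fun k => ?_
  have h3 := fun p => mul_mem_rees (hC k p) (hK (π k p))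
  exact ((hV k).mul_left (.of_rees (hc k)) (fun p => .of_rees (h3 p))
    (.of_rees ((hV k).mem_rees h3))).congr fun p => (mul_assoc _ _ _).symm

theorem hParity_mem_generatedIdeal {K : ι → HOp m q A₀ A₁} {p : ι → ℕ}
    (hp : ∀ i, HPar (p i) (K i)) {X : HOp m q A₀ A₁} (hX : X ∈ generatedIdeal K) :
    hParity X ∈ generatedIdeal K := by
  obtain ⟨c, hc, hX⟩ := hX
  refine ⟨fun i => (-1 : ℂ) ^ p i • hParity (c i),
    fun i => smul_mem_rees _ (hParity_pow_mem_rees 1 (hc i)),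
    (hX.hParity_pow 1).congr fun i => ?_⟩
  rw [Function.iterate_one, hParity_mul, hp i, mul_smul_hop, smul_mul_hop]

section Ideal

variable {K : ι → HOp m q A₀ A₁} {p : ι → ℕ} {c : ι → ι → ℂ} {τ : ι → ι → ι}

/-- Write $X=\sum a_iK_i$ and $Y=\sum b_kK_k$. By the Leibniz rule, $[X,Y]$ consists of terms
$[X,b_k]K_k$, $b_k[K_k,a_i]K_i$ and $b_ka_i[K_k,K_i]$ up to signs. The first two kinds are divisible
by $\hbar^2$ by degree, the third by the relations among generators. Each kind is shown to converge
and to lie in the ideal separately. -/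
theorem hbr_div_mem_generatedIdeal (hK : ∀ i, K i ∈ reesWeyl m q A₀ A₁) (hKf : HFin K)
    (hp : ∀ i, HPar (p i) (K i))
    (hc : ∀ i k, hbr (p i) (K i) (K k) = hbarPow 2 1 * (c i k • K (τ i k)))
    (hτ : ∀ l, {x : ι × ι | c x.1 x.2 ≠ 0 ∧ τ x.1 x.2 = l}.Finite) {e : ℕ} {X Y : HOp m q A₀ A₁}
    (he : HPar e X) (hX : X ∈ generatedIdeal K) (hY : Y ∈ generatedIdeal K) :
    hbarPow (-2) 1 * hbr e X Y ∈ generatedIdeal K := by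
  classical
  have hXr := generatedIdeal_subset_rees hK hX
  obtain ⟨a, ha, hX⟩ := hX
  obtain ⟨b, hb, hY⟩ := hY
  have hcancel : ∀ Z : HOp m q A₀ A₁, hbarPow (-2) 1 * (hbarPow 2 1 * Z) = Z := fun Z => by
    rw [hbarPow_mul_hbarPow_mul]; exact one_mul Z
  -- brackets with the coefficients of `Y`
  have hW := fun k => hbr_div_mem_rees hXr (hb k) he
  obtain ⟨Z₁, -, hZ₁⟩ := HFin.exists_isSum
    (hKf.mul_left (fun k => .of_rees (hW k)) fun i => .of_rees (hK i))
    fun k => mul_mem_rees (hW k) (hK k)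
  have hZ₁' : Z₁ ∈ generatedIdeal K := ⟨_, hW, hZ₁⟩
  -- brackets with the coefficients of `X`
  have hU := fun k i => hbr_div_mem_rees (hK k) (ha i) (hp k)
  have hUs : ∀ k, ∃ V, IsSum (fun i => hbarPow (-2) 1 * hbr (p k) (K k) (a i) * K i) V := fun k =>
    let ⟨V, _, h⟩ := HFin.exists_isSum
      (hKf.mul_left (fun i => .of_rees (hU k i)) fun i => .of_rees (hK i))
      fun i => mul_mem_rees (hU k i) (hK i)
    ⟨V, h⟩
  choose V₂ hV₂ using hUs
  let ε : ι → HOp m q A₀ A₁ := fun k => (-(-1 : ℂ) ^ (e * p k)) • hParity^[e] (b k)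
  have hε : ∀ k, ε k ∈ reesWeyl m q A₀ A₁ := fun k =>
    smul_mem_rees _ (hParity_pow_mem_rees e (hb k))
  obtain ⟨Z₂, hZ₂', hZ₂⟩ := exists_isSum_mul (π := fun _ i => i) hK hKf hU (fun l n => by
    -- For a fixed coefficient of `X`, its brackets with the generators are pointwise finite because
    -- the generators are.
    have h1 : HFin fun k => hbr (p k) (K k) (a l) := fun n =>
      ((hKf.mul_right (.of_rees (ha l)) fun k => .of_rees (hK k)) n).sub
        ((hKf.mul_left (fun k => .of_rees (hParity_pow_mem_rees (p k) (ha l)))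
          fun k => .of_rees (hK k)) n)
    have h2 := h1 (n - -2)
    refine fun f => ((h2 f).image fun k => (k, l)).subset fun x hx => ?_
    obtain ⟨k, i⟩ := x
    by_cases hi : i = l
    · subst hi
      refine ⟨k, ?_, rfl⟩
      simpa only [Function.mem_support, if_true, hbarPow_mul_coeff] using hx
    · simp [hi] at hx) hε hV₂
  -- brackets of the generators
  let C : ι → ι → HOp m q A₀ A₁ := fun k i => c k i • hParity^[p k] (a i)
  have hC : ∀ k i, C k i ∈ reesWeyl m q A₀ A₁ := fun k i =>
    smul_mem_rees _ (hParity_pow_mem_rees _ (ha i))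
  -- The sum of these terms is found by subtraction: the bracket of `K k` with `X`, minus the part
  -- `V₂ k` in which the coefficients were bracketed.
  have hV₃ : ∀ k, IsSum (fun i => C k i * K (τ k i))
      (hbarPow (-2) 1 * hbr (p k) (K k) X - V₂ k) := fun k => by
    refine (((hX.hbr (p k) (hK k) fun i => mul_mem_rees (ha i) (hK i)).hbarPow_mul (-2)).sub
      (hV₂ k)).congr fun i => ?_
    rw [hbr_mul, hbarPow_mul_add, hbarPow_mul_mul, hop_add_sub_cancel, hc, hbarPow_comm, hcancel,
      smul_mul_hop, mul_smul_hop]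
  obtain ⟨Z₃, hZ₃', hZ₃⟩ := exists_isSum_mul hK hKf hC (fun l n f =>
    (hτ l).subset fun x hx => by
      rw [Function.mem_support] at hx
      by_cases hl : τ x.1 x.2 = l
      · refine ⟨fun h0 => hx ?_, hl⟩
        simp [C, hl, h0]
      · simp [hl] at hx) hε hV₃
  have key : IsSum (fun k => hbarPow (-2) 1 * hbr e X (b k * K k)) (Z₁ + Z₂ + Z₃) := by
    refine ((hZ₁.add hZ₂).add hZ₃).congr fun k => ?_
    rw [hbr_mul, hbarPow_mul_add, hbarPow_mul_mul, add_assoc, hop_mul_add_mul_sub,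
      he.hbr_swap (hp k), mul_smul_hop, mul_smul_hop, smul_mul_hop, hbarPow_comm]
  rw [((hY.hbr e hXr fun k => mul_mem_rees (hb k) (hK k)).hbarPow_mul (-2)).unique key]
  exact add_mem_generatedIdeal (add_mem_generatedIdeal hZ₁' hZ₂') hZ₃'

/-- A left ideal whose generators close under the supercommutator up to `ħ²` is closed under the
supercommutator up to `ħ²`. -/
theorem superComm_mem_generatedIdeal (hK : ∀ i, K i ∈ reesWeyl m q A₀ A₁) (hKf : HFin K)
    (hp : ∀ i, HPar (p i) (K i))
    (hc : ∀ i k, hbr (p i) (K i) (K k) = hbarPow 2 1 * (c i k • K (τ i k)))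
    (hτ : ∀ l, {x : ι × ι | c x.1 x.2 ≠ 0 ∧ τ x.1 x.2 = l}.Finite) {X Y : HOp m q A₀ A₁}
    (hX : X ∈ generatedIdeal K) (hY : Y ∈ generatedIdeal K) :
    ∃ Z ∈ generatedIdeal K, superComm X Y = hbarPow 2 1 * Z := by
  have hX' := hParity_mem_generatedIdeal hp hX
  have h0 : evenPart X ∈ generatedIdeal K :=
    smul_mem_generatedIdeal hK _ (add_mem_generatedIdeal hX hX')
  have h1 : oddPart X ∈ generatedIdeal K := by
    have h : X - hParity X = X + (-1 : ℂ) • hParity X := hop_ext fun n => by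
      simp only [HahnSeries.coeff_add, HahnSeries.coeff_sub, HahnSeries.coeff_smul]
      module
    rw [oddPart, h]
    exact smul_mem_generatedIdeal hK _
      (add_mem_generatedIdeal hX (smul_mem_generatedIdeal hK (-1) hX'))
  refine ⟨_, add_mem_generatedIdeal
    (hbr_div_mem_generatedIdeal hK hKf hp hc hτ (hPar_evenPart X) h0 hY)
    (hbr_div_mem_generatedIdeal hK hKf hp hc hτ (hPar_oddPart X) h1 hY), ?_⟩
  rw [superComm_eq_hbr, ← hbarPow_mul_add, hbarPow_mul_hbarPow_mul]
  exact (one_mul _).symm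

end Ideal

end SuperAiry

end

/-! ### Nilpotency of odd constants and inversion of column-finite matrices. -/

noncomputable section

namespace SuperAiry

namespace SPoly

variable {E O : Type}

/-! ### The body of a superpolynomial -/

/-- The body of a superpolynomial: set all odd generators to zero. -/
def body : SPoly E O →ₐ[ℂ] MvPolynomial E ℂ :=
  Algebra.TensorProduct.lift (AlgHom.id ℂ (MvPolynomial E ℂ))
    ((Algebra.ofId ℂ (MvPolynomial E ℂ)).comp ExteriorAlgebra.algebraMapInv)
    (fun _ _ => mul_comm _ _)

/-- Polynomials in the even generators. -/
def ofBody : MvPolynomial E ℂ →ₐ[ℂ] SPoly E O := Algebra.TensorProduct.includeLeft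

theorem body_evenGen (e : E) : body (evenGen e : SPoly E O) = MvPolynomial.X e := by
  have : body (evenGen e : SPoly E O) = _ := Algebra.TensorProduct.lift_tmul _ _ _ _ _
  rw [this]
  simp

theorem body_oddGen (o : O) : body (oddGen o : SPoly E O) = 0 := by
  have : body (oddGen o : SPoly E O) = _ := Algebra.TensorProduct.lift_tmul _ _ _ _ _
  rw [this]
  simp [ExteriorAlgebra.algebraMapInv]

theorem ofBody_X (e : E) : (ofBody (MvPolynomial.X e) : SPoly E O) = evenGen e := rfl

theorem body_parity (f : SPoly E O) : body (parity f) = body f := by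
  refine DFunLike.congr_fun (algHom_ext (φ := body.comp parityHom) (ψ := body) fun i => ?_) f
  change body (parity (gen i)) = body (gen i)
  rw [parity_gen, map_smul]
  cases i with
  | inl e => simp [genPar]
  | inr o => simp [genPar, gen, body_oddGen]

theorem IsOdd.body {f : SPoly E O} (hf : IsOdd f) : body f = 0 := by
  have h := body_parity f
  rw [hf, map_neg] at h
  exact self_eq_neg.mp h.symm

theorem oddGen_mul_self (o : O) : (oddGen o : SPoly E O) * oddGen o = 0 := (isOdd_oddGen o).sq

/-- Products of odd generators. -/
def oddWord (w : List O) : SPoly E O := (w.map oddGen).prod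

theorem oddWord_mul_comm (w : List O) (f : SPoly E O) :
    oddWord w * f = parity^[w.length] f * oddWord w := by
  induction w generalizing f with
  | nil => simp [oddWord]
  | cons o w ih =>
    have h : oddWord (o :: w) = (oddGen o * oddWord w : SPoly E O) := by simp [oddWord]
    rw [h, mul_assoc, ih, ← mul_assoc, oddGen_comm, mul_assoc, List.length_cons,
      Function.iterate_succ_apply']

theorem oddGen_mul_oddWord (o : O) (w : List O) :
    (oddGen o : SPoly E O) * oddWord w = 0 ∨ o ∉ w := by
  induction w with
  | nil => right; simp
  | cons o' w ih =>
    have h : oddWord (o' :: w) = (oddGen o' * oddWord w : SPoly E O) := by simp [oddWord]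
    by_cases ho : o = o'
    · left; rw [h, ho, ← mul_assoc, oddGen_mul_self, zero_mul]
    · rcases ih with ih | ih
      · left; rw [h, ← mul_assoc, oddGen_comm, mul_assoc, ih, mul_zero]
      · right; simp [ho, ih]

theorem oddWord_eq_zero (w : List O) (hw : ¬w.Nodup) : (oddWord w : SPoly E O) = 0 := by
  induction w with
  | nil => simp at hw
  | cons o w ih =>
    have h : oddWord (o :: w) = (oddGen o * oddWord w : SPoly E O) := by simp [oddWord]
    rw [List.nodup_cons, not_and_or, not_not] at hw
    rcases hw with hw | hw
    · rcases oddGen_mul_oddWord (E := E) o w with h' | h'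
      · rw [h, h']
      · exact absurd hw h'
    · rw [h, ih hw, mul_zero]

/-- The powers of the ideal of the odd generators. -/
def oddFil (k : ℕ) : Submodule ℂ (SPoly E O) :=
  Submodule.span ℂ {p | ∃ (f : SPoly E O) (w : List O), k ≤ w.length ∧ p = f * oddWord w}

theorem mem_oddFil_zero (f : SPoly E O) : f ∈ oddFil (E := E) (O := O) 0 :=
  Submodule.subset_span ⟨f, [], by simp, by simp [oddWord]⟩

theorem mul_mem_oddFil {a b : ℕ} {f g : SPoly E O} (hf : f ∈ oddFil a) (hg : g ∈ oddFil b) :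
    f * g ∈ oddFil (a + b) := by
  induction hf using Submodule.span_induction with
  | mem f h =>
    obtain ⟨f, w, hw, rfl⟩ := h
    induction hg using Submodule.span_induction with
    | mem g h =>
      obtain ⟨g, w', hw', rfl⟩ := h
      refine Submodule.subset_span ⟨f * parity^[w.length] g, w ++ w', by simp; omega, ?_⟩
      have : oddWord (w ++ w') = (oddWord w * oddWord w' : SPoly E O) := by simp [oddWord]
      rw [this, mul_assoc f, ← mul_assoc (oddWord w), oddWord_mul_comm]
      simp only [mul_assoc]
    | zero => rw [mul_zero]; exact zero_mem _
    | add x y _ _ hx hy => rw [mul_add]; exact add_mem hx hy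
    | smul c x _ hx => rw [mul_smul_comm]; exact Submodule.smul_mem _ _ hx
  | zero => rw [zero_mul]; exact zero_mem _
  | add x y _ _ hx hy => rw [add_mul]; exact add_mem hx hy
  | smul c x _ hx => rw [smul_mul_assoc]; exact Submodule.smul_mem _ _ hx

/-- A product of more odd generators than there are repeats one of them. So the ideal of odd
generators of $R$ is nilpotent. -/
theorem oddFil_card [Fintype O] {f : SPoly E O} (hf : f ∈ oddFil (Fintype.card O + 1)) : f = 0 := by
  induction hf using Submodule.span_induction with
  | mem f h =>
    obtain ⟨f, w, hw, rfl⟩ := h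
    rw [oddWord_eq_zero w fun h => ?_, mul_zero]
    have := h.length_le_card
    omega
  | zero => rfl
  | add x y _ _ hx hy => rw [hx, hy, add_zero]
  | smul c x _ hx => rw [hx, smul_zero]

theorem sub_ofBody_mem (f : SPoly E O) : f - ofBody (body f) ∈ oddFil (E := E) (O := O) 1 := by
  induction f using left_induction with
  | one => rw [map_one, map_one, sub_self]; exact zero_mem _
  | add f g hf hg => rw [map_add, map_add, add_sub_add_comm]; exact add_mem hf hg
  | smul c f hf => rw [map_smul, map_smul, ← smul_sub]; exact Submodule.smul_mem _ _ hf
  | gen_mul i f hf =>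
    cases i with
    | inl e =>
      rw [map_mul, map_mul]
      change evenGen e * f - ofBody (body (evenGen e)) * _ ∈ _
      rw [body_evenGen, ofBody_X, ← mul_sub]
      have := mul_mem_oddFil (mem_oddFil_zero (evenGen e)) hf
      rwa [zero_add] at this
    | inr o =>
      rw [map_mul, map_mul]
      change oddGen o * f - ofBody (body (oddGen o)) * _ ∈ _
      rw [body_oddGen, map_zero, zero_mul, sub_zero]
      have h1 : (oddGen o : SPoly E O) ∈ oddFil (E := E) (O := O) 1 :=
        Submodule.subset_span ⟨1, [o], by simp, by simp [oddWord]⟩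
      have := mul_mem_oddFil h1 (mem_oddFil_zero f)
      rwa [add_zero] at this

theorem mem_oddFil_one {f : SPoly E O} (hf : body f = 0) : f ∈ oddFil (E := E) (O := O) 1 := by
  have := sub_ofBody_mem f
  rwa [hf, map_zero, sub_zero] at this

end SPoly

/-! ### Column-finite matrices -/

section Matrix

variable {S : Type} [Ring S] {ι : Type}

open Classical in
/-- The right linear map given by a column-finite matrix. -/
def colMap (X : ι → ι →₀ S) : (ι →₀ S) →+ (ι →₀ S) :=
  Finsupp.liftAddHom fun j =>
    { toFun := fun a => (X j).mapRange (· * a) (zero_mul a)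
      map_zero' := by ext; simp
      map_add' := fun a b => by ext; simp [mul_add] }

theorem colMap_apply (X : ι → ι →₀ S) (v : ι →₀ S) (l : ι) :
    colMap X v l = v.sum fun j a => X j l * a := by
  rw [colMap, Finsupp.liftAddHom_apply, Finsupp.sum_apply]
  rfl

theorem colMap_single (X : ι → ι →₀ S) (j : ι) (a : S) (l : ι) :
    colMap X (Finsupp.single j a) l = X j l * a := by
  rw [colMap_apply, Finsupp.sum_single_index (mul_zero _)]

theorem colMap_mulRight (X : ι → ι →₀ S) (v : ι →₀ S) (a : S) :
    colMap X (v.mapRange (· * a) (zero_mul a)) = (colMap X v).mapRange (· * a) (zero_mul a) := by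
  ext l
  rw [Finsupp.mapRange_apply, colMap_apply, colMap_apply, Finsupp.sum_mapRange_index (by simp),
    Finsupp.sum_mul]
  simp only [mul_assoc]

variable {F : ℕ → AddSubgroup S} (w : ι → ℕ)

/-- Modulo `F 1` the matrix strictly lowers the weight, so a vector of bounded weight moves one step
up the filtration `F` after finitely many applications. Since `F` reaches zero, every vector is
eventually killed, though the number of steps depends on the vector. -/
theorem exists_iterate_colMap_eq_zero {X : ι → ι →₀ S} (hF0 : ∀ a, a ∈ F 0)
    (hFmul : ∀ {i j a b}, a ∈ F i → b ∈ F j → a * b ∈ F (i + j)) {Q : ℕ} (hQ : ∀ a ∈ F Q, a = 0)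
    (hX : ∀ j l, w j ≤ w l → X j l ∈ F 1) (v : ι →₀ S) : ∃ n, (colMap X)^[n] v = 0 := by
  -- The weight above which the entries already lie one step deeper drops by one: an entry of weight
  -- at least `n` receives contributions from weights above `n`, which are deeper, or through matrix
  -- entries in `F 1`.
  have step : ∀ k n (v : ι →₀ S), (∀ l, v l ∈ F k ∧ (n + 1 ≤ w l → v l ∈ F (k + 1))) →
      ∀ l, colMap X v l ∈ F k ∧ (n ≤ w l → colMap X v l ∈ F (k + 1)) := by
    intro k n v hv l
    rw [colMap_apply]
    refine ⟨sum_mem fun j _ => ?_, fun hl => sum_mem fun j _ => ?_⟩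
    · have := hFmul (hF0 (X j l)) (hv j).1
      rwa [zero_add] at this
    · by_cases hj : n + 1 ≤ w j
      · have := hFmul (hF0 (X j l)) ((hv j).2 hj)
        rwa [zero_add] at this
      · have := hFmul (hX j l (by omega)) (hv j).1
        rwa [add_comm] at this
  have steps : ∀ n k (v : ι →₀ S), (∀ l, v l ∈ F k ∧ (n ≤ w l → v l ∈ F (k + 1))) →
      ∀ l, (colMap X)^[n] v l ∈ F (k + 1) := by
    intro n
    induction n with
    | zero => exact fun k v hv l => (hv l).2 (Nat.zero_le _)
    | succ n ih =>
      intro k v hv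
      exact ih k _ (step k n v hv)
  have main : ∀ d k, k + d = Q → ∀ v : ι →₀ S, (∀ l, v l ∈ F k) → ∃ n, (colMap X)^[n] v = 0 := by
    intro d
    induction d with
    | zero =>
      intro k hk v hv
      refine ⟨0, Finsupp.ext fun l => hQ _ ?_⟩
      rw [← hk]; exact hv l
    | succ d ih =>
      intro k hk v hv
      obtain ⟨n, hn⟩ := ih (k + 1) (by omega) ((colMap X)^[v.support.sup w + 1] v)
        (steps _ k v fun l => ⟨hv l, fun hl => by
          have : v l = 0 := by
            by_contra h
            have := Finset.le_sup (f := w) (Finsupp.mem_support_iff.mpr h)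
            omega
          rw [this]; exact zero_mem _⟩)
      exact ⟨n + (v.support.sup w + 1), by rw [Function.iterate_add_apply, hn]⟩
  exact main Q 0 (zero_add Q) v fun l => hF0 _

open Classical in
/-- A column-finite matrix with ones on the diagonal, strictly triangular up to a nilpotent ideal
away from the diagonal, has a column-finite inverse. -/
theorem exists_inverse_of_diag_one {M : ι → ι → S} (hM : ∀ j, {l | M l j ≠ 0}.Finite)
    (hF0 : ∀ a, a ∈ F 0) (hFmul : ∀ {i j a b}, a ∈ F i → b ∈ F j → a * b ∈ F (i + j)) {Q : ℕ}
    (hQ : ∀ a ∈ F Q, a = 0) (hd : ∀ l, M l l = 1)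
    (hX : ∀ j l, l ≠ j → w j ≤ w l → M l j ∈ F 1) :
    ∃ N : ι → ι → S, (∀ l, {i | N i l ≠ 0}.Finite) ∧
      (∀ l l', ∑ᶠ i, M l i * N i l' = if l = l' then 1 else 0) ∧
      ∀ i j, ∑ᶠ l, N i l * M l j = if i = j then 1 else 0 := by
  let C : ι → ι →₀ S := fun j => Finsupp.onFinset (hM j).toFinset (fun l => M l j) (by simp)
  -- The matrix is $1-X$. As iterates of $X$ kill every vector, the geometric series in $X$ is a
  -- finite sum on each vector and provides preimages, while a fixed vector of $X$ must vanish.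
  let X : ι → ι →₀ S := fun j => Finsupp.single j 1 - C j
  have hC : ∀ v, colMap C v = v - colMap X v := by
    intro v
    induction v using Finsupp.induction_linear with
    | zero => simp
    | add f g hf hg => rw [map_add, map_add, hf, hg]; abel
    | single j a =>
      ext l
      rw [Finsupp.sub_apply, colMap_single, colMap_single, Finsupp.sub_apply, sub_mul]
      by_cases h : j = l
      · subst h; simp
      · simp [h]
  have hnil := exists_iterate_colMap_eq_zero (F := F) w (X := X) hF0 hFmul hQ (fun j l hjl => by
    by_cases h : l = j
    · subst h
      have : X l l = 0 := by simp [X, C, hd]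
      rw [this]; exact zero_mem _
    · have : X j l = -M l j := by simp [X, C, Ne.symm h]
      rw [this]; exact neg_mem (hX j l h hjl))
  have hinj : Function.Injective (colMap C) := by
    rw [injective_iff_map_eq_zero]
    intro v hv
    rw [hC, sub_eq_zero] at hv
    obtain ⟨n, hn⟩ := hnil v
    have : ∀ n, (colMap X)^[n] v = v := fun n => by
      induction n with
      | zero => rfl
      | succ n ih => rw [Function.iterate_succ_apply, ← hv, ih]
    rw [← this n, hn]
  have hsurj : ∀ v, ∃ u, colMap C u = v := by
    intro v
    obtain ⟨n, hn⟩ := hnil v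
    refine ⟨∑ i ∈ Finset.range n, (colMap X)^[i] v, ?_⟩
    rw [hC, map_sum, ← Finset.sum_sub_distrib]
    have := Finset.sum_range_sub' (fun i => (colMap X)^[i] v) n
    simp only [Function.iterate_succ_apply'] at this
    rw [this, hn, sub_zero]; rfl
  choose N hN using fun l => hsurj (Finsupp.single l 1)
  have hMN : ∀ l l', ∑ᶠ i, M l i * N l' i = if l = l' then 1 else 0 := by
    intro l l'
    have h := DFunLike.congr_fun (hN l') l
    rw [colMap_apply, Finsupp.sum] at h
    rw [finsum_eq_sum_of_support_subset _ (s := (N l').support) fun i hi =>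
      Finset.mem_coe.mpr (Finsupp.mem_support_iff.mpr (right_ne_zero_of_mul hi))]
    refine h.trans ?_
    rw [Finsupp.single_apply]
    simp only [eq_comm]
  refine ⟨fun i l => N l i, fun l => (N l).hasFiniteSupport, hMN, fun i j => ?_⟩
  -- both sides of `N * M = 1` have the same image under the injective map `M`
  have h : (∑ l ∈ (C j).support, (N l).mapRange (· * M l j) (zero_mul _)) = Finsupp.single j 1 := by
    apply hinj
    rw [map_sum]
    simp only [colMap_mulRight, hN]
    ext k
    rw [colMap_single, mul_one, Finsupp.finsetSum_apply]
    simp only [Finsupp.mapRange_apply, Finsupp.single_apply, ite_mul, one_mul, zero_mul]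
    rw [Finset.sum_ite_eq']
    by_cases hk : C j k = 0
    · rw [if_neg (by simpa using hk), hk]
    · rw [if_pos (by simpa using hk)]; rfl
  have h' := DFunLike.congr_fun h i
  rw [Finsupp.finsetSum_apply] at h'
  have hs : (Function.support fun l => N l i * M l j) ⊆ (C j).support := fun l hl =>
    Finset.mem_coe.mpr ((Finsupp.mem_support_iff (f := C j)).mpr (right_ne_zero_of_mul hl))
  rw [finsum_eq_sum_of_support_subset _ hs]
  refine h'.trans ?_
  rw [Finsupp.single_apply]
  simp only [eq_comm]

-- Dividing each row by its diagonal entry reduces to ones on the diagonal, and multiplication by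
-- units does not disturb the filtration condition.
open Classical in
theorem exists_inverse {M : ι → ι → S} (hM : ∀ j, {l | M l j ≠ 0}.Finite)
    (hF0 : ∀ a, a ∈ F 0) (hFmul : ∀ {i j a b}, a ∈ F i → b ∈ F j → a * b ∈ F (i + j)) {Q : ℕ}
    (hQ : ∀ a ∈ F Q, a = 0) (hd : ∀ l, IsUnit (M l l))
    (hX : ∀ j l, l ≠ j → w j ≤ w l → M l j ∈ F 1) :
    ∃ N : ι → ι → S, (∀ l, {i | N i l ≠ 0}.Finite) ∧
      (∀ l l', ∑ᶠ i, M l i * N i l' = if l = l' then 1 else 0) ∧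
      ∀ i j, ∑ᶠ l, N i l * M l j = if i = j then 1 else 0 := by
  choose d hd using hd
  obtain ⟨N, hN, h1, h2⟩ := exists_inverse_of_diag_one (F := F) w
    (M := fun l j => (↑(d l)⁻¹ : S) * M l j)
    (fun j => (hM j).subset fun l hl => right_ne_zero_of_mul hl) hF0 hFmul hQ
    (fun l => by rw [← hd, Units.inv_mul]) (fun j l h h' => by
      have := hFmul (hF0 (↑(d l)⁻¹ : S)) (hX j l h h')
      rwa [zero_add] at this)
  refine ⟨fun i l => N i l * ↑(d l)⁻¹, fun l => (hN l).subset fun i hi => left_ne_zero_of_mul hi,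
    fun l l' => ?_, fun i j => ?_⟩
  · have h : ∀ i, M l i * (N i l' * ↑(d l')⁻¹) =
        d l * ((↑(d l)⁻¹ : S) * M l i * N i l') * ↑(d l')⁻¹ := fun i => by
      simp only [mul_assoc, Units.mul_inv_cancel_left]
    have hf : (Function.support fun i => (↑(d l)⁻¹ : S) * M l i * N i l').Finite :=
      (hN l').subset fun i hi => right_ne_zero_of_mul hi
    simp only [h]
    rw [← finsum_mul', ← mul_finsum', h1]
    · split_ifs with hl
      · subst hl; simp
      · simp
    · exact hf
    · exact hf.subset fun i hi => right_ne_zero_of_mul hi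
  · rw [← h2 i j]
    simp only [mul_assoc]

end Matrix

end SuperAiry

end

/-! ### Linear changes of coordinates. -/

noncomputable section

namespace SuperAiry

variable {m q : ℕ} {A₀ A₁ : Type} {ι κ : Type}

/-! ### Constants -/

/-- Set all coordinates to zero. -/
def evalZero : Fun m q A₀ A₁ →ₐ[ℂ] Params m q :=
  SPoly.lift (ev := Sum.elim SPoly.evenGen 0) (od := Sum.elim SPoly.oddGen 0)
    (by
      rintro (i | i)
      · exact SPoly.isEven_evenGen i
      · exact map_zero _)
    (by
      rintro (i | i)
      · exact SPoly.isOdd_oddGen i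
      · exact (map_zero _).trans neg_zero.symm)

theorem evalZero_const (c : Params m q) : evalZero (const c : Fun m q A₀ A₁) = c := by
  refine DFunLike.congr_fun (SPoly.algHom_ext (φ := evalZero.comp const)
    (ψ := AlgHom.id ℂ _) fun i => ?_) c
  cases i with
  | inl i =>
    change evalZero (SPoly.map _ _ (SPoly.evenGen i)) = _
    rw [SPoly.map_evenGen, evalZero, SPoly.lift_evenGen]; rfl
  | inr i =>
    change evalZero (SPoly.map _ _ (SPoly.oddGen i)) = _
    rw [SPoly.map_oddGen, evalZero, SPoly.lift_oddGen]; rfl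

theorem const_injective : Function.Injective (const : Params m q → Fun m q A₀ A₁) :=
  Function.LeftInverse.injective evalZero_const

theorem mulOp_injective : Function.Injective (mulOp : Fun m q A₀ A₁ → Op m q A₀ A₁) :=
  fun f g h => by simpa [mulOp_apply] using DFunLike.congr_fun h 1

theorem parity_of_hasPar {e : ℕ} {c : Params m q}
    (h : HasPar e (mulOp (const c) : Op m q A₀ A₁)) : SPoly.parity c = (-1 : ℂ) ^ e • c := by
  rw [HasPar, sgn_mulOp, parity_const, ← mulOp_smul, ← map_smul] at h
  exact const_injective (mulOp_injective h)

theorem hasPar_const {e : ℕ} {c : Params m q} (h : SPoly.parity c = (-1 : ℂ) ^ e • c) :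
    HasPar e (mulOp (const c) : Op m q A₀ A₁) := by
  rw [HasPar, sgn_mulOp, parity_const, h, map_smul, mulOp_smul]

/-! ### Operators of degree one -/

theorem ad_eq_neg_br (e : ℕ) (Y D : Op m q A₀ A₁) : ad e Y D = -br e Y ((sgn ^ e) D) := by
  rw [ad_apply, br_apply, sgn_pow_sgn_pow, neg_sub]

theorem ad_mem_Fil {n e : ℕ} {Y D : Op m q A₀ A₁} (hY : Y ∈ Fil m q A₀ A₁ 2) (he : HasPar e Y)
    (hD : D ∈ Fil m q A₀ A₁ (n + 1)) : ad e Y D ∈ Fil m q A₀ A₁ n := by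
  rw [ad_eq_neg_br]
  exact neg_mem (br_mem_Fil hY (sgn_pow_mem_Fil hD e) he (by omega))

theorem psum_partialDeriv (c : A₀ ⊕ A₁ → Params m q) :
    PSum (fun j => mulOp (const (c j)) * partialDeriv j : A₀ ⊕ A₁ → Op m q A₀ A₁)
      (opSum fun j => mulOp (const (c j)) * partialDeriv j) :=
  (pfin_partialDeriv.mul_left fun j => mulOp (const (c j))).psum

theorem ad_psum_partialDeriv (c : A₀ ⊕ A₁ → Params m q) (k : A₀ ⊕ A₁) :
    ad (par k) (mulOp (coord k)) (opSum fun j => mulOp (const (c j)) * partialDeriv j) =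
      (mulOp (const (c k)) : Op m q A₀ A₁) := by
  classical
  refine ((psum_partialDeriv c).ad (par k) (mulOp (coord k))).unique
    ((PSum.ite_eq k fun j => mulOp (const (c j))).congr fun j => ?_)
  rw [ad_mulOp_left, ad_coord_partialDeriv, mul_ite, mul_one, mul_zero]

theorem eq_of_ad_const {D : Op m q A₀ A₁} (hD : D ∈ RLin m q A₀ A₁) {c : A₀ ⊕ A₁ → Params m q}
    (hc : ∀ j, ad (par j) (mulOp (coord j)) D = mulOp (const (c j))) :
    D = opSum (fun j => mulOp (const (c j)) * partialDeriv j) + mulOp (D 1) := by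
  refine RLin.ext hD (add_mem ((psum_partialDeriv c).mem_RLin fun j =>
    mul_mem (mulOp_mem_RLin _) (partialDeriv_mem_RLin j)) (mulOp_mem_RLin _)) ?_ fun j => ?_
  · rw [LinearMap.add_apply, mulOp_apply, mul_one, (psum_partialDeriv c).2 1]
    simp [partialDeriv_one]
  · rw [map_add, ad_psum_partialDeriv, ad_coord_mulOp, add_zero, hc]

/-- If all brackets with coordinates are constants, the operator is a first-order operator with
these constant coefficients plus multiplication by its value at $1$. This spares the brackets with
derivatives, which are hard to reach after a change of coordinates. -/
theorem mem_Fil_two {D : Op m q A₀ A₁} (hD : D ∈ RLin m q A₀ A₁) (h1 : D 1 ∈ degLE 1)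
    (hc : ∀ j, ad (par j) (mulOp (coord j)) D ∈ Fil m q A₀ A₁ 1) : D ∈ Fil m q A₀ A₁ 2 := by
  choose c hc using fun j => mem_Fil_one.mp (hc j)
  rw [eq_of_ad_const hD hc]
  exact add_mem ((psum_partialDeriv c).mem_Fil fun j =>
    const_mul_mem_Fil _ (partialDeriv_mem_Fil j)) (mulOp_mem_Fil h1)

/-! ### Linear changes of coordinates -/

/-- The expression of an operator in the coordinates `Ψ(x_j)`. -/
def conjOp (Ψ : Fun m q A₀ A₁ ≃ₐ[ℂ] Fun m q A₀ A₁) : Op m q A₀ A₁ →ₐ[ℂ] Op m q A₀ A₁ :=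
  AlgHom.ofLinearMap Ψ.symm.toLinearEquiv.conj.toLinearMap
    (LinearMap.ext fun f => Ψ.symm_apply_apply f)
    (fun D E => LinearMap.ext fun f => congrArg (fun g => Ψ.symm (D g))
      (Ψ.apply_symm_apply (E (Ψ f))).symm)

theorem conjOp_apply (Ψ : Fun m q A₀ A₁ ≃ₐ[ℂ] Fun m q A₀ A₁) (D : Op m q A₀ A₁)
    (f : Fun m q A₀ A₁) : conjOp Ψ D f = Ψ.symm (D (Ψ f)) := rfl

/-- An affine change of coordinates over the constants. -/
structure IsAffine (Ψ : Fun m q A₀ A₁ ≃ₐ[ℂ] Fun m q A₀ A₁) : Prop where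
  map_const : ∀ c : Params m q, Ψ (const c) = const c
  map_parity : ∀ f, Ψ (SPoly.parity f) = SPoly.parity (Ψ f)
  map_coord : ∀ j, Ψ (coord j) ∈ degLE 1
  symm_coord : ∀ j, Ψ.symm (coord j) ∈ degLE 1

namespace IsAffine

variable {Ψ : Fun m q A₀ A₁ ≃ₐ[ℂ] Fun m q A₀ A₁}

theorem symm (h : IsAffine Ψ) : IsAffine Ψ.symm where
  map_const c := by rw [AlgEquiv.symm_apply_eq, h.map_const]
  map_parity f := by rw [AlgEquiv.symm_apply_eq, h.map_parity, AlgEquiv.apply_symm_apply]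
  map_coord := h.symm_coord
  symm_coord := h.map_coord

theorem conjOp_conjOp_symm (Ψ : Fun m q A₀ A₁ ≃ₐ[ℂ] Fun m q A₀ A₁) (D : Op m q A₀ A₁) :
    conjOp Ψ (conjOp Ψ.symm D) = D :=
  LinearMap.ext fun f => by simp [conjOp_apply]

theorem conjOp_mulOp (Ψ : Fun m q A₀ A₁ ≃ₐ[ℂ] Fun m q A₀ A₁) (f : Fun m q A₀ A₁) :
    conjOp Ψ (mulOp f) = mulOp (Ψ.symm f) :=
  LinearMap.ext fun g => by simp [conjOp_apply, mulOp_apply]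

theorem sgn_conjOp (h : IsAffine Ψ) (D : Op m q A₀ A₁) : sgn (conjOp Ψ D) = conjOp Ψ (sgn D) :=
  LinearMap.ext fun f => by
    rw [sgn_apply, conjOp_apply, conjOp_apply, sgn_apply, h.map_parity, h.symm.map_parity]

theorem sgn_pow_conjOp (h : IsAffine Ψ) (e : ℕ) (D : Op m q A₀ A₁) :
    (sgn ^ e) (conjOp Ψ D) = conjOp Ψ ((sgn ^ e) D) := by
  induction e with
  | zero => rfl
  | succ e ih => rw [sgn_pow_succ_apply, ih, h.sgn_conjOp, sgn_pow_succ_apply]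

theorem hasPar_conjOp (h : IsAffine Ψ) {e : ℕ} {D : Op m q A₀ A₁} (hD : HasPar e D) :
    HasPar e (conjOp Ψ D) := by
  rw [HasPar, h.sgn_conjOp, hD, map_smul]

theorem ad_conjOp (h : IsAffine Ψ) (e : ℕ) (Y D : Op m q A₀ A₁) :
    ad e (conjOp Ψ Y) (conjOp Ψ D) = conjOp Ψ (ad e Y D) := by
  rw [ad_apply, ad_apply, h.sgn_pow_conjOp, map_sub, map_mul, map_mul]

theorem conjOp_mem_RLin (h : IsAffine Ψ) {D : Op m q A₀ A₁} (hD : D ∈ RLin m q A₀ A₁) :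
    conjOp Ψ D ∈ RLin m q A₀ A₁ := fun f c => by
  rw [conjOp_apply, map_mul, h.map_const, hD, map_mul, h.symm.map_const, conjOp_apply]

theorem conjOp_mem_Fil_one (h : IsAffine Ψ) {D : Op m q A₀ A₁} (hD : D ∈ Fil m q A₀ A₁ 1) :
    conjOp Ψ D ∈ Fil m q A₀ A₁ 1 := by
  obtain ⟨c, rfl⟩ := mem_Fil_one.mp hD
  rw [conjOp_mulOp, h.symm.map_const]
  exact const_mem_Fil c

theorem hasPar_map_coord (h : IsAffine Ψ) (j : A₀ ⊕ A₁) :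
    HasPar (par j) (mulOp (Ψ (coord j)) : Op m q A₀ A₁) := by
  have := h.symm.hasPar_conjOp (hasPar_coord (m := m) (q := q) j)
  rwa [conjOp_mulOp] at this

theorem ad_coord_conjOp (h : IsAffine Ψ) (j : A₀ ⊕ A₁) (D : Op m q A₀ A₁) :
    ad (par j) (mulOp (coord j)) (conjOp Ψ D) =
      conjOp Ψ (ad (par j) (mulOp (Ψ (coord j))) D) := by
  rw [← h.ad_conjOp, conjOp_mulOp, AlgEquiv.symm_apply_apply]

theorem conjOp_partialDeriv_mem_Fil (h : IsAffine Ψ) (j : A₀ ⊕ A₁) :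
    conjOp Ψ (partialDeriv j) ∈ Fil m q A₀ A₁ 2 := by
  refine mem_Fil_two (h.conjOp_mem_RLin (partialDeriv_mem_RLin j)) ?_ fun k => ?_
  · rw [conjOp_apply, map_one, partialDeriv_one, map_zero]
    exact zero_mem _
  · rw [h.ad_coord_conjOp]
    exact h.conjOp_mem_Fil_one (ad_mem_Fil (mulOp_mem_Fil (h.map_coord k)) (h.hasPar_map_coord k)
      (partialDeriv_mem_Fil j))

/-- Brackets of the transformed operator with coordinates and derivatives are transformed brackets
of `D` with operators of degree at most one, and these lower the degree by one. -/
theorem conjOp_mem_Fil (h : IsAffine Ψ) {n : ℕ} {D : Op m q A₀ A₁} (hD : D ∈ Fil m q A₀ A₁ n) :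
    conjOp Ψ D ∈ Fil m q A₀ A₁ n := by
  induction n generalizing D with
  | zero => rw [mem_Fil_zero.mp hD, map_zero]; exact zero_mem _
  | succ n ih =>
    refine mem_Fil_succ.mpr ⟨h.conjOp_mem_RLin (Fil_le_RLin hD), fun j => ⟨?_, ?_⟩⟩
    · rw [h.ad_coord_conjOp]
      exact ih (ad_mem_Fil (mulOp_mem_Fil (h.map_coord j)) (h.hasPar_map_coord j) hD)
    · rw [← conjOp_conjOp_symm Ψ (partialDeriv j), h.ad_conjOp]
      exact ih (ad_mem_Fil (h.symm.conjOp_partialDeriv_mem_Fil j)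
        (h.symm.hasPar_conjOp (hasPar_partialDeriv j)) hD)

end IsAffine

theorem PSum.conjOp {F : ι → Op m q A₀ A₁} {D : Op m q A₀ A₁} (hD : PSum F D)
    (Ψ : Fun m q A₀ A₁ ≃ₐ[ℂ] Fun m q A₀ A₁) :
    PSum (fun i => SuperAiry.conjOp Ψ (F i)) (SuperAiry.conjOp Ψ D) := by
  refine ⟨fun f => (hD.1 (Ψ f)).subset fun i hi h0 => hi ?_, fun f => ?_⟩
  · change Ψ.symm (F i (Ψ f)) = 0
    exact (congrArg Ψ.symm h0).trans (map_zero _)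
  · rw [conjOp_apply, hD.2]
    exact AddMonoidHom.map_finsum Ψ.symm.toAlgHom.toLinearMap.toAddMonoidHom (hD.1 (Ψ f))

/-! ### Changes of coordinates on series -/

section InCoordinates

variable {Ψ : Fun m q A₀ A₁ ≃ₐ[ℂ] Fun m q A₀ A₁}

theorem coeff_inCoordinates (Ψ : Fun m q A₀ A₁ ≃ₐ[ℂ] Fun m q A₀ A₁) (Z : HOp m q A₀ A₁) (n : ℤ) :
    (inCoordinates Ψ Z).coeff n = conjOp Ψ (Z.coeff n) := rfl

theorem inCoordinates_mul (Ψ : Fun m q A₀ A₁ ≃ₐ[ℂ] Fun m q A₀ A₁) (X Y : HOp m q A₀ A₁) :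
    inCoordinates Ψ (X * Y) = inCoordinates Ψ X * inCoordinates Ψ Y :=
  HahnSeries.map_mul (conjOp Ψ).toNonUnitalRingHom

theorem inCoordinates_add (Ψ : Fun m q A₀ A₁ ≃ₐ[ℂ] Fun m q A₀ A₁) (X Y : HOp m q A₀ A₁) :
    inCoordinates Ψ (X + Y) = inCoordinates Ψ X + inCoordinates Ψ Y :=
  hop_ext fun n => by simp only [coeff_inCoordinates, HahnSeries.coeff_add, map_add]

theorem inCoordinates_sub (Ψ : Fun m q A₀ A₁ ≃ₐ[ℂ] Fun m q A₀ A₁) (X Y : HOp m q A₀ A₁) :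
    inCoordinates Ψ (X - Y) = inCoordinates Ψ X - inCoordinates Ψ Y :=
  hop_ext fun n => by simp only [coeff_inCoordinates, HahnSeries.coeff_sub, map_sub]

theorem inCoordinates_smul (Ψ : Fun m q A₀ A₁ ≃ₐ[ℂ] Fun m q A₀ A₁) (a : ℂ) (X : HOp m q A₀ A₁) :
    inCoordinates Ψ (a • X) = a • inCoordinates Ψ X :=
  hop_ext fun n => by simp only [coeff_inCoordinates, HahnSeries.coeff_smul, map_smul]

theorem inCoordinates_hbarPow_mul (Ψ : Fun m q A₀ A₁ ≃ₐ[ℂ] Fun m q A₀ A₁) (k : ℤ)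
    (X : HOp m q A₀ A₁) : inCoordinates Ψ (hbarPow k 1 * X) = hbarPow k 1 * inCoordinates Ψ X :=
  hop_ext fun n => by simp only [coeff_inCoordinates, hbarPow_mul_coeff]

theorem inCoordinates_symm (Ψ : Fun m q A₀ A₁ ≃ₐ[ℂ] Fun m q A₀ A₁) (X : HOp m q A₀ A₁) :
    inCoordinates Ψ (inCoordinates Ψ.symm X) = X :=
  hop_ext fun n => by rw [coeff_inCoordinates, coeff_inCoordinates, IsAffine.conjOp_conjOp_symm]

theorem IsAffine.hParity_inCoordinates (h : IsAffine Ψ) (X : HOp m q A₀ A₁) :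
    hParity (inCoordinates Ψ X) = inCoordinates Ψ (hParity X) :=
  hop_ext fun n => by
    rw [coeff_hParity, coeff_inCoordinates, coeff_inCoordinates, h.sgn_conjOp, coeff_hParity]

theorem IsAffine.superComm_inCoordinates (h : IsAffine Ψ) (X Y : HOp m q A₀ A₁) :
    superComm (inCoordinates Ψ X) (inCoordinates Ψ Y) = inCoordinates Ψ (superComm X Y) := by
  simp only [superComm, evenPart, oddPart, inCoordinates_sub, inCoordinates_mul,
    inCoordinates_smul, inCoordinates_add, h.hParity_inCoordinates]

theorem IsAffine.inCoordinates_mem_rees (h : IsAffine Ψ) {X : HOp m q A₀ A₁}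
    (hX : X ∈ reesWeyl m q A₀ A₁) : inCoordinates Ψ X ∈ reesWeyl m q A₀ A₁ :=
  mem_reesWeyl.mpr ⟨fun n hn => by rw [coeff_inCoordinates, Nonneg.of_rees hX n hn, map_zero],
    fun n => by rw [coeff_inCoordinates]; exact h.conjOp_mem_Fil (rees_coeff hX n)⟩

theorem IsSum.inCoordinates {F : ι → HOp m q A₀ A₁} {Z : HOp m q A₀ A₁} (h : IsSum F Z)
    (Ψ : Fun m q A₀ A₁ ≃ₐ[ℂ] Fun m q A₀ A₁) :
    IsSum (fun i => SuperAiry.inCoordinates Ψ (F i)) (SuperAiry.inCoordinates Ψ Z) := by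
  rw [isSum_iff] at *
  exact fun n => (h n).conjOp Ψ

theorem HFin.inCoordinates {F : ι → HOp m q A₀ A₁} (h : HFin F)
    (Ψ : Fun m q A₀ A₁ ≃ₐ[ℂ] Fun m q A₀ A₁) : HFin fun i => SuperAiry.inCoordinates Ψ (F i) :=
  fun n => ((h n).psum.conjOp Ψ).1

theorem IsAffine.inCoordinates_mem_generatedIdeal (h : IsAffine Ψ) {K : ι → HOp m q A₀ A₁}
    {X : HOp m q A₀ A₁} (hX : X ∈ generatedIdeal K) :
    inCoordinates Ψ X ∈ generatedIdeal fun i => inCoordinates Ψ (K i) := by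
  obtain ⟨c, hc, hX⟩ := hX
  exact ⟨_, fun i => h.inCoordinates_mem_rees (hc i),
    (hX.inCoordinates Ψ).congr fun i => inCoordinates_mul _ _ _⟩

theorem IsAffine.image_generatedIdeal (h : IsAffine Ψ) (K : ι → HOp m q A₀ A₁) :
    inCoordinates Ψ '' generatedIdeal K = generatedIdeal fun i => inCoordinates Ψ (K i) := by
  refine Set.Subset.antisymm ?_ fun X hX => ?_
  · rintro _ ⟨X, hX, rfl⟩
    exact h.inCoordinates_mem_generatedIdeal hX
  · have := h.symm.inCoordinates_mem_generatedIdeal hX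
    have h2 : (fun i => inCoordinates Ψ.symm (inCoordinates Ψ (K i))) = K :=
      funext fun i => inCoordinates_symm Ψ.symm (K i)
    rw [h2] at this
    exact ⟨_, this, inCoordinates_symm _ _⟩

end InCoordinates

end SuperAiry

end

/-! ### Frames of generators and normalisation of their linear parts. -/

noncomputable section

namespace SuperAiry

variable {m q : ℕ} {A₀ A₁ : Type} {ι κ : Type}

/-! ### Constant coefficients -/

/-- A constant, as a series of operators. -/
def cst (c : Params m q) : HOp m q A₀ A₁ := hbarPow 0 (mulOp (const c))

theorem coeff_cst_mul (c : Params m q) (Z : HOp m q A₀ A₁) (n : ℤ) :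
    (cst c * Z).coeff n = mulOp (const c) * Z.coeff n := by
  rw [cst, hbarPow, HahnSeries.coeff_single_mul, sub_zero]

theorem cst_mem_rees (c : Params m q) : (cst c : HOp m q A₀ A₁) ∈ reesWeyl m q A₀ A₁ :=
  hbarPow_mem_rees (k := 0) (n := 0) le_rfl (const_mem_Fil c)

theorem cst_zero : (cst 0 : HOp m q A₀ A₁) = 0 := by
  rw [cst, map_zero, mulOp_zero, hbarPow, HahnSeries.single_eq_zero]

theorem cst_one_mul (Z : HOp m q A₀ A₁) : cst 1 * Z = Z :=
  hop_ext fun n => by rw [coeff_cst_mul, map_one, mulOp_one, one_mul]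

theorem cst_mul_cst_mul (a b : Params m q) (Z : HOp m q A₀ A₁) :
    cst a * (cst b * Z) = cst (a * b) * Z :=
  hop_ext fun n => by
    rw [coeff_cst_mul, coeff_cst_mul, coeff_cst_mul, map_mul, mulOp_mul, mul_assoc]

theorem psum_const_mul {f : ι → Params m q} (hf : (Function.support f).Finite)
    (D : Op m q A₀ A₁) :
    PSum (fun i => mulOp (const (f i)) * D) (mulOp (const (∑ᶠ i, f i)) * D) := by
  refine PSum.mul_right ⟨fun g => hf.subset fun i hi h0 => hi ?_, fun g => ?_⟩ D
  · simp only [h0, map_zero, mulOp_zero, LinearMap.zero_apply]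
  · let φ : Params m q →+ Fun m q A₀ A₁ :=
      (AddMonoidHom.mulRight g).comp (const : Params m q →ₐ[ℂ] Fun m q A₀ A₁).toRingHom.toAddMonoidHom
    exact φ.map_finsum hf

theorem isSum_cst_mul {f : ι → Params m q} (hf : (Function.support f).Finite)
    (Z : HOp m q A₀ A₁) : IsSum (fun i => cst (f i) * Z) (cst (∑ᶠ i, f i) * Z) :=
  isSum_iff.mpr fun n => by
    simp only [coeff_cst_mul]
    exact psum_const_mul hf _

theorem IsSum.swap {F : ι → κ → HOp m q A₀ A₁} {Z : HOp m q A₀ A₁}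
    (h : IsSum (fun p : ι × κ => F p.1 p.2) Z) : IsSum (fun p : κ × ι => F p.2 p.1) Z := by
  rw [isSum_iff] at *
  exact fun n => (h n).comp_equiv (Equiv.prodComm κ ι)

theorem isSum_ite [DecidableEq ι] (j : ι) (F : ι → HOp m q A₀ A₁) :
    IsSum (fun i => cst (if j = i then 1 else 0) * F i) (F j) :=
  isSum_iff.mpr fun n => (PSum.ite_eq j fun i => (F i).coeff n).congr fun i => by
    by_cases h : i = j
    · subst h; simp [cst_one_mul]
    · simp [h, Ne.symm h, cst_zero]

theorem fiberFin_of_finite {π : κ → ι} {C : κ → HOp m q A₀ A₁}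
    (h : ∀ l, {k | π k = l ∧ C k ≠ 0}.Finite) : FiberFin π C := fun l n f =>
  (h l).subset fun k hk => by
    by_cases hl : π k = l
    · refine ⟨hl, fun h0 => hk ?_⟩
      simp [hl, h0]
    · simp [hl] at hk

/-! ### Linear parts of families of generators -/

/-- A family of homogeneous generators without constant terms, whose linear parts have symbols
`M`. -/
structure IsFrame (Ahat : Set (A₀ ⊕ A₁)) (K : {j // j ∉ Ahat} → HOp m q A₀ A₁)
    (M : {j // j ∉ Ahat} → A₀ ⊕ A₁ → Params m q) : Prop where
  rees : ∀ i, K i ∈ reesWeyl m q A₀ A₁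
  hfin : HFin K
  hpar : ∀ i, HPar (par i.1) (K i)
  coeff_zero : ∀ i, (K i).coeff 0 = 0
  symbol : ∀ i j, ad (par j) (mulOp (coord j)) ((K i).coeff 1) = mulOp (const (M i j))

namespace IsFrame

variable {Ahat : Set (A₀ ⊕ A₁)} {K : {j // j ∉ Ahat} → HOp m q A₀ A₁}
  {M : {j // j ∉ Ahat} → A₀ ⊕ A₁ → Params m q}

theorem finite_column (h : IsFrame Ahat K M) (j : A₀ ⊕ A₁) : {i | M i j ≠ 0}.Finite := by
  refine ((h.hfin 1).ad (par j) (mulOp (coord j)) 1).subset fun i hi h0 => hi ?_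
  simp only [h.symbol, mulOp_apply, mul_one] at h0
  exact const_injective (h0.trans (map_zero _).symm)

theorem parity_symbol (h : IsFrame Ahat K M) (i : {j // j ∉ Ahat}) (j : A₀ ⊕ A₁) :
    SPoly.parity (M i j) = (-1 : ℂ) ^ (par i.1 + par j) • M i j := by
  have := HasPar.ad (k := par j) (hasPar_coord j) ((h.hpar i).coeff 1)
  rw [h.symbol, add_comm] at this
  exact parity_of_hasPar this

theorem parity_finsum {f : ι → Params m q} (hf : (Function.support f).Finite) :
    SPoly.parity (∑ᶠ i, f i) = ∑ᶠ i, SPoly.parity (f i) :=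
  AddMonoidHom.map_finsum (SPoly.parity : Params m q →ₗ[ℂ] Params m q).toAddMonoidHom hf

-- Twisting an inverse by parity gives another two-sided inverse, because the entries of `M` have
-- definite parities. The average of the two is an inverse with homogeneous entries, which keeps the
-- new generators homogeneous.
open Classical in
theorem exists_homogeneous_inverse (h : IsFrame Ahat K M)
    {N : {j // j ∉ Ahat} → {j // j ∉ Ahat} → Params m q} (hN : ∀ l, {i | N i l ≠ 0}.Finite)
    (hMN : ∀ l l', ∑ᶠ i : {j // j ∉ Ahat}, M l i * N i l' = if l = l' then 1 else 0)
    (hNM : ∀ i j : {j // j ∉ Ahat}, ∑ᶠ l, N i l * M l j = if i = j then 1 else 0) :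
    ∃ N : {j // j ∉ Ahat} → {j // j ∉ Ahat} → Params m q, (∀ l, {i | N i l ≠ 0}.Finite) ∧
    (∀ l l', ∑ᶠ i : {j // j ∉ Ahat}, M l i * N i l' = if l = l' then 1 else 0) ∧
    (∀ i j : {j // j ∉ Ahat}, ∑ᶠ l, N i l * M l j = if i = j then 1 else 0) ∧
    ∀ i l, SPoly.parity (N i l) = (-1 : ℂ) ^ (par i.1 + par l.1) • N i l := by
  let N' : {j // j ∉ Ahat} → {j // j ∉ Ahat} → Params m q := fun i l =>
    (-1 : ℂ) ^ (par i.1 + par l.1) • SPoly.parity (N i l)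
  have hN' : ∀ l, {i | N' i l ≠ 0}.Finite := fun l => (hN l).subset fun i hi h0 => hi (by
    simp [N', h0])
  have hsq : ∀ n : ℕ, (-1 : ℂ) ^ (n + n) = 1 := fun n => by
    rw [pow_add, SPoly.neg_one_pow_mul_self]
  have hM : ∀ i j, M i j = (-1 : ℂ) ^ (par i.1 + par j) • SPoly.parity (M i j) := fun i j => by
    rw [h.parity_symbol, smul_smul, SPoly.neg_one_pow_mul_self, one_smul]
  have hfin₁ : ∀ l l', (Function.support fun i : {j // j ∉ Ahat} => M l i * N i l').Finite :=
    fun l l' => (hN l').subset fun i hi => right_ne_zero_of_mul hi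
  have hfin₁' : ∀ l l', (Function.support fun i : {j // j ∉ Ahat} => M l i * N' i l').Finite :=
    fun l l' => (hN' l').subset fun i hi => right_ne_zero_of_mul hi
  have hfin₂ : ∀ i j : {j // j ∉ Ahat}, (Function.support fun l => N i l * M l j).Finite :=
    fun i j => (h.finite_column j).subset fun i hi => right_ne_zero_of_mul hi
  have hfin₂' : ∀ i j : {j // j ∉ Ahat}, (Function.support fun l => N' i l * M l j).Finite :=
    fun i j => (h.finite_column j).subset fun i hi => right_ne_zero_of_mul hi
  have hδ : ∀ l l' : {j // j ∉ Ahat}, (-1 : ℂ) ^ (par l.1 + par l'.1) •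
      SPoly.parity (if l = l' then 1 else 0 : Params m q) = if l = l' then 1 else 0 := by
    intro l l'
    by_cases hl : l = l'
    · subst hl; rw [if_pos rfl, hsq, one_smul, SPoly.parity_one]
    · rw [if_neg hl, map_zero, smul_zero]
  have hMN' : ∀ l l', ∑ᶠ i : {j // j ∉ Ahat}, M l i * N' i l' = if l = l' then 1 else 0 := by
    intro l l'
    rw [← hδ, ← hMN, parity_finsum (hfin₁ l l'), smul_finsum]
    refine finsum_congr fun i => ?_
    rw [SPoly.parity_mul]
    conv_lhs => rw [hM]
    rw [smul_mul_smul_comm, ← pow_add, show par l.1 + par i.1 + (par i.1 + par l'.1) =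
      par l.1 + par l'.1 + (par i.1 + par i.1) by ring, pow_add, hsq, mul_one]
  have hNM' : ∀ i j : {j // j ∉ Ahat}, ∑ᶠ l, N' i l * M l j = if i = j then 1 else 0 := by
    intro i j
    rw [← hδ, ← hNM, parity_finsum (hfin₂ i j), smul_finsum]
    refine finsum_congr fun l => ?_
    rw [SPoly.parity_mul]
    conv_lhs => rw [hM]
    rw [smul_mul_smul_comm, ← pow_add, show par i.1 + par l.1 + (par l.1 + par j.1) =
      par i.1 + par j.1 + (par l.1 + par l.1) by ring, pow_add, hsq, mul_one]
  have hhalf : ∀ x : Params m q, (1 / 2 : ℂ) • (x + x) = x := fun x => by module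
  refine ⟨fun i l => (1 / 2 : ℂ) • (N i l + N' i l), fun l => ((hN l).union (hN' l)).subset
    fun i hi => ?_, fun l l' => ?_, fun i j => ?_, fun i l => ?_⟩
  · by_contra hc
    simp only [Set.mem_union, Set.mem_ofPred_eq, not_or, not_not] at hc
    exact hi (by simp only [hc.1, hc.2, add_zero, smul_zero])
  · simp only [mul_smul_comm, mul_add]
    rw [← smul_finsum, finsum_add_distrib (hfin₁ l l') (hfin₁' l l'), hMN, hMN', hhalf]
  · simp only [smul_mul_assoc, add_mul]
    rw [← smul_finsum, finsum_add_distrib (hfin₂ i j) (hfin₂' i j), hNM, hNM', hhalf]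
  · simp only [N', map_smul, map_add, SPoly.parity_parity]
    rw [smul_comm ((-1 : ℂ) ^ _), smul_add ((-1 : ℂ) ^ _), smul_smul, SPoly.neg_one_pow_mul_self,
      one_smul, add_comm]

open Classical in
/-- Multiplying a family of generators by the inverse of the matrix of its symbols, the symbols
become the identity matrix. -/
theorem exists_reduced (h : IsFrame Ahat K M)
    {N : {j // j ∉ Ahat} → {j // j ∉ Ahat} → Params m q} (hN : ∀ l, {i | N i l ≠ 0}.Finite)
    (hMN : ∀ l l', ∑ᶠ i : {j // j ∉ Ahat}, M l i * N i l' = if l = l' then 1 else 0)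
    (hNM : ∀ i j : {j // j ∉ Ahat}, ∑ᶠ l, N i l * M l j = if i = j then 1 else 0) :
    ∃ H C, IsFrame Ahat H C ∧
      (∀ i j : {j // j ∉ Ahat}, C i j = if i = j then (1 : Params m q) else 0) ∧
      generatedIdeal H = generatedIdeal K := by
  obtain ⟨N, hN, hMN, hNM, hNp⟩ := h.exists_homogeneous_inverse hN hMN hNM
  have hcK : ∀ c i, cst c * K i ∈ reesWeyl m q A₀ A₁ := fun c i =>
    mul_mem_rees (cst_mem_rees c) (h.rees i)
  choose H hHr hH using fun i => HFin.exists_isSum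
    (h.hfin.mul_left (c := fun l => cst (N i l)) (fun l => .of_rees (cst_mem_rees _))
      fun l => .of_rees (h.rees l)) fun l => hcK _ l
  have hf : FiberFin (fun x : {j // j ∉ Ahat} × {j // j ∉ Ahat} => x.2)
      (fun x => (cst (N x.1 x.2) : HOp m q A₀ A₁)) := fiberFin_of_finite fun l =>
    ((hN l).image fun i => (i, l)).subset fun x hx =>
      ⟨x.1, fun h0 => hx.2 (by rw [← hx.1] at h0; rw [h0, cst_zero]), Prod.ext rfl hx.1.symm⟩
  have hf2 := hf.hfin (fun x => .of_rees (cst_mem_rees _)) h.hfin fun i => .of_rees (h.rees i)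
  have hHf : HFin H := by
    obtain ⟨Z, -, hZ⟩ := hf2.exists_isSum fun x => hcK _ _
    exact (IsSum.curry (F := fun i l => cst (N i l) * K l) hZ hH).hfin
  have hcoeff : ∀ i n, PSum (fun l => mulOp (const (N i l)) * (K l).coeff n) ((H i).coeff n) :=
    fun i n => (isSum_iff.mp (hH i) n).congr fun l => coeff_cst_mul _ _ _
  have hHp : ∀ i, HPar (par i.1) (H i) := fun i => .of_coeff fun n => by
    refine ((hcoeff i n).sgn).unique (((hcoeff i n).smul _).congr fun l => ?_)
    rw [map_mul, hasPar_const (hNp i l), (h.hpar l).coeff n, smul_mul_smul_comm, ← pow_add,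
      add_assoc, pow_add, pow_add _ (par l.1), SPoly.neg_one_pow_mul_self, mul_one]
  refine ⟨H, fun i j => ∑ᶠ l, N i l * M l j, ⟨hHr, hHf, hHp, fun i => ?_, fun i j => ?_⟩, hNM, ?_⟩
  · exact (hcoeff i 0).unique (PSum.zero.congr fun l => by rw [h.coeff_zero, mul_zero])
  · have h1 : (Function.support fun l => N i l * M l j).Finite :=
      (h.finite_column j).subset fun i hi => right_ne_zero_of_mul hi
    have h2 := psum_const_mul (A₀ := A₀) (A₁ := A₁) h1 1
    rw [mul_one] at h2
    refine ((hcoeff i 1).ad (par j) (mulOp (coord j))).unique (h2.congr fun l => ?_)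
    rw [ad_mulOp_left, h.symbol, mul_one, map_mul, mulOp_mul]
  · refine Set.Subset.antisymm (generatedIdeal_subset h.rees h.hfin (π := fun _ l => l)
      (fun i l => cst_mem_rees (N i l)) hf hH)
      (generatedIdeal_subset hHr hHf (π := fun _ i => i) (fun l i => cst_mem_rees (M l i)) ?_ ?_)
    · exact fiberFin_of_finite fun i =>
        ((h.finite_column i).image fun l => (l, i)).subset fun x hx =>
          ⟨x.1, fun h0 => hx.2 (by rw [← hx.1] at h0; rw [h0, cst_zero]), Prod.ext rfl hx.1.symm⟩
    · intro l
      -- The old generator is recovered from the new ones by summing the same double family in both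
      -- orders: one order gives the combination of the new generators, the other collapses to `K l`
      -- because `M` times `N` is the identity.
      have h1 : HFin fun x : {j // j ∉ Ahat} × {j // j ∉ Ahat} =>
          cst (M l x.1) * (cst (N x.1 x.2) * K x.2) :=
        hf2.mul_left (fun x => .of_rees (cst_mem_rees _)) fun x => .of_rees (hcK _ _)
      obtain ⟨Z, -, hZ⟩ := h1.exists_isSum fun x => mul_mem_rees (cst_mem_rees _) (hcK _ _)
      have h2 : IsSum (fun i : {j // j ∉ Ahat} => cst (M l i) * H i) Z :=
        IsSum.curry (F := fun (i : {j // j ∉ Ahat}) l' => cst (M l i) * (cst (N i l') * K l')) hZ fun i =>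
          (hH i).mul_left (.of_rees (cst_mem_rees _)) (fun l => .of_rees (hcK _ l))
            (.of_rees (hHr i))
      have h3 : IsSum (fun x : {j // j ∉ Ahat} × {j // j ∉ Ahat} =>
          cst (M l x.2) * (cst (N x.2 x.1) * K x.1)) Z :=
        IsSum.swap (F := fun (i : {j // j ∉ Ahat}) l' => cst (M l i) * (cst (N i l') * K l')) hZ
      have h4 : ∀ l', IsSum (fun i : {j // j ∉ Ahat} => cst (M l i) * (cst (N i l') * K l'))
          (cst (if l = l' then 1 else 0) * K l') := fun l' => by
        rw [← hMN]
        simp only [cst_mul_cst_mul]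
        exact isSum_cst_mul ((hN l').subset fun i hi => right_ne_zero_of_mul hi) _
      have h5 := IsSum.curry (F := fun l' (i : {j // j ∉ Ahat}) =>
        cst (M l i) * (cst (N i l') * K l'))
        (E := fun l' => cst (if l = l' then 1 else 0) * K l') h3 h4
      rw [(isSum_ite l K).unique h5]
      exact h2

end IsFrame

end SuperAiry

end

/-! ### Shears and the general criterion for partial Airy structures. -/

noncomputable section

namespace SuperAiry

variable {m q : ℕ} {A₀ A₁ : Type} {ι κ : Type}

theorem fun_algHom_ext {S : Type} [Ring S] [Algebra ℂ S] {φ ψ : Fun m q A₀ A₁ →ₐ[ℂ] S}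
    (hc : ∀ c : Params m q, φ (const c) = ψ (const c)) (hx : ∀ j, φ (coord j) = ψ (coord j)) :
    φ = ψ := by
  refine SPoly.algHom_ext fun i => ?_
  rcases i with (i | i) | (i | i)
  · have := hc (SPoly.evenGen i)
    rwa [const, SPoly.map_evenGen] at this
  · exact hx (.inl i)
  · have := hc (SPoly.oddGen i)
    rwa [const, SPoly.map_oddGen] at this
  · exact hx (.inr i)

/-! ### Shears -/

section Shear

variable (Ahat : Set (A₀ ⊕ A₁)) (C : {j // j ∉ Ahat} → A₀ ⊕ A₁ → Params m q)

open Classical in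
/-- The image of a coordinate under the shear with coefficients `s C`. -/
def shearFun (s : ℂ) (j : A₀ ⊕ A₁) : Fun m q A₀ A₁ :=
  if j ∈ Ahat then coord j + s • ∑ᶠ i : {j // j ∉ Ahat}, coord i.1 * const (C i j) else coord j

variable {Ahat C}

/-- Finitely many coefficients, which have the appropriate parity. -/
structure IsShearMatrix (Ahat : Set (A₀ ⊕ A₁)) (C : {j // j ∉ Ahat} → A₀ ⊕ A₁ → Params m q) :
    Prop where
  finite : ∀ j, {i | C i j ≠ 0}.Finite
  parity : ∀ i j, SPoly.parity (C i j) = (-1 : ℂ) ^ (par i.1 + par j) • C i j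

namespace IsShearMatrix

theorem support_finite (h : IsShearMatrix Ahat C) (j : A₀ ⊕ A₁) :
    (Function.support fun i : {j // j ∉ Ahat} => (coord i.1 * const (C i j) : Fun m q A₀ A₁)).Finite :=
  (h.finite j).subset fun i hi h0 => hi (by simp only [h0, map_zero, mul_zero])

theorem parity_term (h : IsShearMatrix Ahat C) (i : {j // j ∉ Ahat}) (j : A₀ ⊕ A₁) :
    SPoly.parity (coord i.1 * const (C i j) : Fun m q A₀ A₁) =
      (-1 : ℂ) ^ par j • (coord i.1 * const (C i j)) := by
  rw [SPoly.parity_mul, parity_coord, parity_const, h.parity, map_smul, smul_mul_smul_comm,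
    pow_add, ← mul_assoc, SPoly.neg_one_pow_mul_self, one_mul]

theorem parity_shearFun (h : IsShearMatrix Ahat C) (s : ℂ) (j : A₀ ⊕ A₁) :
    SPoly.parity (shearFun Ahat C s j) = (-1 : ℂ) ^ par j • shearFun Ahat C s j := by
  rw [shearFun]
  split_ifs with hj
  · have h1 := AddMonoidHom.map_finsum
      (SPoly.parity : Fun m q A₀ A₁ →ₗ[ℂ] Fun m q A₀ A₁).toAddMonoidHom (h.support_finite j)
    have h2 : SPoly.parity (∑ᶠ i : {j // j ∉ Ahat}, (coord i.1 * const (C i j) : Fun m q A₀ A₁)) =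
        (-1 : ℂ) ^ par j • ∑ᶠ i : {j // j ∉ Ahat}, coord i.1 * const (C i j) := by
      rw [smul_finsum]
      exact h1.trans (finsum_congr fun i => h.parity_term i j)
    rw [map_add, map_smul, parity_coord, h2, smul_add, smul_comm s]
  · exact parity_coord j

/-- The shear, as an endomorphism. -/
def hom (h : IsShearMatrix Ahat C) (s : ℂ) : Fun m q A₀ A₁ →ₐ[ℂ] Fun m q A₀ A₁ :=
  SPoly.lift (ev := Sum.elim (fun i => SPoly.evenGen (.inl i)) fun a => shearFun Ahat C s (.inl a))
    (od := Sum.elim (fun i => SPoly.oddGen (.inl i)) fun a => shearFun Ahat C s (.inr a))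
    (by
      rintro (i | i)
      · exact SPoly.isEven_evenGen _
      · have := h.parity_shearFun s (.inl i)
        rwa [par, pow_zero, one_smul] at this)
    (by
      rintro (i | i)
      · exact SPoly.isOdd_oddGen _
      · have := h.parity_shearFun s (.inr i)
        rwa [par, pow_one, neg_smul, one_smul] at this)

theorem hom_const (h : IsShearMatrix Ahat C) (s : ℂ) (c : Params m q) :
    h.hom s (const c) = const c := by
  refine DFunLike.congr_fun (SPoly.algHom_ext (φ := (h.hom s).comp const) (ψ := const)
    fun i => ?_) c
  cases i with
  | inl i =>
    change h.hom s (SPoly.map _ _ (SPoly.evenGen i)) = SPoly.map _ _ (SPoly.evenGen i)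
    rw [SPoly.map_evenGen, hom, SPoly.lift_evenGen]; rfl
  | inr i =>
    change h.hom s (SPoly.map _ _ (SPoly.oddGen i)) = SPoly.map _ _ (SPoly.oddGen i)
    rw [SPoly.map_oddGen, hom, SPoly.lift_oddGen]; rfl

theorem hom_coord (h : IsShearMatrix Ahat C) (s : ℂ) (j : A₀ ⊕ A₁) :
    h.hom s (coord j) = shearFun Ahat C s j := by
  cases j with
  | inl i => exact SPoly.lift_evenGen _ _ _
  | inr i => exact SPoly.lift_oddGen _ _ _

/-- The terms added to the coordinates in `Ahat` involve only coordinates that a shear fixes, so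
coefficients of composed shears add. -/
theorem hom_comp (h : IsShearMatrix Ahat C) {s t : ℂ} (hst : s + t = 0) :
    (h.hom s).comp (h.hom t) = AlgHom.id ℂ _ := by
  refine fun_algHom_ext (fun c => ?_) fun j => ?_
  · rw [AlgHom.comp_apply, h.hom_const, h.hom_const]; rfl
  · rw [AlgHom.comp_apply, h.hom_coord, AlgHom.id_apply, shearFun]
    split_ifs with hj
    · have h1 := AddMonoidHom.map_finsum (h.hom s).toLinearMap.toAddMonoidHom (h.support_finite j)
      have h2 : h.hom s (∑ᶠ i : {j // j ∉ Ahat}, (coord i.1 * const (C i j) : Fun m q A₀ A₁)) =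
          ∑ᶠ i : {j // j ∉ Ahat}, coord i.1 * const (C i j) := by
        refine h1.trans (finsum_congr fun i => ?_)
        change h.hom s (coord i.1 * const (C i j)) = _
        rw [map_mul, h.hom_const, h.hom_coord, shearFun, if_neg i.2]
      rw [map_add, map_smul, h2, h.hom_coord, shearFun, if_pos hj, add_assoc, ← add_smul, hst,
        zero_smul, add_zero]
    · rw [h.hom_coord, shearFun, if_neg hj]

/-- The shear. -/
def equiv (h : IsShearMatrix Ahat C) : Fun m q A₀ A₁ ≃ₐ[ℂ] Fun m q A₀ A₁ :=
  AlgEquiv.ofAlgHom (h.hom (-1)) (h.hom 1) (h.hom_comp (by norm_num)) (h.hom_comp (by norm_num))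

theorem equiv_coord (h : IsShearMatrix Ahat C) (j : A₀ ⊕ A₁) :
    h.equiv (coord j) = shearFun Ahat C (-1) j := h.hom_coord _ j

theorem shearFun_mem_degLE (s : ℂ) (j : A₀ ⊕ A₁) : shearFun Ahat C s j ∈ degLE 1 := by
  have hx : ∀ k : A₀ ⊕ A₁, ∀ c : Params m q,
      (coord k * const c : Fun m q A₀ A₁) ∈ degLE (m := m) (q := q) (A₀ := A₀) (A₁ := A₁) 1 :=
    fun k c => coord_mul_mem_degLE k (const_mem_degLE c 0)
  have hx' : ∀ k : A₀ ⊕ A₁,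
      (coord k : Fun m q A₀ A₁) ∈ degLE (m := m) (q := q) (A₀ := A₀) (A₁ := A₁) 1 := fun k => by
    have := hx k 1
    rwa [map_one, mul_one] at this
  rw [shearFun]
  split_ifs
  · refine add_mem (hx' j) (Submodule.smul_mem _ _ ?_)
    exact finsum_induction (fun f => f ∈ degLE (m := m) (q := q) (A₀ := A₀) (A₁ := A₁) 1)
      (zero_mem _) (fun _ _ => add_mem) fun i => hx _ _
  · exact hx' j

theorem equiv_parity (h : IsShearMatrix Ahat C) (f : Fun m q A₀ A₁) :
    h.equiv (SPoly.parity f) = SPoly.parity (h.equiv f) := by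
  have : (h.hom (-1)).comp SPoly.parityHom = SPoly.parityHom.comp (h.hom (-1)) := by
    refine fun_algHom_ext (fun c => ?_) fun j => ?_
    · change h.hom (-1) (SPoly.parity _) = SPoly.parity (h.hom (-1) _)
      rw [parity_const, h.hom_const, h.hom_const, parity_const]
    · change h.hom (-1) (SPoly.parity _) = SPoly.parity (h.hom (-1) _)
      rw [parity_coord, map_smul, h.hom_coord, h.parity_shearFun]
  exact DFunLike.congr_fun this f

theorem isAffine (h : IsShearMatrix Ahat C) : IsAffine h.equiv where
  map_const c := h.hom_const _ c
  map_parity := h.equiv_parity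
  map_coord j := by rw [h.equiv_coord]; exact shearFun_mem_degLE _ j
  symm_coord j := (h.hom_coord 1 j).symm ▸ shearFun_mem_degLE _ j

theorem isShear (h : IsShearMatrix Ahat C) : IsShear Ahat h.equiv where
  map_const c := h.hom_const _ c
  map_parity := h.equiv_parity
  map_coord j hj := by rw [h.equiv_coord, shearFun, if_neg hj]
  map_coord_hat j hj := by
    rw [h.equiv_coord, shearFun, if_pos hj, add_sub_cancel_left]
    refine Submodule.smul_mem _ _ (finsum_induction (fun f => f ∈ Submodule.span ℂ _)
      (zero_mem _) (fun _ _ => add_mem) fun i => ?_)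
    exact Submodule.subset_span ⟨SPoly.parity^[par i.1] (C i j), i.1, i.2, coord_mul_const _ _⟩

theorem equiv_eq_refl (h : IsShearMatrix Ahat C) (h0 : ∀ i, ∀ j ∈ Ahat, C i j = 0) :
    h.equiv = AlgEquiv.refl := by
  have : h.hom (-1) = AlgHom.id ℂ _ := by
    refine fun_algHom_ext (fun c => h.hom_const _ c) fun j => ?_
    rw [h.hom_coord, shearFun, AlgHom.id_apply]
    split_ifs with hj
    · simp [h0 _ j hj]
    · rfl
  exact AlgEquiv.ext fun f => DFunLike.congr_fun this f

end IsShearMatrix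

end Shear

theorem rees_coeff_one {Z : HOp m q A₀ A₁} (h : Z ∈ reesWeyl m q A₀ A₁) :
    Z.coeff 1 ∈ Fil m q A₀ A₁ 2 := rees_coeff h 1

theorem coeff_mul_one {X Y : HOp m q A₀ A₁} (hX : Nonneg X) (hY : Nonneg Y) (hY0 : Y.coeff 0 = 0) :
    (X * Y).coeff 1 = X.coeff 0 * Y.coeff 1 := by
  have := coeff_mul_nat hX hY 1
  rw [Finset.Nat.antidiagonal_succ] at this
  simpa [hY0] using this

/-- The parity of `c` is such that the product with the coordinate `i` has the parity of `j`; the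
constant can then be moved to the right through `D` at the cost of exactly the matching sign. -/
theorem ad_coord_mul_const {i j : A₀ ⊕ A₁} {c : Params m q}
    (hc : SPoly.parity c = (-1 : ℂ) ^ (par i + par j) • c) {D : Op m q A₀ A₁}
    (hD : D ∈ RLin m q A₀ A₁) :
    ad (par j) (mulOp (coord i * const c)) D =
      ad (par i) (mulOp (coord i)) D * mulOp (const c) := by
  have h := br_const (hasPar_const hc) (sgn_pow_mem_RLin hD (par j))
  have h2 : (sgn ^ (par i + par j)) ((sgn ^ par j) D) = (sgn ^ par i) D := by
    rw [pow_add, AlgHom.mul_apply, sgn_pow_sgn_pow]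
  rw [br_apply, sub_eq_zero, h2] at h
  rw [ad_apply, ad_apply, mulOp_mul, sub_mul, mul_assoc, mul_assoc, mul_assoc, h]

theorem ad_mulOp_add (e : ℕ) (f g : Fun m q A₀ A₁) (D : Op m q A₀ A₁) :
    ad e (mulOp (f + g)) D = ad e (mulOp f) D + ad e (mulOp g) D := by
  simp only [ad_apply, mulOp_add, mul_add, add_mul]; abel

theorem ad_mulOp_smul (e : ℕ) (a : ℂ) (f : Fun m q A₀ A₁) (D : Op m q A₀ A₁) :
    ad e (mulOp (a • f)) D = a • ad e (mulOp f) D := by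
  simp only [ad_apply, mulOp_smul, smul_sub, smul_mul_assoc, mul_smul_comm]

namespace IsFrame

variable {Ahat : Set (A₀ ⊕ A₁)} {H K : {j // j ∉ Ahat} → HOp m q A₀ A₁}
  {C M : {j // j ∉ Ahat} → A₀ ⊕ A₁ → Params m q}

theorem isShearMatrix (h : IsFrame Ahat H C) : IsShearMatrix Ahat C :=
  ⟨h.finite_column, h.parity_symbol⟩

-- The factor `-1` is chosen so that a sheared coordinate in `Ahat` has bracket $C_{ij}-C_{ij}=0$
-- with the linear part of `H i`: in the new coordinates the unwanted derivatives disappear.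
open Classical in
theorem ad_shearFun (h : IsFrame Ahat H C)
    (hC : ∀ i j : {j // j ∉ Ahat}, C i j = if i = j then (1 : Params m q) else 0)
    (i : {j // j ∉ Ahat}) (j : A₀ ⊕ A₁) :
    ad (par j) (mulOp (shearFun Ahat C (-1) j)) ((H i).coeff 1) = if i.1 = j then 1 else 0 := by
  rw [shearFun]
  split_ifs with hj hij hij
  · exact absurd hj (hij ▸ i.2)
  · have hD := Fil_le_RLin (rees_coeff_one (h.rees i))
    let φ : Fun m q A₀ A₁ →+ Op m q A₀ A₁ :=
      { toFun := fun f => ad (par j) (mulOp f) ((H i).coeff 1)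
        map_zero' := by simp [ad_apply, mulOp_zero]
        map_add' := fun f g => ad_mulOp_add _ f g _ }
    have h1 : ad (par j) (mulOp (∑ᶠ i : {j // j ∉ Ahat}, coord i.1 * const (C i j)))
        ((H i).coeff 1) = ∑ᶠ k : {j // j ∉ Ahat},
          ad (par j) (mulOp (coord k.1 * const (C k j))) ((H i).coeff 1) :=
      φ.map_finsum (h.isShearMatrix.support_finite j)
    have h2 : ∀ k : {j // j ∉ Ahat},
        ad (par j) (mulOp (coord k.1 * const (C k j))) ((H i).coeff 1) =
          if k = i then mulOp (const (C i j)) else 0 := fun k => by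
      rw [ad_coord_mul_const (h.parity_symbol k j) hD, h.symbol, hC]
      by_cases hk : k = i
      · subst hk; simp [mulOp_one]
      · simp [hk, Ne.symm hk, mulOp_zero]
    rw [ad_mulOp_add, ad_mulOp_smul, h1, h.symbol, finsum_congr h2,
      finsum_eq_single _ i fun k hk => if_neg hk, if_pos rfl]
    module
  · subst hij
    rw [h.symbol, hC, if_pos rfl, map_one, mulOp_one]
  · rw [h.symbol, show j = (⟨j, hj⟩ : {j // j ∉ Ahat}).1 from rfl, hC, if_neg, map_zero, mulOp_zero]
    exact fun h => hij (congrArg Subtype.val h)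

theorem coeff_one_inCoordinates (h : IsFrame Ahat H C)
    (hC : ∀ i j : {j // j ∉ Ahat}, i ≠ j → C i j = 0) (hC' : ∀ i : {j // j ∉ Ahat}, C i i = 1)
    (i : {j // j ∉ Ahat}) : ∃ p ∈ degLE 1,
      (inCoordinates h.isShearMatrix.equiv (H i)).coeff 1 = partialDeriv i.1 + mulOp p := by
  classical
  have hA := h.isShearMatrix.isAffine
  have hmem := hA.conjOp_mem_Fil (rees_coeff_one (h.rees i))
  refine ⟨_, apply_one_mem_degLE hmem, RLin.ext (Fil_le_RLin hmem)
    (add_mem (partialDeriv_mem_RLin _) (mulOp_mem_RLin _)) ?_ fun j => ?_⟩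
  · rw [LinearMap.add_apply, partialDeriv_one, zero_add, mulOp_apply, mul_one]; rfl
  · have h1 := h.ad_shearFun (fun i j => by
      by_cases hij : i = j
      · subst hij; rw [if_pos rfl, hC']
      · rw [if_neg hij, hC i j hij]) i j
    rw [coeff_inCoordinates, hA.ad_coord_conjOp, h.isShearMatrix.equiv_coord, h1, map_add,
      ad_coord_partialDeriv, ad_coord_mulOp, add_zero]
    split_ifs
    · exact map_one _
    · exact map_zero _

/-- As the `g k` have no $\hbar^0$ term, the $\hbar^1$ coefficient of a combination of them only
sees the $\hbar^0$ coefficients of the multipliers, which are constants. A derivative absent from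
all linear parts is therefore absent from those of the whole ideal. The hypothesis `hj` expresses
this absence through the values at $1$ and at the coordinate. -/
theorem symbol_eq_zero_of_generated (h : IsFrame Ahat H C) {g : κ → HOp m q A₀ A₁}
    (hg : ∀ k, g k ∈ reesWeyl m q A₀ A₁) (hg0 : ∀ k, (g k).coeff 0 = 0)
    (hH : ∀ i, H i ∈ generatedIdeal g) {j : A₀ ⊕ A₁}
    (hj : ∀ k, (g k).coeff 1 (coord j) = (g k).coeff 1 1 * coord j) (i : {j // j ∉ Ahat}) :
    C i j = 0 := by
  have h1 : ∀ k, ad (par j) (mulOp (coord j)) ((g k).coeff 1) = 0 := fun k => by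
    obtain ⟨c, hc⟩ := mem_Fil_one.mp (ad_mem_Fil (coord_mem_Fil j) (hasPar_coord j)
      (rees_coeff_one (hg k)))
    have h2 := DFunLike.congr_fun hc 1
    rw [ad_apply, LinearMap.sub_apply, Module.End.mul_apply, Module.End.mul_apply, mulOp_apply,
      mulOp_apply, mulOp_apply, mul_one, mul_one, sgn_pow_apply,
      Function.iterate_fixed SPoly.parity_one, hj, mul_coord, sub_self] at h2
    rw [hc, ← h2, mulOp_zero]
  obtain ⟨c, hc, hs⟩ := hH i
  have h2 := (isSum_iff.mp hs 1).ad (par j) (mulOp (coord j))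
  rw [h.symbol] at h2
  have h3 := h2.unique (PSum.zero.congr fun k => ?_)
  · have := DFunLike.congr_fun h3 1
    rw [mulOp_apply, mul_one, LinearMap.zero_apply] at this
    exact const_injective (this.trans (map_zero _).symm)
  · obtain ⟨b, hb⟩ := mem_Fil_one.mp (rees_coeff (hc k) 0)
    have h4 : (c k * g k).coeff 1 = mulOp (const b) * (g k).coeff 1 := by
      rw [coeff_mul_one (.of_rees (hc k)) (.of_rees (hg k)) (hg0 k)]
      exact congrArg (· * (g k).coeff 1) hb
    rw [h4, ad_mulOp_left, h1, mul_zero]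

end IsFrame

/-- A family of generators whose matrix of symbols is triangular up to odd constants, with
invertible diagonal, and which closes under supercommutators up to `ħ²`, generates a partial Airy
structure after a shear. -/
theorem IsFrame.exists_isPartialAiryStructure {Ahat : Set (A₀ ⊕ A₁)}
    {K : {j // j ∉ Ahat} → HOp m q A₀ A₁} {M : {j // j ∉ Ahat} → A₀ ⊕ A₁ → Params m q}
    (hA : Ahat.Finite) (h : IsFrame Ahat K M) (w : {j // j ∉ Ahat} → ℕ)
    (hd : ∀ l : {j // j ∉ Ahat}, IsUnit (M l l))
    (hM : ∀ j l : {j // j ∉ Ahat}, l ≠ j → w j ≤ w l → SPoly.body (M l j) = 0)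
    {c : {j // j ∉ Ahat} → {j // j ∉ Ahat} → ℂ}
    {τ : {j // j ∉ Ahat} → {j // j ∉ Ahat} → {j // j ∉ Ahat}}
    (hc : ∀ i k, hbr (par i.1) (K i) (K k) = hbarPow 2 1 * (c i k • K (τ i k)))
    (hτ : ∀ l, {x : {j // j ∉ Ahat} × {j // j ∉ Ahat} | c x.1 x.2 ≠ 0 ∧ τ x.1 x.2 = l}.Finite)
    {g : κ → HOp m q A₀ A₁} (hg : ∀ k, g k ∈ reesWeyl m q A₀ A₁)
    (hg0 : ∀ k, (g k).coeff 0 = 0) (hgK : generatedIdeal g = generatedIdeal K) :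
    ∃ Ψ : Fun m q A₀ A₁ ≃ₐ[ℂ] Fun m q A₀ A₁, IsShear Ahat Ψ ∧
      IsPartialAiryStructure Ahat (inCoordinates Ψ '' generatedIdeal g) ∧
      ((∀ k, ∀ j ∈ Ahat, (g k).coeff 1 (coord j) = (g k).coeff 1 1 * coord j) →
        Ψ = AlgEquiv.refl) := by
  classical
  -- The nilpotent filtration consists of the powers of the ideal of odd generators of $R$;
  -- vanishing body means membership in the first power.
  obtain ⟨N, hN, hMN, hNM⟩ := exists_inverse (S := Params m q) (M := fun l j => M l j.1)
    (F := fun k => (SPoly.oddFil (E := Fin m) (O := Fin q) k).toAddSubgroup) w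
    (fun j => h.finite_column j) SPoly.mem_oddFil_zero SPoly.mul_mem_oddFil
    (fun a ha => SPoly.oddFil_card ha) hd fun j l hlj hw => SPoly.mem_oddFil_one (hM j l hlj hw)
  obtain ⟨H, C, hH, hC, hHK⟩ := h.exists_reduced hN (fun l l' => (hMN l l').trans (by congr))
    (fun i j => (hNM i j).trans (by congr))
  have hHm : ∀ i, H i ∈ generatedIdeal H := fun i =>
    ⟨fun k => cst (if i = k then 1 else 0), fun k => cst_mem_rees _, isSum_ite i H⟩
  have hP := hH.isShearMatrix.isAffine
  have himg : inCoordinates hH.isShearMatrix.equiv '' generatedIdeal g =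
      generatedIdeal fun i => inCoordinates hH.isShearMatrix.equiv (H i) := by
    rw [hgK, ← hHK, hP.image_generatedIdeal]
  have hHr : ∀ i, inCoordinates hH.isShearMatrix.equiv (H i) ∈ reesWeyl m q A₀ A₁ := fun i =>
    hP.inCoordinates_mem_rees (hH.rees i)
  refine ⟨hH.isShearMatrix.equiv, hH.isShearMatrix.isShear, ⟨hA, ?_, ?_, ?_, ?_, ?_, ?_⟩, ?_⟩
  · rw [himg]; exact generatedIdeal_subset_rees hHr
  · rw [himg]; exact zero_mem_generatedIdeal _
  · rw [himg]; exact fun X hX Y hY => add_mem_generatedIdeal hX hY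
  · rw [himg]; exact fun c hc X hX => mul_mem_generatedIdeal hHr hc hX
  · refine ⟨_, fun j => ?_, isBounded_of_hfin hHr (hH.hfin.inCoordinates _), himg, fun j => ⟨?_, ?_⟩⟩
    · refine HPar.isHomogeneous (e := par j.1) ?_
      rw [HPar, hP.hParity_inCoordinates, hH.hpar j, inCoordinates_smul]
    · rw [coeff_inCoordinates, hH.coeff_zero, map_zero]
    · exact hH.coeff_one_inCoordinates (fun i j hij => (hC i j).trans (if_neg hij))
        (fun i => (hC i i).trans (if_pos rfl)) j
  -- Closure under supercommutators is a property of the ideal. It is proved with `K`, which has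
  -- explicit structure constants, and then transported to the new coordinates.
  · rintro _ ⟨X, hX, rfl⟩ _ ⟨Y, hY, rfl⟩
    rw [hgK] at hX hY
    obtain ⟨Z, hZ, hXY⟩ := superComm_mem_generatedIdeal h.rees h.hfin h.hpar hc hτ hX hY
    exact ⟨_, ⟨Z, hgK ▸ hZ, rfl⟩, by
      rw [hP.superComm_inCoordinates, hXY, inCoordinates_hbarPow_mul]⟩
  · intro hj
    refine hH.isShearMatrix.equiv_eq_refl fun i j hjA => ?_
    exact hH.symbol_eq_zero_of_generated hg hg0 (fun i => by rw [hgK, ← hHK]; exact hHm i)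
      (fun k => hj k j hjA) i

end SuperAiry

end

/-! ### Heisenberg and Clifford modes and their commutation relations. -/

noncomputable section

namespace SuperAiry

variable {m q r : ℕ} {ι κ : Type}

section

variable {A₀ A₁ : Type}

theorem ad_smul_left (e : ℕ) (c : ℂ) (y D : Op m q A₀ A₁) : ad e (c • y) D = c • ad e y D := by
  simp only [ad_apply, mul_smul_comm, smul_mul_assoc, smul_sub]

theorem ad_add_left (e : ℕ) (y z D : Op m q A₀ A₁) : ad e (y + z) D = ad e y D + ad e z D := by
  simp only [ad_apply, mul_add, add_mul]; abel

theorem ad_sub_left (e : ℕ) (y z D : Op m q A₀ A₁) : ad e (y - z) D = ad e y D - ad e z D := by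
  simp only [ad_apply, mul_sub, sub_mul]; abel

theorem ad_zero_left (e : ℕ) (D : Op m q A₀ A₁) : ad e 0 D = 0 := by
  simp only [ad_apply, mul_zero, zero_mul, sub_zero]

end

/-! ### Modes -/

/-- Indices of the Heisenberg modes and of the Clifford modes. -/
abbrev Mode (r : ℕ) : Type := (Fin r × ℤ) ⊕ (Fin r × ℤ)

/-- The parity of a mode. -/
def mpar : Mode r → ℕ
  | .inl _ => 0
  | .inr _ => 1

/-- The number of a mode. -/
def mnum : Mode r → ℤ
  | .inl i => i.2
  | .inr i => i.2

/-- The Heisenberg and Clifford modes, divided by `ħ`. -/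
def mode : Mode r → OpR m q r
  | .inl i => jOp i.1 i.2
  | .inr i => gammaOp i.1 i.2

/-- The supercommutator of two modes. -/
def pairing : Mode r → Mode r → ℂ
  | .inl i, .inl j => if i.1 = j.1 ∧ i.2 + j.2 = 0 then i.2 else 0
  | .inr i, .inr j => if i.1 = j.1 ∧ i.2 + j.2 = 0 then 1 else 0
  | _, _ => 0

theorem jOp_zero (a : Fin r) : (jOp a 0 : OpR m q r) = 0 := rfl

theorem jOp_negSucc (a : Fin r) (n : ℕ) :
    (jOp a (Int.negSucc n) : OpR m q r) = ((n : ℂ) + 1) • mulOp (coord (ixB a n.succPNat)) := rfl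

theorem gammaOp_zero (a : Fin r) : (gammaOp a 0 : OpR m q r) =
    (1 / 2 : ℂ) • mulOp (coord (ixF a 0)) + partialDeriv (ixF a 0) := rfl

theorem par_ixF (a : Fin r) (k : ℕ) : par (ixF a k) = 1 := rfl

/-- The index of the coordinate that occurs in a mode. -/
def modeIx : Mode r → (Fin r × ℕ+) ⊕ (Fin r × ℕ)
  | .inl i => ixB i.1 i.2.natAbs.toPNat'
  | .inr i => ixF i.1 i.2.natAbs

/-- The coefficient of the coordinate in a mode. -/
def modeCoord : Mode r → ℂ
  | .inl i => if i.2 < 0 then -(i.2 : ℂ) else 0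
  | .inr i => if i.2 < 0 then 1 else if i.2 = 0 then 1 / 2 else 0

/-- The coefficient of the derivative in a mode. -/
def modeDeriv : Mode r → ℂ
  | .inl i => if 0 < i.2 then 1 else 0
  | .inr i => if 0 ≤ i.2 then 1 else 0

theorem par_modeIx (u : Mode r) : par (modeIx u) = mpar u := by
  rcases u with u | u <;> rfl

theorem mode_eq (u : Mode r) : (mode u : OpR m q r) =
    modeCoord u • mulOp (coord (modeIx u)) + modeDeriv u • partialDeriv (modeIx u) := by
  rcases u with ⟨a, k⟩ | ⟨a, k⟩
  · rcases k with (- | k) | k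
    · simp [mode, modeCoord, modeDeriv, jOp_zero]
    · change partialDeriv (ixB a k.succPNat) = (if Int.ofNat (k + 1) < 0 then -((Int.ofNat (k + 1) : ℤ) : ℂ) else (0 : ℂ)) •
          mulOp (coord (ixB a k.succPNat)) +
        (if 0 < Int.ofNat (k + 1) then (1 : ℂ) else 0) • partialDeriv (ixB a k.succPNat)
      rw [if_neg (by simp; omega), if_pos (by simp), zero_smul, zero_add, one_smul]
    · change ((k : ℂ) + 1) • mulOp (coord (ixB a k.succPNat)) =
        (if Int.negSucc k < 0 then -((Int.negSucc k : ℤ) : ℂ) else (0 : ℂ)) •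
          mulOp (coord (ixB a k.succPNat)) +
        (if 0 < Int.negSucc k then (1 : ℂ) else 0) • partialDeriv (ixB a k.succPNat)
      rw [if_pos (by simp), if_neg (by simp), zero_smul, add_zero]
      congr 1
      push_cast [Int.negSucc_eq]
      ring
  · rcases k with (- | k) | k
    · simp [mode, modeCoord, modeDeriv, gammaOp_zero, modeIx]
    · change partialDeriv (ixF a (k + 1)) = (if Int.ofNat (k + 1) < 0 then (1 : ℂ) else
        if Int.ofNat (k + 1) = 0 then 1 / 2 else 0) • mulOp (coord (ixF a (k + 1))) +
        (if 0 ≤ Int.ofNat (k + 1) then (1 : ℂ) else 0) • partialDeriv (ixF a (k + 1))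
      rw [if_neg (by simp; omega), if_neg (by simp; omega), if_pos (by simp; omega), zero_smul,
        zero_add, one_smul]
    · change mulOp (coord (ixF a (k + 1))) = (if Int.negSucc k < 0 then (1 : ℂ) else
        if Int.negSucc k = 0 then 1 / 2 else 0) • mulOp (coord (ixF a (k + 1))) +
        (if 0 ≤ Int.negSucc k then (1 : ℂ) else 0) • partialDeriv (ixF a (k + 1))
      rw [if_pos (by simp), if_neg (by simp), zero_smul, add_zero, one_smul]

/-- Every mode is a combination of one coordinate and its own derivative (`mode_eq`), so this single
bracket covers all pairs of modes. -/
theorem ad_linear_linear {A₀ A₁ : Type} (i j : A₀ ⊕ A₁) (α β α' β' : ℂ) :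
    ad (par j) (α • mulOp (coord j) + β • partialDeriv j)
      (α' • mulOp (coord i) + β' • partialDeriv i : Op m q A₀ A₁) =
    open Classical in
    if i = j then (α * β' - (-1) ^ par j * (β * α')) • (1 : Op m q A₀ A₁) else 0 := by
  classical
  rw [ad_add_left, ad_smul_left, ad_smul_left, map_add, map_add, map_smul, map_smul, map_smul,
    map_smul, ad_coord_mulOp, ad_partialDeriv_partialDeriv, smul_zero, smul_zero, zero_add, add_zero,
    ad_coord_partialDeriv, ad_partialDeriv_coord]
  by_cases h : i = j
  · subst h
    simp only [if_true]
    simp only [smul_smul, ← neg_smul, ← add_smul, smul_neg]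
    rcases i with i | i <;> simp [par, sub_eq_add_neg, add_smul, neg_smul, smul_smul]
  · simp [h, Ne.symm h]

theorem hasPar_mode (u : Mode r) : HasPar (mpar u) (mode u : OpR m q r) := by
  rcases u with ⟨a, k⟩ | ⟨a, k⟩
  · rcases k with (- | k) | k
    · exact hasPar_zero 0
    · exact hasPar_partialDeriv (ixB a k.succPNat)
    · exact (hasPar_coord (ixB a k.succPNat)).smul _
  · rcases k with (- | k) | k
    · exact ((hasPar_coord (ixF a 0)).smul _).add (hasPar_partialDeriv (ixF a 0))
    · exact hasPar_partialDeriv (ixF a (k + 1))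
    · exact hasPar_coord (ixF a (k + 1))

theorem mode_mem_Fil (u : Mode r) : (mode u : OpR m q r) ∈ Fil m q (Fin r × ℕ+) (Fin r × ℕ) 2 := by
  rcases u with ⟨a, k⟩ | ⟨a, k⟩
  · rcases k with (- | k) | k
    · exact zero_mem _
    · exact partialDeriv_mem_Fil (ixB a k.succPNat)
    · exact Submodule.smul_mem _ _ (coord_mem_Fil (ixB a k.succPNat))
  · rcases k with (- | k) | k
    · exact add_mem (Submodule.smul_mem _ _ (coord_mem_Fil (ixF a 0)))
        (partialDeriv_mem_Fil (ixF a 0))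
    · exact partialDeriv_mem_Fil (ixF a (k + 1))
    · exact coord_mem_Fil (ixF a (k + 1))

theorem ad_mode_const (u : Mode r) (c : Params m q) :
    ad (mpar u) (mode u) (mulOp (const c) : OpR m q r) = 0 := by
  rcases u with ⟨a, k⟩ | ⟨a, k⟩
  · rcases k with (- | k) | k
    · exact ad_zero_left _ _
    · exact ad_partialDeriv_const (ixB a k.succPNat) c
    · exact (ad_smul_left _ _ _ _).trans
        ((congrArg _ (ad_coord_mulOp (ixB a k.succPNat) _)).trans (smul_zero _))
  · rcases k with (- | k) | k
    · refine (ad_add_left _ _ _ _).trans ?_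
      have h1 : ad 1 (mulOp (coord (ixF a 0))) (mulOp (const c) : OpR m q r) = 0 :=
        ad_coord_mulOp (ixF a 0) _
      have h2 : ad 1 (partialDeriv (ixF a 0)) (mulOp (const c) : OpR m q r) = 0 :=
        ad_partialDeriv_const (ixF a 0) c
      rw [ad_smul_left, mpar, h1, h2, smul_zero, add_zero]
    · exact ad_partialDeriv_const (ixF a (k + 1)) c
    · exact ad_coord_mulOp (ixF a (k + 1)) _

theorem ad_mode_mode (u v : Mode r) :
    ad (mpar v) (mode v) (mode u : OpR m q r) = pairing u v • (1 : OpR m q r) := by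
  classical
  rw [mode_eq, mode_eq u, ← par_modeIx, ad_linear_linear]
  rcases u with ⟨a, k⟩ | ⟨a, k⟩ <;> rcases v with ⟨b, l⟩ | ⟨b, l⟩
  · by_cases hk : k = 0
    · subst hk
      simp [modeCoord, modeDeriv, pairing]
    by_cases hl : l = 0
    · subst hl
      simp [modeCoord, modeDeriv, pairing, hk]
    have h1 : modeIx (.inl (a, k) : Mode r) = modeIx (.inl (b, l)) ↔ a = b ∧ (k = l ∨ k = -l) := by
      rw [← Int.natAbs_eq_natAbs_iff]
      simp only [modeIx, ixB, Sum.inl.injEq, Prod.mk.injEq, ← PNat.coe_inj,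
        Nat.toPNat'_coe, Int.natAbs_pos, hk, hl, ne_eq, not_false_eq_true, if_true]
    simp only [h1]
    by_cases hab : a = b
    · rcases lt_or_gt_of_ne hk with hk' | hk' <;> rcases lt_or_gt_of_ne hl with hl' | hl' <;>
        simp only [modeCoord, modeDeriv, pairing, par_modeIx, mpar, hab, hk', hl', not_lt.mpr hk'.le,
          not_lt.mpr hl'.le, if_true, if_false, true_and] <;> split_ifs <;>
        first
        | omega
        | (simp; done)
        | skip
      all_goals
        have e : (k : ℂ) = -(l : ℂ) := by
          rw [← Int.cast_neg]; congr 1; omega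
        simp [e]
    · simp [hab, pairing]
  · rw [if_neg (by simp [modeIx, ixB, ixF])]; simp [pairing]
  · rw [if_neg (by simp [modeIx, ixB, ixF])]; simp [pairing]
  · have h1 : modeIx (.inr (a, k) : Mode r) = modeIx (.inr (b, l)) ↔ a = b ∧ (k = l ∨ k = -l) := by
      rw [← Int.natAbs_eq_natAbs_iff]
      simp [modeIx, ixF]
    simp only [h1]
    by_cases hab : a = b
    · simp only [modeCoord, modeDeriv, pairing, par_modeIx, mpar, hab, true_and]
      split_ifs <;> first
        | (exfalso; omega)
        | (simp; done)
        | norm_num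
    · simp [hab, pairing]

/-! ### The second zero mode -/

/-- The combination of `θ^{a,0}` and its derivative that supercommutes with all modes. -/
def gammaDual (a : Fin r) : OpR m q r :=
  (1 / 2 : ℂ) • mulOp (coord (ixF a 0)) - partialDeriv (ixF a 0)

/-- The only mode that involves the same coordinate is $\Gamma_{a,0}$, and there the two cross terms
are $\tfrac12$ and $-\tfrac12$. -/
theorem ad_gammaDual_mode (a : Fin r) (u : Mode r) :
    ad 1 (gammaDual a) (mode u : OpR m q r) = 0 := by
  classical
  have h : (gammaDual a : OpR m q r) =
      (1 / 2 : ℂ) • mulOp (coord (ixF a 0)) + (-1 : ℂ) • partialDeriv (ixF a 0) := by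
    rw [gammaDual]; module
  rw [h, mode_eq]
  refine (ad_linear_linear _ (ixF a 0) _ _ _ _).trans ?_
  split_ifs with h'
  · rcases u with ⟨b, k⟩ | ⟨b, k⟩
    · simp [modeIx, ixB, ixF] at h'
    · obtain rfl : k = 0 := by simpa [modeIx, ixF] using (Prod.mk.inj (Sum.inr.inj h')).2
      simp [modeCoord, modeDeriv, par_ixF]
  · rfl

theorem hasPar_gammaDual (a : Fin r) : HasPar 1 (gammaDual a : OpR m q r) :=
  ((hasPar_coord (ixF a 0)).smul _).sub (hasPar_partialDeriv (ixF a 0))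

/-- An operator that supercommutes with all modes is a constant. -/
theorem eq_const_of_ad_mode {Z : OpR m q r} (hZ : Z ∈ RLin m q (Fin r × ℕ+) (Fin r × ℕ))
    (h : ∀ u, ad (mpar u) (mode u) Z = 0) (h' : ∀ a, ad 1 (gammaDual a) Z = 0) :
    Z = mulOp (const (evalZero (Z 1))) := by
  have hm : Z ∈ Fil m q (Fin r × ℕ+) (Fin r × ℕ) 1 := by
    refine mem_Fil_succ.mpr ⟨hZ, fun j => ?_⟩
    rw [mem_Fil_zero, mem_Fil_zero]
    rcases j with ⟨a, k⟩ | ⟨a, k⟩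
    · obtain ⟨n, rfl⟩ : ∃ n : ℕ, k = n.succPNat := ⟨k.natPred, (PNat.succPNat_natPred k).symm⟩
      refine ⟨?_, h (.inl (a, Int.ofNat (n + 1)))⟩
      have := h (.inl (a, Int.negSucc n))
      rw [mode, jOp_negSucc, ad_smul_left] at this
      exact (smul_eq_zero.mp this).resolve_left (by exact_mod_cast n.succ_ne_zero)
    · rcases k with - | n
      · have h1 := h (.inr (a, 0))
        have h2 := h' a
        rw [mode, gammaOp_zero, ad_add_left, ad_smul_left] at h1
        rw [gammaDual, ad_sub_left, ad_smul_left] at h2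
        change (1 / 2 : ℂ) • ad 1 (mulOp (coord (ixF a 0))) Z + ad 1 (partialDeriv (ixF a 0)) Z = 0
          at h1
        change ad 1 (mulOp (coord (ixF a 0))) Z = 0 ∧ ad 1 (partialDeriv (ixF a 0)) Z = 0
        generalize ad 1 (mulOp (coord (ixF a 0))) Z = x at h1 h2 ⊢
        generalize ad 1 (partialDeriv (ixF a 0)) Z = y at h1 h2 ⊢
        constructor
        · linear_combination (norm := module) h1 + h2
        · linear_combination (norm := module) (1 / 2 : ℂ) • h1 - (1 / 2 : ℂ) • h2
      · exact ⟨h (.inr (a, Int.negSucc n)), h (.inr (a, Int.ofNat (n + 1)))⟩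
  obtain ⟨c, rfl⟩ := mem_Fil_one.mp hm
  rw [mulOp_apply, mul_one, evalZero_const]

/-! ### Modes of large number -/

/-- A polynomial involves finitely many coordinates, and modes of positive number are derivatives.
This uniform threshold is the source of pointwise finiteness for all sums over modes. -/
theorem exists_mode_eq_zero (f : FunR m q r) :
    ∃ N : ℤ, 0 < N ∧ ∀ u : Mode r, N ≤ mnum u → mode u f = 0 := by
  let num : (Fin r × ℕ+) ⊕ (Fin r × ℕ) → ℕ := Sum.elim (fun i => i.2) fun i => i.2
  obtain ⟨N, hN⟩ := ((pfin_partialDeriv (m := m) (q := q) f).image num).bddAbove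
  refine ⟨N + 1, by omega, fun u hu => ?_⟩
  have key : ∀ j, N < num j → partialDeriv j f = 0 := fun j hj => by
    by_contra h
    exact absurd (hN ⟨j, h, rfl⟩) (not_le.mpr hj)
  rcases u with ⟨a, k⟩ | ⟨a, k⟩
  · change (N : ℤ) + 1 ≤ k at hu
    rcases k with (- | k) | k
    · rfl
    · exact key (ixB a k.succPNat) (by change N < k + 1; simp at hu; omega)
    · simp at hu; omega
  · change (N : ℤ) + 1 ≤ k at hu
    rcases k with (- | k) | k
    · simp at hu; omega
    · exact key (ixF a (k + 1)) (by change N < k + 1; simp at hu; omega)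
    · simp at hu; omega

end SuperAiry

end

/-! ### The two sectors and the splitting of the super Virasoro operators. -/

noncomputable section

namespace SuperAiry

variable {m q r : ℕ} {ι κ : Type}

/-! ### Normally ordered products of two modes -/

/-- The product of two modes, with the mode of larger number on the right. -/
def nprod (u v : Mode r) : OpR m q r :=
  if mnum v < mnum u then (-1 : ℂ) ^ (mpar u * mpar v) • (mode v * mode u) else mode u * mode v

theorem mode_mul_mode (u v : Mode r) : (mode u * mode v : OpR m q r) =
    (-1 : ℂ) ^ (mpar u * mpar v) • (mode v * mode u) + pairing u v • (1 : OpR m q r) := by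
  rw [← ad_mode_mode, ad_apply, (hasPar_mode u).pow, mul_smul_comm, add_sub_cancel]

theorem nprod_eq_sub (u v : Mode r) : (nprod u v : OpR m q r) =
    mode u * mode v - (if mnum v < mnum u then pairing u v else 0) • (1 : OpR m q r) := by
  rw [nprod]
  split_ifs
  · rw [mode_mul_mode u v, add_sub_cancel_right]
  · rw [zero_smul, sub_zero]

theorem smul_apply_eq_zero {c : ℂ} {D : OpR m q r} {f : FunR m q r} (h : D f = 0) :
    (c • D) f = 0 := by
  rw [LinearMap.smul_apply, h, smul_zero]

theorem ad_one (e : ℕ) (y : OpR m q r) : ad e y 1 = 0 := by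
  rw [ad_apply, map_one, one_mul, mul_one, sub_self]

theorem ad_nprod (w u v : Mode r) : ad (mpar w) (mode w) (nprod u v : OpR m q r) =
    pairing v w • mode u + ((-1 : ℂ) ^ (mpar v * mpar w) * pairing u w) • mode v := by
  rw [nprod_eq_sub, map_sub, map_smul, ad_one, smul_zero, sub_zero, ad_mul, ad_mode_mode,
    ad_mode_mode, (hasPar_mode v).pow, mul_smul_comm, mul_one, smul_mul_assoc, one_mul, smul_smul,
    mul_comm (pairing u w)]

theorem ad_gammaDual_nprod (a : Fin r) (u v : Mode r) :
    ad 1 (gammaDual a) (nprod u v : OpR m q r) = 0 := by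
  rw [nprod_eq_sub, map_sub, map_smul, ad_one, smul_zero, sub_zero, ad_mul, ad_gammaDual_mode,
    ad_gammaDual_mode, mul_zero, zero_mul, add_zero]

theorem nprod_mem_Fil (u v : Mode r) :
    (nprod u v : OpR m q r) ∈ Fil m q (Fin r × ℕ+) (Fin r × ℕ) 3 := by
  rw [nprod]
  split_ifs
  · exact Submodule.smul_mem _ _ (mul_mem_Fil (mode_mem_Fil v) (mode_mem_Fil u) le_rfl)
  · exact mul_mem_Fil (mode_mem_Fil u) (mode_mem_Fil v) le_rfl

theorem hasPar_nprod (u v : Mode r) : HasPar (mpar u + mpar v) (nprod u v : OpR m q r) := by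
  rw [nprod]
  split_ifs
  · rw [add_comm]
    exact ((hasPar_mode v).mul (hasPar_mode u)).smul _
  · exact (hasPar_mode u).mul (hasPar_mode v)

theorem nprod_apply_eq_zero {u v : Mode r} {f : FunR m q r} {N : ℤ}
    (h : ∀ w : Mode r, N ≤ mnum w → mode w f = 0) (huv : N ≤ mnum u ∨ N ≤ mnum v) :
    nprod u v f = 0 := by
  rw [nprod]
  split_ifs with hlt
  · rw [LinearMap.smul_apply, Module.End.mul_apply, h u (by omega), map_zero, smul_zero]
  · rw [Module.End.mul_apply, h v (by omega), map_zero]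

/-- Normal ordering puts the larger number on the right, so a product kills the polynomial as soon
as either number passes the threshold. -/
theorem pfin_nprod {U V : ι → Mode r}
    (h : ∀ N : ℤ, {i | mnum (U i) < N ∧ mnum (V i) < N}.Finite) :
    PFin fun i => (nprod (U i) (V i) : OpR m q r) := fun f => by
  obtain ⟨N, -, hN⟩ := exists_mode_eq_zero f
  refine (h N).subset fun i hi => ?_
  by_contra hi'
  refine hi (nprod_apply_eq_zero hN ?_)
  simp only [Set.mem_ofPred_eq] at hi'
  omega

theorem normalJJ_eq (a : Fin r) (k l : ℤ) :
    (normalJJ a k l : OpR m q r) = nprod (.inl (a, k)) (.inl (a, l)) := by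
  rw [nprod_eq_sub, normalJJ]
  congr 2
  simp only [mnum, pairing, true_and]
  split_ifs <;> first | rfl | omega

/-- The two orderings differ only for a pair of zero modes, where the vacuum value $\tfrac12$ is
subtracted on one side but `nprod` subtracts nothing. -/
theorem normalGammaGamma_eq (a : Fin r) (k l : ℤ) :
    (normalGammaGamma a k l : OpR m q r) = nprod (.inr (a, k)) (.inr (a, l)) -
      (if k = 0 ∧ l = 0 then 1 / 2 else 0 : ℂ) • (1 : OpR m q r) := by
  rw [nprod_eq_sub, normalGammaGamma, sub_sub, ← add_smul]
  congr 2
  simp only [mnum, pairing, true_and]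
  split_ifs <;> first | (exfalso; omega) | simp

theorem jOp_mul_gammaOp (a : Fin r) (k l : ℤ) :
    (jOp a k * gammaOp a l : OpR m q r) = nprod (.inl (a, k)) (.inr (a, l)) := by
  rw [nprod_eq_sub, show pairing (.inl (a, k)) (.inr (a, l)) = 0 from rfl, ite_self, zero_smul,
    sub_zero]
  rfl

/-! ### The modes of the untwisted and of the twisted sector -/

/-- `J_{a,k}` for odd and `Γ_{a,k}` for even `k`. -/
def oMode (a : Fin r) (k : ℤ) : Mode r := if Even k then .inr (a, k) else .inl (a, k)

/-- `J_{a,k}` for even and `Γ_{a,k}` for odd `k`. -/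
def eMode (a : Fin r) (k : ℤ) : Mode r := if Even k then .inl (a, k) else .inr (a, k)

theorem mnum_oMode (a : Fin r) (k : ℤ) : mnum (oMode a k) = k := by
  rw [oMode]; split_ifs <;> rfl

theorem mnum_eMode (a : Fin r) (k : ℤ) : mnum (eMode a k) = k := by
  rw [eMode]; split_ifs <;> rfl

theorem mpar_oMode (a : Fin r) (k : ℤ) : mpar (oMode a k) = if Even k then 1 else 0 := by
  rw [oMode]; split_ifs <;> rfl

theorem mpar_eMode (a : Fin r) (k : ℤ) : mpar (eMode a k) = if Even k then 0 else 1 := by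
  rw [eMode]; split_ifs <;> rfl

theorem exists_eq_oMode_or_eMode (w : Mode r) : ∃ a k, w = oMode a k ∨ w = eMode a k := by
  rcases w with ⟨a, k⟩ | ⟨a, k⟩ <;> refine ⟨a, k, ?_⟩ <;> by_cases h : Even k <;>
    simp [oMode, eMode, h]

theorem pairing_oMode_oMode (a b : Fin r) (i k : ℤ) : pairing (oMode a i) (oMode b k) =
    if a = b ∧ i + k = 0 then (if Even k then 1 else (i : ℂ)) else 0 := by
  have h : i + k = 0 → (Even i ↔ Even k) := fun h => by
    rw [← Int.even_add, h]; exact Even.zero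
  rw [oMode, oMode]
  by_cases hi : Even i <;> by_cases hk : Even k <;> simp only [hi, hk, if_true, if_false, pairing]
  all_goals
    rw [if_neg]
    exact fun h' => by simpa [hi, hk] using h h'.2

/-- Modes pair only if their numbers are opposite, hence of equal parity; for equal parity one of
these is a $J$ and the other a $\Gamma$. So the two sectors supercommute. -/
theorem pairing_oMode_eMode (a b : Fin r) (i k : ℤ) : pairing (oMode a i) (eMode b k) = 0 := by
  have h : i + k = 0 → (Even i ↔ Even k) := fun h => by
    rw [← Int.even_add, h]; exact Even.zero
  rw [oMode, eMode]
  by_cases hi : Even i <;> by_cases hk : Even k <;> simp only [hi, hk, if_true, if_false, pairing]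
  all_goals
    rw [if_neg]
    exact fun h' => by simpa [hi, hk] using h h'.2

theorem finite_mnum_lt (c N : ℤ) : {j : ℤ | -j < N ∧ c + j < N}.Finite :=
  (Set.finite_Ioo (-N) (N - c)).subset fun j hj => ⟨by have := hj.1; omega, by have := hj.2; omega⟩

/-! ### Twisted super Virasoro operators -/

/-- The coefficients of the part of `L_{a,2n}` with modes from the untwisted sector. -/
def coeffL (n j : ℤ) : ℂ := if Even j then ((j : ℂ) + n) / 2 else 1 / 2

/-- The part of `ħ⁻² L_{a,2n}` with modes from the untwisted sector. -/
def opL (a : Fin r) (n : ℤ) : OpR m q r :=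
  opSum (fun j : ℤ => coeffL n j • nprod (oMode a (-j)) (oMode a (2 * n + j))) +
    (if n = 0 then (1 / 4 : ℂ) else 0) • (1 : OpR m q r)

/-- The coefficients of the part of `G_{a,2n+1}` with modes from the untwisted sector. -/
def coeffG (j : ℤ) : ℂ := if Even j then 0 else 1

/-- The part of `ħ⁻² G_{a,2n+1}` with modes from the untwisted sector. -/
def opG (a : Fin r) (n : ℤ) : OpR m q r :=
  opSum fun j : ℤ =>
    coeffG j • nprod (oMode a (-j)) (oMode a (2 * n + 1 + j))

/-- The coefficients of the part of `L_{a,2n}` with modes from the twisted sector. -/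
def coeffLRest (n j : ℤ) : ℂ := if Even j then -(1 / 2) else -(((j : ℂ) + n) / 2)

theorem psum_opL (a : Fin r) (n : ℤ) :
    PSum (fun j : ℤ => coeffL n j • nprod (oMode a (-j)) (oMode a (2 * n + j)))
      ((opL a n : OpR m q r) - (if n = 0 then (1 / 4 : ℂ) else 0) • (1 : OpR m q r)) := by
  rw [opL, add_sub_cancel_right]
  refine (PFin.smul (pfin_nprod fun N => ?_) _).psum
  simp only [mnum_oMode]
  exact finite_mnum_lt _ N

theorem psum_opG (a : Fin r) (n : ℤ) :
    PSum (fun j : ℤ => coeffG j •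
      nprod (oMode a (-j)) (oMode a (2 * n + 1 + j))) (opG a n : OpR m q r) := by
  refine (PFin.smul (pfin_nprod fun N => ?_) _).psum
  simp only [mnum_oMode]
  exact finite_mnum_lt _ N

/-- The numbers in a term of $L_{a,2n}$ have equal parity, so both factors are of the same sector:
for even `j` the $JJ$ term belongs to the `eMode`s and the $\Gamma\Gamma$ term to the `oMode`s, and
conversely for odd `j`. Removing `opL` leaves the `eMode` terms. -/
theorem isSum_L (a : Fin r) (n : ℤ) :
    IsSum (fun j : ℤ => coeffLRest n j • hbarPow 2 (nprod (eMode a (-j)) (eMode a (2 * n + j))))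
      (L a n - hbarPow 2 (opL a n) : HOpR m q r) := by
  have hF : PFin fun j : ℤ => (-1 : ℂ) ^ (j - 1) • (normalJJ a (-j) (2 * n + j) : OpR m q r) := by
    refine PFin.smul ?_ _
    simp only [normalJJ_eq]
    exact pfin_nprod fun N => finite_mnum_lt _ N
  have hG : PSum (fun j : ℤ => ((-1 : ℂ) ^ j * ((j : ℂ) + n)) •
      (nprod (.inr (a, -j)) (.inr (a, 2 * n + j)) : OpR m q r))
      (opSum fun j : ℤ => ((-1 : ℂ) ^ j * ((j : ℂ) + n)) •
        normalGammaGamma a (-j) (2 * n + j)) := by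
    have e : (fun j : ℤ => ((-1 : ℂ) ^ j * ((j : ℂ) + n)) •
        (normalGammaGamma a (-j) (2 * n + j) : OpR m q r)) = fun j : ℤ =>
        ((-1 : ℂ) ^ j * ((j : ℂ) + n)) • nprod (.inr (a, -j)) (.inr (a, 2 * n + j)) := by
      funext j
      rw [normalGammaGamma_eq]
      -- The vacuum value of a pair of zero modes does not matter: its coefficient $j+n$ is zero
      -- there.
      by_cases h : -j = 0 ∧ 2 * n + j = 0
      · have h1 : j = 0 := by omega
        have h2 : n = 0 := by omega
        subst h1 h2
        simp
      · rw [if_neg h, zero_smul, sub_zero]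
    rw [e]
    exact (PFin.smul (pfin_nprod fun N => finite_mnum_lt _ N) _).psum
  have h := ((hF.psum.smul (1 / 2)).add (hG.smul (1 / 2))).sub (psum_opL (m := m) (q := q) a n)
  refine isSum_iff.mpr fun k => ?_
  by_cases hk : k = 2
  · subst hk
    have e : (L a n - hbarPow 2 (opL a n) : HOpR m q r).coeff 2 =
        (1 / 2 : ℂ) • opSum (fun j : ℤ => (-1 : ℂ) ^ (j - 1) • normalJJ a (-j) (2 * n + j)) +
          (1 / 2 : ℂ) • opSum (fun j : ℤ => ((-1 : ℂ) ^ j * ((j : ℂ) + n)) •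
            normalGammaGamma a (-j) (2 * n + j)) -
        (opL a n - (if n = 0 then (1 / 4 : ℂ) else 0) • (1 : OpR m q r)) := by
      rw [HahnSeries.coeff_sub, L, hbarPow, hbarPow, HahnSeries.coeff_single_same,
        HahnSeries.coeff_single_same]
      abel
    rw [e]
    refine h.congr fun j => ?_
    rw [HahnSeries.coeff_smul, hbarPow, HahnSeries.coeff_single_same, normalJJ_eq, coeffL,
      coeffLRest]
    by_cases hj : Even j
    · have h1 : (-1 : ℂ) ^ j = 1 := hj.neg_one_zpow
      have h2 : (-1 : ℂ) ^ (j - 1) = -1 := (hj.sub_odd odd_one).neg_one_zpow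
      have h3 : Even (2 * n + j) := by simp [Int.even_add, hj]
      rw [h1, h2, oMode, oMode, eMode, eMode, if_pos hj, if_pos hj, if_pos (by simpa using hj),
        if_pos h3, if_pos (by simpa using hj), if_pos h3]
      module
    · have hj' := Int.not_even_iff_odd.mp hj
      have h1 : (-1 : ℂ) ^ j = -1 := hj'.neg_one_zpow
      have h2 : (-1 : ℂ) ^ (j - 1) = 1 := (hj'.sub_odd odd_one).neg_one_zpow
      have h3 : ¬ Even (2 * n + j) := by simp [Int.even_add, hj]
      rw [h1, h2, oMode, oMode, eMode, eMode, if_neg hj, if_neg hj, if_neg (by simpa using hj),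
        if_neg h3, if_neg (by simpa using hj), if_neg h3]
      module
  · have e : (L a n - hbarPow 2 (opL a n) : HOpR m q r).coeff k = 0 := by
      rw [HahnSeries.coeff_sub, L, hbarPow, hbarPow, HahnSeries.coeff_single_of_ne hk,
        HahnSeries.coeff_single_of_ne hk, sub_zero]
    rw [e]
    refine PSum.zero.congr fun j => ?_
    rw [HahnSeries.coeff_smul, hbarPow, HahnSeries.coeff_single_of_ne hk, smul_zero]

/-- The numbers in a term of $G_{a,2n+1}$ have opposite parity, while one factor is a $J$ and the
other a $\Gamma$. So both factors are again of one sector, the `oMode`s for odd `j`. -/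
theorem isSum_G (a : Fin r) (n : ℤ) :
    IsSum (fun j : ℤ => (if Even j then -1 else 0 : ℂ) •
      hbarPow 2 (nprod (eMode a (-j)) (eMode a (2 * n + 1 + j))))
      (G a n - hbarPow 2 (opG a n) : HOpR m q r) := by
  have hF : PFin fun j : ℤ =>
      (-1 : ℂ) ^ (j - 1) • (jOp a (-j) * gammaOp a (2 * n + 1 + j) : OpR m q r) := by
    refine PFin.smul ?_ _
    simp only [jOp_mul_gammaOp]
    exact pfin_nprod fun N => finite_mnum_lt _ N
  have h := hF.psum.sub (psum_opG (m := m) (q := q) a n)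
  refine isSum_iff.mpr fun k => ?_
  by_cases hk : k = 2
  · subst hk
    rw [HahnSeries.coeff_sub, G, hbarPow, hbarPow, HahnSeries.coeff_single_same,
      HahnSeries.coeff_single_same]
    refine h.congr fun j => ?_
    rw [HahnSeries.coeff_smul, hbarPow, HahnSeries.coeff_single_same, jOp_mul_gammaOp]
    by_cases hj : Even j
    · have h2 : (-1 : ℂ) ^ (j - 1) = -1 := (hj.sub_odd odd_one).neg_one_zpow
      have h3 : ¬ Even (2 * n + 1 + j) := by simp [Int.even_add, hj]
      rw [h2, coeffG, if_pos hj, if_pos hj, eMode, eMode, if_pos (by simpa using hj), if_neg h3, zero_smul,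
        sub_zero]
    · have hj' := Int.not_even_iff_odd.mp hj
      have h2 : (-1 : ℂ) ^ (j - 1) = 1 := (hj'.sub_odd odd_one).neg_one_zpow
      have h3 : Even (2 * n + 1 + j) := by simp [Int.even_add, hj]
      rw [h2, coeffG, if_neg hj, if_neg hj, oMode, oMode, if_neg (by simpa using hj), if_pos h3, zero_smul,
        sub_self]
  · have e : (G a n - hbarPow 2 (opG a n) : HOpR m q r).coeff k = 0 := by
      rw [HahnSeries.coeff_sub, G, hbarPow, hbarPow, HahnSeries.coeff_single_of_ne hk,
        HahnSeries.coeff_single_of_ne hk, sub_zero]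
    rw [e]
    refine PSum.zero.congr fun j => ?_
    rw [HahnSeries.coeff_smul, hbarPow, HahnSeries.coeff_single_of_ne hk, smul_zero]

/-! ### Brackets with the modes -/

theorem eq_add_of_psum_ite {α β : ι → OpR m q r} {D : OpR m q r} [DecidableEq ι] {i j : ι}
    (h : PSum (fun k => (if k = i then α k else 0) + (if k = j then β k else 0)) D) :
    D = α i + β j :=
  h.unique ((PSum.ite_eq i α).add (PSum.ite_eq j β))

/-- The structure constants of the bracket of `opL` with the modes of the untwisted sector. -/
def lam (n k : ℤ) : ℂ := if Even k then -((k : ℂ) + n) else -k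

/-- The structure constants of the bracket of `opG` with the modes of the untwisted sector. -/
def gam (k : ℤ) : ℂ := if Even k then 1 else -k

/-- Exactly the terms `j = k` and `j = -(2 * n) - k` contain a partner of the mode `k`. They
contribute equally, which accounts for the halves in `coeffL`. -/
theorem ad_oMode_opL (a : Fin r) (n k : ℤ) :
    ad (mpar (oMode a k)) (mode (oMode a k)) (opL a n : OpR m q r) =
      lam n k • mode (oMode a (2 * n + k)) := by
  have h := (psum_opL (m := m) (q := q) a n).ad (mpar (oMode a k)) (mode (oMode a k))
  rw [map_sub, map_smul, ad_one, smul_zero, sub_zero] at h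
  have h' := eq_add_of_psum_ite (i := -(2 * n) - k) (j := k)
    (α := fun j => (lam n k / 2) • mode (oMode a (-j)))
    (β := fun j => (lam n k / 2) • mode (oMode a (2 * n + j))) (h.congr fun j => ?_)
  · rw [h', show -(-(2 * n) - k) = 2 * n + k by ring, ← add_smul, add_halves]
  · rw [map_smul, ad_nprod, smul_add, smul_smul, smul_smul]
    have e := even_two_mul n
    congr 1
    · by_cases hj : j = -(2 * n) - k
      · subst hj
        rw [if_pos rfl, pairing_oMode_oMode, if_pos ⟨rfl, by ring⟩, coeffL, lam]
        congr 1
        by_cases hk : Even k <;> simp [Int.even_sub, e, hk] <;> ring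
      · rw [if_neg hj, pairing_oMode_oMode, if_neg (fun h => hj (by omega)), mul_zero, zero_smul]
    · by_cases hj : j = k
      · subst hj
        rw [if_pos rfl, pairing_oMode_oMode, if_pos ⟨rfl, by ring⟩, coeffL, lam, mpar_oMode,
          mpar_oMode]
        congr 1
        by_cases hk : Even j <;> simp [Int.even_add, e, hk] <;> ring
      · rw [if_neg hj, pairing_oMode_oMode, if_neg (fun h => hj (by omega)), mul_zero, mul_zero,
          zero_smul]

/-- The terms `j = k` and `j = -(2 * n + 1) - k` could pair with the mode `k`, but their indices
have opposite parities and `coeffG` kills the one with even index. -/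
theorem ad_oMode_opG (a : Fin r) (n k : ℤ) :
    ad (mpar (oMode a k)) (mode (oMode a k)) (opG a n : OpR m q r) =
      gam k • mode (oMode a (2 * n + 1 + k)) := by
  have h := (psum_opG (m := m) (q := q) a n).ad (mpar (oMode a k)) (mode (oMode a k))
  have h' := eq_add_of_psum_ite (i := -(2 * n + 1) - k) (j := k)
    (α := fun j => (if Even k then 1 else 0 : ℂ) • mode (oMode a (-j)))
    (β := fun j => (if Even k then 0 else -k : ℂ) • mode (oMode a (2 * n + 1 + j)))
    (h.congr fun j => ?_)
  · rw [h', show -(-(2 * n + 1) - k) = 2 * n + 1 + k by ring, ← add_smul, gam]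
    congr 1
    split_ifs <;> simp
  · rw [map_smul, ad_nprod, smul_add, smul_smul, smul_smul]
    have e := even_two_mul n
    congr 1
    · by_cases hj : j = -(2 * n + 1) - k
      · subst hj
        rw [if_pos rfl, pairing_oMode_oMode, if_pos ⟨rfl, by ring⟩]
        congr 1
        by_cases hk : Even k <;> simp [coeffG, Int.even_sub, Int.even_add, e, hk]
      · rw [if_neg hj, pairing_oMode_oMode, if_neg (fun h => hj (by omega)), mul_zero, zero_smul]
    · by_cases hj : j = k
      · subst hj
        rw [if_pos rfl, pairing_oMode_oMode, if_pos ⟨rfl, by ring⟩, mpar_oMode, mpar_oMode]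
        congr 1
        by_cases hk : Even j <;> simp [coeffG, Int.even_add, e, hk]
      · rw [if_neg hj, pairing_oMode_oMode, if_neg (fun h => hj (by omega)), mul_zero, mul_zero,
          zero_smul]

theorem ad_nprod_eq_zero {w u v : Mode r} (hu : pairing u w = 0) (hv : pairing v w = 0) :
    ad (mpar w) (mode w) (nprod u v : OpR m q r) = 0 := by
  rw [ad_nprod, hu, hv, mul_zero, zero_smul, zero_smul, add_zero]

theorem ad_opL_eq_zero {e : ℕ} {w : OpR m q r} {a : Fin r} (n : ℤ)
    (h : ∀ i j, ad e w (nprod (oMode a i) (oMode a j)) = 0) : ad e w (opL a n) = 0 := by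
  have h' := (psum_opL (m := m) (q := q) a n).ad e w
  rw [map_sub, map_smul, ad_one, smul_zero, sub_zero] at h'
  exact h'.unique (PSum.zero.congr fun j => by rw [map_smul, h, smul_zero])

theorem ad_opG_eq_zero {e : ℕ} {w : OpR m q r} {a : Fin r} (n : ℤ)
    (h : ∀ i j, ad e w (nprod (oMode a i) (oMode a j)) = 0) : ad e w (opG a n) = 0 :=
  ((psum_opG (m := m) (q := q) a n).ad e w).unique
    (PSum.zero.congr fun j => by rw [map_smul, h, smul_zero])

theorem opL_mem_Fil (a : Fin r) (n : ℤ) :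
    (opL a n : OpR m q r) ∈ Fil m q (Fin r × ℕ+) (Fin r × ℕ) 3 := by
  have h := (psum_opL (m := m) (q := q) a n).mem_Fil (n := 3)
    fun j => Submodule.smul_mem _ _ (nprod_mem_Fil _ _)
  have h1 := Submodule.smul_mem _ (if n = 0 then (1 / 4 : ℂ) else 0)
    (Fil_mono (by norm_num : 1 ≤ 3) (one_mem_Fil (m := m) (q := q)
      (A₀ := Fin r × ℕ+) (A₁ := Fin r × ℕ)))
  simpa using add_mem h h1

theorem opG_mem_Fil (a : Fin r) (n : ℤ) :
    (opG a n : OpR m q r) ∈ Fil m q (Fin r × ℕ+) (Fin r × ℕ) 3 :=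
  (psum_opG (m := m) (q := q) a n).mem_Fil fun _ => Submodule.smul_mem _ _ (nprod_mem_Fil _ _)

theorem PSum.hasPar {F : ι → OpR m q r} {D : OpR m q r} {e : ℕ} (h : PSum F D)
    (hF : ∀ i, HasPar e (F i)) : HasPar e D :=
  (h.sgn.congr hF).unique (h.smul _)

theorem hasPar_opL (a : Fin r) (n : ℤ) : HasPar 0 (opL a n : OpR m q r) := by
  have h := (psum_opL (m := m) (q := q) a n).hasPar (e := 0) fun j => ?_
  · have h1 := h.add (hasPar_one.smul (if n = 0 then (1 / 4 : ℂ) else 0))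
    simpa using h1
  · refine HasPar.smul ((hasPar_nprod _ _).congr ?_) _
    rw [mpar_oMode, mpar_oMode]
    by_cases hj : Even j <;> simp [Int.even_add, hj]

theorem hasPar_opG (a : Fin r) (n : ℤ) : HasPar 1 (opG a n : OpR m q r) := by
  refine (psum_opG (m := m) (q := q) a n).hasPar fun j => ?_
  refine HasPar.smul ((hasPar_nprod _ _).congr ?_) _
  rw [mpar_oMode, mpar_oMode]
  have e := Int.not_odd_iff_even.mpr (even_two_mul n)
  by_cases hj : Even j <;> simp [Int.even_add, e, hj]

theorem opL_apply_eq_zero {a : Fin r} {n N : ℤ} {f : FunR m q r} (hN : 0 < N)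
    (h : ∀ w : Mode r, N ≤ mnum w → mode w f = 0) (hn : N ≤ n) : opL a n f = 0 := by
  have h' := psum_opL (m := m) (q := q) a n
  rw [if_neg (by omega), zero_smul, sub_zero] at h'
  rw [h'.2 f]
  refine finsum_eq_zero_of_forall_eq_zero fun j => ?_
  have hj := nprod_apply_eq_zero (u := oMode a (-j)) (v := oMode a (2 * n + j)) h
    (by rw [mnum_oMode, mnum_oMode]; omega)
  exact smul_apply_eq_zero hj

theorem opG_apply_eq_zero {a : Fin r} {n N : ℤ} {f : FunR m q r}
    (h : ∀ w : Mode r, N ≤ mnum w → mode w f = 0) (hn : N ≤ n) : opG a n f = 0 := by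
  rw [(psum_opG a n).2 f]
  refine finsum_eq_zero_of_forall_eq_zero fun j => ?_
  have hj := nprod_apply_eq_zero (u := oMode a (-j)) (v := oMode a (2 * n + 1 + j)) h
    (by rw [mnum_oMode, mnum_oMode]; omega)
  exact smul_apply_eq_zero hj

end SuperAiry

end

/-! ### Vacuum expectation values and the super Virasoro relations. -/

noncomputable section

namespace SuperAiry

variable {m q r : ℕ} {ι κ : Type}

/-! ### Vacuum expectation values -/

theorem br_smul_left (e : ℕ) (x : ℂ) (D E : OpR m q r) : br e (x • D) E = x • br e D E := by
  simp only [br_apply, mul_smul_comm, smul_mul_assoc, smul_sub]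

theorem br_zero_left (e : ℕ) (E : OpR m q r) : br e 0 E = 0 := by
  rw [br_apply, mul_zero, zero_mul, sub_zero]

theorem evalZero_coord (j : (Fin r × ℕ+) ⊕ (Fin r × ℕ)) :
    evalZero (coord j : FunR m q r) = 0 := by
  rcases j with j | j
  · exact (SPoly.lift_evenGen ..).trans rfl
  · exact (SPoly.lift_oddGen ..).trans rfl

theorem evalZero_coord_mul (j : (Fin r × ℕ+) ⊕ (Fin r × ℕ)) (f : FunR m q r) :
    evalZero (coord j * f) = 0 := by
  rw [map_mul, evalZero_coord, zero_mul]

theorem mode_apply (u : Mode r) (f : FunR m q r) : mode u f =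
    modeCoord u • (coord (modeIx u) * f) + modeDeriv u • partialDeriv (modeIx u) f := by
  rw [mode_eq]; rfl

theorem mode_one (u : Mode r) :
    mode u (1 : FunR m q r) = modeCoord u • coord (modeIx u) := by
  rw [mode_apply, partialDeriv_one, smul_zero, add_zero, mul_one]

theorem modeDeriv_of_neg {u : Mode r} (hu : mnum u < 0) : modeDeriv u = 0 := by
  rcases u with ⟨a, k⟩ | ⟨a, k⟩
  · exact if_neg (by simp only [mnum] at hu; simp only; omega)
  · exact if_neg (by simp only [mnum] at hu; simp only; omega)

theorem evalZero_mode_of_neg {u : Mode r} (hu : mnum u < 0) (f : FunR m q r) :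
    evalZero (mode u f) = 0 := by
  rw [mode_apply, modeDeriv_of_neg hu, zero_smul, add_zero, map_smul, evalZero_coord_mul, smul_zero]

theorem mode_one_of_pos {u : Mode r} (hu : 1 ≤ mnum u) : mode u (1 : FunR m q r) = 0 := by
  rw [mode_one]
  rcases u with ⟨a, k⟩ | ⟨a, k⟩ <;> simp only [mnum] at hu
  · rw [modeCoord, if_neg (by simp only; omega), zero_smul]
  · rw [modeCoord, if_neg (by simp only; omega), if_neg (by simp only; omega), zero_smul]

theorem evalZero_mode_mode (w v : Mode r) : evalZero (mode w (mode v (1 : FunR m q r))) =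
    (open Classical in if modeIx w = modeIx v then modeDeriv w * modeCoord v else 0 : ℂ) •
      (1 : Params m q) := by
  classical
  rw [mode_one, map_smul, mode_apply, map_smul, map_add, map_smul, map_smul, evalZero_coord_mul,
    smul_zero, zero_add]
  have h := partialDeriv_coord_mul (m := m) (q := q) (modeIx w) (modeIx v) 1
  rw [mul_one, partialDeriv_one, mul_zero, smul_zero, add_zero] at h
  rw [h]
  by_cases hwv : modeIx w = modeIx v
  · rw [if_pos hwv, if_pos hwv, map_one, smul_smul, mul_comm]
  · rw [if_neg hwv, if_neg hwv, map_zero, smul_zero, smul_zero, zero_smul]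

theorem evalZero_mode_mode_of_ne {w v : Mode r} (h : mpar w ≠ mpar v) :
    evalZero (mode w (mode v (1 : FunR m q r))) = 0 := by
  rw [evalZero_mode_mode, if_neg, zero_smul]
  intro h'
  exact h (by rw [← par_modeIx, h', par_modeIx])

theorem evalZero_psum {F : ι → OpR m q r} {D : OpR m q r} (h : PSum F D) {f : FunR m q r}
    (hF : ∀ i, evalZero (F i f) = 0) : evalZero (D f) = 0 := by
  rw [h.2 f]
  refine (AddMonoidHom.map_finsum (evalZero : FunR m q r →ₐ[ℂ] _).toAddMonoidHom (h.1 f)).trans ?_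
  exact finsum_eq_zero_of_forall_eq_zero hF

/-- A mode of negative number multiplies by a coordinate, so the term in which it acts last vanishes
at the origin and only the bracket remains. -/
theorem evalZero_apply_mode {u : Mode r} (hu : mnum u < 0) (D : OpR m q r) (f : FunR m q r) :
    evalZero (D (mode u f)) = evalZero (ad (mpar u) (mode u) D f) := by
  rw [ad_apply, LinearMap.sub_apply, map_sub, Module.End.mul_apply, Module.End.mul_apply,
    evalZero_mode_of_neg hu, sub_zero]

theorem evalZero_nprod {u v : Mode r} (h : mnum u < 0 ∨ mnum v < 0) (f : FunR m q r) :
    evalZero (nprod u v f) = 0 := by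
  rw [nprod]
  split_ifs
  · rw [LinearMap.smul_apply, map_smul, Module.End.mul_apply, evalZero_mode_of_neg (by omega),
      smul_zero]
  · rw [Module.End.mul_apply, evalZero_mode_of_neg (by omega)]

theorem nprod_one {u v : Mode r} (h : 1 ≤ mnum u ∨ 1 ≤ mnum v) :
    nprod u v (1 : FunR m q r) = 0 :=
  nprod_apply_eq_zero (fun _ => mode_one_of_pos) h

/-- A factor of positive number kills $1$ and one of negative number has no vacuum value. What is
left is the pair of zero modes for `n = 0`, whose coefficient is zero, so only the constant
$\tfrac14$ survives. -/
theorem evalZero_opL (a : Fin r) (n : ℤ) :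
    evalZero (opL a n (1 : FunR m q r)) = (if n = 0 then (1 / 4 : ℂ) else 0) • 1 := by
  have h := evalZero_psum (psum_opL (m := m) (q := q) a n) (f := 1) fun j => ?_
  · rw [LinearMap.sub_apply, map_sub, sub_eq_zero] at h
    rw [h, LinearMap.smul_apply, map_smul, Module.End.one_apply, map_one]
  · rw [LinearMap.smul_apply, map_smul]
    by_cases h1 : 1 ≤ mnum (oMode a (-j)) ∨ 1 ≤ mnum (oMode a (2 * n + j))
    · rw [nprod_one h1, map_zero, smul_zero]
    by_cases h2 : mnum (oMode a (-j)) < 0 ∨ mnum (oMode a (2 * n + j)) < 0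
    · rw [evalZero_nprod h2, smul_zero]
    rw [mnum_oMode, mnum_oMode] at h1 h2
    obtain rfl : j = 0 := by omega
    obtain rfl : n = 0 := by omega
    simp [coeffL]

theorem opG_one {a : Fin r} {n : ℤ} (hn : 0 ≤ n) : opG a n (1 : FunR m q r) = 0 := by
  rw [(psum_opG a n).2 1]
  refine finsum_eq_zero_of_forall_eq_zero fun j => ?_
  have := nprod_one (m := m) (q := q) (u := oMode a (-j)) (v := oMode a (2 * n + 1 + j))
    (by rw [mnum_oMode, mnum_oMode]; omega)
  exact smul_apply_eq_zero this

theorem opG_neg_one_one (a : Fin r) :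
    opG a (-1) (1 : FunR m q r) = mode (oMode a (-1)) (mode (oMode a 0) 1) := by
  rw [(psum_opG a (-1)).2 1, finsum_eq_single _ 1]
  · rw [LinearMap.smul_apply, nprod, if_neg (by rw [mnum_oMode, mnum_oMode]; norm_num), coeffG,
      if_neg (by decide), one_smul]
    rfl
  · intro j hj
    by_cases h : 1 ≤ mnum (oMode a (-j)) ∨ 1 ≤ mnum (oMode a (2 * -1 + 1 + j))
    · exact smul_apply_eq_zero (nprod_one h)
    · rw [mnum_oMode, mnum_oMode] at h
      obtain rfl : j = 0 := by omega
      simp [coeffG]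

theorem evalZero_opG {a : Fin r} {n : ℤ} (hn : -1 ≤ n) :
    evalZero (opG a n (1 : FunR m q r)) = 0 := by
  by_cases h : 0 ≤ n
  · rw [opG_one h, map_zero]
  · obtain rfl : n = -1 := by omega
    rw [opG_neg_one_one, evalZero_mode_of_neg (by rw [mnum_oMode]; norm_num)]

/-! ### Operators that permute the modes of the untwisted sector -/

/-- Operators of parity `e` whose bracket with the mode `k` of the untwisted sector is `c k` times the
mode `s + k`, and which supercommute with all other modes. -/
structure IsModeOp (a : Fin r) (e : ℕ) (s : ℤ) (c : ℤ → ℂ) (D : OpR m q r) : Prop where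
  mem_RLin : D ∈ RLin m q (Fin r × ℕ+) (Fin r × ℕ)
  hasPar : HasPar e D
  parity : Even s ↔ Even e
  ad_oMode : ∀ k, ad (mpar (oMode a k)) (mode (oMode a k)) D = c k • mode (oMode a (s + k))
  ad_eq_zero : ∀ w, (∀ k, w ≠ oMode a k) → ad (mpar w) (mode w) D = 0
  ad_gammaDual : ∀ b, ad 1 (gammaDual b) D = 0

theorem pairing_oMode_of_ne {a : Fin r} {w : Mode r} (h : ∀ k, w ≠ oMode a k) (i : ℤ) :
    pairing (oMode a i) w = 0 := by
  obtain ⟨b, k, rfl | rfl⟩ := exists_eq_oMode_or_eMode w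
  · rw [pairing_oMode_oMode, if_neg]
    rintro ⟨rfl, -⟩
    exact h k rfl
  · exact pairing_oMode_eMode a b i k

theorem isModeOp_opL (a : Fin r) (n : ℤ) : IsModeOp a 0 (2 * n) (lam n) (opL a n : OpR m q r) where
  mem_RLin := Fil_le_RLin (opL_mem_Fil a n)
  hasPar := hasPar_opL a n
  parity := by simp
  ad_oMode := ad_oMode_opL a n
  ad_eq_zero w hw := ad_opL_eq_zero n fun i j =>
    ad_nprod_eq_zero (pairing_oMode_of_ne hw i) (pairing_oMode_of_ne hw j)
  ad_gammaDual b := ad_opL_eq_zero n fun _ _ => ad_gammaDual_nprod b _ _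

theorem isModeOp_opG (a : Fin r) (n : ℤ) :
    IsModeOp a 1 (2 * n + 1) (fun k => gam k) (opG a n : OpR m q r) where
  mem_RLin := Fil_le_RLin (opG_mem_Fil a n)
  hasPar := hasPar_opG a n
  parity := by simp [Int.even_add]
  ad_oMode := ad_oMode_opG a n
  ad_eq_zero w hw := ad_opG_eq_zero n fun i j =>
    ad_nprod_eq_zero (pairing_oMode_of_ne hw i) (pairing_oMode_of_ne hw j)
  ad_gammaDual b := ad_opG_eq_zero n fun _ _ => ad_gammaDual_nprod b _ _

theorem HasPar.br_eq_ad {d e : ℕ} {D Y : OpR m q r} (hD : HasPar d D) (hY : HasPar e Y) :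
    SuperAiry.br d D Y = SuperAiry.ad e Y D := by
  rw [br_apply, ad_apply, hD.pow, hY.pow, mul_comm d e, smul_mul_assoc, mul_smul_comm]

theorem br_mem_RLin {e : ℕ} {D E : OpR m q r} (hD : D ∈ RLin m q (Fin r × ℕ+) (Fin r × ℕ))
    (hE : E ∈ RLin m q (Fin r × ℕ+) (Fin r × ℕ)) :
    br e D E ∈ RLin m q (Fin r × ℕ+) (Fin r × ℕ) := by
  rw [br_apply]
  exact sub_mem (mul_mem hD hE) (mul_mem (sgn_pow_mem_RLin hE _) hD)

namespace IsModeOp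

variable {a : Fin r} {d e : ℕ} {s t : ℤ} {b c : ℤ → ℂ} {D E : OpR m q r}

theorem smul (h : IsModeOp a e s c D) (x : ℂ) : IsModeOp a e s (fun k => x * c k) (x • D) where
  mem_RLin := Subalgebra.smul_mem _ h.mem_RLin x
  hasPar := h.hasPar.smul x
  parity := h.parity
  ad_oMode k := by rw [map_smul, h.ad_oMode, smul_smul]
  ad_eq_zero w hw := by rw [map_smul, h.ad_eq_zero w hw, smul_zero]
  ad_gammaDual b := by rw [map_smul, h.ad_gammaDual, smul_zero]

theorem br_eq_zero (h : IsModeOp a e s c D) {w : Mode r} (hw : ∀ k, w ≠ oMode a k) :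
    SuperAiry.br e D (mode w) = 0 := by
  rw [h.hasPar.br_eq_ad (hasPar_mode w), h.ad_eq_zero w hw]

theorem br_oMode (h : IsModeOp a e s c D) (k : ℤ) :
    SuperAiry.br e D (mode (oMode a k)) = c k • mode (oMode a (s + k)) := by
  rw [h.hasPar.br_eq_ad (hasPar_mode _), h.ad_oMode]

/-- By the Jacobi identity, the structure constants of a bracket are those of the supercommutator of
two weighted shifts of the modes. -/
theorem br (hD : IsModeOp a d s b D) (hE : IsModeOp a e t c E) :
    IsModeOp a (d + e) (s + t) (fun k => c k * b (t + k) - (-1) ^ (d * e) * (b k * c (s + k)))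
      (SuperAiry.br d D E) where
  mem_RLin := br_mem_RLin hD.mem_RLin hE.mem_RLin
  hasPar := hD.hasPar.br hE.hasPar
  parity := by rw [Int.even_add, Nat.even_add, hD.parity, hE.parity]
  ad_oMode k := by
    have h1 : HasPar (d + mpar (oMode a k)) (mode (oMode a (s + k)) : OpR m q r) := by
      refine (hasPar_mode _).congr ?_
      rw [mpar_oMode, mpar_oMode]
      have hp := hD.parity
      by_cases hk : Even k <;> by_cases hs : Even s
      · simp [Int.even_add, hk, hs, (hp.mp hs).neg_one_pow, pow_add]
      · simp [Int.even_add, hk, hs, (Nat.not_even_iff_odd.mp (mt hp.mpr hs)).neg_one_pow, pow_add]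
      · simp [Int.even_add, hk, hs, (hp.mp hs).neg_one_pow, pow_add]
      · simp [Int.even_add, hk, hs, (Nat.not_even_iff_odd.mp (mt hp.mpr hs)).neg_one_pow, pow_add]
    rw [ad_br (hasPar_mode _) hD.hasPar, hD.ad_oMode, hE.ad_oMode, map_smul, hD.br_oMode,
      hE.hasPar.pow, map_smul, br_smul_left, h1.br_swap hE.hasPar, hE.br_oMode, smul_smul, smul_smul,
      smul_smul, smul_smul, add_assoc s, ← add_assoc t, ← add_assoc s, add_comm t s, add_assoc s,
      ← add_smul]
    congr 1
    rw [sub_eq_add_neg]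
    congr 1
    have h2 : ((-1 : ℂ) ^ (e * mpar (oMode a k))) ^ 2 = 1 := by rw [← pow_mul, mul_comm, pow_mul]; simp
    have h3 : (-1 : ℂ) ^ ((d + mpar (oMode a k)) * e) =
        (-1) ^ (d * e) * (-1) ^ (e * mpar (oMode a k)) := by
      rw [add_mul, pow_add, mul_comm e]
    rw [h3]
    linear_combination (-(-1) ^ (d * e) * (b k * c (s + k))) * h2
  ad_eq_zero w hw := by
    rw [ad_br (hasPar_mode _) hD.hasPar, hD.ad_eq_zero w hw, hE.ad_eq_zero w hw, map_zero, zero_add,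
      br_zero_left]
  ad_gammaDual b := by
    rw [ad_br (hasPar_gammaDual b) hD.hasPar, hD.ad_gammaDual, hE.ad_gammaDual, map_zero, zero_add,
      br_zero_left]

theorem congr (h : IsModeOp a e s c D) {e' : ℕ} {t : ℤ} (he : (-1 : ℂ) ^ e = (-1) ^ e')
    (hp : Even e ↔ Even e') (hs : s = t) (hc : ∀ k, c k = b k) : IsModeOp a e' t b D where
  mem_RLin := h.mem_RLin
  hasPar := h.hasPar.congr he
  parity := by rw [← hs, h.parity, hp]
  ad_oMode k := by rw [h.ad_oMode, hc, hs]
  ad_eq_zero := h.ad_eq_zero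
  ad_gammaDual := h.ad_gammaDual

/-- The difference supercommutes with all modes and with the second zero mode, so it is a constant,
which the vacuum expectation value detects. Bracket relations thus reduce to arithmetic of structure
constants and one number. -/
theorem eq (hD : IsModeOp a e s c D) (hE : IsModeOp a e s c E)
    (h : evalZero (D 1) = evalZero (E 1)) : D = E := by
  rw [← sub_eq_zero, eq_const_of_ad_mode (sub_mem hD.mem_RLin hE.mem_RLin), LinearMap.sub_apply,
    map_sub, h, sub_self, map_zero, mulOp_zero]
  · intro w
    rw [map_sub]
    by_cases hw : ∃ k, w = oMode a k
    · obtain ⟨k, rfl⟩ := hw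
      rw [hD.ad_oMode, hE.ad_oMode, sub_self]
    · rw [not_exists] at hw
      rw [hD.ad_eq_zero w hw, hE.ad_eq_zero w hw, sub_self]
  · intro b
    rw [map_sub, hD.ad_gammaDual, hE.ad_gammaDual, sub_self]

theorem br_nprod_eq_zero (h : IsModeOp a e s c D) {b : Fin r} (hab : a ≠ b) (i j : ℤ) :
    SuperAiry.br e D (nprod (oMode b i) (oMode b j)) = 0 := by
  have hne : ∀ i k, oMode b i ≠ oMode a k := fun i k hik => by
    rw [oMode, oMode] at hik
    split_ifs at hik <;> simp_all
  rw [nprod_eq_sub, map_sub, map_smul, br_mul, h.br_eq_zero (hne i), h.br_eq_zero (hne j), mul_zero,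
    zero_mul, add_zero, br_apply, map_one, mul_one, one_mul, sub_self, smul_zero, sub_self]

theorem br_opL_eq_zero (h : IsModeOp a e s c D) {b : Fin r} (hab : a ≠ b) (n : ℤ) :
    SuperAiry.br e D (opL b n) = 0 := by
  have h' := (psum_opL (m := m) (q := q) b n).br e D
  have h1 : SuperAiry.br e D 1 = 0 := by
    rw [br_apply, map_one, mul_one, one_mul, sub_self]
  rw [map_sub, map_smul, h1, smul_zero, sub_zero] at h'
  exact h'.unique (PSum.zero.congr fun j => by rw [map_smul, h.br_nprod_eq_zero hab, smul_zero])

theorem br_opG_eq_zero (h : IsModeOp a e s c D) {b : Fin r} (hab : a ≠ b) (n : ℤ) :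
    SuperAiry.br e D (opG b n) = 0 :=
  ((psum_opG (m := m) (q := q) b n).br e D).unique
    (PSum.zero.congr fun j => by rw [map_smul, h.br_nprod_eq_zero hab, smul_zero])

theorem evalZero_opG_neg_one (h : IsModeOp a e s c D) : evalZero (D (opG a (-1) 1)) =
    c (-1) • evalZero (mode (oMode a (s + -1)) (mode (oMode a 0) (1 : FunR m q r))) := by
  rw [opG_neg_one_one, evalZero_apply_mode (by rw [mnum_oMode]; norm_num), h.ad_oMode,
    LinearMap.smul_apply, map_smul]

/-- Either a factor kills $1$, or the left factor has negative number and is replaced by its bracket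
with `D`. The condition `hs` says that the two remaining modes then have different parity, so their
vacuum value is zero. -/
theorem evalZero_nprod_eq_zero (h : IsModeOp a e s c D) {i j : ℤ} (hij : ¬ (i = 0 ∧ j = 0))
    (hs : Even (s + i) ↔ ¬ Even j) :
    evalZero (D (nprod (oMode a i) (oMode a j) 1)) = 0 := by
  by_cases h1 : 1 ≤ mnum (oMode a i) ∨ 1 ≤ mnum (oMode a j)
  · rw [nprod_one h1, map_zero, map_zero]
  rw [mnum_oMode, mnum_oMode] at h1
  have key : ∀ i j : ℤ, i < 0 → (Even (s + i) ↔ ¬ Even j) →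
      evalZero (D ((mode (oMode a i) * mode (oMode a j) : OpR m q r) 1)) = 0 := fun i j hi hs => by
    rw [Module.End.mul_apply, evalZero_apply_mode (by rwa [mnum_oMode]), h.ad_oMode,
      LinearMap.smul_apply, map_smul, evalZero_mode_mode_of_ne, smul_zero]
    rw [mpar_oMode, mpar_oMode]
    by_cases hj : Even j <;> simp [hs, hj]
  rw [nprod, mnum_oMode, mnum_oMode]
  split_ifs
  · rw [LinearMap.smul_apply, map_smul, map_smul, key j i (by omega) (by
      rw [Int.even_add] at hs ⊢; tauto), smul_zero]
  · exact key i j (by omega) hs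

end IsModeOp

/-! ### The super Virasoro relations -/

variable {a : Fin r}

/-- In this range the only non-zero vacuum value of a product is the one of `opG a 0` and `opG a
(-1)`, equal to $\tfrac12$. It matches twice the constant $\tfrac14$ in the zero mode of `opL`, so
there is no central term. -/
theorem br_opG_opG {k l : ℤ} (hk : -1 ≤ k) (hl : -1 ≤ l) :
    br 1 (opG a k) (opG a l) = (2 : ℂ) • (opL a (k + l + 1) : OpR m q r) := by
  have key : ∀ k l : ℤ, -1 ≤ k → -1 ≤ l → evalZero (opG a k (opG a l (1 : FunR m q r))) =
      (if k = 0 ∧ l = -1 then (1 / 2 : ℂ) else 0) • 1 := fun k l hk hl => by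
    by_cases hl' : 0 ≤ l
    · rw [opG_one hl', map_zero, map_zero, if_neg (by omega), zero_smul]
    · obtain rfl : l = -1 := by omega
      rw [(isModeOp_opG a k).evalZero_opG_neg_one, evalZero_mode_mode, smul_smul]
      congr 1
      have e : Even (2 * k + 1 + -1) := by simp
      rw [oMode, oMode, if_pos e, if_pos Even.zero]
      by_cases hk0 : k = 0
      · subst hk0
        rw [if_pos (by simp [modeIx]), if_pos ⟨rfl, rfl⟩]
        simp [gam, modeDeriv, modeCoord]
      · rw [if_neg, if_neg (by tauto), mul_zero]
        simpa [modeIx, ixF] using hk0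
  refine (((isModeOp_opG a k).br (isModeOp_opG a l)).congr (e' := 0) (t := 2 * (k + l + 1))
    (b := fun i => 2 * lam (k + l + 1) i) (by norm_num) (by simp) (by ring) fun i => ?_).eq
    ((isModeOp_opL a (k + l + 1)).smul 2) ?_
  · simp only [gam, lam]
    have hk' := Int.not_odd_iff_even.mpr (even_two_mul k)
    have hl' := Int.not_odd_iff_even.mpr (even_two_mul l)
    by_cases hi : Even i <;> simp [Int.even_add, hi, hk', hl'] <;> ring
  · rw [br_apply, (hasPar_opG a l).pow, LinearMap.sub_apply, smul_mul_assoc, LinearMap.smul_apply,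
      map_sub, map_smul, Module.End.mul_apply, Module.End.mul_apply, key k l hk hl, key l k hl hk,
      LinearMap.smul_apply, map_smul, evalZero_opL, smul_smul, smul_smul, ← sub_smul]
    congr 1
    by_cases h1 : k = 0 ∧ l = -1
    · rw [if_pos h1, if_neg (by omega), if_pos (by omega)]; norm_num
    · by_cases h2 : l = 0 ∧ k = -1
      · rw [if_neg h1, if_pos h2, if_pos (by omega)]; norm_num
      · by_cases h3 : k = -1 ∧ l = 0
        · omega
        · rw [if_neg h1, if_neg h2, if_neg (by omega)]; norm_num

theorem br_opL_opG {k l : ℤ} (hk : -1 ≤ k) (hl : -1 ≤ l) :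
    br 0 (opL a k) (opG a l) = ((k : ℂ) - 2 * l - 1) • (opG a (k + l) : OpR m q r) := by
  refine (((isModeOp_opL a k).br (isModeOp_opG a l)).congr (e' := 1) (t := 2 * (k + l) + 1)
    (b := fun i => ((k : ℂ) - 2 * l - 1) * gam i) (by norm_num) (by simp) (by ring) fun i => ?_).eq
    ((isModeOp_opG a (k + l)).smul _) ?_
  · simp only [gam, lam]
    have hk' := Int.not_odd_iff_even.mpr (even_two_mul k)
    have hl' := Int.not_odd_iff_even.mpr (even_two_mul l)
    by_cases hi : Even i <;> simp [Int.even_add, hi, hk', hl'] <;> ring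
  · have h1 : evalZero (opL a k (opG a l (1 : FunR m q r))) = 0 := by
      by_cases hl' : 0 ≤ l
      · rw [opG_one hl', map_zero, map_zero]
      · obtain rfl : l = -1 := by omega
        rw [(isModeOp_opL a k).evalZero_opG_neg_one, evalZero_mode_mode_of_ne, smul_zero]
        rw [mpar_oMode, mpar_oMode]
        simp [Int.even_add]
    have h2 : evalZero (opG a l (opL a k (1 : FunR m q r))) = 0 := by
      have h := evalZero_psum ((psum_opL (m := m) (q := q) a k).mul_left (opG a l)) (f := 1)
        fun j => ?_
      · rw [Module.End.mul_apply, LinearMap.sub_apply, map_sub, map_sub, LinearMap.smul_apply,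
          map_smul, map_smul, Module.End.one_apply, evalZero_opG hl, smul_zero, sub_zero] at h
        exact h
      · rw [Module.End.mul_apply, LinearMap.smul_apply, map_smul, map_smul]
        by_cases h0 : -j = 0 ∧ 2 * k + j = 0
        · obtain rfl : j = 0 := by omega
          obtain rfl : k = 0 := by omega
          simp [coeffL]
        · rw [(isModeOp_opG a l).evalZero_nprod_eq_zero h0, smul_zero]
          by_cases hj : Even j <;> simp [Int.even_add, hj]
    -- The index can leave the range only for `k = l = -1`, and then the coefficient is zero.
    have h3 : evalZero (((k : ℂ) - 2 * l - 1) • (opG a (k + l) : OpR m q r) 1) = 0 := by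
      by_cases hkl : -1 ≤ k + l
      · rw [map_smul, evalZero_opG hkl, smul_zero]
      · obtain rfl : k = -1 := by omega
        obtain rfl : l = -1 := by omega
        norm_num
    rw [br_apply, pow_zero, AlgHom.one_apply, LinearMap.sub_apply, map_sub, Module.End.mul_apply,
      Module.End.mul_apply, h1, h2, sub_zero, LinearMap.smul_apply, h3]

theorem ring_jacobi {S : Type*} [Ring S] (x a b c : S) :
    x * (a * b) - a * b * x - (x * (c * a) - c * a * x) =
      (x * a - a * x) * b - c * (x * a - a * x) +
        (a * (x * b) - x * c * a - (a * (b * x) - c * x * a)) := by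
  noncomm_ring

theorem br_zero_br_one {X A B : OpR m q r} (hA : HasPar 1 A) (hXA : HasPar 1 (br 0 X A))
    (hX : HasPar 0 X) :
    br 0 X (br 1 A B) = br 1 (br 0 X A) B + br 1 A (br 0 X B) := by
  have hX' : sgn X = X := hX.trans (by rw [pow_zero, one_smul])
  simp only [br_apply, pow_zero, pow_one, AlgHom.one_apply, map_sub, map_mul, hX']
  exact ring_jacobi X A B (sgn B)

/-- The operator `opL a l` is half the bracket of `opG a (-1)` and `opG a l`, so the Jacobi identity
reduces everything to the two previous relations and no further vacuum value is needed. -/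
theorem br_opL_opL {k l : ℤ} (hk : -1 ≤ k) (hl : -1 ≤ l) :
    br 0 (opL a k) (opL a l) = (2 * ((k : ℂ) - l)) • (opL a (k + l) : OpR m q r) := by
  have hl2 : (opL a l : OpR m q r) = (1 / 2 : ℂ) • br 1 (opG a (-1)) (opG a l) := by
    rw [br_opG_opG le_rfl hl, smul_smul, show -1 + l + 1 = l by ring]
    norm_num
  have h1 : br 1 (((k : ℂ) + 1) • (opG a (k + -1) : OpR m q r)) (opG a l) =
      (2 * ((k : ℂ) + 1)) • opL a (k + l) := by
    -- The relation for two odd operators is not available at index `-2`, but the coefficient $k+1$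
    -- vanishes in that case.
    by_cases hk' : k = -1
    · subst hk'
      norm_num
      rw [br_zero_left]
    · rw [br_smul_left, br_opG_opG (by omega) hl, smul_smul, show k + -1 + l + 1 = k + l by ring,
        mul_comm]
  have h2 : br 1 (opG a (-1)) (((k : ℂ) - 2 * l - 1) • (opG a (k + l) : OpR m q r)) =
      (2 * ((k : ℂ) - 2 * l - 1)) • opL a (k + l) := by
    by_cases hkl : -1 ≤ k + l
    · rw [map_smul, br_opG_opG le_rfl hkl, smul_smul, show -1 + (k + l) + 1 = k + l by ring, mul_comm]
    · obtain rfl : k = -1 := by omega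
      obtain rfl : l = -1 := by omega
      norm_num
  have h3 := br_opL_opG (m := m) (q := q) (a := a) hk (l := -1) le_rfl
  rw [show (k : ℂ) - 2 * ((-1 : ℤ) : ℂ) - 1 = k + 1 by push_cast; ring] at h3
  have h4 := br_opL_opG (m := m) (q := q) (a := a) hk hl
  have hp := ((isModeOp_opL (m := m) (q := q) a k).br (isModeOp_opG a (-1))).hasPar
  rw [zero_add] at hp
  have h5 := br_zero_br_one (B := (opG a l : OpR m q r)) (hasPar_opG a (-1)) hp (hasPar_opL a k)
  rw [h3, h4, h1, h2, ← add_smul] at h5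
  rw [hl2, map_smul, h5, smul_smul]
  congr 1
  ring

end SuperAiry

end

/-! ### Exponentials of inner derivations. -/

noncomputable section

namespace SuperAiry

/-! ### Exponentials of inner derivations -/

section Exp

variable {S : Type*} [Ring S] [Algebra ℂ S]

/-- The inner derivation `Y ↦ X Y - Y X`. -/
def adj (X : S) : S →ₗ[ℂ] S := LinearMap.mulLeft ℂ X - LinearMap.mulRight ℂ X

theorem adj_apply (X Y : S) : adj X Y = X * Y - Y * X := rfl

theorem adj_mul (X Y Z : S) : adj X (Y * Z) = Y * adj X Z + adj X Y * Z := by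
  simp only [adj_apply]; noncomm_ring

theorem adj_iterate_map_sum {ι : Type*} (X : S) (n : ℕ) (s : Finset ι) (f : ι → S) :
    (adj X)^[n] (∑ i ∈ s, f i) = ∑ i ∈ s, (adj X)^[n] (f i) := by
  rw [← Module.End.coe_pow, map_sum]

theorem adj_iterate_zero (X : S) (n : ℕ) : (adj X)^[n] 0 = 0 := by
  rw [← Module.End.coe_pow, map_zero]

theorem adj_iterate_add (X Y Z : S) (n : ℕ) :
    (adj X)^[n] (Y + Z) = (adj X)^[n] Y + (adj X)^[n] Z := by
  rw [← Module.End.coe_pow, map_add]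

theorem adj_iterate_sub (X Y Z : S) (n : ℕ) :
    (adj X)^[n] (Y - Z) = (adj X)^[n] Y - (adj X)^[n] Z := by
  rw [← Module.End.coe_pow, map_sub]

theorem adj_iterate_smul (X Y : S) (c : ℂ) (n : ℕ) :
    (adj X)^[n] (c • Y) = c • (adj X)^[n] Y := by
  rw [← Module.End.coe_pow, map_smul]

theorem adj_iterate_eq_zero_of_le {X Y : S} {k n : ℕ} (h : (adj X)^[k] Y = 0) (hkn : k ≤ n) :
    (adj X)^[n] Y = 0 := by
  rw [← Nat.sub_add_cancel hkn, Function.iterate_add_apply, h, adj_iterate_zero]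

theorem adj_iterate_mul (X Y Z : S) (n : ℕ) : (adj X)^[n] (Y * Z) =
    ∑ p ∈ Finset.HasAntidiagonal.antidiagonal n,
      n.choose p.1 • ((adj X)^[p.1] Y * (adj X)^[p.2] Z) := by
  induction n with
  | zero => simp
  | succ n ih =>
    rw [Function.iterate_succ_apply', ih, map_sum, Finset.sum_antidiagonal_choose_succ_nsmul
      (fun i j => (adj X)^[i] Y * (adj X)^[j] Z) n, ← Finset.sum_add_distrib]
    refine Finset.sum_congr rfl fun p hp => ?_
    rw [map_nsmul, adj_mul, nsmul_add, ← Function.iterate_succ_apply' (adj X),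
      ← Function.iterate_succ_apply' (adj X)]
    congr 2
    exact (Nat.choose_symm_of_eq_add (Finset.HasAntidiagonal.mem_antidiagonal.mp hp).symm)

theorem adj_iterate_mul_eq_zero {X Y Z : S} {k l n : ℕ} (hY : (adj X)^[k] Y = 0)
    (hZ : (adj X)^[l] Z = 0) (h : k + l ≤ n + 1) : (adj X)^[n] (Y * Z) = 0 := by
  rw [adj_iterate_mul]
  refine Finset.sum_eq_zero fun p hp => ?_
  have := Finset.HasAntidiagonal.mem_antidiagonal.mp hp
  by_cases hk : k ≤ p.1
  · rw [adj_iterate_eq_zero_of_le hY hk, zero_mul, nsmul_zero]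
  · rw [adj_iterate_eq_zero_of_le hZ (by omega), mul_zero, nsmul_zero]

/-- `exp(X) Y exp(-X)`, for `Y` on which the inner derivation of `X` is nilpotent. -/
def expAdj (X Y : S) : S := ∑ᶠ n : ℕ, ((n.factorial : ℂ)⁻¹) • (adj X)^[n] Y

theorem expAdj_eq_sum {X Y : S} {N : ℕ} (h : (adj X)^[N] Y = 0) :
    expAdj X Y = ∑ n ∈ Finset.range N, ((n.factorial : ℂ)⁻¹) • (adj X)^[n] Y := by
  refine finsum_eq_sum_of_support_subset _ fun n hn => ?_
  rw [Finset.coe_range, Set.mem_Iio]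
  by_contra hn'
  exact hn (by simp only [adj_iterate_eq_zero_of_le h (not_lt.mp hn'), smul_zero])

theorem expAdj_of_adj_eq_zero {X Y : S} (h : adj X Y = 0) : expAdj X Y = Y := by
  rw [expAdj_eq_sum (N := 1) h]; simp

theorem expAdj_add {X Y Z : S} {N : ℕ} (hY : (adj X)^[N] Y = 0) (hZ : (adj X)^[N] Z = 0) :
    expAdj X (Y + Z) = expAdj X Y + expAdj X Z := by
  rw [expAdj_eq_sum hY, expAdj_eq_sum hZ, expAdj_eq_sum (N := N), ← Finset.sum_add_distrib]
  · exact Finset.sum_congr rfl fun n _ => by rw [adj_iterate_add, smul_add]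
  · rw [adj_iterate_add, hY, hZ, add_zero]

theorem expAdj_smul {X Y : S} {N : ℕ} (hY : (adj X)^[N] Y = 0) (c : ℂ) :
    expAdj X (c • Y) = c • expAdj X Y := by
  rw [expAdj_eq_sum hY, expAdj_eq_sum (N := N), Finset.smul_sum]
  · exact Finset.sum_congr rfl fun n _ => by rw [adj_iterate_smul, smul_comm]
  · rw [adj_iterate_smul, hY, smul_zero]

/-- The exponential of a derivation is multiplicative. Nilpotency on both factors gives nilpotency
on the product with twice the bound, so all sums are finite and the double sum can be grouped by
total order. -/
theorem expAdj_mul {X Y Z : S} {N : ℕ} (hY : (adj X)^[N] Y = 0) (hZ : (adj X)^[N] Z = 0) :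
    expAdj X (Y * Z) = expAdj X Y * expAdj X Z := by
  rw [expAdj_eq_sum hY, expAdj_eq_sum hZ, expAdj_eq_sum
    (adj_iterate_mul_eq_zero hY hZ (n := N + N) (by omega)), Finset.sum_mul_sum,
    ← Finset.sum_product', ← Finset.sum_fiberwise_of_maps_to (t := Finset.range (N + N))
      (g := fun p : ℕ × ℕ => p.1 + p.2)]
  · refine Finset.sum_congr rfl fun n _ => ?_
    rw [adj_iterate_mul, Finset.smul_sum]
    symm
    have e : ∀ p ∈ Finset.HasAntidiagonal.antidiagonal n, ((n.factorial : ℂ)⁻¹) •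
        (n.choose p.1 • ((adj X)^[p.1] Y * (adj X)^[p.2] Z)) =
        ((p.1.factorial : ℂ)⁻¹) • (adj X)^[p.1] Y * ((p.2.factorial : ℂ)⁻¹) • (adj X)^[p.2] Z :=
      fun p hp => by
        have hp' := Finset.HasAntidiagonal.mem_antidiagonal.mp hp
        rw [smul_mul_smul_comm, ← Nat.cast_smul_eq_nsmul ℂ, smul_smul]
        congr 1
        have h1 := Nat.add_choose_mul_factorial_mul_factorial p.1 p.2
        rw [hp', ← Nat.choose_symm_of_eq_add hp'.symm] at h1
        have h2 : (n.choose p.1 : ℂ) * p.1.factorial * p.2.factorial = n.factorial := by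
          exact_mod_cast h1
        have h3 : (p.1.factorial : ℂ) ≠ 0 := by exact_mod_cast p.1.factorial_ne_zero
        have h4 : (p.2.factorial : ℂ) ≠ 0 := by exact_mod_cast p.2.factorial_ne_zero
        have h5 : (n.factorial : ℂ) ≠ 0 := by exact_mod_cast n.factorial_ne_zero
        field_simp
        linear_combination h2
    rw [Finset.sum_congr rfl e]
    -- Pairs on the antidiagonal outside the square of side `N` contribute nothing, since one of the
    -- two iterates already vanishes.
    refine Finset.sum_subset (fun p hp => ?_) fun p hp hp' => ?_
    · exact Finset.HasAntidiagonal.mem_antidiagonal.mpr (Finset.mem_filter.mp hp).2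
    · simp only [Finset.mem_filter, Finset.mem_product, Finset.mem_range,
        Finset.HasAntidiagonal.mem_antidiagonal.mp hp, and_true, not_and_or, not_lt] at hp'
      rcases hp' with hp' | hp'
      · rw [adj_iterate_eq_zero_of_le hY hp', smul_zero, zero_mul]
      · rw [adj_iterate_eq_zero_of_le hZ hp', smul_zero, mul_zero]
  · intro p hp
    have := Finset.mem_product.mp hp
    rw [Finset.mem_range, Finset.mem_range] at this
    rw [Finset.mem_range]
    omega

end Exp

variable {m q : ℕ} {A₀ A₁ : Type} {ι κ : Type}

/-! ### Conjugation of operator-valued series -/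

theorem adj_hbarPow (k l : ℤ) (X Y : Op m q A₀ A₁) :
    adj (hbarPow k X) (hbarPow l Y) = hbarPow (k + l) (adj X Y) := by
  refine hop_ext fun n => ?_
  rw [adj_apply, hbarPow, hbarPow, HahnSeries.single_mul_single, HahnSeries.single_mul_single,
    add_comm l k, HahnSeries.coeff_sub, hbarPow, adj_apply]
  by_cases h : n = k + l
  · subst h
    simp only [HahnSeries.coeff_single_same]
  · simp only [HahnSeries.coeff_single_of_ne h, sub_zero]

theorem adj_iterate_hbarPow (k l : ℤ) (X Y : Op m q A₀ A₁) (n : ℕ) :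
    (adj (hbarPow k X))^[n] (hbarPow l Y) = hbarPow (n * k + l) ((adj X)^[n] Y) := by
  induction n with
  | zero => simp
  | succ n ih =>
    rw [Function.iterate_succ_apply', ih, adj_hbarPow, Function.iterate_succ_apply']
    congr 1
    push_cast
    ring

theorem coeff_adj_hbarPow (k n : ℤ) (X : Op m q A₀ A₁) (Z : HOp m q A₀ A₁) :
    (adj (hbarPow k X) Z).coeff n = adj X (Z.coeff (n - k)) := by
  rw [adj_apply, HahnSeries.coeff_sub, adj_apply]
  congr 1
  · have h := HahnSeries.coeff_single_mul_add (r := X) (x := Z) (a := n - k) (b := k)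
    rw [sub_add_cancel] at h
    exact h
  · have h := HahnSeries.coeff_mul_single_add (r := X) (x := Z) (a := n - k) (b := k)
    rw [sub_add_cancel] at h
    exact h

theorem coeff_adj_iterate_hbarPow (k : ℤ) (X : Op m q A₀ A₁) (Z : HOp m q A₀ A₁) (i : ℕ) (n : ℤ) :
    ((adj (hbarPow k X))^[i] Z).coeff n = (adj X)^[i] (Z.coeff (n - i * k)) := by
  induction i generalizing n with
  | zero => simp
  | succ i ih =>
    rw [Function.iterate_succ_apply', coeff_adj_hbarPow, ih, Function.iterate_succ_apply']
    congr 3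
    push_cast
    ring

theorem PFin.adj_iterate {F : ι → Op m q A₀ A₁} (h : PFin F) (X : Op m q A₀ A₁) (n : ℕ) :
    PFin fun i => (adj X)^[n] (F i) := by
  induction n with
  | zero => exact h
  | succ n ih =>
    simp only [Function.iterate_succ_apply']
    exact (ih.mul_left fun _ => X).sub (ih.mul_right X)

theorem PSum.adj_iterate {F : ι → Op m q A₀ A₁} {D : Op m q A₀ A₁} (h : PSum F D)
    (X : Op m q A₀ A₁) (n : ℕ) : PSum (fun i => (adj X)^[n] (F i)) ((adj X)^[n] D) := by
  induction n with
  | zero => exact h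
  | succ n ih =>
    simp only [Function.iterate_succ_apply']
    exact (ih.mul_left X).sub (ih.mul_right X)

theorem PSum.adj_iterate_eq_zero {F : ι → Op m q A₀ A₁} {D : Op m q A₀ A₁} (h : PSum F D)
    {X : Op m q A₀ A₁} {n : ℕ} (hF : ∀ i, (adj X)^[n] (F i) = 0) : (adj X)^[n] D = 0 :=
  (h.adj_iterate X n).unique (PSum.zero.congr fun i => (hF i).symm)

theorem coeff_hop_sum (s : Finset ι) (F : ι → HOp m q A₀ A₁) (n : ℤ) :
    (∑ i ∈ s, F i).coeff n = ∑ i ∈ s, (F i).coeff n := by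
  classical
  induction s using Finset.induction_on with
  | empty => rfl
  | insert i s hi ih => rw [Finset.sum_insert hi, Finset.sum_insert hi, HahnSeries.coeff_add, ih]

theorem coeff_expAdj {k : ℤ} {X : Op m q A₀ A₁} {Z : HOp m q A₀ A₁} {N : ℕ}
    (h : (adj (hbarPow k X))^[N] Z = 0) (n : ℤ) : (expAdj (hbarPow k X) Z).coeff n =
      ∑ i ∈ Finset.range N, ((i.factorial : ℂ)⁻¹) • (adj X)^[i] (Z.coeff (n - i * k)) := by
  rw [expAdj_eq_sum h]
  refine (coeff_hop_sum _ _ n).trans (Finset.sum_congr rfl fun i _ => ?_)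
  rw [← coeff_adj_iterate_hbarPow]
  rfl

/-- A bound `N` common to the whole family turns every coefficient of the exponential into a sum
with a fixed number of terms, each pointwise finite. -/
theorem HFin.expAdj {F : ι → HOp m q A₀ A₁} (hF : HFin F) {k : ℤ} {X : Op m q A₀ A₁} {N : ℕ}
    (h : ∀ i, (adj (hbarPow k X))^[N] (F i) = 0) :
    HFin fun i => SuperAiry.expAdj (hbarPow k X) (F i) := fun n => by
  simp only [coeff_expAdj (h _)]
  exact PFin.finset_sum _ fun j _ => PFin.smul (PFin.adj_iterate (hF _) X j) _

theorem IsSum.adj_iterate_eq_zero {F : ι → HOp m q A₀ A₁} {Z : HOp m q A₀ A₁} (hF : IsSum F Z)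
    {k : ℤ} {X : Op m q A₀ A₁} {N : ℕ} (h : ∀ i, (adj (hbarPow k X))^[N] (F i) = 0) :
    (adj (hbarPow k X))^[N] Z = 0 :=
  hop_ext fun n => by
    rw [coeff_adj_iterate_hbarPow]
    refine (isSum_iff.mp hF _).adj_iterate_eq_zero fun i => ?_
    rw [← coeff_adj_iterate_hbarPow, h]
    rfl

theorem IsSum.expAdj {F : ι → HOp m q A₀ A₁} {Z : HOp m q A₀ A₁} (hF : IsSum F Z) {k : ℤ}
    {X : Op m q A₀ A₁} {N : ℕ} (h : ∀ i, (adj (hbarPow k X))^[N] (F i) = 0) :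
    IsSum (fun i => SuperAiry.expAdj (hbarPow k X) (F i)) (SuperAiry.expAdj (hbarPow k X) Z) := by
  refine isSum_iff.mpr fun n => ?_
  simp only [coeff_expAdj (h _), coeff_expAdj (hF.adj_iterate_eq_zero h)]
  exact PSum.finset_sum _ fun j _ => (PSum.adj_iterate (isSum_iff.mp hF _) X j).smul _

theorem expAdj_hbarPow {k l : ℤ} {X Y : Op m q A₀ A₁} {N : ℕ} (h : (adj X)^[N] Y = 0) :
    expAdj (hbarPow k X) (hbarPow l Y) =
      ∑ n ∈ Finset.range N, hbarPow (n * k + l) (((n.factorial : ℂ)⁻¹) • (adj X)^[n] Y) := by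
  rw [expAdj_eq_sum (N := N)]
  · refine Finset.sum_congr rfl fun n _ => ?_
    rw [adj_iterate_hbarPow]
    refine hop_ext fun i => ?_
    rw [HahnSeries.coeff_smul]
    by_cases hi : i = n * k + l
    · subst hi
      rw [hbarPow, hbarPow, HahnSeries.coeff_single_same, HahnSeries.coeff_single_same]
    · rw [hbarPow, hbarPow, HahnSeries.coeff_single_of_ne hi, HahnSeries.coeff_single_of_ne hi,
        smul_zero]
  · rw [adj_iterate_hbarPow, h]
    exact HahnSeries.single_eq_zero

end SuperAiry

end

/-! ### Quadratic exponents in modes of non-negative number. -/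

noncomputable section

namespace SuperAiry

variable {m q r : ℕ} {A₀ A₁ : Type} {ι κ : Type}

/-! ### Inner derivations of even operators -/

theorem adj_eq_br (X D : Op m q A₀ A₁) : adj X D = br 0 X D := rfl

theorem adj_eq_neg_br {X : Op m q A₀ A₁} (hX : HasPar 0 X) (e : ℕ) (D : Op m q A₀ A₁) :
    adj X D = -br e D X := by
  rw [adj_apply, br_apply, hX.pow, zero_mul, pow_zero, one_smul, neg_sub]

theorem HasPar.adj {X D : Op m q A₀ A₁} {e : ℕ} (hX : HasPar 0 X) (hD : HasPar e D) :
    HasPar e (SuperAiry.adj X D) := by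
  have h := hX.br (k := 0) hD
  rwa [zero_add] at h

theorem HasPar.adj_iterate {X D : Op m q A₀ A₁} {e : ℕ} (hX : HasPar 0 X) (hD : HasPar e D)
    (n : ℕ) : HasPar e ((SuperAiry.adj X)^[n] D) := by
  induction n with
  | zero => exact hD
  | succ n ih => rw [Function.iterate_succ_apply']; exact hX.adj ih

theorem adj_mem_Fil {a b n : ℕ} {X D : Op m q A₀ A₁} (hX : HasPar 0 X) (ha : X ∈ Fil m q A₀ A₁ a)
    (hb : D ∈ Fil m q A₀ A₁ b) (hn : a + b ≤ n + 3) : adj X D ∈ Fil m q A₀ A₁ n := by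
  rw [adj_eq_br]
  exact br_mem_Fil ha hb hX hn

theorem adj_const {X : Op m q A₀ A₁} (hX : HasPar 0 X) (hR : X ∈ RLin m q A₀ A₁)
    (c : Params m q) : adj X (mulOp (const c)) = 0 :=
  br_const_right hX hR c

theorem ad_mul_const {e : ℕ} {y : Op m q A₀ A₁} (hy : ∀ c, ad e y (mulOp (const c)) = 0)
    (D : Op m q A₀ A₁) (c : Params m q) : ad e y (D * mulOp (const c)) =
      ad e y D * mulOp (const (SPoly.parity^[e] c)) := by
  rw [ad_mul, hy, mul_zero, zero_add, sgn_pow_mulOp, parity_pow_const]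

/-! ### Constants with vanishing body -/

/-- Multiplications by constants whose body is zero. -/
def bodyZero (m q : ℕ) (A₀ A₁ : Type) : Submodule ℂ (Op m q A₀ A₁) where
  carrier := {D | ∃ c : Params m q, SPoly.body c = 0 ∧ D = mulOp (const c)}
  add_mem' := by
    rintro _ _ ⟨c, hc, rfl⟩ ⟨c', hc', rfl⟩
    exact ⟨c + c', by rw [map_add, hc, hc', add_zero], by rw [map_add, mulOp_add]⟩
  zero_mem' := ⟨0, map_zero _, by rw [map_zero, mulOp_zero]⟩
  smul_mem' := by
    rintro a _ ⟨c, hc, rfl⟩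
    exact ⟨a • c, by rw [map_smul, hc, smul_zero], by rw [map_smul, mulOp_smul]⟩

theorem const_mem_bodyZero {c : Params m q} :
    (mulOp (const c) : Op m q A₀ A₁) ∈ bodyZero m q A₀ A₁ ↔ SPoly.body c = 0 := by
  constructor
  · rintro ⟨c', hc', h⟩
    rwa [const_injective (mulOp_injective h)]
  · exact fun h => ⟨c, h, rfl⟩

theorem bodyZero_mul_const {D : Op m q A₀ A₁} (hD : D ∈ bodyZero m q A₀ A₁) (c : Params m q) :
    D * mulOp (const c) ∈ bodyZero m q A₀ A₁ := by
  obtain ⟨c', hc', rfl⟩ := hD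
  exact ⟨c' * c, by rw [map_mul, hc', zero_mul], by rw [map_mul, mulOp_mul]⟩

theorem sgn_pow_bodyZero {D : Op m q A₀ A₁} (hD : D ∈ bodyZero m q A₀ A₁) (e : ℕ) :
    (sgn ^ e) D ∈ bodyZero m q A₀ A₁ := by
  obtain ⟨c, hc, rfl⟩ := hD
  rw [sgn_pow_mulOp, parity_pow_const]
  refine ⟨_, ?_, rfl⟩
  induction e with
  | zero => exact hc
  | succ e ih => rw [Function.iterate_succ_apply', SPoly.body_parity, ih]

/-- The sum is a constant by the degree filtration. Its value at $1$ is a finite sum, with which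
taking the body commutes. -/
theorem PSum.mem_bodyZero {F : ι → Op m q A₀ A₁} {D : Op m q A₀ A₁} (h : PSum F D)
    (hF : ∀ i, F i ∈ bodyZero m q A₀ A₁) : D ∈ bodyZero m q A₀ A₁ := by
  have hle : ∀ i, F i ∈ Fil m q A₀ A₁ 1 := fun i => by
    obtain ⟨c, -, hc⟩ := hF i
    exact mem_Fil_one.mpr ⟨c, hc⟩
  obtain ⟨c, rfl⟩ := mem_Fil_one.mp (h.mem_Fil hle)
  refine ⟨c, ?_, rfl⟩
  choose b hb hFb using hF
  have h1 := h.2 1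
  have e : ∀ i, F i 1 = const (b i) := fun i => by rw [hFb i, mulOp_apply, mul_one]
  have h2 := congrArg (fun f => SPoly.body (evalZero f)) h1
  simp only [mulOp_apply, mul_one, evalZero_const] at h2
  rw [h2]
  have h3 := AddMonoidHom.map_finsum
    (((SPoly.body : Params m q →ₐ[ℂ] _).comp (evalZero : Fun m q A₀ A₁ →ₐ[ℂ] _)).toAddMonoidHom)
    (h.1 1)
  refine h3.trans (finsum_eq_zero_of_forall_eq_zero fun i => ?_)
  change SPoly.body (evalZero (F i 1)) = 0
  rw [e, evalZero_const, hb]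

/-! ### Products of two modes of non-negative number -/

/-- Combinations of even products of two modes of non-negative number, not both zero, with constant
coefficients. -/
def posQuad (m q r : ℕ) : Submodule ℂ (OpR m q r) :=
  Submodule.span ℂ {P | ∃ (u v : Mode r) (c : Params m q), 0 ≤ mnum u ∧ 0 ≤ mnum v ∧
    (mnum u = 0 → mnum v = 0 → c = 0) ∧ SPoly.parity c = (-1 : ℂ) ^ (mpar u + mpar v) • c ∧
    P = mode u * mode v * mulOp (const c)}

theorem posQuad_induction {Q : OpR m q r → Prop} (zero : Q 0) (add : ∀ D E, Q D → Q E → Q (D + E))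
    (smul : ∀ (a : ℂ) D, Q D → Q (a • D))
    (mul : ∀ (u v : Mode r) (c : Params m q), 0 ≤ mnum u → 0 ≤ mnum v →
      (mnum u = 0 → mnum v = 0 → c = 0) → Q (mode u * mode v * mulOp (const c)))
    {P : OpR m q r} (hP : P ∈ posQuad m q r) : Q P := by
  refine Submodule.span_induction ?_ zero (fun _ _ _ _ => add _ _) (fun a _ _ => smul a _) hP
  rintro _ ⟨u, v, c, hu, hv, h0, -, rfl⟩
  exact mul u v c hu hv h0

theorem hasPar_of_mem_posQuad {P : OpR m q r} (hP : P ∈ posQuad m q r) : HasPar 0 P := by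
  refine Submodule.span_induction ?_ (hasPar_zero 0) (fun _ _ _ _ => HasPar.add)
    (fun a _ _ h => h.smul a) hP
  rintro _ ⟨u, v, c, -, -, -, hc, rfl⟩
  refine (((hasPar_mode u).mul (hasPar_mode v)).mul (hasPar_const hc)).congr ?_
  rw [← two_mul, pow_mul]
  norm_num

theorem mem_Fil_of_mem_posQuad {P : OpR m q r} (hP : P ∈ posQuad m q r) :
    P ∈ Fil m q (Fin r × ℕ+) (Fin r × ℕ) 3 :=
  posQuad_induction (Q := fun P => P ∈ Fil m q (Fin r × ℕ+) (Fin r × ℕ) 3) (zero_mem _)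
    (fun _ _ => add_mem) (fun a _ => Submodule.smul_mem _ a)
    (fun u v c _ _ _ => mul_const_mem_Fil c (mul_mem_Fil (mode_mem_Fil u) (mode_mem_Fil v) le_rfl)) hP

theorem pairing_eq_zero {u v : Mode r} (h : mnum u + mnum v ≠ 0) : pairing u v = 0 := by
  rcases u with u | u <;> rcases v with v | v
  · exact if_neg fun h' => h h'.2
  · rfl
  · rfl
  · exact if_neg fun h' => h h'.2

/-- Modes of non-negative number supercommute unless both numbers are zero, so whichever factor has
a large number can be moved to the right, where it kills the polynomial. -/
theorem pfin_mode_mul_mode {U V : ι → Mode r} (hU : ∀ i, 0 ≤ mnum (U i)) (hV : ∀ i, 0 ≤ mnum (V i))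
    (h : ∀ N : ℤ, {i | mnum (U i) < N ∧ mnum (V i) < N}.Finite) :
    PFin fun i => (mode (U i) * mode (V i) : OpR m q r) := fun f => by
  obtain ⟨N, hN0, hN⟩ := exists_mode_eq_zero f
  refine (h N).subset fun i hi => ?_
  by_contra hi'
  refine hi ?_
  have hV' := hV i
  rw [Set.mem_ofPred_eq, not_and_or, not_lt, not_lt] at hi'
  by_cases hc : N ≤ mnum (V i)
  · change mode (U i) (mode (V i) f) = 0
    rw [hN _ hc, map_zero]
  · have hu := hi'.resolve_right hc
    change (mode (U i) * mode (V i) : OpR m q r) f = 0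
    rw [mode_mul_mode, pairing_eq_zero (by omega), zero_smul, add_zero]
    refine smul_apply_eq_zero ?_
    rw [Module.End.mul_apply, hN _ hu, map_zero]

section

variable {D : OpR m q r} {e : ℕ}

theorem exists_ad_mode_eq_const (hD : D ∈ Fil m q (Fin r × ℕ+) (Fin r × ℕ) 2) (u : Mode r) :
    ∃ c : Params m q, ad (mpar u) (mode u) D = mulOp (const c) :=
  mem_Fil_one.mp (ad_mem_Fil (mode_mem_Fil u) (hasPar_mode u) hD)

theorem br_mul_mul_const (hD : HasPar e D) (hR : D ∈ RLin m q (Fin r × ℕ+) (Fin r × ℕ))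
    (u v : Mode r) (c : Params m q) : br e D (mode u * mode v * mulOp (const c)) =
      ad (mpar u) (mode u) D * (mode v * mulOp (const c)) +
        (-1 : ℂ) ^ (mpar u * e) • (mode u * (ad (mpar v) (mode v) D * mulOp (const c))) := by
  rw [br_mul, br_const_right hD hR, mul_zero, add_zero, br_mul, hD.br_eq_ad (hasPar_mode u),
    hD.br_eq_ad (hasPar_mode v), (hasPar_mode u).pow, add_mul, smul_mul_assoc, smul_mul_assoc,
    mul_assoc, mul_assoc]

theorem br_posQuad_eq_zero (hD : HasPar e D) (hR : D ∈ RLin m q (Fin r × ℕ+) (Fin r × ℕ))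
    (h : ∀ u : Mode r, 0 ≤ mnum u → ad (mpar u) (mode u) D = 0) {P : OpR m q r}
    (hP : P ∈ posQuad m q r) : br e D P = 0 := by
  refine posQuad_induction (Q := fun P => br e D P = 0) (map_zero _)
    (fun _ _ h1 h2 => by rw [map_add, h1, h2, add_zero])
    (fun a _ h1 => by rw [map_smul, h1, smul_zero]) (fun u v c hu hv _ => ?_) hP
  rw [br_mul_mul_const hD hR, h u hu, h v hv, zero_mul, zero_mul, mul_zero, smul_zero, add_zero]

theorem ad_mode_mode_eq_zero {u v : Mode r} (hu : 0 ≤ mnum u) (hv : 1 ≤ mnum v) :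
    ad (mpar u) (mode u) (mode v : OpR m q r) = 0 := by
  rw [ad_mode_mode, pairing_eq_zero (by omega), zero_smul]

theorem ad_posQuad_eq_zero {w : Mode r} (hw : 1 ≤ mnum w) {P : OpR m q r}
    (hP : P ∈ posQuad m q r) : ad (mpar w) (mode w) P = 0 := by
  refine posQuad_induction (Q := fun P => ad (mpar w) (mode w) P = 0) (map_zero _)
    (fun _ _ h1 h2 => by rw [map_add, h1, h2, add_zero])
    (fun a _ h1 => by rw [map_smul, h1, smul_zero]) (fun u v c hu hv _ => ?_) hP
  rw [ad_mul_const (ad_mode_const w), ad_mul, ad_mode_mode, ad_mode_mode,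
    pairing_eq_zero (by omega), pairing_eq_zero (by omega), zero_smul, mul_zero, zero_mul, add_zero,
    zero_mul]

/-- Such a `D` brackets non-trivially only with zero modes among the factors of `P`. The partner of
a zero mode has positive number because two zero modes never occur together, and it supercommutes
with all modes of non-negative number. -/
theorem ad_br_posQuad_eq_zero (hD : HasPar e D) (hD' : D ∈ Fil m q (Fin r × ℕ+) (Fin r × ℕ) 2)
    (h : ∀ u : Mode r, 1 ≤ mnum u → ad (mpar u) (mode u) D = 0) {w : Mode r} (hw : 0 ≤ mnum w)
    {P : OpR m q r} (hP : P ∈ posQuad m q r) : ad (mpar w) (mode w) (br e D P) = 0 := by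
  refine posQuad_induction (Q := fun P => ad (mpar w) (mode w) (br e D P) = 0) ?_
    (fun _ _ h1 h2 => by rw [map_add, map_add, h1, h2, add_zero])
    (fun a _ h1 => by rw [map_smul, map_smul, h1, smul_zero]) (fun u v c hu hv h0 => ?_) hP
  · rw [map_zero, map_zero]
  by_cases h00 : mnum u = 0 ∧ mnum v = 0
  · rw [h0 h00.1 h00.2, map_zero, mulOp_zero, mul_zero, map_zero, map_zero]
  obtain ⟨α, hα⟩ := exists_ad_mode_eq_const hD' u
  obtain ⟨β, hβ⟩ := exists_ad_mode_eq_const hD' v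
  rw [br_mul_mul_const hD (Fil_le_RLin hD'), map_add, map_smul]
  have h1 : ad (mpar w) (mode w) (ad (mpar u) (mode u) D * (mode v * mulOp (const c))) = 0 := by
    by_cases hu1 : 1 ≤ mnum u
    · rw [h u hu1, zero_mul, map_zero]
    · rw [hα, ad_mul, ad_mode_const, zero_mul, add_zero, ad_mul_const (ad_mode_const w),
        ad_mode_mode_eq_zero hw (by omega), zero_mul, mul_zero]
  have h2 : ad (mpar w) (mode w) (mode u * (ad (mpar v) (mode v) D * mulOp (const c))) = 0 := by
    by_cases hv1 : 1 ≤ mnum v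
    · rw [h v hv1, zero_mul, mul_zero, map_zero]
    · rw [hβ, ← mulOp_mul, ← map_mul, ad_mul, ad_mode_const, mul_zero, zero_add,
        ad_mode_mode_eq_zero hw (by omega), zero_mul]
  rw [h1, h2, smul_zero, add_zero]

/-- Bracketing with a product of two such modes replaces one of them by a constant of vanishing
body; the bracket of the other one with any mode is a number. -/
theorem ad_br_posQuad_mem_bodyZero (hD : HasPar e D)
    (hR : D ∈ RLin m q (Fin r × ℕ+) (Fin r × ℕ))
    (h : ∀ u : Mode r, 0 ≤ mnum u →
      ad (mpar u) (mode u) D ∈ bodyZero m q (Fin r × ℕ+) (Fin r × ℕ)) (w : Mode r)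
    {P : OpR m q r} (hP : P ∈ posQuad m q r) :
    ad (mpar w) (mode w) (br e D P) ∈ bodyZero m q (Fin r × ℕ+) (Fin r × ℕ) := by
  refine posQuad_induction
    (Q := fun P => ad (mpar w) (mode w) (br e D P) ∈ bodyZero m q (Fin r × ℕ+) (Fin r × ℕ)) ?_
    (fun _ _ h1 h2 => by rw [map_add, map_add]; exact add_mem h1 h2)
    (fun a _ h1 => by rw [map_smul, map_smul]; exact Submodule.smul_mem _ a h1)
    (fun u v c hu hv _ => ?_) hP
  · rw [map_zero, map_zero]; exact zero_mem _
  rw [br_mul_mul_const hD hR, map_add, map_smul]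
  refine add_mem ?_ (Submodule.smul_mem _ _ ?_)
  · obtain ⟨α, -, hα⟩ := id (h u hu)
    have hz := h u hu
    rw [ad_mul, hα, ad_mode_const, zero_mul, add_zero, ← hα, ad_mul_const (ad_mode_const w),
      ad_mode_mode, smul_mul_assoc, one_mul, mul_smul_comm]
    exact Submodule.smul_mem _ _ (bodyZero_mul_const hz _)
  · obtain ⟨β, -, hβ⟩ := id (h v hv)
    have hz := sgn_pow_bodyZero (bodyZero_mul_const (h v hv) c) (mpar w)
    rw [hβ, ← mulOp_mul, ← map_mul] at hz
    rw [hβ, ← mulOp_mul, ← map_mul, ad_mul, ad_mode_const, mul_zero, zero_add, ad_mode_mode,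
      smul_mul_assoc, one_mul]
    exact Submodule.smul_mem _ _ hz

end

/-- Infinite sums of operators in `posQuad`. -/
def IsPosQuad (X : OpR m q r) : Prop :=
  ∃ (ι : Type) (F : ι → OpR m q r), PSum F X ∧ ∀ i, F i ∈ posQuad m q r

namespace IsPosQuad

variable {X D : OpR m q r} {e : ℕ}

theorem hasPar (h : IsPosQuad X) : HasPar 0 X := by
  obtain ⟨ι, F, hF, hP⟩ := h
  exact hF.hasPar fun i => hasPar_of_mem_posQuad (hP i)

theorem mem_Fil (h : IsPosQuad X) : X ∈ Fil m q (Fin r × ℕ+) (Fin r × ℕ) 3 := by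
  obtain ⟨ι, F, hF, hP⟩ := h
  exact hF.mem_Fil fun i => mem_Fil_of_mem_posQuad (hP i)

theorem adj_eq_zero (h : IsPosQuad X) (hD : HasPar e D)
    (hR : D ∈ RLin m q (Fin r × ℕ+) (Fin r × ℕ))
    (h0 : ∀ u : Mode r, 0 ≤ mnum u → ad (mpar u) (mode u) D = 0) : adj X D = 0 := by
  rw [adj_eq_neg_br h.hasPar e, neg_eq_zero]
  obtain ⟨ι, F, hF, hP⟩ := h
  exact (hF.br e D).unique (PSum.zero.congr fun i => (br_posQuad_eq_zero hD hR h0 (hP i)).symm)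

theorem ad_adj_eq_zero (h : IsPosQuad X) (hD : HasPar e D)
    (hD' : D ∈ Fil m q (Fin r × ℕ+) (Fin r × ℕ) 2) {w : Mode r} (hw : 1 ≤ mnum w) :
    ad (mpar w) (mode w) (adj X D) = 0 := by
  have hX : ad (mpar w) (mode w) X = 0 := by
    obtain ⟨ι, F, hF, hP⟩ := h
    exact (hF.ad _ _).unique (PSum.zero.congr fun i => (ad_posQuad_eq_zero hw (hP i)).symm)
  obtain ⟨c, hc⟩ := exists_ad_mode_eq_const hD' w
  rw [adj_eq_br, ad_br (hasPar_mode w) h.hasPar, hX, br_zero_left, add_zero, hc,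
    br_const_right h.hasPar (Fil_le_RLin h.mem_Fil)]

theorem adj_mem_Fil (h : IsPosQuad X) {n : ℕ} (hD : D ∈ Fil m q (Fin r × ℕ+) (Fin r × ℕ) n) :
    adj X D ∈ Fil m q (Fin r × ℕ+) (Fin r × ℕ) n :=
  SuperAiry.adj_mem_Fil h.hasPar h.mem_Fil hD (by omega)

theorem adj_iterate_mem_Fil (h : IsPosQuad X) {n : ℕ}
    (hD : D ∈ Fil m q (Fin r × ℕ+) (Fin r × ℕ) n) (k : ℕ) :
    (adj X)^[k] D ∈ Fil m q (Fin r × ℕ+) (Fin r × ℕ) n := by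
  induction k with
  | zero => exact hD
  | succ k ih => rw [Function.iterate_succ_apply']; exact h.adj_mem_Fil ih

/-- After one step only modes of non-negative number remain, after two steps the zero modes are gone
too, and positive modes supercommute with the exponent. The zero modes cost one step more than
purely positive exponents would. -/
theorem adj_iterate_three (h : IsPosQuad X) (hD : HasPar e D)
    (hD' : D ∈ Fil m q (Fin r × ℕ+) (Fin r × ℕ) 2) : (adj X)^[3] D = 0 := by
  have hp := h.hasPar.adj hD
  have hf := h.adj_mem_Fil hD'
  refine h.adj_eq_zero (h.hasPar.adj hp) (Fil_le_RLin (h.adj_mem_Fil hf)) fun w hw => ?_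
  rw [adj_eq_neg_br h.hasPar e, map_neg, neg_eq_zero]
  have h1 := fun (u : Mode r) (hu : 1 ≤ mnum u) => h.ad_adj_eq_zero hD hD' hu
  obtain ⟨ι, F, hF, hP⟩ := h
  exact ((hF.br e _).ad _ _).unique
    (PSum.zero.congr fun i => (ad_br_posQuad_eq_zero hp hf h1 hw (hP i)).symm)

theorem ad_adj_mem_bodyZero (h : IsPosQuad X) (hD : HasPar e D)
    (hR : D ∈ RLin m q (Fin r × ℕ+) (Fin r × ℕ))
    (h0 : ∀ u : Mode r, 0 ≤ mnum u →
      ad (mpar u) (mode u) D ∈ bodyZero m q (Fin r × ℕ+) (Fin r × ℕ)) (w : Mode r) :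
    ad (mpar w) (mode w) (adj X D) ∈ bodyZero m q (Fin r × ℕ+) (Fin r × ℕ) := by
  rw [adj_eq_neg_br h.hasPar e, map_neg]
  refine neg_mem ?_
  obtain ⟨ι, F, hF, hP⟩ := h
  exact ((hF.br e _).ad _ _).mem_bodyZero fun i => ad_br_posQuad_mem_bodyZero hD hR h0 w (hP i)

/-- Three steps kill each factor, so at most two can fall on each: by the Leibniz rule the product
is killed after five. -/
theorem adj_iterate_five (h : IsPosQuad X) (u v : Mode r) :
    (adj X)^[5] (nprod u v : OpR m q r) = 0 := by
  rw [nprod]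
  have key : ∀ u v : Mode r, (adj X)^[5] (mode u * mode v : OpR m q r) = 0 := fun u v =>
    adj_iterate_mul_eq_zero (h.adj_iterate_three (hasPar_mode u) (mode_mem_Fil u))
      (h.adj_iterate_three (hasPar_mode v) (mode_mem_Fil v)) le_rfl
  split_ifs
  · rw [adj_iterate_smul, key, smul_zero]
  · exact key u v

end IsPosQuad

end SuperAiry

end

/-! ### Conjugation by the dilaton shift and the change of polarisation. -/

noncomputable section

namespace SuperAiry

variable {m q r : ℕ} {ι κ : Type}

theorem hbarPow_zero_right {A₀ A₁ : Type} (k : ℤ) : (hbarPow k 0 : HOp m q A₀ A₁) = 0 :=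
  HahnSeries.single_eq_zero

theorem coeff_hbarPow_same {A₀ A₁ : Type} (k : ℤ) (D : Op m q A₀ A₁) : (hbarPow k D).coeff k = D :=
  HahnSeries.coeff_single_same k D

theorem coeff_hbarPow_of_ne {A₀ A₁ : Type} {k l : ℤ} (h : l ≠ k) (D : Op m q A₀ A₁) :
    (hbarPow k D).coeff l = 0 :=
  HahnSeries.coeff_single_of_ne h

theorem hbarPow_mul_hbarPow {A₀ A₁ : Type} (k l : ℤ) (D E : Op m q A₀ A₁) :
    hbarPow k D * hbarPow l E = hbarPow (k + l) (D * E) :=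
  HahnSeries.single_mul_single

namespace LocalData

variable (d : LocalData m q r)

/-! ### The exponents -/

/-- `ħ log T`. -/
def opT : OpR m q r := opSum fun i : Fin r × ℤ =>
  ((i.2 : ℂ)⁻¹) • (jOp i.1 i.2 * mulOp (const ((d.t i.1).coeff i.2))) -
    gammaOp i.1 i.2 * mulOp (const ((d.τ i.1).coeff i.2))

/-- `log Φ`, as an operator. -/
def opPhi : OpR m q r := (1 / 2 : ℂ) • opSum fun i : (Fin r × Fin r) × (ℕ × ℕ) =>
  (((i.2.1 : ℂ) * (i.2.2 : ℂ))⁻¹) •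
      (jOp i.1.1 i.2.1 * jOp i.1.2 i.2.2 * mulOp (const (d.B i.1.1 i.1.2 i.2.1 i.2.2))) -
    (2 * (i.2.1 : ℂ)⁻¹) •
      (jOp i.1.1 i.2.1 * gammaOp i.1.2 i.2.2 * mulOp (const (d.φ i.1.1 i.1.2 i.2.1 i.2.2))) +
    gammaOp i.1.1 i.2.1 * gammaOp i.1.2 i.2.2 *
      mulOp (const (d.V i.1.1 i.1.2 i.2.1 i.2.2))

theorem logT_eq : d.logT = hbarPow (-1) d.opT := rfl

theorem logPhi_eq : d.logPhi = hbarPow 0 d.opPhi := rfl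

/-- The constant that the dilaton shift adds to a mode. -/
def shift : Mode r → Params m q
  | .inl i => (d.t i.1).coeff (-i.2)
  | .inr i => (d.τ i.1).coeff (-i.2)

theorem parity_shift (w : Mode r) : SPoly.parity (d.shift w) = (-1 : ℂ) ^ mpar w • d.shift w := by
  rcases w with w | w
  · rw [mpar, pow_zero, one_smul]; exact d.t_even _ _
  · rw [mpar, pow_one, neg_one_smul]; exact d.τ_odd _ _

/-- The coefficients vanish for very negative numbers, since they come from a Laurent series, and
modes of large number kill the given polynomial. -/
theorem pfin_mode_const {U : Fin r × ℤ → Mode r} (hU : ∀ i, mnum (U i) = i.2)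
    (c : Fin r → LaurentSeries (Params m q)) :
    PFin fun i => (mode (U i) * mulOp (const ((c i.1).coeff i.2)) : OpR m q r) := by
  classical
  have h : PFin fun i : Fin r × ℤ =>
      if (c i.1).coeff i.2 = 0 then 0 else (mode (U i) : OpR m q r) := fun f => by
    obtain ⟨N, -, hN⟩ := exists_mode_eq_zero f
    refine (Set.finite_iUnion fun a : Fin r =>
      (Set.finite_Ico (c a).order N).image fun k => (a, k)).subset fun i hi => ?_
    by_cases hc : (c i.1).coeff i.2 = 0
    · exact absurd (by simp [hc]) hi
    · refine Set.mem_iUnion.mpr ⟨i.1, i.2, ⟨HahnSeries.order_le_of_coeff_ne_zero hc, ?_⟩, rfl⟩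
      by_contra hlt
      refine hi ?_
      simp only [hc, if_false]
      exact hN _ (by rw [hU]; omega)
  refine (h.mul_const (fun i => ?_) fun i => (c i.1).coeff i.2).mono fun i f hi => ?_
  · split_ifs
    · exact zero_mem _
    · exact Fil_le_RLin (mode_mem_Fil _)
  · by_cases hc : (c i.1).coeff i.2 = 0
    · rw [hc, map_zero, mulOp_zero, mul_zero]; rfl
    · simpa only [hc, if_false] using hi

theorem jOp_eq_mode (a : Fin r) (k : ℤ) : (jOp a k : OpR m q r) = mode (.inl (a, k)) := rfl

theorem gammaOp_eq_mode (a : Fin r) (k : ℤ) : (gammaOp a k : OpR m q r) = mode (.inr (a, k)) := rfl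

theorem psum_opT : PSum (fun i : Fin r × ℤ =>
    ((i.2 : ℂ)⁻¹) • (mode (.inl (i.1, i.2)) * mulOp (const ((d.t i.1).coeff i.2))) -
      mode (.inr (i.1, i.2)) * mulOp (const ((d.τ i.1).coeff i.2))) d.opT := by
  have h1 : PFin fun i : Fin r × ℤ => (((i.2 : ℂ)⁻¹) •
      (mode (.inl (i.1, i.2)) * mulOp (const ((d.t i.1).coeff i.2))) : OpR m q r) :=
    PFin.smul (pfin_mode_const (U := fun i => Sum.inl (i.1, i.2)) (fun _ => rfl) d.t) _
  have h2 : PFin fun i : Fin r × ℤ =>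
      (mode (.inr (i.1, i.2)) * mulOp (const ((d.τ i.1).coeff i.2)) : OpR m q r) :=
    pfin_mode_const (U := fun i => Sum.inr (i.1, i.2)) (fun _ => rfl) d.τ
  have h := (h1.sub h2).psum
  unfold opT
  simp only [jOp_eq_mode, gammaOp_eq_mode]
  exact h

theorem hasPar_opT : HasPar 0 d.opT := by
  refine d.psum_opT.hasPar fun i => ?_
  have h1 : HasPar (mpar (.inl (i.1, i.2))) (mode (.inl (i.1, i.2)) : OpR m q r) := hasPar_mode _
  have h2 : HasPar (mpar (.inr (i.1, i.2))) (mode (.inr (i.1, i.2)) : OpR m q r) := hasPar_mode _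
  have h3 : HasPar 0 (mulOp (const ((d.t i.1).coeff i.2)) : OpR m q r) :=
    hasPar_const_even (d.t_even _ _)
  have h4 : HasPar 1 (mulOp (const ((d.τ i.1).coeff i.2)) : OpR m q r) :=
    hasPar_const_odd (d.τ_odd _ _)
  exact HasPar.sub (HasPar.smul (h1.mul h3) _) ((h2.mul h4).congr (by norm_num [mpar]))

theorem opT_mem_Fil : d.opT ∈ Fil m q (Fin r × ℕ+) (Fin r × ℕ) 2 :=
  d.psum_opT.mem_Fil fun _ => sub_mem
    (Submodule.smul_mem _ _ (mul_const_mem_Fil _ (mode_mem_Fil _)))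
    (mul_const_mem_Fil _ (mode_mem_Fil _))

/-- Only the term of opposite number at the same puncture pairs with `w`, and the divisor $k$ in the
exponent cancels the pairing $k$ of Heisenberg modes. -/
theorem ad_opT (w : Mode r) : ad (mpar w) (mode w) d.opT = mulOp (const (d.shift w)) := by
  classical
  have h := d.psum_opT.ad (mpar w) (mode w)
  rcases w with ⟨b, l⟩ | ⟨b, l⟩
  · refine h.unique ((PSum.ite_eq (b, -l) fun _ => mulOp (const (d.shift (.inl (b, l))))).congr
      fun i => ?_)
    rw [map_sub, map_smul, ad_mul_const (ad_mode_const _), ad_mul_const (ad_mode_const _),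
      ad_mode_mode, ad_mode_mode]
    by_cases hi : i = (b, -l)
    · subst hi
      rw [if_pos rfl]
      -- At number zero there is no Heisenberg term; this agrees with the shift, because
      -- $t_{a,0}=0$.
      by_cases hl : l = 0
      · subst hl
        simp [pairing, shift, d.t_zero, mulOp_zero]
      · have hl' : (l : ℂ) ≠ 0 := by exact_mod_cast hl
        simp [pairing, shift, mpar, smul_smul, hl']
    · have : ¬ (i.1 = b ∧ i.2 + l = 0) := fun h' => hi (Prod.ext h'.1 (by dsimp only; omega))
      rw [if_neg hi]
      simp [pairing, this]
  · refine h.unique ((PSum.ite_eq (b, -l) fun _ => mulOp (const (d.shift (.inr (b, l))))).congr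
      fun i => ?_)
    rw [map_sub, map_smul, ad_mul_const (ad_mode_const _), ad_mul_const (ad_mode_const _),
      ad_mode_mode, ad_mode_mode]
    by_cases hi : i = (b, -l)
    · subst hi
      -- The sign from moving an odd mode past the odd coefficient cancels the minus sign in the
      -- exponent.
      have ho : SPoly.parity ((d.τ b).coeff (-l)) = -(d.τ b).coeff (-l) := d.τ_odd b (-l)
      rw [if_pos rfl]
      simp [pairing, shift, mpar, ho, mulOp_neg]
    · have : ¬ (i.1 = b ∧ i.2 + l = 0) := fun h' => hi (Prod.ext h'.1 (by dsimp only; omega))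
      rw [if_neg hi]
      simp [pairing, this]

theorem adj_opT_mode (w : Mode r) : adj d.opT (mode w) = mulOp (const (d.shift w)) := by
  rw [← ad_opT, adj_apply, ad_apply, d.hasPar_opT.pow, zero_mul, pow_zero, one_smul]

/-- The bracket of the exponent with a mode is a constant and supercommutes with `D`, so the extra
term in the Jacobi identity drops out. -/
theorem ad_adj_opT {e : ℕ} {D : OpR m q r} (hR : D ∈ RLin m q (Fin r × ℕ+) (Fin r × ℕ))
    (w : Mode r) : ad (mpar w) (mode w) (adj d.opT D) = adj d.opT (ad (mpar w) (mode w) D) := by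
  rw [adj_eq_br, ad_br (hasPar_mode w) d.hasPar_opT, ad_opT, zero_add,
    br_const (hasPar_const (d.parity_shift w)) (sgn_pow_mem_RLin hR _), add_zero, adj_eq_br]

/-- The exponent of $T$ has degree one and carries $\hbar^{-1}$: each bracket lowers the degree and
the power of $\hbar$ by one, which is why conjugation respects the Rees algebra. -/
theorem adj_opT_mem_Fil {n : ℕ} {D : OpR m q r}
    (hD : D ∈ Fil m q (Fin r × ℕ+) (Fin r × ℕ) (n + 1)) :
    adj d.opT D ∈ Fil m q (Fin r × ℕ+) (Fin r × ℕ) n :=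
  adj_mem_Fil d.hasPar_opT d.opT_mem_Fil hD (by omega)

theorem adj_opT_iterate_mem_Fil {n k : ℕ} {D : OpR m q r}
    (hD : D ∈ Fil m q (Fin r × ℕ+) (Fin r × ℕ) (n + k)) :
    (adj d.opT)^[k] D ∈ Fil m q (Fin r × ℕ+) (Fin r × ℕ) n := by
  induction k generalizing D with
  | zero => exact hD
  | succ k ih =>
    rw [Function.iterate_succ_apply]
    exact ih (d.adj_opT_mem_Fil hD)

theorem adj_opT_iterate_eq_zero {n k : ℕ} {D : OpR m q r}
    (hD : D ∈ Fil m q (Fin r × ℕ+) (Fin r × ℕ) n) (h : n ≤ k) : (adj d.opT)^[k] D = 0 := by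
  refine adj_iterate_eq_zero_of_le (mem_Fil_zero.mp (d.adj_opT_iterate_mem_Fil (k := n) ?_)) h
  rwa [zero_add]

/-- The vanishing of $B_{0l}$, $\phi_{0l}$ and $V_{00}$ is what excludes products of two zero modes,
and the parities of the coefficients make every term even. -/
theorem isPosQuad_opPhi : IsPosQuad d.opPhi := by
  have hfin : ∀ {U V : (Fin r × Fin r) × (ℕ × ℕ) → Mode r}, (∀ i, mnum (U i) = i.2.1) →
      (∀ i, mnum (V i) = i.2.2) → PFin fun i => (mode (U i) * mode (V i) : OpR m q r) :=
    fun {U V} hU hV => by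
      refine pfin_mode_mul_mode (fun i => by rw [hU]; omega) (fun i => by rw [hV]; omega) fun N => ?_
      refine ((Set.finite_univ (α := Fin r × Fin r)).prod
        ((Set.finite_Iio N.toNat).prod (Set.finite_Iio N.toNat))).subset fun i hi => ?_
      rw [Set.mem_ofPred_eq, hU, hV] at hi
      exact ⟨trivial, by rw [Set.mem_Iio]; omega, by rw [Set.mem_Iio]; omega⟩
  have hR : ∀ u v : Mode r, (mode u * mode v : OpR m q r) ∈ RLin m q (Fin r × ℕ+) (Fin r × ℕ) :=
    fun u v => mul_mem (Fil_le_RLin (mode_mem_Fil u)) (Fil_le_RLin (mode_mem_Fil v))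
  have h1 := (hfin (U := fun i => .inl (i.1.1, i.2.1)) (V := fun i => .inl (i.1.2, i.2.2))
    (fun _ => rfl) fun _ => rfl).mul_const (fun _ => hR _ _)
      fun i => d.B i.1.1 i.1.2 i.2.1 i.2.2
  have h2 := (hfin (U := fun i => .inl (i.1.1, i.2.1)) (V := fun i => .inr (i.1.2, i.2.2))
    (fun _ => rfl) fun _ => rfl).mul_const (fun _ => hR _ _)
      fun i => d.φ i.1.1 i.1.2 i.2.1 i.2.2
  have h3 := (hfin (U := fun i => .inr (i.1.1, i.2.1)) (V := fun i => .inr (i.1.2, i.2.2))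
    (fun _ => rfl) fun _ => rfl).mul_const (fun _ => hR _ _)
      fun i => d.V i.1.1 i.1.2 i.2.1 i.2.2
  refine ⟨_, _, (((h1.smul fun i => ((i.2.1 : ℂ) * (i.2.2 : ℂ))⁻¹).sub
    (h2.smul fun i => 2 * (i.2.1 : ℂ)⁻¹)).add h3).psum.smul (1 / 2), fun i => ?_⟩
  refine Submodule.smul_mem _ _ (add_mem (sub_mem (Submodule.smul_mem _ _ ?_)
    (Submodule.smul_mem _ _ ?_)) ?_)
  · refine Submodule.subset_span ⟨_, _, _, ?_, ?_, fun hu hv => ?_, ?_, rfl⟩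
    · exact Int.natCast_nonneg _
    · exact Int.natCast_nonneg _
    · have : i.2.1 = 0 := Int.natCast_eq_zero.mp hu
      rw [this, d.B_zero_left]
    · exact (d.B_even _ _ _ _).trans (by simp [mpar])
  · refine Submodule.subset_span ⟨_, _, _, ?_, ?_, fun hu hv => ?_, ?_, rfl⟩
    · exact Int.natCast_nonneg _
    · exact Int.natCast_nonneg _
    · have : i.2.1 = 0 := Int.natCast_eq_zero.mp hu
      rw [this, d.φ_zero_left]
    · exact (d.φ_odd _ _ _ _).trans (by simp [mpar])
  · refine Submodule.subset_span ⟨_, _, _, ?_, ?_, fun hu hv => ?_, ?_, rfl⟩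
    · exact Int.natCast_nonneg _
    · exact Int.natCast_nonneg _
    · have h1 : i.2.1 = 0 := Int.natCast_eq_zero.mp hu
      have h2 : i.2.2 = 0 := Int.natCast_eq_zero.mp hv
      rw [h1, h2, d.V_zero_zero]
    · exact (d.V_even _ _ _ _).trans (by simp [mpar])

/-! ### Conjugation by the dilaton shift and the change of polarisation -/

/-- `Φ T Z T⁻¹ Φ⁻¹`. -/
def conj (Z : HOpR m q r) : HOpR m q r := expAdj d.logPhi (expAdj d.logT Z)

/-- Series on which the exponents act nilpotently. -/
structure IsNil (N : ℕ) (Z : HOpR m q r) : Prop where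
  logT : (adj (hbarPow (-1) d.opT))^[N] Z = 0
  logPhi : (adj (hbarPow 0 d.opPhi))^[N] (expAdj (hbarPow (-1) d.opT) Z) = 0

variable {d} {M N : ℕ} {Y Z : HOpR m q r}

theorem IsNil.mono (h : d.IsNil M Z) (hMN : M ≤ N) : d.IsNil N Z :=
  ⟨adj_iterate_eq_zero_of_le h.logT hMN, adj_iterate_eq_zero_of_le h.logPhi hMN⟩

theorem IsNil.mul (hY : d.IsNil M Y) (hZ : d.IsNil M Z) : d.IsNil (M + M) (Y * Z) := by
  refine ⟨adj_iterate_mul_eq_zero hY.logT hZ.logT (by omega), ?_⟩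
  rw [expAdj_mul hY.logT hZ.logT]
  exact adj_iterate_mul_eq_zero hY.logPhi hZ.logPhi (by omega)

theorem conj_mul (hY : d.IsNil M Y) (hZ : d.IsNil M Z) : d.conj (Y * Z) = d.conj Y * d.conj Z := by
  rw [conj, logT_eq, logPhi_eq, expAdj_mul hY.logT hZ.logT, expAdj_mul hY.logPhi hZ.logPhi]
  rfl

theorem conj_add (hY : d.IsNil M Y) (hZ : d.IsNil M Z) : d.conj (Y + Z) = d.conj Y + d.conj Z := by
  rw [conj, logT_eq, logPhi_eq, expAdj_add hY.logT hZ.logT, expAdj_add hY.logPhi hZ.logPhi]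
  rfl

theorem IsNil.smul (hZ : d.IsNil M Z) (c : ℂ) : d.IsNil M (c • Z) := by
  refine ⟨(adj_iterate_smul _ _ _ _).trans ?_, ?_⟩
  · rw [hZ.logT]; exact smul_zero c
  · refine (congrArg _ (expAdj_smul hZ.logT c)).trans ((adj_iterate_smul _ _ _ _).trans ?_)
    rw [hZ.logPhi]; exact smul_zero c

theorem conj_smul (hZ : d.IsNil M Z) (c : ℂ) : d.conj (c • Z) = c • d.conj Z := by
  rw [conj, logT_eq, logPhi_eq]
  exact (congrArg _ (expAdj_smul hZ.logT c)).trans (expAdj_smul hZ.logPhi c)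

theorem coeff_conj (h : d.IsNil N Z) (j : ℤ) : (d.conj Z).coeff j =
    ∑ i ∈ Finset.range N, ((i.factorial : ℂ)⁻¹) • (adj d.opPhi)^[i]
      (∑ n ∈ Finset.range N, ((n.factorial : ℂ)⁻¹) • (adj d.opT)^[n] (Z.coeff (j + n))) := by
  rw [conj, logT_eq, logPhi_eq, coeff_expAdj h.logPhi]
  simp only [mul_zero, sub_zero, coeff_expAdj h.logT, mul_neg_one, sub_neg_eq_add]

theorem HPar_conj {e : ℕ} (h : d.IsNil N Z) (hZ : HPar e Z) : HPar e (d.conj Z) :=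
  .of_coeff fun j => by
    rw [coeff_conj h]
    have hs : ∀ (F : ℕ → OpR m q r), (∀ i, HasPar e (F i)) →
        HasPar e (∑ i ∈ Finset.range N, F i) := fun F hF =>
      Finset.sum_induction F (HasPar e) (fun _ _ => HasPar.add) (hasPar_zero e) fun i _ => hF i
    exact hs _ fun i => (d.isPosQuad_opPhi.hasPar.adj_iterate
      (hs _ fun n => (d.hasPar_opT.adj_iterate (hZ.coeff _) n).smul _) i).smul _

theorem HFin.conj {F : ι → HOpR m q r} (hF : HFin F) (h : ∀ i, d.IsNil N (F i)) :
    HFin fun i => d.conj (F i) :=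
  (hF.expAdj fun i => (h i).logT).expAdj fun i => (h i).logPhi

theorem IsNil.isSum {F : ι → HOpR m q r} (hF : IsSum F Z) (h : ∀ i, d.IsNil N (F i)) :
    d.IsNil N Z :=
  ⟨hF.adj_iterate_eq_zero fun i => (h i).logT,
    (hF.expAdj fun i => (h i).logT).adj_iterate_eq_zero fun i => (h i).logPhi⟩

theorem isSum_conj {F : ι → HOpR m q r} (hF : IsSum F Z) (h : ∀ i, d.IsNil N (F i)) :
    IsSum (fun i => d.conj (F i)) (d.conj Z) :=
  (hF.expAdj fun i => (h i).logT).expAdj fun i => (h i).logPhi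

/-- For homogeneous `Z` the bracket is a fixed linear combination of the two products, and
conjugation is multiplicative and preserves parity. -/
theorem conj_hbr {e f : ℕ} (hY : d.IsNil N Y) (hZ : d.IsNil N Z) (hf : HPar f Z) :
    d.conj (hbr e Y Z) = hbr e (d.conj Y) (d.conj Z) := by
  have e1 : ∀ {A B : HOpR m q r}, HPar f B →
      hbr e A B = A * B + (-(-1 : ℂ) ^ (f * e)) • (B * A) := fun {A B} hB => by
    rw [hbr, hB.pow]
    refine hop_ext fun n => ?_
    rw [HahnSeries.coeff_sub, HahnSeries.coeff_add, smul_mul_hop, HahnSeries.coeff_smul,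
      HahnSeries.coeff_smul, neg_smul, sub_eq_add_neg]
  rw [e1 hf, e1 (HPar_conj hZ hf), conj_add (hY.mul hZ) ((hZ.mul hY).smul _), conj_mul hY hZ,
    conj_smul (hZ.mul hY), conj_mul hZ hY]

theorem isNil_hbarPow {D : OpR m q r} (k : ℤ) (hT : (adj d.opT)^[N] D = 0)
    (hP : ∀ n, (adj d.opPhi)^[N] ((adj d.opT)^[n] D) = 0) : d.IsNil N (hbarPow k D) := by
  refine ⟨?_, ?_⟩
  · rw [adj_iterate_hbarPow, hT, hbarPow_zero_right]
  · rw [expAdj_hbarPow hT, adj_iterate_map_sum]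
    refine Finset.sum_eq_zero fun n _ => ?_
    rw [adj_iterate_hbarPow, adj_iterate_smul, hP, smul_zero, hbarPow_zero_right]

/-- The action of `Φ` on operators. -/
def expPhi (d : LocalData m q r) (N : ℕ) (D : OpR m q r) : OpR m q r :=
  ∑ i ∈ Finset.range N, ((i.factorial : ℂ)⁻¹) • (adj d.opPhi)^[i] D

theorem expPhi_smul (N : ℕ) (c : ℂ) (D : OpR m q r) : d.expPhi N (c • D) = c • d.expPhi N D := by
  rw [expPhi, expPhi, Finset.smul_sum]
  exact Finset.sum_congr rfl fun i _ => by rw [adj_iterate_smul, smul_comm]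

theorem expPhi_zero (N : ℕ) : d.expPhi N 0 = 0 :=
  Finset.sum_eq_zero fun i _ => by rw [adj_iterate_zero, smul_zero]

theorem expPhi_mem_Fil {n : ℕ} {D : OpR m q r} (N : ℕ)
    (hD : D ∈ Fil m q (Fin r × ℕ+) (Fin r × ℕ) n) :
    d.expPhi N D ∈ Fil m q (Fin r × ℕ+) (Fin r × ℕ) n :=
  sum_mem fun i _ => Submodule.smul_mem _ _ (d.isPosQuad_opPhi.adj_iterate_mem_Fil hD i)

/-- The powers of $\hbar$ separate the terms of the exponential of $T$: the coefficient of
$\hbar^{k-n}$ comes from exactly $n$ brackets with its exponent, whereas $\Phi$ does not change the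
power. -/
theorem coeff_conj_hbarPow {D : OpR m q r} {k : ℤ} (h : d.IsNil N (hbarPow k D))
    (hT : (adj d.opT)^[N] D = 0) (n : ℕ) : (d.conj (hbarPow k D)).coeff (k - n) =
      ((n.factorial : ℂ)⁻¹) • d.expPhi N ((adj d.opT)^[n] D) := by
  rw [coeff_conj h, ← expPhi, ← expPhi_smul]
  congr 1
  by_cases hn : n < N
  · rw [Finset.sum_eq_single n]
    · rw [sub_add_cancel, coeff_hbarPow_same]
    · intro i _ hi
      rw [coeff_hbarPow_of_ne (by omega), adj_iterate_zero, smul_zero]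
    · exact fun h => absurd (Finset.mem_range.mpr hn) h
  · rw [adj_iterate_eq_zero_of_le hT (not_lt.mp hn), smul_zero]
    refine Finset.sum_eq_zero fun i hi => ?_
    rw [Finset.mem_range] at hi
    rw [coeff_hbarPow_of_ne (by omega), adj_iterate_zero, smul_zero]

theorem coeff_conj_hbarPow_of_lt {D : OpR m q r} {k j : ℤ} (h : d.IsNil N (hbarPow k D))
    (hj : k < j) : (d.conj (hbarPow k D)).coeff j = 0 := by
  rw [coeff_conj h, ← expPhi, Finset.sum_eq_zero, expPhi_zero]
  intro n _
  rw [coeff_hbarPow_of_ne (by omega), adj_iterate_zero, smul_zero]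

theorem conj_hbarPow_mem_rees {D : OpR m q r} {k : ℕ} (h : d.IsNil N (hbarPow k D))
    (hD : D ∈ Fil m q (Fin r × ℕ+) (Fin r × ℕ) (k + 1)) (hN : k + 1 ≤ N) :
    d.conj (hbarPow k D) ∈ reesWeyl m q (Fin r × ℕ+) (Fin r × ℕ) := by
  have hT : (adj d.opT)^[N] D = 0 := d.adj_opT_iterate_eq_zero hD hN
  rw [mem_reesWeyl]
  refine ⟨fun j hj => ?_, fun j => ?_⟩
  · obtain ⟨n, rfl⟩ : ∃ n : ℕ, j = k - n := ⟨(k - j).toNat, by omega⟩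
    rw [coeff_conj_hbarPow h hT, d.adj_opT_iterate_eq_zero hD (by omega), expPhi_zero, smul_zero]
  · by_cases hjk : k < j
    · rw [coeff_conj_hbarPow_of_lt h (by omega)]
      exact zero_mem _
    · obtain ⟨n, rfl⟩ : ∃ n : ℕ, k = j + n := ⟨k - j, by omega⟩
      have e : (j : ℤ) = ((j + n : ℕ) : ℤ) - n := by push_cast; ring
      rw [e, coeff_conj_hbarPow h hT]
      refine Submodule.smul_mem _ _ (expPhi_mem_Fil _ (d.adj_opT_iterate_mem_Fil ?_))
      rwa [show j + 1 + n = j + n + 1 by omega]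

theorem isNil_hbarPow_one (k : ℤ) : d.IsNil 1 (hbarPow k 1) := by
  have h1 : ∀ X : OpR m q r, adj X 1 = 0 := fun X => by rw [adj_apply, mul_one, one_mul, sub_self]
  refine isNil_hbarPow k (h1 _) fun n => ?_
  rcases n with - | n
  · exact h1 _
  · rw [Function.iterate_succ_apply (⇑(adj d.opT)) n, h1, adj_iterate_zero, adj_iterate_zero]

theorem conj_hbarPow_one (k : ℤ) : d.conj (hbarPow k 1) = hbarPow k 1 := by
  have h1 : ∀ X : OpR m q r, adj X 1 = 0 := fun X => by rw [adj_apply, mul_one, one_mul, sub_self]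
  rw [conj, logT_eq, logPhi_eq, expAdj_of_adj_eq_zero (X := hbarPow (-1) d.opT),
    expAdj_of_adj_eq_zero]
  · rw [adj_hbarPow, h1, hbarPow_zero_right]
  · rw [adj_hbarPow, h1, hbarPow_zero_right]

theorem conj_hbarPow_mul (k : ℤ) (h : d.IsNil N Z) (hN : 1 ≤ N) :
    d.conj (hbarPow k 1 * Z) = hbarPow k 1 * d.conj Z := by
  rw [conj_mul ((isNil_hbarPow_one k).mono hN) h, conj_hbarPow_one]

/-! ### Conjugation of modes -/

theorem isNil_mode (k : ℤ) (w : Mode r) : d.IsNil 3 (hbarPow k (mode w)) := by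
  refine isNil_hbarPow k (d.adj_opT_iterate_eq_zero (mode_mem_Fil w) (by norm_num)) fun n => ?_
  rcases n with - | n
  · exact d.isPosQuad_opPhi.adj_iterate_three (hasPar_mode w) (mode_mem_Fil w)
  · refine d.isPosQuad_opPhi.adj_iterate_three (d.hasPar_opT.adj_iterate (hasPar_mode w) _) ?_
    have h := d.adj_opT_iterate_mem_Fil (n := 0) (k := 2 + n) (D := mode w)
      (Fil_mono (by omega) (mode_mem_Fil w))
    rcases n with - | n
    · exact Fil_mono (by norm_num) (d.adj_opT_mem_Fil (mode_mem_Fil w))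
    · rw [d.adj_opT_iterate_eq_zero (mode_mem_Fil w) (by omega)]
      exact zero_mem _

/-- The dilaton shift adds nothing to `w`, and modes of positive number supercommute with the
non-negative modes in the exponent of $\Phi$. -/
theorem conj_mode_eq {w : Mode r} (hw : 1 ≤ mnum w) (h : d.shift w = 0) (k : ℤ) :
    d.conj (hbarPow k (mode w)) = hbarPow k (mode w) := by
  rw [conj, logT_eq, logPhi_eq, expAdj_of_adj_eq_zero (X := hbarPow (-1) d.opT),
    expAdj_of_adj_eq_zero]
  · rw [adj_hbarPow, d.isPosQuad_opPhi.adj_eq_zero (hasPar_mode w) (Fil_le_RLin (mode_mem_Fil w))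
      (fun u hu => ad_mode_mode_eq_zero hu hw), hbarPow_zero_right]
  · rw [adj_hbarPow, adj_opT_mode, h, map_zero, mulOp_zero, hbarPow_zero_right]

theorem conj_mode_mem_rees (w : Mode r) :
    d.conj (hbarPow 1 (mode w)) ∈ reesWeyl m q (Fin r × ℕ+) (Fin r × ℕ) :=
  conj_hbarPow_mem_rees (k := 1) (isNil_mode _ w) (mode_mem_Fil w) (by norm_num)

/-! ### Conjugation of quadratic operators -/

/-- Homogeneous operators of degree two on which `Φ` acts nilpotently. -/
structure IsQuad (d : LocalData m q r) (e : ℕ) (D : OpR m q r) : Prop where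
  mem_Fil : D ∈ Fil m q (Fin r × ℕ+) (Fin r × ℕ) 3
  hasPar : HasPar e D
  nil : (adj d.opPhi)^[5] D = 0

theorem isQuad_opL (a : Fin r) (n : ℤ) : d.IsQuad 0 (opL a n) where
  mem_Fil := opL_mem_Fil a n
  hasPar := hasPar_opL a n
  nil := by
    have h := (psum_opL (m := m) (q := q) a n).adj_iterate_eq_zero (X := d.opPhi) (n := 5) fun j => by
      rw [adj_iterate_smul, d.isPosQuad_opPhi.adj_iterate_five, smul_zero]
    have h1 : (adj d.opPhi)^[5] (1 : OpR m q r) = 0 :=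
      adj_iterate_eq_zero_of_le (k := 1) (by
        change adj d.opPhi 1 = 0
        rw [adj_apply, mul_one, one_mul, sub_self]) (by norm_num)
    rwa [adj_iterate_sub, adj_iterate_smul, h1, smul_zero, sub_zero] at h

theorem isQuad_opG (a : Fin r) (n : ℤ) : d.IsQuad 1 (opG a n) where
  mem_Fil := opG_mem_Fil a n
  hasPar := hasPar_opG a n
  nil := (psum_opG (m := m) (q := q) a n).adj_iterate_eq_zero fun j => by
    rw [adj_iterate_smul, d.isPosQuad_opPhi.adj_iterate_five, smul_zero]

namespace IsQuad

variable {e : ℕ} {D : OpR m q r} (h : d.IsQuad e D)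

theorem adj_mem_Fil (h : d.IsQuad e D) :
    adj d.opT D ∈ Fil m q (Fin r × ℕ+) (Fin r × ℕ) 2 :=
  d.adj_opT_mem_Fil h.mem_Fil

theorem isNil (h : d.IsQuad e D) (k : ℤ) : d.IsNil 5 (hbarPow k D) := by
  refine isNil_hbarPow k (d.adj_opT_iterate_eq_zero h.mem_Fil (by norm_num)) fun n => ?_
  rcases n with - | n
  · exact h.nil
  · refine adj_iterate_eq_zero_of_le (k := 3) (d.isPosQuad_opPhi.adj_iterate_three
      (d.hasPar_opT.adj_iterate h.hasPar _) ?_) (by norm_num)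
    by_cases hn : n ≤ 2
    · exact d.adj_opT_iterate_mem_Fil (Fil_mono (by omega) h.mem_Fil)
    · rw [d.adj_opT_iterate_eq_zero h.mem_Fil (by omega)]
      exact zero_mem _

theorem conj_mem_rees (h : d.IsQuad e D) :
    d.conj (hbarPow 2 D) ∈ reesWeyl m q (Fin r × ℕ+) (Fin r × ℕ) :=
  conj_hbarPow_mem_rees (k := 2) (h.isNil _) h.mem_Fil (by norm_num)

theorem coeff_conj_one (h : d.IsQuad e D) :
    (d.conj (hbarPow 2 D)).coeff 1 = d.expPhi 5 (adj d.opT D) := by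
  have := coeff_conj_hbarPow (h.isNil 2) (d.adj_opT_iterate_eq_zero h.mem_Fil (by norm_num)) 1
  simp only [Nat.factorial_one, Nat.cast_one, inv_one, one_smul] at this
  exact this

theorem coeff_conj_zero (h : d.IsQuad e D) (h0 : (adj d.opT)^[2] D = 0) :
    (d.conj (hbarPow 2 D)).coeff 0 = 0 := by
  have := coeff_conj_hbarPow (h.isNil 2) (d.adj_opT_iterate_eq_zero h.mem_Fil (by norm_num)) 2
  rw [h0, expPhi_zero, smul_zero] at this
  exact this

/-- This lets the symbols be computed from $T$ alone, modulo nilpotents. Each bracket with the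
exponent of $\Phi$ uses brackets of the linear part with modes of non-negative number; these have
vanishing body, and the property is inherited by further brackets. -/
theorem ad_coeff_conj_one_sub_mem (h : d.IsQuad e D)
    (h0 : ∀ u : Mode r, 0 ≤ mnum u → ad (mpar u) (mode u) (adj d.opT D) ∈
      bodyZero m q (Fin r × ℕ+) (Fin r × ℕ)) (w : Mode r) :
    ad (mpar w) (mode w) ((d.conj (hbarPow 2 D)).coeff 1) - ad (mpar w) (mode w) (adj d.opT D) ∈
      bodyZero m q (Fin r × ℕ+) (Fin r × ℕ) := by
  have key : ∀ i : ℕ, HasPar e ((adj d.opPhi)^[i] (adj d.opT D)) ∧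
      (adj d.opPhi)^[i] (adj d.opT D) ∈ RLin m q (Fin r × ℕ+) (Fin r × ℕ) ∧
      ∀ u : Mode r, 0 ≤ mnum u → ad (mpar u) (mode u) ((adj d.opPhi)^[i] (adj d.opT D)) ∈
        bodyZero m q (Fin r × ℕ+) (Fin r × ℕ) := fun i => by
    induction i with
    | zero => exact ⟨d.hasPar_opT.adj h.hasPar, Fil_le_RLin h.adj_mem_Fil, h0⟩
    | succ i ih =>
      rw [Function.iterate_succ_apply']
      exact ⟨d.isPosQuad_opPhi.hasPar.adj ih.1,
        Fil_le_RLin (d.isPosQuad_opPhi.adj_mem_Fil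
          (d.isPosQuad_opPhi.adj_iterate_mem_Fil h.adj_mem_Fil i)),
        fun u _ => d.isPosQuad_opPhi.ad_adj_mem_bodyZero ih.1 ih.2.1 ih.2.2 u⟩
  rw [h.coeff_conj_one, expPhi, Finset.sum_range_succ', map_add]
  simp only [Nat.factorial_zero, Nat.cast_one, inv_one, one_smul, Function.iterate_zero, id_eq,
    add_sub_cancel_right]
  rw [map_sum]
  refine sum_mem fun i _ => ?_
  rw [map_smul, Function.iterate_succ_apply']
  exact Submodule.smul_mem _ _
    (d.isPosQuad_opPhi.ad_adj_mem_bodyZero (key i).1 (key i).2.1 (key i).2.2 w)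

end IsQuad

end LocalData

end SuperAiry

end

/-! ### The Casimir condition and the vanishing of constant terms. -/

noncomputable section

namespace SuperAiry

variable {m q r : ℕ} {ι κ : Type}

/-! ### The Casimir condition -/

/-- A coefficient of a product is written as a sum of operators over all integers, so that it can be
compared term by term with the sums that define `opL` and `opG`. -/
theorem psum_coeff_mul (f g : LaurentSeries (Params m q)) (N : ℤ) :
    PSum (fun i : ℤ => (mulOp (const (f.coeff i * g.coeff (N - i))) : OpR m q r))
      (mulOp (const ((f * g).coeff N))) := by
  classical
  have hs : ∀ i, f.coeff i * g.coeff (N - i) ≠ 0 →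
      i ∈ (Finset.antidiagonal f.isPWO_support g.isPWO_support N).image Prod.fst := fun i hi => by
    refine Finset.mem_image.mpr ⟨(i, N - i), ?_, rfl⟩
    rw [Finset.mem_antidiagonal]
    exact ⟨fun h => hi (by rw [h, zero_mul]), fun h => hi (by rw [h, mul_zero]),
      add_sub_cancel i N⟩
  have hf : PFin fun i : ℤ => (mulOp (const (f.coeff i * g.coeff (N - i))) : OpR m q r) :=
    fun h => (Finset.finite_toSet _).subset fun i hi => hs i fun h0 => hi <| by
      simp only [h0, map_zero, mulOp_apply, zero_mul]
  refine ⟨hf, fun h => ?_⟩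
  rw [finsum_eq_sum_of_support_subset (s := (Finset.antidiagonal f.isPWO_support
    g.isPWO_support N).image Prod.fst) _ fun i hi => Finset.mem_coe.mpr <| hs i fun h0 => hi <| by
      simp only [h0, map_zero, mulOp_apply, zero_mul]]
  rw [Finset.sum_image, HahnSeries.coeff_mul]
  · simp only [mulOp_apply, map_sum, Finset.sum_mul]
    refine Finset.sum_congr rfl fun p hp => ?_
    rw [Finset.mem_antidiagonal] at hp
    rw [← hp.2.2, add_sub_cancel_left]
  · intro p hp p' hp' h
    rw [Finset.mem_coe, Finset.mem_antidiagonal] at hp hp'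
    exact Prod.ext h (by have := hp.2.2; have := hp'.2.2; omega)

theorem mulOp_sub {A₀ A₁ : Type} (f g : Fun m q A₀ A₁) : mulOp (f - g) = mulOp f - mulOp g :=
  LinearMap.ext fun h => sub_mul f g h

theorem odd_mul_odd_swap {f g : Params m q} (hf : SPoly.IsOdd f) (hg : SPoly.IsOdd g) :
    f * g = -(g * f) := by
  rw [hf.comm, hg, neg_mul]

namespace LocalData

variable {d : LocalData m q r} {a : Fin r} {s : ℤ}

theorem omega01_coef : (d.omega01 a).coef = ⟨d.τ a, d.t a⟩ := by
  have h1 : (d.omega01 a).coef = ⟨0 + d.τ a, HahnSeries.single 1 1 *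
    (HahnSeries.single (-1) 1 * d.t a) + 0⟩ := rfl
  rw [h1, zero_add, add_zero, ← mul_assoc, HahnSeries.single_mul_single]
  norm_num

/-- Pulling back by the involution changes the coefficient of $[dz]\,z^{k-1}$ by $(-1)^k$, so the
symmetrised form contains twice the even $t_k$ and cancels the odd ones. -/
theorem t_eq_zero (h : ((d.omega01 a) + (d.omega01 a).sigma).coef.IsBigO 1) {k : ℤ} (hk : k < 1)
    (hev : Even k) : (d.t a).coeff k = 0 := by
  have h1 := (h k hk).2
  have h2 : ((d.omega01 a) + (d.omega01 a).sigma).coef.c1.coeff k =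
      (d.omega01 a).coef.c1.coeff k - -((-1 : ℂ) ^ k • (d.omega01 a).coef.c1.coeff k) := by
    rw [sub_eq_add_neg]; rfl
  rw [h2, omega01_coef, hev.neg_one_zpow, one_smul, sub_neg_eq_add, ← two_smul ℂ] at h1
  exact (smul_eq_zero.mp h1).resolve_left two_ne_zero

theorem τ_eq_zero (h : ((d.omega01 a) + (d.omega01 a).sigma).coef.IsBigO 1) {k : ℤ} (hk : k < 1)
    (hod : Odd k) : (d.τ a).coeff k = 0 := by
  have h1 := (h k hk).1
  have h2 : ((d.omega01 a) + (d.omega01 a).sigma).coef.c0.coeff k =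
      (d.omega01 a).coef.c0.coeff k - ((-1 : ℂ) ^ k • (d.omega01 a).coef.c0.coeff k) := by
    rw [sub_eq_add_neg]; rfl
  rw [h2, omega01_coef, hod.neg_one_zpow, neg_smul, one_smul, sub_neg_eq_add, ← two_smul ℂ] at h1
  exact (smul_eq_zero.mp h1).resolve_left two_ne_zero

theorem psum_casimir_zero (h : (d.omega01 a).twistedCasimir.IsBigO s) {N : ℤ} (hN : N < s) :
    PSum (fun i : ℤ => (mulOp (const ((d.t a).coeff i * ((-1 : ℂ) ^ (N - i) • (d.τ a).coeff (N - i)) -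
      ((-1 : ℂ) ^ i • (d.t a).coeff i) * (d.τ a).coeff (N - i))) : OpR m q r)) 0 := by
  have h1 := (h N hN).1
  have h2 : (d.omega01 a).twistedCasimir.c0.coeff N = (1 / 2 : ℂ) •
      (((d.omega01 a).coef.c1 * scaleCoeff (fun k => (-1 : ℂ) ^ k) (d.omega01 a).coef.c0).coeff N -
        (scaleCoeff (fun k => (-1 : ℂ) ^ k) (d.omega01 a).coef.c1 * (d.omega01 a).coef.c0).coeff N) :=
    rfl
  rw [h2, omega01_coef] at h1
  have h3 := (smul_eq_zero.mp h1).resolve_left (by norm_num)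
  have h4 := (psum_coeff_mul (r := r) (d.t a) (scaleCoeff (fun k => (-1 : ℂ) ^ k) (d.τ a)) N).sub
    (psum_coeff_mul (scaleCoeff (fun k => (-1 : ℂ) ^ k) (d.t a)) (d.τ a) N)
  rw [← mulOp_sub, ← map_sub, h3, map_zero, mulOp_zero] at h4
  exact h4.congr fun i => by rw [← mulOp_sub, ← map_sub]; rfl

theorem psum_casimir_one (h : (d.omega01 a).twistedCasimir.IsBigO s) {N : ℤ} (hN : N < s) :
    PSum (fun i : ℤ => (mulOp (const
      ((((i : ℂ) • (d.τ a).coeff i) * ((-1 : ℂ) ^ (N - i) • (d.τ a).coeff (N - i)) +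
        (d.t a).coeff i * -((-1 : ℂ) ^ (N - i) • (d.t a).coeff (N - i))) -
      (-((-1 : ℂ) ^ i • (i : ℂ) • (d.τ a).coeff i) * (d.τ a).coeff (N - i) +
        ((-1 : ℂ) ^ i • (d.t a).coeff i) * (d.t a).coeff (N - i)))) : OpR m q r)) 0 := by
  have hP : ∀ c : ℤ → ℂ, (scaleCoeff c (d.t a)).map SPoly.parity = scaleCoeff c (d.t a) := fun c => by
    ext k
    change SPoly.parity (c k • (d.t a).coeff k) = c k • (d.t a).coeff k
    rw [map_smul, d.t_even]
  have hP' : (d.t a).map SPoly.parity = d.t a := by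
    ext k
    exact d.t_even a k
  have h1 := (h N hN).2
  have h2 : (d.omega01 a).twistedCasimir.c1.coeff N = (1 / 2 : ℂ) •
      (((scaleCoeff (fun k => (k : ℂ)) (d.omega01 a).coef.c0 *
          scaleCoeff (fun k => (-1 : ℂ) ^ k) (d.omega01 a).coef.c0).coeff N +
        ((d.omega01 a).coef.c1.map SPoly.parity *
          -scaleCoeff (fun k => (-1 : ℂ) ^ k) (d.omega01 a).coef.c1).coeff N) -
      ((-scaleCoeff (fun k => (-1 : ℂ) ^ k) (scaleCoeff (fun k => (k : ℂ)) (d.omega01 a).coef.c0) *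
          (d.omega01 a).coef.c0).coeff N +
        ((scaleCoeff (fun k => (-1 : ℂ) ^ k) (d.omega01 a).coef.c1).map SPoly.parity *
          (d.omega01 a).coef.c1).coeff N)) :=
    rfl
  rw [h2, omega01_coef] at h1
  simp only [hP, hP'] at h1
  have h3 := (smul_eq_zero.mp h1).resolve_left (by norm_num)
  have h4 := ((psum_coeff_mul (r := r) (scaleCoeff (fun k => (k : ℂ)) (d.τ a))
    (scaleCoeff (fun k => (-1 : ℂ) ^ k) (d.τ a)) N).add
    (psum_coeff_mul (d.t a) (-scaleCoeff (fun k => (-1 : ℂ) ^ k) (d.t a)) N)).sub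
    ((psum_coeff_mul (-scaleCoeff (fun k => (-1 : ℂ) ^ k) (scaleCoeff (fun k => (k : ℂ)) (d.τ a)))
      (d.τ a) N).add (psum_coeff_mul (scaleCoeff (fun k => (-1 : ℂ) ^ k) (d.t a)) (d.t a) N))
  rw [← mulOp_add, ← map_add, ← mulOp_add, ← map_add, ← mulOp_sub, ← map_sub, h3, map_zero,
    mulOp_zero] at h4
  exact h4.congr fun i => by
    rw [← mulOp_add, ← map_add, ← mulOp_add, ← map_add, ← mulOp_sub, ← map_sub]; rfl

/-- In the $\theta$-free part of the Casimir the terms with odd index add up. Products with even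
index vanish one by one by the linear condition: the indices sum to an odd number at most $1$, so an
even $t$ or an odd $\tau$ of non-positive index occurs. -/
theorem psum_t_mul_τ (hlin : ((d.omega01 a) + (d.omega01 a).sigma).coef.IsBigO 1)
    (hcas : (d.omega01 a).twistedCasimir.IsBigO s) (hs : s ≤ 3) {N : ℤ} (hN : N < s) (hodd : Odd N) :
    PSum (fun i : ℤ => (coeffG i • mulOp (const ((d.t a).coeff i * (d.τ a).coeff (N - i))) :
      OpR m q r)) 0 := by
  have h := (psum_casimir_zero hcas hN).smul (1 / 2 : ℂ)
  rw [smul_zero] at h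
  refine h.congr fun i => ?_
  rcases Int.even_or_odd i with hi | hi
  · rw [coeffG, if_pos hi, zero_smul]
    have h0 : (d.t a).coeff i * (d.τ a).coeff (N - i) = 0 := by
      by_cases h1 : i < 1
      · rw [t_eq_zero hlin h1 hi, zero_mul]
      · rw [τ_eq_zero hlin (k := N - i) (by obtain ⟨j, rfl⟩ := hi; omega) (hodd.sub_even hi), mul_zero]
    rw [mul_smul_comm, smul_mul_assoc, h0, smul_zero, smul_zero, sub_zero, map_zero, mulOp_zero,
      smul_zero]
  · rw [coeffG, if_neg (Int.not_even_iff_odd.mpr hi), one_smul, mul_smul_comm, smul_mul_assoc,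
      hi.neg_one_zpow, (hodd.sub_odd hi).neg_one_zpow, ← mulOp_smul, ← map_smul]
    congr 2
    module

/-- The Casimir pairs $t$ with $t$ and $\tau$ with $\tau$ in all indices; the linear condition
removes the products of even $t$'s and of odd $\tau$'s. As `N` is at most $2$, the only odd product
it does not reach is $\tau_{a,1}^2$, which is zero anyway. -/
theorem psum_t_mul_t (hlin : ((d.omega01 a) + (d.omega01 a).sigma).coef.IsBigO 1)
    (hcas : (d.omega01 a).twistedCasimir.IsBigO s) (hs : s ≤ 3) {N : ℤ} (hN : N < s) (hev : Even N) :
    PSum (fun i : ℤ => (mulOp (const (if Even i then (i : ℂ) • ((d.τ a).coeff i * (d.τ a).coeff (N - i))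
      else (d.t a).coeff i * (d.t a).coeff (N - i))) : OpR m q r)) 0 := by
  have h := (psum_casimir_one hcas hN).smul (1 / 2 : ℂ)
  rw [smul_zero] at h
  refine h.congr fun i => ?_
  rw [← mulOp_smul, ← map_smul]
  congr 2
  rcases Int.even_or_odd i with hi | hi
  · have h0 : (d.t a).coeff i * (d.t a).coeff (N - i) = 0 := by
      by_cases h1 : i < 1
      · rw [t_eq_zero hlin h1 hi, zero_mul]
      · rw [t_eq_zero hlin (k := N - i) (by obtain ⟨j, rfl⟩ := hi; obtain ⟨l, rfl⟩ := hev; omega)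
          (hev.sub hi), mul_zero]
    rw [if_pos hi, hi.neg_one_zpow, (hev.sub hi).neg_one_zpow]
    simp only [one_smul, mul_neg, h0, neg_mul, smul_mul_assoc]
    module
  · have h0 : (d.τ a).coeff i * (d.τ a).coeff (N - i) = 0 := by
      by_cases h1 : i < 1
      · rw [τ_eq_zero hlin h1 hi, zero_mul]
      · by_cases h2 : N - i < 1
        · rw [τ_eq_zero hlin h2 (hev.sub_odd hi), mul_zero]
        · have e1 : i = 1 := by obtain ⟨j, rfl⟩ := hi; obtain ⟨l, rfl⟩ := hev; omega
          have e2 : N - i = 1 := by obtain ⟨l, rfl⟩ := hev; omega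
          rw [e2, e1]
          exact (d.τ_odd a 1).sq
    rw [if_neg (Int.not_even_iff_odd.mpr hi), hi.neg_one_zpow, (hev.sub_odd hi).neg_one_zpow]
    simp only [neg_smul, one_smul, mul_neg, neg_mul, smul_mul_assoc, h0, smul_zero]
    module

/-- The reflection $i\mapsto N-i$ changes the sign of every term. This allows the weights $i$ of the
Casimir to be replaced by the weights $i+n$ of `coeffL`. -/
theorem psum_τ_mul_τ (a : Fin r) {N : ℤ} (hev : Even N) :
    PSum (fun i : ℤ => (mulOp (const (if Even i then (d.τ a).coeff i * (d.τ a).coeff (N - i)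
      else 0)) : OpR m q r)) 0 := by
  have hf : PFin (fun i : ℤ => (mulOp (const (if Even i then
      (d.τ a).coeff i * (d.τ a).coeff (N - i) else 0)) : OpR m q r)) :=
    (psum_coeff_mul (d.τ a) (d.τ a) N).1.mono fun i f hi => by
      split_ifs
      · exact hi
      · rw [map_zero, mulOp_zero]; rfl
  have h1 := hf.psum
  have h2 := (h1.comp_equiv (Equiv.subLeft N)).add h1
  have h3 := h2.unique (PSum.zero.congr fun i => ?_)
  · rw [← two_smul ℂ] at h3
    have h4 := (smul_eq_zero.mp h3).resolve_left two_ne_zero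
    rwa [h4] at h1
  · rw [Equiv.subLeft_apply, ← mulOp_add, ← map_add, sub_sub_cancel]
    by_cases hi : Even i
    · rw [if_pos hi, if_pos (hev.sub hi), odd_mul_odd_swap (d.τ_odd a i) (d.τ_odd a (N - i)),
        add_neg_cancel, map_zero, mulOp_zero]
    · rw [if_neg hi, if_neg fun h => hi (by simpa using hev.sub h), add_zero, map_zero, mulOp_zero]

/-- Take the least odd `l` below `s` with non-zero body. In the Casimir identity of order $2l$ the
$\tau$'s have no body and every other product contains a $t$ of odd index below `l`, so the square
of the body of $t_l$ vanishes in a domain. The order $2l$ is below `s` precisely because `s` is $1$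
or $3$. -/
theorem body_t_eq_zero (hlin : ((d.omega01 a) + (d.omega01 a).sigma).coef.IsBigO 1)
    (hcas : (d.omega01 a).twistedCasimir.IsBigO s) (hs : s = 1 ∨ s = 3) {k : ℤ} (hk : k < s)
    (hodd : Odd k) : SPoly.body ((d.t a).coeff k) = 0 := by
  classical
  by_contra hne
  obtain ⟨l, ⟨hlo, hls, hl⟩, hmin⟩ := Int.exists_least_of_bdd
    (P := fun l => Odd l ∧ l < s ∧ SPoly.body ((d.t a).coeff l) ≠ 0)
    ⟨(d.t a).order, fun z hz => HahnSeries.order_le_of_coeff_ne_zero fun h0 => hz.2.2 (by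
      rw [h0, map_zero])⟩ ⟨k, hodd, hk, hne⟩
  have h1 := psum_t_mul_t hlin hcas (by omega) (N := 2 * l)
    (by obtain ⟨j, rfl⟩ := hlo; omega) (even_two_mul l)
  have h2 := h1.sub (PSum.ite_eq l fun _ => mulOp (const ((d.t a).coeff l * (d.t a).coeff l)))
  have h3 := h2.mem_bodyZero fun i => ?_
  · rw [zero_sub, neg_mem_iff, const_mem_bodyZero, map_mul, mul_self_eq_zero] at h3
    exact hl h3
  · by_cases hi : i = l
    · subst hi
      rw [if_neg (Int.not_even_iff_odd.mpr hlo), if_pos rfl, two_mul, add_sub_cancel_right, sub_self]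
      exact zero_mem _
    · rw [if_neg hi, sub_zero, const_mem_bodyZero]
      split_ifs with he
      · rw [map_smul, map_mul, SPoly.IsOdd.body (d.τ_odd a i), zero_mul, smul_zero]
      · rw [map_mul]
        have ho := Int.not_even_iff_odd.mp he
        rcases lt_or_gt_of_ne hi with hlt | hgt
        · rw [mul_eq_zero]; left
          by_contra h0
          exact absurd (hmin i ⟨ho, by omega, h0⟩) (by omega)
        · rw [mul_eq_zero]; right
          by_contra h0
          exact absurd (hmin (2 * l - i) ⟨(even_two_mul l).sub_odd ho, by omega, h0⟩) (by omega)

/-! ### The dilaton shift of the quadratic operators -/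

/-- One bracket must fall on each factor and turns it into its shift; the two orders give the factor
$2$, and the ordering constant is killed. -/
theorem adj_adj_nprod (u v : Mode r) : (adj d.opT)^[2] (nprod u v : OpR m q r) =
    (2 : ℂ) • mulOp (const (d.shift u * d.shift v)) := by
  have hc : ∀ c : Params m q, adj d.opT (mulOp (const c)) = 0 :=
    adj_const d.hasPar_opT (Fil_le_RLin d.opT_mem_Fil)
  have h1 : (adj d.opT)^[2] (1 : OpR m q r) = 0 :=
    adj_iterate_eq_zero_of_le (k := 1) (by
      change adj d.opT 1 = 0
      rw [adj_apply, mul_one, one_mul, sub_self]) (by norm_num)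
  rw [nprod_eq_sub, adj_iterate_sub, adj_iterate_smul, h1, smul_zero, sub_zero]
  change adj d.opT (adj d.opT (mode u * mode v)) = _
  rw [adj_mul, map_add, adj_mul, adj_mul, adj_opT_mode, adj_opT_mode, hc, hc, mul_zero, zero_add,
    zero_mul, add_zero, ← mulOp_mul, ← map_mul, two_smul]

theorem shift_oMode (a : Fin r) (k : ℤ) : d.shift (oMode a k) =
    if Even k then (d.τ a).coeff (-k) else (d.t a).coeff (-k) := by
  unfold oMode
  split_ifs <;> rfl

/-- The shifts have indices adding to $-2n$, so the sum is the Casimir coefficient of order $-2n<s$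
plus $n$ times the antisymmetric sum of the $\tau$'s. -/
theorem adj_adj_opL (hlin : ((d.omega01 a) + (d.omega01 a).sigma).coef.IsBigO 1)
    (hcas : (d.omega01 a).twistedCasimir.IsBigO s) (hs : s ≤ 3) {n : ℤ} (hn : -s < 2 * n) :
    (adj d.opT)^[2] (opL a n) = 0 := by
  have h := (psum_opL (m := m) (q := q) a n).adj_iterate d.opT 2
  have h1 : (adj d.opT)^[2] (1 : OpR m q r) = 0 :=
    adj_iterate_eq_zero_of_le (k := 1) (by
      change adj d.opT 1 = 0
      rw [adj_apply, mul_one, one_mul, sub_self]) (by norm_num)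
  rw [adj_iterate_sub, adj_iterate_smul, h1, smul_zero, sub_zero] at h
  have h2 := (psum_t_mul_t hlin hcas hs (N := -(2 * n)) (by omega) (even_two_mul n).neg).add
    ((psum_τ_mul_τ (d := d) a (even_two_mul n).neg).smul (n : ℂ))
  rw [smul_zero, add_zero] at h2
  refine h.unique (h2.congr fun j => ?_)
  rw [adj_iterate_smul, adj_adj_nprod, shift_oMode, shift_oMode, neg_neg, ← mulOp_smul, ← map_smul,
    ← mulOp_add, ← map_add, ← mulOp_smul, ← map_smul, ← mulOp_smul, ← map_smul, coeffL]
  congr 2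
  have e : -(2 * n + j) = -(2 * n) - j := by ring
  by_cases hj : Even j
  · rw [if_pos hj, if_pos hj, if_pos hj, if_pos hj.neg, if_pos ((even_two_mul n).add hj), e]
    module
  · have hj' := Int.not_even_iff_odd.mp hj
    rw [if_neg hj, if_neg hj, if_neg hj, if_neg (Int.not_even_iff_odd.mpr hj'.neg),
      if_neg (Int.not_even_iff_odd.mpr ((even_two_mul n).add_odd hj')), e]
    module

theorem adj_adj_opG (hlin : ((d.omega01 a) + (d.omega01 a).sigma).coef.IsBigO 1)
    (hcas : (d.omega01 a).twistedCasimir.IsBigO s) (hs : s ≤ 3) {n : ℤ} (hn : -s < 2 * n + 1) :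
    (adj d.opT)^[2] (opG a n) = 0 := by
  have h := (psum_opG (m := m) (q := q) a n).adj_iterate d.opT 2
  have hodd : Odd (-(2 * n + 1)) := (odd_two_mul_add_one n).neg
  have h2 := (psum_t_mul_τ hlin hcas hs (N := -(2 * n + 1)) (by omega) hodd).smul (2 : ℂ)
  rw [smul_zero] at h2
  refine h.unique (h2.congr fun j => ?_)
  rw [adj_iterate_smul, adj_adj_nprod, shift_oMode, shift_oMode, neg_neg, smul_comm]
  by_cases hj : Even j
  · rw [coeffG, if_pos hj, zero_smul, zero_smul]
  · have hj' := Int.not_even_iff_odd.mp hj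
    have he : Even (2 * n + 1 + j) := (odd_two_mul_add_one n).add_odd hj'
    rw [if_neg (Int.not_even_iff_odd.mpr hj'.neg), if_pos he,
      show -(2 * n + 1 + j) = -(2 * n + 1) - j by ring]

end LocalData

end SuperAiry

end

/-! ### A common numbering of the quadratic operators. -/

noncomputable section

namespace SuperAiry

variable {m q r : ℕ} {ι κ : Type}

/-! ### The untwisted parts of `L` and `G`, with a common numbering -/

/-- The operator `opL a n` for `k = 2n` and `opG a n` for `k = 2n + 1`. -/
def quad (a : Fin r) (k : ℤ) : OpR m q r := if Even k then opL a (k / 2) else opG a (k / 2)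

/-- The parity of `quad a k`. -/
def quadPar (k : ℤ) : ℕ := if Even k then 0 else 1

/-- The structure constants of the bracket of `quad a k` with the modes of the untwisted sector. -/
def quadCoeff (k j : ℤ) : ℂ := if Even k then lam (k / 2) j else gam j

/-- The structure constants of the operators `quad`. -/
def quadBracket (k l : ℤ) : ℂ :=
  if Even k then (if Even l then k - l else k / 2 - l) else (if Even l then k - l / 2 else 2)

theorem quad_two_mul (a : Fin r) (n : ℤ) : (quad a (2 * n) : OpR m q r) = opL a n := by
  rw [quad, if_pos (even_two_mul n), Int.mul_ediv_cancel_left _ two_ne_zero]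

theorem quad_two_mul_add_one (a : Fin r) (n : ℤ) :
    (quad a (2 * n + 1) : OpR m q r) = opG a n := by
  rw [quad, if_neg (Int.not_even_two_mul_add_one n), show (2 * n + 1) / 2 = n by omega]

theorem quadPar_two_mul (n : ℤ) : quadPar (2 * n) = 0 := if_pos (even_two_mul n)

theorem quadPar_two_mul_add_one (n : ℤ) : quadPar (2 * n + 1) = 1 :=
  if_neg (Int.not_even_two_mul_add_one n)

theorem isModeOp_quad (a : Fin r) (k : ℤ) :
    IsModeOp a (quadPar k) k (quadCoeff k) (quad a k : OpR m q r) := by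
  obtain ⟨n, rfl | rfl⟩ := Int.even_or_odd' k
  · rw [quad_two_mul, quadPar_two_mul]
    refine (isModeOp_opL a n).congr rfl Iff.rfl rfl fun j => ?_
    rw [quadCoeff, if_pos (even_two_mul n), Int.mul_ediv_cancel_left _ two_ne_zero]
  · rw [quad_two_mul_add_one, quadPar_two_mul_add_one]
    refine (isModeOp_opG a n).congr rfl Iff.rfl rfl fun j => ?_
    rw [quadCoeff, if_neg (Int.not_even_two_mul_add_one n)]

theorem hasPar_quad (a : Fin r) (k : ℤ) : HasPar (quadPar k) (quad a k : OpR m q r) :=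
  (isModeOp_quad a k).hasPar

theorem quad_apply_eq_zero {a : Fin r} {k N : ℤ} {f : FunR m q r} (hN : 0 < N)
    (h : ∀ w : Mode r, N ≤ mnum w → mode w f = 0) (hk : 2 * N ≤ k) : quad a k f = 0 := by
  obtain ⟨n, rfl | rfl⟩ := Int.even_or_odd' k
  · rw [quad_two_mul]; exact opL_apply_eq_zero hN h (by omega)
  · rw [quad_two_mul_add_one]; exact opG_apply_eq_zero h (by omega)

theorem br_swap_of_hasPar {A₀ A₁ : Type} {D E : Op m q A₀ A₁} {e : ℕ} (hE : HasPar 0 E)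
    (hD : HasPar e D) : br e D E = -br 0 E D := by
  rw [br_apply, br_apply, hE.pow, zero_mul, pow_zero, one_smul, pow_zero, neg_sub]
  rfl

/-- The lower bound `-2` corresponds to index `-1` in `opL`, and for `opG` it leaves odd numbers
from `-1` on: this is the range in which the relations have no central term. -/
theorem br_quad (a : Fin r) {k l : ℤ} (hk : -2 ≤ k) (hl : -2 ≤ l) :
    br (quadPar k) (quad a k) (quad a l) = quadBracket k l • (quad a (k + l) : OpR m q r) := by
  obtain ⟨i, rfl | rfl⟩ := Int.even_or_odd' k <;> obtain ⟨j, rfl | rfl⟩ := Int.even_or_odd' l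
  · rw [quadPar_two_mul, quad_two_mul, quad_two_mul, br_opL_opL (by omega) (by omega), ← mul_add,
      quad_two_mul, quadBracket, if_pos (even_two_mul i), if_pos (even_two_mul j)]
    congr 1
    push_cast; ring
  · rw [quadPar_two_mul, quad_two_mul, quad_two_mul_add_one, br_opL_opG (by omega) (by omega),
      ← add_assoc, ← mul_add, quad_two_mul_add_one, quadBracket, if_pos (even_two_mul i),
      if_neg (Int.not_even_two_mul_add_one j)]
    congr 1
    push_cast; ring
  · rw [quadPar_two_mul_add_one, quad_two_mul, quad_two_mul_add_one,
      br_swap_of_hasPar (hasPar_opL a j) (hasPar_opG a i), br_opL_opG (by omega) (by omega),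
      show 2 * i + 1 + 2 * j = 2 * (j + i) + 1 by ring, quad_two_mul_add_one, quadBracket,
      if_neg (Int.not_even_two_mul_add_one i), if_pos (even_two_mul j),
      show ((2 * i + 1 : ℤ) : ℂ) - ((2 * j : ℤ) : ℂ) / 2 = -((j : ℂ) - 2 * i - 1) by
        push_cast; ring]
    exact (neg_smul _ _).symm
  · rw [quadPar_two_mul_add_one, quad_two_mul_add_one, quad_two_mul_add_one,
      br_opG_opG (by omega) (by omega), show 2 * i + 1 + (2 * j + 1) = 2 * (i + j + 1) by ring,
      quad_two_mul, quadBracket, if_neg (Int.not_even_two_mul_add_one i),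
      if_neg (Int.not_even_two_mul_add_one j)]

theorem br_quad_eq_zero {a b : Fin r} (hab : a ≠ b) (k l : ℤ) :
    br (quadPar k) (quad a k) (quad b l : OpR m q r) = 0 := by
  obtain ⟨j, rfl | rfl⟩ := Int.even_or_odd' l
  · rw [quad_two_mul]; exact (isModeOp_quad a k).br_opL_eq_zero hab j
  · rw [quad_two_mul_add_one]; exact (isModeOp_quad a k).br_opG_eq_zero hab j

theorem eMode_ne_oMode (a b : Fin r) (k l : ℤ) : eMode a k ≠ oMode b l := by
  unfold eMode oMode
  intro h
  by_cases h1 : Even k <;> by_cases h2 : Even l <;> simp only [h1, h2, if_true, if_false] at h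
  · cases h
  · exact h2 ((Prod.mk.inj (Sum.inl_injective h)).2 ▸ h1)
  · exact h1 ((Prod.mk.inj (Sum.inr_injective h)).2 ▸ h2)
  · cases h

theorem br_quad_eMode (a b : Fin r) (k j : ℤ) :
    br (quadPar k) (quad a k) (mode (eMode b j) : OpR m q r) = 0 :=
  (isModeOp_quad a k).br_eq_zero fun l => eMode_ne_oMode b a j l

theorem br_eMode_quad (a b : Fin r) (k j : ℤ) :
    br (mpar (eMode b j)) (mode (eMode b j)) (quad a k : OpR m q r) = 0 := by
  have h := br_quad_eMode (m := m) (q := q) a b k j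
  rw [br_apply, (hasPar_mode _).pow, smul_mul_assoc, sub_eq_zero] at h
  rw [br_apply, (hasPar_quad a k).pow, smul_mul_assoc, h, smul_smul, ← pow_add, mul_comm,
    ← two_mul, pow_mul]
  norm_num

theorem br_eMode_eMode (a b : Fin r) {k l : ℤ} (hk : 1 ≤ k) (hl : 1 ≤ l) :
    br (mpar (eMode a k)) (mode (eMode a k)) (mode (eMode b l) : OpR m q r) = 0 := by
  rw [(hasPar_mode _).br_eq_ad (hasPar_mode _)]
  exact ad_mode_mode_eq_zero (by rw [mnum_eMode]; omega) (by rw [mnum_eMode]; omega)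

/-- The series `L_{a,2n}` for `k = 2n` and `G_{a,2n+1}` for `k = 2n + 1`. -/
def virasoro (a : Fin r) (k : ℤ) : HOpR m q r := if Even k then L a (k / 2) else G a (k / 2)

/-- The coefficients of the twisted part of `virasoro a k`. -/
def restCoeff (k j : ℤ) : ℂ :=
  if Even k then coeffLRest (k / 2) j else if Even j then -1 else 0

theorem isSum_virasoro (a : Fin r) (k : ℤ) :
    IsSum (fun j => restCoeff k j • hbarPow 2 (nprod (eMode a (-j)) (eMode a (k + j))))
      (virasoro a k - hbarPow 2 (quad a k) : HOpR m q r) := by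
  obtain ⟨n, rfl | rfl⟩ := Int.even_or_odd' k
  · rw [quad_two_mul, virasoro, if_pos (even_two_mul n), Int.mul_ediv_cancel_left _ two_ne_zero]
    refine (isSum_L a n).congr fun j => ?_
    rw [restCoeff, if_pos (even_two_mul n), Int.mul_ediv_cancel_left _ two_ne_zero]
  · rw [quad_two_mul_add_one, virasoro, if_neg (Int.not_even_two_mul_add_one n),
      show (2 * n + 1) / 2 = n by omega]
    refine (isSum_G a n).congr fun j => ?_
    rw [restCoeff, if_neg (Int.not_even_two_mul_add_one n)]

namespace LocalData

variable {d : LocalData m q r} {a : Fin r} {s : ℤ}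

theorem isQuad_quad (a : Fin r) (k : ℤ) : d.IsQuad (quadPar k) (quad a k) := by
  obtain ⟨n, rfl | rfl⟩ := Int.even_or_odd' k
  · rw [quad_two_mul, quadPar_two_mul]; exact isQuad_opL a n
  · rw [quad_two_mul_add_one, quadPar_two_mul_add_one]; exact isQuad_opG a n

theorem adj_adj_quad (hlin : ((d.omega01 a) + (d.omega01 a).sigma).coef.IsBigO 1)
    (hcas : (d.omega01 a).twistedCasimir.IsBigO s) (hs : s ≤ 3) {k : ℤ} (hk : -s < k) :
    (adj d.opT)^[2] (quad a k) = 0 := by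
  obtain ⟨n, rfl | rfl⟩ := Int.even_or_odd' k
  · rw [quad_two_mul]; exact adj_adj_opL hlin hcas hs hk
  · rw [quad_two_mul_add_one]; exact adj_adj_opG hlin hcas hs hk

theorem ad_oMode_adj_quad (k j : ℤ) :
    ad (mpar (oMode a j)) (mode (oMode a j)) (adj d.opT (quad a k)) =
      quadCoeff k j • mulOp (const (d.shift (oMode a (k + j)))) := by
  rw [d.ad_adj_opT (e := 0) (isModeOp_quad a k).mem_RLin, (isModeOp_quad a k).ad_oMode, map_smul,
    adj_opT_mode]

theorem ad_adj_quad_eq_zero {w : Mode r} (hw : ∀ j, w ≠ oMode a j) (k : ℤ) :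
    ad (mpar w) (mode w) (adj d.opT (quad a k)) = 0 := by
  rw [d.ad_adj_opT (e := 0) (isModeOp_quad a k).mem_RLin, (isModeOp_quad a k).ad_eq_zero _ hw, map_zero]

theorem body_shift_oMode (hlin : ((d.omega01 a) + (d.omega01 a).sigma).coef.IsBigO 1)
    (hcas : (d.omega01 a).twistedCasimir.IsBigO s) (hs : s = 1 ∨ s = 3) {k : ℤ} (hk : -s < k) :
    SPoly.body (d.shift (oMode a k)) = 0 := by
  rw [shift_oMode]
  split_ifs with h
  · exact SPoly.IsOdd.body (d.τ_odd _ _)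
  · exact body_t_eq_zero hlin hcas hs (by omega) (Int.not_even_iff_odd.mp h).neg

/-- The shift of a mode of number $k$ has index $-k\le0$, where the linear condition kills exactly
the even $t$'s and the odd $\tau$'s. -/
theorem shift_eMode (hlin : ((d.omega01 a) + (d.omega01 a).sigma).coef.IsBigO 1) {k : ℤ}
    (hk : 0 ≤ k) : d.shift (eMode a k) = 0 := by
  unfold eMode
  split_ifs with h
  · exact t_eq_zero hlin (k := -k) (by omega) h.neg
  · exact τ_eq_zero hlin (k := -k) (by omega) (Int.not_even_iff_odd.mp h).neg

/-- The bracket is a multiple of the shift of an `oMode` whose number exceeds `-s`, that is, of an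
odd $\tau$ or of a $t$ of odd index below `s`. -/
theorem ad_adj_quad_mem_bodyZero (hlin : ((d.omega01 a) + (d.omega01 a).sigma).coef.IsBigO 1)
    (hcas : (d.omega01 a).twistedCasimir.IsBigO s) (hs : s = 1 ∨ s = 3) {k : ℤ} {u : Mode r}
    (hu : -s < k + mnum u) :
    ad (mpar u) (mode u) (adj d.opT (quad a k)) ∈ bodyZero m q (Fin r × ℕ+) (Fin r × ℕ) := by
  by_cases h : ∃ j, u = oMode a j
  · obtain ⟨j, rfl⟩ := h
    rw [mnum_oMode] at hu
    rw [ad_oMode_adj_quad]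
    exact Submodule.smul_mem _ _ (const_mem_bodyZero.mpr (body_shift_oMode hlin hcas hs hu))
  · push Not at h
    rw [ad_adj_quad_eq_zero h]
    exact zero_mem _

end LocalData

end SuperAiry

end

/-! ### Comparison of ideals and matching of generators with coordinates. -/

noncomputable section

namespace SuperAiry

variable {m q r : ℕ} {ι κ : Type}

section

variable {A₀ A₁ : Type}

/-! ### Comparison of generated ideals -/

theorem IsSum.comp_equiv {F : ι → HOp m q A₀ A₁} {Z : HOp m q A₀ A₁} (h : IsSum F Z) (e : κ ≃ ι) :
    IsSum (fun k => F (e k)) Z :=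
  isSum_iff.mpr fun n => (isSum_iff.mp h n).comp_equiv e

theorem generatedIdeal_comp_equiv (K : ι → HOp m q A₀ A₁) (e : κ ≃ ι) :
    generatedIdeal (fun k => K (e k)) = generatedIdeal K := by
  ext Z
  constructor
  · rintro ⟨c, hc, h⟩
    refine ⟨fun i => c (e.symm i), fun i => hc _, (h.comp_equiv e.symm).congr fun i => ?_⟩
    simp only [Equiv.apply_symm_apply]
  · rintro ⟨c, hc, h⟩
    exact ⟨fun k => c (e k), fun k => hc _, h.comp_equiv e⟩

theorem hop_add_sub_cancel' (Y Z : HOp m q A₀ A₁) : Y + Z - Z = Y := add_sub_cancel_right Y Z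

theorem hop_sub_add_cancel (Y Z : HOp m q A₀ A₁) : Y - Z + Z = Y := sub_add_cancel Y Z

/-- A combination of the `g k` splits into the same combination of the `K k` and one of the `V k`.
Fiber finiteness makes the second part converge on its own, inside the ideal. -/
theorem generatedIdeal_subset_of_add {g K V : ι → HOp m q A₀ A₁}
    (hK : ∀ i, K i ∈ reesWeyl m q A₀ A₁) (hKf : HFin K) {P : Type} {π : ι → P → ι}
    {C : ι → P → HOp m q A₀ A₁} (hC : ∀ k p, C k p ∈ reesWeyl m q A₀ A₁)
    (hCf : FiberFin (fun x : ι × P => π x.1 x.2) fun x => C x.1 x.2)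
    (hV : ∀ k, IsSum (fun p => C k p * K (π k p)) (V k)) (hg : ∀ k, g k = K k + V k) :
    generatedIdeal g ⊆ generatedIdeal K := by
  rintro Z ⟨c, hc, h⟩
  obtain ⟨Z', hZ', hs⟩ := exists_isSum_mul hK hKf hC hCf hc hV
  have h1 : Z - Z' ∈ generatedIdeal K := by
    refine ⟨c, hc, (h.sub hs).congr fun i => ?_⟩
    rw [hg, mul_add]
    exact hop_add_sub_cancel' _ _
  have h2 := add_mem_generatedIdeal h1 hZ'
  rwa [hop_sub_add_cancel] at h2

theorem hfin_of_isSum {P : Type} {F : ι → P → HOp m q A₀ A₁} {V : ι → HOp m q A₀ A₁}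
    (hF : HFin fun x : ι × P => F x.1 x.2) (hV : ∀ k, IsSum (F k) (V k)) : HFin V := fun n f => by
  refine ((hF n f).image Prod.fst).subset fun k hk => ?_
  by_contra hne
  refine hk ?_
  refine (hV k n f).2.trans ?_
  refine finsum_eq_zero_of_forall_eq_zero fun p => ?_
  by_contra hp
  exact hne ⟨(k, p), hp, rfl⟩

theorem smul_hbarPow (c : ℂ) (k : ℤ) (D : Op m q A₀ A₁) :
    c • hbarPow k D = hbarPow k (c • D) := by
  refine hop_ext fun n => ?_
  rw [HahnSeries.coeff_smul]
  by_cases h : n = k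
  · rw [h, coeff_hbarPow_same, coeff_hbarPow_same]
  · rw [coeff_hbarPow_of_ne h, coeff_hbarPow_of_ne h, smul_zero]

theorem hbr_hbarPow (e : ℕ) (k l : ℤ) (D E : Op m q A₀ A₁) :
    hbr e (hbarPow k D) (hbarPow l E) = hbarPow (k + l) (br e D E) := by
  have h : hParity^[e] (hbarPow l E) = hbarPow l ((sgn ^ e) E) := by
    refine hop_ext fun n => ?_
    rw [coeff_hParity_pow]
    by_cases h : n = l
    · rw [h, coeff_hbarPow_same, coeff_hbarPow_same]
    · rw [coeff_hbarPow_of_ne h, coeff_hbarPow_of_ne h, map_zero]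
  rw [hbr, h, hbarPow_mul_hbarPow, hbarPow_mul_hbarPow, add_comm l k]
  refine hop_ext fun n => ?_
  rw [HahnSeries.coeff_sub]
  by_cases h : n = k + l
  · rw [h, coeff_hbarPow_same, coeff_hbarPow_same, coeff_hbarPow_same, br_apply]
  · rw [coeff_hbarPow_of_ne h, coeff_hbarPow_of_ne h, coeff_hbarPow_of_ne h, sub_zero]

end

/-! ### Coordinates and modes of negative number -/

theorem modeCoord_ne_zero {u : Mode r} (hu : mnum u < 0) : modeCoord u ≠ 0 := by
  rcases u with ⟨a, k⟩ | ⟨a, k⟩ <;> change k < 0 at hu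
  · rw [modeCoord, if_pos hu]
    exact neg_ne_zero.mpr (by exact_mod_cast ne_of_lt hu)
  · rw [modeCoord, if_pos hu]
    exact one_ne_zero

theorem mulOp_coord_modeIx {u : Mode r} (hu : mnum u < 0) :
    (mulOp (coord (modeIx u)) : OpR m q r) = (modeCoord u)⁻¹ • mode u := by
  rw [mode_eq, modeDeriv_of_neg hu, zero_smul, add_zero, smul_smul,
    inv_mul_cancel₀ (modeCoord_ne_zero hu), one_smul]

/-- A mode of negative number is a non-zero multiple of a coordinate, so symbols can be computed
from brackets with modes. -/
theorem ad_coord_modeIx {u : Mode r} (hu : mnum u < 0) (D : OpR m q r) :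
    ad (par (modeIx u)) (mulOp (coord (modeIx u))) D =
      (modeCoord u)⁻¹ • ad (mpar u) (mode u) D := by
  rw [par_modeIx, mulOp_coord_modeIx hu, ad_smul_left]

theorem modeIx_inl_neg (a : Fin r) (k : ℕ+) : modeIx (.inl (a, -((k : ℕ) : ℤ))) = ixB a k := by
  rw [modeIx, Int.natAbs_neg, Int.natAbs_natCast, PNat.coe_toPNat']

theorem modeIx_inr_neg (a : Fin r) (k : ℕ) : modeIx (.inr (a, -(k : ℤ))) = ixF a k := by
  rw [modeIx, Int.natAbs_neg, Int.natAbs_natCast]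

/-- Indices of the generators; the first summand belongs to the modes of the twisted sector, the second
to the quadratic generators. -/
abbrev FrameIx (r : ℕ) : Type := (Fin r × ℕ+) ⊕ (Fin r × ℕ+)

/-- The mode of negative number that corresponds to an index. -/
def negMode : FrameIx r → Mode r
  | .inl x => eMode x.1 (-((x.2 : ℕ) : ℤ))
  | .inr x => oMode x.1 (-((x.2 : ℕ) : ℤ))

/-- The number of an index. -/
def frameNum : FrameIx r → ℕ
  | .inl x => x.2
  | .inr x => x.2

theorem frameNum_pos (x : FrameIx r) : 0 < frameNum x := by
  rcases x with x | x <;> exact x.2.pos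

theorem mnum_negMode (x : FrameIx r) : mnum (negMode x) = -(frameNum x : ℤ) := by
  rcases x with x | x
  · exact mnum_eMode _ _
  · exact mnum_oMode _ _

theorem mnum_negMode_neg (x : FrameIx r) : mnum (negMode x) < 0 := by
  have := frameNum_pos x
  rw [mnum_negMode]; omega

theorem modeIx_eMode_neg (a : Fin r) (k : ℕ+) : modeIx (eMode a (-((k : ℕ) : ℤ))) =
    if Even (k : ℕ) then ixB a k else ixF a k := by
  unfold eMode
  simp only [even_neg, Int.even_coe_nat]
  split_ifs
  · exact modeIx_inl_neg a k
  · exact modeIx_inr_neg a k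

theorem modeIx_oMode_neg (a : Fin r) (k : ℕ+) : modeIx (oMode a (-((k : ℕ) : ℤ))) =
    if Even (k : ℕ) then ixF a k else ixB a k := by
  unfold oMode
  simp only [even_neg, Int.even_coe_nat]
  split_ifs
  · exact modeIx_inr_neg a k
  · exact modeIx_inl_neg a k

theorem ixB_injective {a b : Fin r} {k l : ℕ+} (h : ixB a k = ixB b l) : a = b ∧ k = l :=
  Prod.mk.inj (Sum.inl_injective h)

theorem ixF_injective {a b : Fin r} {k l : ℕ} (h : ixF a k = ixF b l) : a = b ∧ k = l :=
  Prod.mk.inj (Sum.inr_injective h)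

theorem ixB_ne_ixF (a b : Fin r) (k : ℕ+) (l : ℕ) : ixB a k ≠ ixF b l := Sum.inl_ne_inr

theorem ixF_mem_zeroModes {a : Fin r} {k : ℕ} : ixF a k ∈ zeroModes r ↔ k = 0 :=
  ⟨fun ⟨_, hb⟩ => (ixF_injective hb).2.symm, fun h => ⟨a, by rw [h]⟩⟩

theorem ixB_notMem_zeroModes (a : Fin r) (k : ℕ+) : ixB a k ∉ zeroModes r :=
  fun ⟨_, hb⟩ => ixB_ne_ixF _ _ _ _ hb.symm

theorem modeIx_negMode_notMem (x : FrameIx r) : modeIx (negMode x) ∉ zeroModes r := by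
  rcases x with ⟨a, k⟩ | ⟨a, k⟩
  · rw [negMode, modeIx_eMode_neg]
    split_ifs
    · exact ixB_notMem_zeroModes a k
    · exact fun h => k.ne_zero (ixF_mem_zeroModes.mp h)
  · rw [negMode, modeIx_oMode_neg]
    split_ifs
    · exact fun h => k.ne_zero (ixF_mem_zeroModes.mp h)
    · exact ixB_notMem_zeroModes a k

theorem modeIx_negMode_injective : Function.Injective fun x : FrameIx r => modeIx (negMode x) := by
  rintro (⟨a, k⟩ | ⟨a, k⟩) (⟨b, l⟩ | ⟨b, l⟩) h <;>
    simp only [negMode, modeIx_eMode_neg, modeIx_oMode_neg] at h <;> split_ifs at h with h1 h2 h2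
  · obtain ⟨rfl, rfl⟩ := ixB_injective h; rfl
  · exact absurd h (ixB_ne_ixF _ _ _ _)
  · exact absurd h.symm (ixB_ne_ixF _ _ _ _)
  · obtain ⟨rfl, hkl⟩ := ixF_injective h; rw [PNat.coe_injective hkl]
  · exact absurd h (ixB_ne_ixF _ _ _ _)
  · obtain ⟨rfl, rfl⟩ := ixB_injective h; exact absurd h1 h2
  · obtain ⟨rfl, hkl⟩ := ixF_injective h; rw [hkl] at h1; exact absurd h2 h1
  · exact absurd h.symm (ixB_ne_ixF _ _ _ _)
  · exact absurd h.symm (ixB_ne_ixF _ _ _ _)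
  · obtain ⟨rfl, hkl⟩ := ixF_injective h; rw [hkl] at h1; exact absurd h1 h2
  · obtain ⟨rfl, rfl⟩ := ixB_injective h; exact absurd h2 h1
  · exact absurd h (ixB_ne_ixF _ _ _ _)
  · obtain ⟨rfl, hkl⟩ := ixF_injective h; rw [PNat.coe_injective hkl]
  · exact absurd h.symm (ixB_ne_ixF _ _ _ _)
  · exact absurd h (ixB_ne_ixF _ _ _ _)
  · obtain ⟨rfl, rfl⟩ := ixB_injective h; rfl

theorem exists_modeIx_negMode {j : (Fin r × ℕ+) ⊕ (Fin r × ℕ)} (hj : j ∉ zeroModes r) :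
    ∃ x : FrameIx r, modeIx (negMode x) = j := by
  rcases j with ⟨a, k⟩ | ⟨a, k⟩
  · by_cases hk : Even (k : ℕ)
    · exact ⟨.inl (a, k), by rw [negMode, modeIx_eMode_neg, if_pos hk]; rfl⟩
    · exact ⟨.inr (a, k), by rw [negMode, modeIx_oMode_neg, if_neg hk]; rfl⟩
  · have h0 : 0 < k := Nat.pos_of_ne_zero fun h => hj (ixF_mem_zeroModes.mpr h)
    by_cases hk : Even k
    · exact ⟨.inr (a, ⟨k, h0⟩), (modeIx_oMode_neg a ⟨k, h0⟩).trans (if_pos hk)⟩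
    · exact ⟨.inl (a, ⟨k, h0⟩), (modeIx_eMode_neg a ⟨k, h0⟩).trans (if_neg hk)⟩

/-- The coordinates other than the zero modes, as indices of the generators. -/
def frameEquiv (r : ℕ) : FrameIx r ≃ {j // j ∉ zeroModes r} :=
  Equiv.ofBijective (fun x => ⟨modeIx (negMode x), modeIx_negMode_notMem x⟩)
    ⟨fun _ _ h => modeIx_negMode_injective (congrArg Subtype.val h), fun j =>
      (exists_modeIx_negMode j.2).imp fun _ hx => Subtype.ext hx⟩

end SuperAiry

end

/-! ### Generators before conjugation and their structure constants. -/

noncomputable section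

namespace SuperAiry

variable {m q r : ℕ} {ι κ : Type}

/-- After multiplication by an inverse of the body, the element is one plus a nilpotent. The ring is
not commutative, so this is done on both sides and the two one-sided inverses are compared. -/
theorem SPoly.isUnit_of_isUnit_body {E O : Type} [Fintype O] {c : SPoly E O}
    (h : IsUnit (SPoly.body c)) : IsUnit c := by
  obtain ⟨v, hv⟩ := h.exists_right_inv
  have hbody : ∀ f : MvPolynomial E ℂ, SPoly.body (SPoly.ofBody f : SPoly E O) = f := fun f => by
    have : ((SPoly.body : SPoly E O →ₐ[ℂ] _).comp SPoly.ofBody : MvPolynomial E ℂ →ₐ[ℂ] MvPolynomial E ℂ) =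
        AlgHom.id ℂ _ := by
      refine MvPolynomial.algHom_ext fun e => ?_
      rw [AlgHom.comp_apply, SPoly.ofBody_X (O := O), SPoly.body_evenGen]
      rfl
    exact DFunLike.congr_fun this f
  have hu : ∀ x : SPoly E O, SPoly.body x = 1 → IsUnit x := fun x hx => by
    have hn : x - 1 ∈ SPoly.oddFil (E := E) (O := O) 1 :=
      SPoly.mem_oddFil_one (by rw [map_sub, hx, map_one, sub_self])
    have hp : ∀ n : ℕ, (x - 1) ^ n ∈ SPoly.oddFil (E := E) (O := O) n := fun n => by
      induction n with
      | zero => rw [pow_zero]; exact SPoly.mem_oddFil_zero _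
      | succ n ih => rw [pow_succ]; exact SPoly.mul_mem_oddFil ih hn
    have : IsNilpotent (x - 1) := ⟨_, SPoly.oddFil_card (hp _)⟩
    simpa using this.isUnit_add_one
  obtain ⟨y, hy⟩ := (hu (c * SPoly.ofBody v) (by rw [map_mul, hbody, hv])).exists_right_inv
  obtain ⟨z, hz⟩ := (hu (SPoly.ofBody v * c) (by rw [map_mul, hbody, mul_comm, hv])).exists_left_inv
  rw [mul_assoc] at hy
  rw [← mul_assoc] at hz
  exact ⟨⟨c, _, hy, by rw [← left_inv_eq_right_inv hz hy]; exact hz⟩, rfl⟩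

theorem pairing_ne_zero {u v : Mode r} (h : pairing u v ≠ 0) : modeIx u = modeIx v := by
  rcases u with ⟨a, k⟩ | ⟨a, k⟩ <;> rcases v with ⟨b, l⟩ | ⟨b, l⟩
  · rw [pairing, ite_ne_right_iff] at h
    obtain ⟨⟨h1, h2⟩, -⟩ := h
    change a = b at h1; change k + l = 0 at h2
    rw [modeIx, modeIx, h1, show k = -l by omega, Int.natAbs_neg]
  · exact absurd rfl h
  · exact absurd rfl h
  · rw [pairing, ite_ne_right_iff] at h
    obtain ⟨⟨h1, h2⟩, -⟩ := h
    change a = b at h1; change k + l = 0 at h2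
    rw [modeIx, modeIx, h1, show k = -l by omega, Int.natAbs_neg]

theorem modeIx_eMode (a : Fin r) (k : ℤ) : modeIx (eMode a (-k)) = modeIx (eMode a k) := by
  unfold eMode
  simp only [even_neg]
  split_ifs <;> simp only [modeIx, Int.natAbs_neg]

theorem pairing_eMode_neg {a : Fin r} {k : ℤ} (hk : 0 < k) :
    pairing (eMode a k) (eMode a (-k)) ≠ 0 := by
  unfold eMode
  simp only [even_neg]
  split_ifs
  · simp only [pairing, add_neg_cancel, and_self, if_true]
    exact_mod_cast hk.ne'
  · simp [pairing]

theorem finite_frameNum_lt (B : ℕ) : {x : FrameIx r | frameNum x < B}.Finite := by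
  have h := (Set.finite_univ (α := Fin r)).prod (Set.finite_Iic B.toPNat')
  have hB : ∀ k : ℕ+, (k : ℕ) < B → k ≤ B.toPNat' := fun k hk => by
    rw [← PNat.coe_le_coe, Nat.toPNat'_coe, if_pos (by omega)]
    exact hk.le
  refine ((h.image Sum.inl).union (h.image Sum.inr)).subset ?_
  rintro (x | x) hx
  · exact .inl ⟨x, ⟨trivial, hB _ hx⟩, rfl⟩
  · exact .inr ⟨x, ⟨trivial, hB _ hx⟩, rfl⟩

/-- The generators before conjugation. -/
def source (s : Fin r → ℤ) : FrameIx r → HOpR m q r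
  | .inl x => hbarPow 1 (mode (eMode x.1 (x.2 : ℕ)))
  | .inr x => hbarPow 2 (quad x.1 ((x.2 : ℕ) - s x.1))

/-- The two numbers in a term of `quad a k` add up to `k`, so one of them is at least half of it;
this explains twice the threshold in the bound, and the extra three compensates `s`. -/
theorem hfin_source {s : Fin r → ℤ} (hs : ∀ a, s a ≤ 3) :
    HFin (source s : FrameIx r → HOpR m q r) := fun n f => by
  obtain ⟨N, hN0, hN⟩ := exists_mode_eq_zero f
  refine (finite_frameNum_lt (2 * N.toNat + 3)).subset fun x hx => ?_
  by_contra hlt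
  rw [Set.mem_ofPred_eq, not_lt] at hlt
  refine hx ?_
  rcases x with ⟨a, k⟩ | ⟨a, k⟩ <;> simp only [frameNum] at hlt
  · change (hbarPow 1 (mode (eMode a (k : ℕ))) : HOpR m q r).coeff n f = 0
    by_cases hn : n = 1
    · rw [hn, coeff_hbarPow_same]
      exact hN _ (by rw [mnum_eMode]; omega)
    · rw [coeff_hbarPow_of_ne hn]; rfl
  · change (hbarPow 2 (quad a ((k : ℕ) - s a)) : HOpR m q r).coeff n f = 0
    by_cases hn : n = 2
    · rw [hn, coeff_hbarPow_same]
      exact quad_apply_eq_zero hN0 hN (by have := hs a; omega)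
    · rw [coeff_hbarPow_of_ne hn]; rfl

theorem hPar_hbarPow {e : ℕ} {D : OpR m q r} (h : HasPar e D) (k : ℤ) : HPar e (hbarPow k D) :=
  .of_coeff fun n => by
    by_cases hn : n = k
    · rw [hn, coeff_hbarPow_same]; exact h
    · rw [coeff_hbarPow_of_ne hn]; exact hasPar_zero e

/-- The coefficients of the supercommutators of the generators. -/
def frameBracket (s : Fin r → ℤ) : FrameIx r → FrameIx r → ℂ
  | .inl _, _ => 0
  | .inr _, .inl _ => 0
  | .inr x, .inr y =>
    if x.1 = y.1 then quadBracket ((x.2 : ℕ) - s x.1) ((y.2 : ℕ) - s x.1) else 0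

/-- The index of the supercommutator of two generators. -/
def frameIndex (s : Fin r → ℤ) (x y : FrameIx r) : FrameIx r :=
  .inr (Sum.elim Prod.fst Prod.fst x,
    ((frameNum x : ℤ) + frameNum y - s (Sum.elim Prod.fst Prod.fst x)).toNat.toPNat')

theorem quadPar_sub {k s : ℤ} (hs : Odd s) : quadPar (k - s) = if Even k then 1 else 0 := by
  rw [quadPar]
  by_cases hk : Even k
  · rw [if_pos hk, if_neg (Int.not_even_iff_odd.mpr (hk.sub_odd hs))]
  · rw [if_neg hk, if_pos ((Int.not_even_iff_odd.mp hk).sub_odd hs)]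

theorem mpar_negMode_inl (x : Fin r × ℕ+) :
    mpar (negMode (.inl x)) = mpar (eMode x.1 (x.2 : ℕ)) := by
  rw [negMode, mpar_eMode, mpar_eMode]
  simp only [even_neg]

theorem mpar_negMode_inr {s : ℤ} (hs : Odd s) (x : Fin r × ℕ+) :
    mpar (negMode (.inr x)) = quadPar ((x.2 : ℕ) - s) := by
  rw [negMode, mpar_oMode, quadPar_sub hs]
  simp only [even_neg]

/-- For `s = 1` brackets never leave the range. For `s = 3` they do so only for the numbers
$(-2,-2)$, $(-2,-1)$ and $(-1,-2)$, where the structure constants are zero: the generators close. -/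
theorem quadBracket_eq_zero {s : ℤ} (hs : s = 1 ∨ s = 3) {k l : ℕ} (hk : 0 < k) (hl : 0 < l)
    (h : (k : ℤ) + l - s < 1) : quadBracket (k - s) (l - s) = 0 := by
  obtain rfl | rfl := hs
  · omega
  · have h' : k = 1 ∧ l = 1 ∨ k = 1 ∧ l = 2 ∨ k = 2 ∧ l = 1 := by omega
    rcases h' with ⟨rfl, rfl⟩ | ⟨rfl, rfl⟩ | ⟨rfl, rfl⟩
    · norm_num [quadBracket, Int.even_iff]
    · norm_num [quadBracket, Int.even_iff]
    · norm_num [quadBracket, Int.even_iff]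

theorem hbr_source {s : Fin r → ℤ} (hs : ∀ a, s a = 1 ∨ s a = 3) (x y : FrameIx r) :
    hbr (mpar (negMode x)) (source s x) (source s y : HOpR m q r) =
      hbarPow 2 1 * (frameBracket s x y • source s (frameIndex s x y)) := by
  have hodd : ∀ a, Odd (s a) := fun a => by
    rcases hs a with h | h <;> rw [h]
    · exact odd_one
    · exact ⟨1, rfl⟩
  have h0 : ∀ Z : HOpR m q r, hbarPow 2 1 * ((0 : ℂ) • Z) = 0 := fun Z => by
    rw [mul_smul_hop]
    exact hop_ext fun n => by rw [HahnSeries.coeff_smul, zero_smul, HahnSeries.coeff_zero]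
  rcases x with ⟨a, k⟩ | ⟨a, k⟩ <;> rcases y with ⟨b, l⟩ | ⟨b, l⟩
  · rw [frameBracket, h0, source, source, hbr_hbarPow, mpar_negMode_inl,
      br_eMode_eMode _ _ (Int.natCast_pos.mpr k.pos) (Int.natCast_pos.mpr l.pos), hbarPow_zero_right]
  · rw [frameBracket, h0, source, source, hbr_hbarPow, mpar_negMode_inl, br_eMode_quad,
      hbarPow_zero_right]
  · rw [frameBracket, h0, source, source, hbr_hbarPow, mpar_negMode_inr (hodd a), br_quad_eMode,
      hbarPow_zero_right]
  · rw [source, source, hbr_hbarPow, mpar_negMode_inr (hodd a)]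
    by_cases hab : a = b
    · subst hab
      have hk := k.pos
      have hl := l.pos
      rw [br_quad a (by have := hs a; dsimp only; omega) (by have := hs a; dsimp only; omega),
        frameBracket, if_pos rfl]
      by_cases h1 : ((k : ℕ) : ℤ) + (l : ℕ) - s a < 1
      · rw [quadBracket_eq_zero (hs a) hk hl h1, h0, zero_smul, hbarPow_zero_right]
      · have e : frameIndex s (.inr (a, k)) (.inr (a, l)) =
            .inr (a, (((k : ℕ) : ℤ) + (l : ℕ) - s a).toNat.toPNat') := rfl
        rw [e, source, smul_hbarPow, hbarPow_mul_hbarPow, one_mul]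
        dsimp only
        rw [Nat.toPNat'_coe, if_pos (by omega), Int.toNat_of_nonneg (by omega)]
        congr 3
        ring
    · rw [frameBracket, if_neg hab, h0, br_quad_eq_zero hab, hbarPow_zero_right]

/-- A non-zero bracket of numbers $k$ and $l$ has number $k+l-s$, so a given result bounds both. -/
theorem finite_frameBracket {s : Fin r → ℤ} (hs : ∀ a, s a = 1 ∨ s a = 3) (z : FrameIx r) :
    {p : FrameIx r × FrameIx r | frameBracket s p.1 p.2 ≠ 0 ∧ frameIndex s p.1 p.2 = z}.Finite := by
  refine ((finite_frameNum_lt (frameNum z + 4)).prod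
    (finite_frameNum_lt (frameNum z + 4))).subset ?_
  rintro ⟨⟨a, k⟩ | ⟨a, k⟩, ⟨b, l⟩ | ⟨b, l⟩⟩ ⟨h, rfl⟩
  · exact absurd rfl h
  · exact absurd rfl h
  · exact absurd rfl h
  · have hk := k.pos
    have hl := l.pos
    rw [frameBracket, ite_ne_right_iff] at h
    obtain ⟨hab, h⟩ := h
    change a = b at hab
    subst hab
    have h1 : ¬ ((k : ℕ) : ℤ) + (l : ℕ) - s a < 1 := fun h1 =>
      h (quadBracket_eq_zero (hs a) hk hl h1)
    have e : frameNum (frameIndex s (.inr (a, k)) (.inr (a, l))) =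
        (((k : ℕ) : ℤ) + (l : ℕ) - s a).toNat := by
      change (((((k : ℕ) : ℤ) + (l : ℕ) - s a).toNat.toPNat' : ℕ+) : ℕ) = _
      rw [Nat.toPNat'_coe, if_pos (by omega)]
    have := hs a
    constructor <;> change _ < frameNum (frameIndex s (.inr (a, k)) (.inr (a, l))) + 4 <;>
      rw [e] <;> simp only [frameNum] <;> omega

end SuperAiry

end

/-! ### The conjugated frame and its matrix of symbols. -/

noncomputable section

namespace SuperAiry

variable {m q r : ℕ} {ι κ : Type}

theorem generatedIdeal_subset_of_sub {A₀ A₁ : Type} {g K V : ι → HOp m q A₀ A₁}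
    (hK : ∀ i, K i ∈ reesWeyl m q A₀ A₁) (hKf : HFin K) {P : Type} {π : ι → P → ι}
    {C : ι → P → HOp m q A₀ A₁} (hC : ∀ k p, C k p ∈ reesWeyl m q A₀ A₁)
    (hCf : FiberFin (fun x : ι × P => π x.1 x.2) fun x => C x.1 x.2)
    (hV : ∀ k, IsSum (fun p => C k p * K (π k p)) (V k)) (hg : ∀ k, K k = g k + V k) :
    generatedIdeal g ⊆ generatedIdeal K := by
  rintro Z ⟨c, hc, h⟩
  obtain ⟨Z', hZ', hs⟩ := exists_isSum_mul hK hKf hC hCf hc hV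
  have h1 : Z + Z' ∈ generatedIdeal K := by
    refine ⟨c, hc, (h.add hs).congr fun i => ?_⟩
    rw [hg, mul_add]
  have h2 := add_mem_generatedIdeal h1 (smul_mem_generatedIdeal hK (-1) hZ')
  have e : Z + Z' + (-1 : ℂ) • Z' = Z := hop_ext fun n => by
    rw [HahnSeries.coeff_add, HahnSeries.coeff_add, HahnSeries.coeff_smul]
    module
  rwa [e] at h2

namespace LocalData

/-- The hypotheses on the dilaton shift. -/
structure IsAdmissible (d : LocalData m q r) (s : Fin r → ℤ) : Prop where
  s_eq : ∀ a, s a = 1 ∨ s a = 3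
  unit : ∀ a, IsUnit ((d.t a).coeff (s a))
  linear : ∀ a, ((d.omega01 a) + (d.omega01 a).sigma).coef.IsBigO 1
  casimir : ∀ a, (d.omega01 a).twistedCasimir.IsBigO (s a)

theorem IsAdmissible.le {d : LocalData m q r} {s : Fin r → ℤ} (h : d.IsAdmissible s) (a : Fin r) :
    s a ≤ 3 := by
  have := h.s_eq a
  omega

theorem IsAdmissible.odd {d : LocalData m q r} {s : Fin r → ℤ} (h : d.IsAdmissible s) (a : Fin r) :
    Odd (s a) := by
  rcases h.s_eq a with h | h <;> rw [h]
  · exact odd_one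
  · exact ⟨1, rfl⟩

/-- Generators of the ideal that are closed under supercommutators. -/
def frame (d : LocalData m q r) (s : Fin r → ℤ) (x : FrameIx r) : HOpR m q r :=
  d.conj (source s x)

variable {d : LocalData m q r} {s : Fin r → ℤ}

theorem isNil_source (x : FrameIx r) : d.IsNil 5 (source s x) := by
  rcases x with ⟨a, k⟩ | ⟨a, k⟩
  · exact (isNil_mode 1 _).mono (by norm_num)
  · exact (isQuad_quad a _).isNil 2

theorem hPar_source (h : d.IsAdmissible s) (x : FrameIx r) :
    HPar (mpar (negMode x)) (source s x : HOpR m q r) := by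
  rcases x with x | x
  · rw [mpar_negMode_inl]
    exact hPar_hbarPow (hasPar_mode _) 1
  · rw [mpar_negMode_inr (h.odd x.1)]
    exact hPar_hbarPow (hasPar_quad _ _) 2

theorem frame_inl (h : d.IsAdmissible s) (x : Fin r × ℕ+) :
    d.frame s (.inl x) = hbarPow 1 (mode (eMode x.1 (x.2 : ℕ))) :=
  conj_mode_eq (by rw [mnum_eMode]; exact Int.natCast_pos.mpr x.2.pos)
    (shift_eMode (h.linear x.1) (Int.natCast_nonneg _)) 1

theorem frame_mem_rees (x : FrameIx r) :
    d.frame s x ∈ reesWeyl m q (Fin r × ℕ+) (Fin r × ℕ) := by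
  rcases x with ⟨a, k⟩ | ⟨a, k⟩
  · exact conj_mode_mem_rees _
  · exact (isQuad_quad a _).conj_mem_rees

theorem hfin_frame (h : d.IsAdmissible s) : HFin (d.frame s) :=
  HFin.conj (hfin_source h.le) isNil_source

theorem hPar_frame (h : d.IsAdmissible s) (x : FrameIx r) :
    HPar (mpar (negMode x)) (d.frame s x) :=
  HPar_conj (isNil_source x) (hPar_source h x)

theorem coeff_zero_frame (h : d.IsAdmissible s) (x : FrameIx r) : (d.frame s x).coeff 0 = 0 := by
  rcases x with ⟨a, k⟩ | ⟨a, k⟩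
  · rw [frame_inl h, coeff_hbarPow_of_ne (by norm_num)]
  · exact (isQuad_quad a _).coeff_conj_zero (adj_adj_quad (h.linear a) (h.casimir a) (h.le a)
      (by have := k.pos; dsimp only; omega))

/-- Conjugation is multiplicative, fixes $\hbar$ and acts nilpotently on the generators, so it
carries over the relations of the unconjugated generators with the same complex structure constants.
-/
theorem hbr_frame (h : d.IsAdmissible s) (x y : FrameIx r) :
    hbr (mpar (negMode x)) (d.frame s x) (d.frame s y) =
      hbarPow 2 1 * (frameBracket s x y • d.frame s (frameIndex s x y)) := by
  rw [frame, frame, ← conj_hbr (isNil_source x) (isNil_source y) (hPar_source h y),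
    hbr_source h.s_eq, conj_hbarPow_mul 2 ((isNil_source _).smul _) (by norm_num),
    conj_smul (isNil_source _)]
  rfl

/-! ### Symbols -/

theorem const_eq_smul_one {A₀ A₁ : Type} {c : Params m q} {z : ℂ}
    (h : z • (1 : Op m q A₀ A₁) = mulOp (const c)) : c = z • 1 := by
  refine const_injective (mulOp_injective (A₀ := A₀) (A₁ := A₁) ?_)
  rw [← h, map_smul, mulOp_smul, map_one, mulOp_one]

theorem ad_frame_inl (h : d.IsAdmissible s) (x : Fin r × ℕ+) (w : Mode r) :
    ad (mpar w) (mode w) ((d.frame s (.inl x)).coeff 1) =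
      pairing (eMode x.1 (x.2 : ℕ)) w • (1 : OpR m q r) := by
  rw [frame_inl h, coeff_hbarPow_same, ad_mode_mode]

theorem ad_frame_inr (h : d.IsAdmissible s) (x : Fin r × ℕ+) (w : Mode r) :
    ad (mpar w) (mode w) ((d.frame s (.inr x)).coeff 1) -
      ad (mpar w) (mode w) (adj d.opT (quad x.1 ((x.2 : ℕ) - s x.1))) ∈
      bodyZero m q (Fin r × ℕ+) (Fin r × ℕ) :=
  (isQuad_quad x.1 _).ad_coeff_conj_one_sub_mem (fun u hu => ad_adj_quad_mem_bodyZero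
    (h.linear x.1) (h.casimir x.1) (h.s_eq x.1) (by have := x.2.pos; omega)) w

theorem ad_negMode_frame {j x : FrameIx r} {c : Params m q}
    (hc : ad (par (modeIx (negMode j))) (mulOp (coord (modeIx (negMode j))))
      ((d.frame s x).coeff 1) = mulOp (const c)) :
    ad (mpar (negMode j)) (mode (negMode j)) ((d.frame s x).coeff 1) =
      mulOp (const (modeCoord (negMode j) • c)) := by
  rw [ad_coord_modeIx (mnum_negMode_neg j)] at hc
  rw [map_smul, mulOp_smul, ← hc, smul_smul,
    mul_inv_cancel₀ (modeCoord_ne_zero (mnum_negMode_neg j)), one_smul]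

/-- A linear generator involves a single derivative. For a quadratic one, a coordinate of smaller
number brackets to a shift of index below $s_a$, which has vanishing body. At equal number the only
mode of that sector at that puncture belongs to the diagonal, and every other mode brackets to zero.
-/
theorem body_symbol_eq_zero (h : d.IsAdmissible s) {j x : FrameIx r} (hj : j ≠ x)
    (hle : frameNum j ≤ frameNum x) {c : Params m q}
    (hc : ad (par (modeIx (negMode j))) (mulOp (coord (modeIx (negMode j))))
      ((d.frame s x).coeff 1) = mulOp (const c)) : SPoly.body c = 0 := by
  have h1 := ad_negMode_frame hc
  have hne := modeCoord_ne_zero (mnum_negMode_neg j)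
  have hz : SPoly.body (modeCoord (negMode j) • c) = 0 → SPoly.body c = 0 := fun h0 => by
    rw [map_smul] at h0
    exact (smul_eq_zero.mp h0).resolve_left hne
  refine hz ?_
  rcases x with x | x
  · rw [ad_frame_inl h] at h1
    rw [const_eq_smul_one h1, map_smul]
    by_cases hp : pairing (eMode x.1 (x.2 : ℕ)) (negMode j) = 0
    · rw [hp, zero_smul]
    · have h2 := pairing_ne_zero hp
      rw [← modeIx_eMode] at h2
      exact absurd (modeIx_negMode_injective (a₁ := j) (a₂ := .inl x) h2.symm) hj
  · have h2 := ad_frame_inr h x (negMode j)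
    rw [h1] at h2
    have h3 : ad (mpar (negMode j)) (mode (negMode j))
        (adj d.opT (quad x.1 ((x.2 : ℕ) - s x.1))) ∈ bodyZero m q (Fin r × ℕ+) (Fin r × ℕ) := by
      rcases hle.lt_or_eq with hlt | heq
      · refine ad_adj_quad_mem_bodyZero (h.linear x.1) (h.casimir x.1) (h.s_eq x.1) ?_
        rw [mnum_negMode]
        simp only [frameNum] at hlt ⊢
        omega
      · rw [ad_adj_quad_eq_zero fun i hi => ?_]
        · exact zero_mem _
        · have h4 := congrArg mnum hi
          rw [mnum_negMode, mnum_oMode, heq] at h4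
          rw [← h4] at hi
          exact hj (modeIx_negMode_injective (a₁ := j) (a₂ := .inr x) (congrArg modeIx hi))
    have h4 := add_mem h2 h3
    rw [sub_add_cancel] at h4
    exact const_mem_bodyZero.mp h4

/-- On the diagonal the numbers $k-s_a$ and $-k$ add up to $-s_a$, so up to vanishing body the
symbol is $t_{a,s_a}$ times a structure constant, which is $k$ or $1$ according to the parity of
$k$. -/
theorem isUnit_symbol (h : d.IsAdmissible s) {x : FrameIx r} {c : Params m q}
    (hc : ad (par (modeIx (negMode x))) (mulOp (coord (modeIx (negMode x))))
      ((d.frame s x).coeff 1) = mulOp (const c)) : IsUnit c := by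
  have h1 := ad_negMode_frame hc
  have hne := modeCoord_ne_zero (mnum_negMode_neg x)
  have hsm : ∀ {S : Type} [Ring S] [Algebra ℂ S] {z : ℂ} {b : S}, z ≠ 0 → IsUnit b →
      IsUnit (z • b) := fun {S} _ _ {z b} hz hb => by
    rw [Algebra.smul_def]
    exact ((IsUnit.mk0 z hz).map (algebraMap ℂ S)).mul hb
  have hz : IsUnit (modeCoord (negMode x) • c) → IsUnit c := fun h0 => by
    have := hsm (inv_ne_zero hne) h0
    rwa [smul_smul, inv_mul_cancel₀ hne, one_smul] at this
  refine hz ?_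
  rcases x with x | x
  · rw [ad_frame_inl h] at h1
    rw [const_eq_smul_one h1]
    exact hsm (pairing_eMode_neg (Int.natCast_pos.mpr x.2.pos)) isUnit_one
  · have h2 := ad_frame_inr h x (negMode (.inr x))
    have hk := x.2.pos
    rw [h1, negMode, ad_oMode_adj_quad, ← mulOp_smul, ← map_smul, ← mulOp_sub, ← map_sub,
      const_mem_bodyZero, map_sub, sub_eq_zero] at h2
    refine SPoly.isUnit_of_isUnit_body ?_
    rw [negMode, h2, map_smul]
    refine hsm ?_ ?_
    · rw [quadCoeff]
      by_cases hev : Even (((x.2 : ℕ) : ℤ) - s x.1)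
      · have ho : ¬ Even (-((x.2 : ℕ) : ℤ)) := by
          rw [even_neg]
          intro h5
          exact Int.not_even_iff_odd.mpr (h5.sub_odd (h.odd x.1)) hev
        rw [if_pos hev, lam, if_neg ho]
        push_cast
        rw [neg_neg]
        exact_mod_cast hk.ne'
      · have ho : Even (-((x.2 : ℕ) : ℤ)) := by
          rw [even_neg]
          by_contra h5
          exact hev ((Int.not_even_iff_odd.mp h5).sub_odd (h.odd x.1))
        rw [if_neg hev, gam, if_pos ho]
        exact one_ne_zero
    · rw [show ((x.2 : ℕ) : ℤ) - s x.1 + -((x.2 : ℕ) : ℤ) = -s x.1 by ring, shift_oMode,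
        if_neg (Int.not_even_iff_odd.mpr (h.odd x.1).neg), neg_neg]
      exact (h.unit x.1).map _

theorem exists_symbol (d : LocalData m q r) (s : Fin r → ℤ) (x : FrameIx r)
    (j : (Fin r × ℕ+) ⊕ (Fin r × ℕ)) : ∃ c : Params m q,
      ad (par j) (mulOp (coord j)) ((d.frame s x).coeff 1) = mulOp (const c) := by
  obtain ⟨c, hc⟩ := mem_Fil_one.mp
    ((mem_Fil_succ.mp (rees_coeff (frame_mem_rees (d := d) (s := s) x) 1)).2 j).1
  exact ⟨c, hc⟩

end LocalData

end SuperAiry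

end

/-! ### Removal of the second sector and identification with the collection. -/

noncomputable section

namespace SuperAiry

variable {m q r : ℕ} {ι κ : Type}

/-! ### The twisted part of the generators -/

/-- The coefficient of the product of the modes `min(-j, k+j)` and `max(-j, k+j)` in `virasoro a k`. -/
def restScalar (a : Fin r) (k j : ℤ) : ℂ :=
  restCoeff k j *
    if k + j < -j then (-1 : ℂ) ^ (mpar (eMode a (-j)) * mpar (eMode a (k + j))) else 1

theorem rest_eq (a : Fin r) (k j : ℤ) :
    restCoeff k j • hbarPow 2 (nprod (eMode a (-j)) (eMode a (k + j))) =
      restScalar a k j • (hbarPow 1 (mode (eMode a (min (-j) (k + j)))) *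
        hbarPow 1 (mode (eMode a (max (-j) (k + j)))) : HOpR m q r) := by
  rw [hbarPow_mul_hbarPow, smul_hbarPow, smul_hbarPow, restScalar, nprod, mnum_eMode, mnum_eMode,
    one_add_one_eq_two]
  congr 1
  split_ifs with h
  · rw [smul_smul, min_eq_right h.le, max_eq_left h.le]
  · rw [mul_one, min_eq_left (not_lt.mp h), max_eq_right (not_lt.mp h)]

theorem mode_eMode_zero (a : Fin r) : (mode (eMode a 0) : OpR m q r) = 0 := by
  rw [eMode, if_pos Even.zero]
  rfl

/-- If the larger number is zero, the right factor is $J_{a,0}=0$. Otherwise both numbers are $-1$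
and `k` is `-2`, where the coefficient $j+n$ vanishes. So every surviving term has a positive mode
on the right. -/
theorem rest_eq_zero {a : Fin r} {k j : ℤ} (hk : -2 ≤ k) (h : max (-j) (k + j) < 1) :
    restCoeff k j • hbarPow 2 (nprod (eMode a (-j)) (eMode a (k + j))) = (0 : HOpR m q r) := by
  rcases eq_or_ne (max (-j) (k + j)) 0 with h0 | h0
  · rw [rest_eq, h0, mode_eMode_zero, hbarPow_zero_right, mul_zero]
    exact hop_ext fun n => by rw [HahnSeries.coeff_smul, HahnSeries.coeff_zero, smul_zero]
  · have h1 : k = -2 ∧ j = 1 := by omega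
    obtain ⟨rfl, rfl⟩ := h1
    have h2 : restCoeff (-2) 1 = 0 := by norm_num [restCoeff, coeffLRest, Int.even_iff]
    rw [h2]
    exact hop_ext fun n => by rw [HahnSeries.coeff_smul, HahnSeries.coeff_zero, zero_smul]

/-- The index of the right factor of a term in the twisted part of a generator. -/
def restIndex (s : Fin r → ℤ) : FrameIx r → ℤ → FrameIx r
  | .inl x, _ => .inl x
  | .inr x, j => .inl (x.1, (max (-j) ((x.2 : ℕ) - s x.1 + j)).toNat.toPNat')

/-- The left factor of a term in the twisted part of a generator, before conjugation. -/
def restFactor (s : Fin r → ℤ) : FrameIx r → ℤ → HOpR m q r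
  | .inl _, _ => 0
  | .inr x, j => if 1 ≤ max (-j) ((x.2 : ℕ) - s x.1 + j) then
      restScalar x.1 ((x.2 : ℕ) - s x.1) j •
        hbarPow 1 (mode (eMode x.1 (min (-j) ((x.2 : ℕ) - s x.1 + j)))) else 0

theorem hop_add_sub {A₀ A₁ : Type} (Y Z : HOp m q A₀ A₁) : Y + (Z - Y) = Z := add_sub_cancel Y Z

namespace LocalData

variable {d : LocalData m q r} {s : Fin r → ℤ}

theorem isNil_zero (N : ℕ) : d.IsNil N 0 := by
  refine ⟨adj_iterate_zero _ _, ?_⟩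
  rw [expAdj_of_adj_eq_zero (map_zero _)]
  exact adj_iterate_zero _ _

theorem conj_zero : d.conj 0 = 0 := by
  rw [conj, expAdj_of_adj_eq_zero (map_zero _), expAdj_of_adj_eq_zero (map_zero _)]

theorem isNil_restFactor (x : FrameIx r) (j : ℤ) : d.IsNil 3 (restFactor s x j) := by
  rcases x with x | x
  · exact isNil_zero 3
  · rw [restFactor]
    split_ifs
    · exact (isNil_mode 1 _).smul _
    · exact isNil_zero 3

theorem conj_restFactor_mem_rees (x : FrameIx r) (j : ℤ) :
    d.conj (restFactor s x j) ∈ reesWeyl m q (Fin r × ℕ+) (Fin r × ℕ) := by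
  rcases x with x | x
  · rw [restFactor, conj_zero]; exact zero_mem_rees
  · rw [restFactor]
    split_ifs
    · rw [conj_smul (isNil_mode 1 _)]; exact smul_mem_rees _ (conj_mode_mem_rees _)
    · rw [conj_zero]; exact zero_mem_rees

/-- Fixing the right factor fixes the larger of two numbers with sum $k-s_a$. For a given polynomial
the smaller number is bounded above by the threshold, hence `k` is bounded, and so is `j`. -/
theorem fiberFin_restFactor (h : d.IsAdmissible s) :
    FiberFin (fun p : FrameIx r × ℤ => restIndex s p.1 p.2)
      fun p => d.conj (restFactor s p.1 p.2) := by
  classical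
  intro l
  have h1 : HFin fun p : FrameIx r × ℤ =>
      if restIndex s p.1 p.2 = l then (restFactor s p.1 p.2 : HOpR m q r) else 0 := fun n f => by
    obtain ⟨N, hN0, hN⟩ := exists_mode_eq_zero f
    refine ((finite_frameNum_lt (N.toNat + 3 + frameNum l)).prod
      (Set.finite_Icc (-(frameNum l : ℤ)) (frameNum l + 3))).subset ?_
    rintro ⟨x | ⟨a, k⟩, j⟩ hp
    · refine absurd ?_ hp
      simp only [restFactor, ite_self]
      rfl
    · have hp' : ((if restIndex s (.inr (a, k)) j = l then restFactor s (.inr (a, k)) j else 0 :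
          HOpR m q r)).coeff n f ≠ 0 := hp
      by_cases hl : restIndex s (.inr (a, k)) j = l
      · rw [if_pos hl, restFactor] at hp'
        dsimp only at hp'
        by_cases hmax : 1 ≤ max (-j) ((k : ℕ) - s a + j)
        · rw [if_pos hmax, smul_hbarPow] at hp'
          have hl' : ((max (-j) ((k : ℕ) - s a + j)).toNat.toPNat' : ℕ) = frameNum l :=
            congrArg frameNum hl
          rw [Nat.toPNat'_coe, if_pos (by omega)] at hl'
          have hlo : min (-j) ((k : ℕ) - s a + j) < N := by
            by_contra hge
            refine hp' ?_
            by_cases hn : n = 1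
            · rw [hn, coeff_hbarPow_same]
              exact smul_apply_eq_zero (hN _ (by rw [mnum_eMode]; omega))
            · rw [coeff_hbarPow_of_ne hn]; rfl
          have := h.le a
          have := k.pos
          constructor
          · change (k : ℕ) < _
            omega
          · rw [Set.mem_Icc]
            dsimp only
            omega
        · rw [if_neg hmax] at hp'
          exact absurd rfl hp'
      · rw [if_neg hl] at hp'
        exact absurd rfl hp'
  have h2 := HFin.conj (d := d) (N := 3) h1 fun p => by
    split_ifs
    · exact isNil_restFactor _ _
    · exact isNil_zero 3
  intro n f
  refine (h2 n f).subset fun p hp => ?_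
  by_cases hl : restIndex s p.1 p.2 = l
  · simpa only [Function.mem_support, hl, if_true] using hp
  · refine absurd ?_ hp
    simp only [hl, if_false]
    rfl

/-- The twisted part of a generator. -/
def rest (d : LocalData m q r) (s : Fin r → ℤ) : FrameIx r → HOpR m q r
  | .inl _ => 0
  | .inr x => d.conj (virasoro x.1 ((x.2 : ℕ) - s x.1) - hbarPow 2 (quad x.1 ((x.2 : ℕ) - s x.1)))

/-- The generators of the ideal, indexed as the coordinates other than the zero modes. -/
def fullFrame (d : LocalData m q r) (s : Fin r → ℤ) : FrameIx r → HOpR m q r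
  | .inl x => hbarPow 1 (mode (eMode x.1 (x.2 : ℕ)))
  | .inr x => d.conj (virasoro x.1 ((x.2 : ℕ) - s x.1))

theorem isNil_rest (a : Fin r) (k : ℤ) : d.IsNil 6 (virasoro a k - hbarPow 2 (quad a k)) :=
  IsNil.isSum (isSum_virasoro a k) fun j => by
    rw [rest_eq]
    exact ((isNil_mode 1 _).mul (isNil_mode 1 _)).smul _

theorem fullFrame_eq (h : d.IsAdmissible s) (x : FrameIx r) :
    d.fullFrame s x = d.frame s x + d.rest s x := by
  rcases x with x | x
  · rw [fullFrame, rest, frame_inl h, add_zero]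
  · rw [fullFrame, rest, frame, source, ← conj_add (((isQuad_quad _ _).isNil 2).mono (by norm_num))
      (isNil_rest _ _), hop_add_sub]

theorem isSum_rest (h : d.IsAdmissible s) (x : FrameIx r) :
    IsSum (fun j => d.conj (restFactor s x j) * d.frame s (restIndex s x j)) (d.rest s x) := by
  rcases x with x | x
  · refine isSum_iff.mpr fun n => ?_
    simp only [restFactor, conj_zero, zero_mul, rest]
    exact PSum.zero
  · refine (isSum_conj (N := 6) (isSum_virasoro x.1 ((x.2 : ℕ) - s x.1)) fun j => ?_).congr
      fun j => ?_
    · rw [rest_eq]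
      exact ((isNil_mode 1 _).mul (isNil_mode 1 _)).smul _
    · rw [restFactor]
      split_ifs with hmax
      · rw [rest_eq, conj_smul ((isNil_mode 1 _).mul (isNil_mode 1 _)),
          conj_mul (isNil_mode 1 _) (isNil_mode 1 _), conj_smul (isNil_mode 1 _), smul_mul_hop,
          restIndex, frame, source]
        dsimp only
        rw [Nat.toPNat'_coe, if_pos (by omega), Int.toNat_of_nonneg (by omega)]
      · have := h.le x.1
        have := x.2.pos
        rw [rest_eq_zero (by omega) (by omega), conj_zero, zero_mul]

theorem rest_mem_rees (h : d.IsAdmissible s) (x : FrameIx r) :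
    d.rest s x ∈ reesWeyl m q (Fin r × ℕ+) (Fin r × ℕ) :=
  (isSum_rest h x).mem_rees fun _ => mul_mem_rees (conj_restFactor_mem_rees _ _) (frame_mem_rees _)

theorem fullFrame_mem_rees (h : d.IsAdmissible s) (x : FrameIx r) :
    d.fullFrame s x ∈ reesWeyl m q (Fin r × ℕ+) (Fin r × ℕ) := by
  rw [fullFrame_eq h]
  exact add_mem_rees (frame_mem_rees x) (rest_mem_rees h x)

theorem hfin_fullFrame (h : d.IsAdmissible s) : HFin (d.fullFrame s) := by
  have h1 : HFin (d.rest s) := hfin_of_isSum ((fiberFin_restFactor h).hfin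
    (fun p => .of_rees (conj_restFactor_mem_rees p.1 p.2)) (hfin_frame h)
    fun x => .of_rees (frame_mem_rees x)) (isSum_rest h)
  intro n
  refine ((hfin_frame h n).add (h1 n)).mono fun x f hx => ?_
  rw [fullFrame_eq h, HahnSeries.coeff_add]
  exact hx

theorem coeff_zero_fullFrame (h : d.IsAdmissible s) (x : FrameIx r) :
    (d.fullFrame s x).coeff 0 = 0 := by
  rw [fullFrame_eq h, HahnSeries.coeff_add, coeff_zero_frame h, zero_add]
  refine (isSum_iff.mp (isSum_rest h x) 0).unique (PSum.zero.congr fun j => ?_)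
  have := coeff_mul_nat (.of_rees (conj_restFactor_mem_rees (d := d) (s := s) x j))
    (.of_rees (frame_mem_rees (d := d) (s := s) (restIndex s x j))) 0
  rw [Finset.Nat.antidiagonal_zero, Finset.sum_singleton, Nat.cast_zero, coeff_zero_frame h,
    mul_zero] at this
  exact this.symm

theorem fullFrame_restIndex (h : d.IsAdmissible s) (x : FrameIx r) (j : ℤ) :
    d.fullFrame s (restIndex s x j) = d.frame s (restIndex s x j) := by
  rcases x with x | x <;> rw [restIndex, frame_inl h, fullFrame]

/-- The two families differ by `rest`, an infinite left combination of positive `eMode`s. These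
belong to both families, so the difference can be added or removed in either direction. -/
theorem generatedIdeal_fullFrame (h : d.IsAdmissible s) :
    generatedIdeal (d.fullFrame s) = generatedIdeal (d.frame s) := by
  refine Set.Subset.antisymm
    (generatedIdeal_subset_of_add frame_mem_rees (hfin_frame h) conj_restFactor_mem_rees
      (fiberFin_restFactor h) (isSum_rest h) (fullFrame_eq h))
    (generatedIdeal_subset_of_sub (fullFrame_mem_rees h) (hfin_fullFrame h)
      conj_restFactor_mem_rees (fiberFin_restFactor h) (fun x => ?_) (fullFrame_eq h))
  refine (isSum_rest h x).congr fun j => ?_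
  rw [fullFrame_restIndex h]

end LocalData

/-! ### The collection of the theorem -/

/-- The position of an element of the collection among the coordinates. -/
def GenIndex.toFrameIx : GenIndex r → FrameIx r
  | .J a j => .inl (a, 2 * j)
  | .Gam a j => .inl (a, (2 * (j : ℕ) - 1).toPNat')
  | .L a j => .inr (a, (2 * (j : ℕ) - 1).toPNat')
  | .G a j => .inr (a, 2 * j)

theorem coe_two_mul_sub_one (j : ℕ+) : ((2 * (j : ℕ) - 1).toPNat' : ℕ) = 2 * j - 1 := by
  have := j.pos
  rw [Nat.toPNat'_coe, if_pos (by omega)]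

theorem coe_two_mul (j : ℕ+) : ((2 * j : ℕ+) : ℕ) = 2 * j := rfl

theorem GenIndex.toFrameIx_bijective : Function.Bijective (GenIndex.toFrameIx (r := r)) := by
  have hne : ∀ {j l : ℕ+}, 2 * j ≠ (2 * (l : ℕ) - 1).toPNat' := fun {j l} h => by
    have h := congrArg PNat.val h
    have := l.pos
    change ((2 * j : ℕ+) : ℕ) = ((2 * (l : ℕ) - 1).toPNat' : ℕ) at h
    rw [coe_two_mul_sub_one, coe_two_mul] at h
    omega
  have heq : ∀ {j l : ℕ+}, (2 * (j : ℕ) - 1).toPNat' = (2 * (l : ℕ) - 1).toPNat' → j = l :=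
    fun {j l} h => by
      have h := congrArg PNat.val h
      change ((2 * (j : ℕ) - 1).toPNat' : ℕ) = ((2 * (l : ℕ) - 1).toPNat' : ℕ) at h
      rw [coe_two_mul_sub_one, coe_two_mul_sub_one] at h
      have := l.pos
      have := j.pos
      exact PNat.coe_injective (by omega)
  have hsur : ∀ k : ℕ+, (∃ j, 2 * j = k) ∨ ∃ j : ℕ+, (2 * (j : ℕ) - 1).toPNat' = k := fun k => by
    have hk := k.pos
    obtain ⟨i, hi | hi⟩ := Nat.even_or_odd' (k : ℕ)
    · exact .inl ⟨⟨i, by omega⟩, PNat.coe_injective hi.symm⟩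
    · refine .inr ⟨i.succPNat, PNat.coe_injective ?_⟩
      rw [coe_two_mul_sub_one, Nat.succPNat_coe]
      omega
  constructor
  · rintro (⟨a, j⟩ | ⟨a, j⟩ | ⟨a, j⟩ | ⟨a, j⟩) (⟨b, l⟩ | ⟨b, l⟩ | ⟨b, l⟩ | ⟨b, l⟩) h <;>
      simp only [GenIndex.toFrameIx, reduceCtorEq, Sum.inl.injEq, Sum.inr.injEq, Prod.mk.injEq] at h
    · rw [h.1, mul_left_cancel h.2]
    · exact absurd h.2 hne
    · exact absurd h.2.symm hne
    · rw [h.1, heq h.2]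
    · rw [h.1, heq h.2]
    · exact absurd h.2.symm hne
    · exact absurd h.2 hne
    · rw [h.1, mul_left_cancel h.2]
  · rintro (⟨a, k⟩ | ⟨a, k⟩) <;> rcases hsur k with ⟨j, rfl⟩ | ⟨j, rfl⟩
    · exact ⟨.J a j, rfl⟩
    · exact ⟨.Gam a j, rfl⟩
    · exact ⟨.G a j, rfl⟩
    · exact ⟨.L a j, rfl⟩

/-- The collection is indexed by the coordinates other than the zero modes. -/
def genEquiv (r : ℕ) : GenIndex r ≃ FrameIx r := Equiv.ofBijective _ GenIndex.toFrameIx_bijective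

/-- As $s_a$ is odd, $L$ and $G$ occupy the odd and the even positions: position $k$ carries the
operator of number $k-s_a$. The two families of modes likewise fill the even and the odd positions
of the other sector. -/
theorem LocalData.generator_eq {d : LocalData m q r} {s : Fin r → ℤ} (h : d.IsAdmissible s)
    (k : GenIndex r) : d.generator s k = d.fullFrame s (genEquiv r k) := by
  rcases k with ⟨a, j⟩ | ⟨a, j⟩ | ⟨a, j⟩ | ⟨a, j⟩ <;>
    simp only [genEquiv, Equiv.ofBijective_apply, GenIndex.toFrameIx, fullFrame, generator] <;>
    have hj := j.pos
  · rw [coe_two_mul, eMode, if_pos (by rw [Int.even_coe_nat]; exact even_two_mul _)]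
    push_cast
    rfl
  · rw [coe_two_mul_sub_one, eMode, if_neg (by
      rw [Int.not_even_iff_odd, Nat.cast_sub (by omega)]
      exact ⟨(j : ℕ) - 1, by push_cast; ring⟩)]
    rw [Nat.cast_sub (by omega)]
    push_cast
    rfl
  · have e : (((2 * (j : ℕ) - 1 : ℕ)) : ℤ) - s a = 2 * j - s a - 1 := by omega
    rw [coe_two_mul_sub_one, e, virasoro, if_pos (by
      rw [sub_sub, add_comm]
      exact (even_two_mul _).sub (Odd.add_odd odd_one (h.odd a)))]
    rfl
  · rw [coe_two_mul, virasoro, if_neg (by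
      rw [Int.not_even_iff_odd]
      push_cast
      exact (even_two_mul _).sub_odd (h.odd a))]
    have e : (((2 * (j : ℕ) : ℕ) : ℤ) - s a) / 2 = (2 * j - s a - 1) / 2 := by
      obtain ⟨i, hi⟩ := h.odd a
      omega
    rw [e]
    rfl

end SuperAiry

end

theorem mainTheorem1 (m q r : ℕ) (d : LocalData m q r) (s : Fin r → ℤ)
    (hs : ∀ a, IsLeast {k : ℤ | Odd k ∧ IsUnit ((d.t a).coeff k)} (s a))
    (hs13 : ∀ a, s a = 1 ∨ s a = 3)
    (hlin : ∀ a, ((d.omega01 a) + (d.omega01 a).sigma).coef.IsBigO 1)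
    (hcas : ∀ a, (d.omega01 a).twistedCasimir.IsBigO (s a)) :
    IsBounded (d.generator s) ∧
    ∃ Ψ : FunR m q r ≃ₐ[ℂ] FunR m q r,
      IsShear (zeroModes r) Ψ ∧
      IsPartialAiryStructure (zeroModes r) (inCoordinates Ψ '' generatedIdeal (d.generator s)) ∧
      ((∀ i, ∀ j ∈ zeroModes r, ((d.generator s) i).coeff 1 (coord j) =
          ((d.generator s) i).coeff 1 1 * coord j) →
        Ψ = AlgEquiv.refl) := by
  have h : d.IsAdmissible s := ⟨hs13, fun a => (hs a).1.2, hlin, hcas⟩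
  have hg : d.generator s = fun k => d.fullFrame s (genEquiv r k) :=
    funext fun k => LocalData.generator_eq h k
  have hrees : ∀ k, d.generator s k ∈ reesWeyl m q (Fin r × ℕ+) (Fin r × ℕ) := fun k => by
    rw [LocalData.generator_eq h]
    exact LocalData.fullFrame_mem_rees h _
  refine ⟨isBounded_of_hfin hrees ?_, ?_⟩
  · rw [hg]
    exact fun n => (LocalData.hfin_fullFrame h n).comp (genEquiv r).injective
  · let e := frameEquiv r
    choose M hM using LocalData.exists_symbol d s
    have hcoe : ∀ i : {j // j ∉ zeroModes r}, modeIx (negMode (e.symm i)) = i.1 := fun i =>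
      congrArg Subtype.val (e.apply_symm_apply i)
    have hpar : ∀ i : {j // j ∉ zeroModes r}, par i.1 = mpar (negMode (e.symm i)) := fun i => by
      rw [← hcoe i, par_modeIx]
    have hsym : ∀ i j : {j // j ∉ zeroModes r},
        ad (par (modeIx (negMode (e.symm j)))) (mulOp (coord (modeIx (negMode (e.symm j)))))
          ((d.frame s (e.symm i)).coeff 1) = mulOp (const (M (e.symm i) j.1)) := fun i j => by
      rw [hcoe]
      exact hM _ _
    -- Coordinates are matched with generators through the mode of negative number that multiplies
    -- by the coordinate, and the number of that mode is the weight for triangularity. The criterion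
    -- is applied to `frame`, whose brackets are explicit, while the conclusion is about the ideal
    -- it shares with the collection.
    refine IsFrame.exists_isPartialAiryStructure (K := fun i => d.frame s (e.symm i))
      (M := fun i => M (e.symm i)) (Set.finite_range _)
      ⟨fun i => LocalData.frame_mem_rees _,
        fun n => (LocalData.hfin_frame h n).comp e.symm.injective,
        fun i => hpar i ▸ LocalData.hPar_frame h _, fun i => LocalData.coeff_zero_frame h _,
        fun i j => hM _ _⟩
      (fun i => frameNum (e.symm i)) (fun l => LocalData.isUnit_symbol h (hsym l l))
      (fun j l hlj hw => LocalData.body_symbol_eq_zero h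
        (fun hjl => hlj (e.symm.injective hjl).symm) hw (hsym l j))
      (c := fun i k => frameBracket s (e.symm i) (e.symm k))
      (τ := fun i k => e (frameIndex s (e.symm i) (e.symm k))) (fun i k => ?_) (fun l => ?_)
      hrees (fun k => ?_) ?_
    · rw [hpar, Equiv.symm_apply_apply]
      exact LocalData.hbr_frame h _ _
    · refine ((finite_frameBracket h.s_eq (e.symm l)).preimage
        (f := Prod.map e.symm e.symm) (e.symm.injective.prodMap e.symm.injective).injOn).subset ?_
      rintro x ⟨h1, h2⟩
      exact ⟨h1, by rw [← h2, Equiv.symm_apply_apply]; rfl⟩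
    · rw [LocalData.generator_eq h]
      exact LocalData.coeff_zero_fullFrame h _
    · rw [hg, generatedIdeal_comp_equiv (d.fullFrame s) (genEquiv r),
        LocalData.generatedIdeal_fullFrame h, generatedIdeal_comp_equiv (d.frame s) e.symm]
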